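/- **Setting.** Three homogeneous balls of equal density, numbered $1,2,3$, have radii $r_1\ge r_2\ge r_3>0$. Units are chosen so that $r_1+r_2+r_3=1$, the total mass is $1$ and the gravitational constant is $1$; thus the masses are $m_i=r_i^3/(r_1^3+r_2^3+r_3^3)$. The centres move in a plane, with distances $d_{ij}\ge r_i+r_j$, and all rotation is about the normal of that plane. Put $$I_S=\tfrac25\sum_i m_ir_i^2,\quad I=\sum_{i<j}m_im_jd_{ij}^2+I_S,\quad U=-\sum_{i<j}\frac{m_im_j}{d_{ij}},\quad \mathcal E_H=\frac{H^2}{2I}+U,$$ where $H\ge0$ is the total angular momentum. The internal kinetic energy of a state is $T_r=E-\mathcal E_H$, with $E$ the total energy. A configuration is a *relative equilibrium* at $H$ if some motion with angular momentum $H$ under gravity and normal contact reactions starts in it and keeps $T_r=0$ over a time interval of positive length. It is *energetically stable* if, moreover, every sufficiently close admissible configuration that does not differ from it by a rigid displacement has a larger value of $\mathcal E_H$ (so that it would need $T_r<0$ at the same energy). Configurations are identified up to translation and rotation, not reflection. **Families.** The following are 28 families of configurations in seven classes. *LR* (2, one per orientation): all three balls in mutual contact. *ER$ijk$* (3, named by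 the middle body $j$): aligned in the order $i,j,k$, with contacts $ij$ and $jk$. *TR$ijk$* (6: middle body and orientation): not aligned, contacts $ij$ and $jk$ but not $ki$. *EA$ij$-$k$* (6): aligned in the order $i,j,k$, $i,j$ in contact and $k$ apart. *IS$ij$-$k$* (6: separated body and orientation): not aligned, $i,j$ in contact, $k$ apart and equidistant from $i$ and $j$. *EO$ijk$* (3): aligned in the order $i,j,k$ without contact. *LO* (2): equilateral without contact. Write $I_{ijk}(x,y,z)=m_im_jx^2+m_jm_ky^2+m_km_iz^2+I_S$ and $z_{ijk}=r_i+2r_j+r_k$, and with $a=r_i+r_j$, $b=r_j+r_k$, $$h^{TR}_{ijk}(d)=\frac{I_{ijk}(a,b,d)}{d^{3/2}},\quad h^{IS}_{ij\text-k}(d)=\frac{I_{ijk}(a,d,d)}{d^{3/2}},\quad h^{LO}(d)=\frac{I_{123}(d,d,d)}{d^{3/2}},$$ $$\Omega^2_{ij}(a,x)=\frac{m_i/x^2+m_j/(x-a)^2}{m_ix+m_j(x-a)},\quad h^{EA}_{ij\text-k}(x)=I_{ijk}(a,x-a,x)\,\Omega_{ij}(a,x).$$ Say that $h$ is *V-shaped*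 on an interval $D$ with vertex $v\in\mathbb R$ if it is strictly decreasing on $D\cap(-\infty,v]$ and strictly increasing on $D\cap[v,\infty)$; it has an *H-bifurcation* if $v$ is interior to $D$. Two families *meet* at $H$ if a relative equilibrium at $H$ is a common limit of relative equilibria of both, angular momenta converging to $H$. **Theorem.** For all $r_1\ge r_2\ge r_3>0$: 1. Each of the 28 families contains a relative equilibrium for some $H$, and every relative equilibrium belongs to exactly one of them. 2. For each of the seven classes there is an $H\ge 0$ at which it contains no relative equilibrium, and an $H\ge0$ at which it contains no energetically stable one. For every $H\ge0$ there is an energetically stable relative equilibrium. 3. The relative equilibria, from $H=0$ to $H=\infty$, are as follows. Except for LR and ER, each family is a curve: it has, up to rigid displacement, one relative equilibrium for each value in an interval $D$ of the stated distance, at angular momentum $h$ of that distance, and no others; $h$ is continuous on $D$. * *LR*: one configuration, in equilibrium exactly for $0\le H\le H_L=h^{TR}_{132}(r_1+r_2)$, stable exactly for $H<H_L$. It meets TR132 of the same orientation at $H_L$. * *ER$ijk$*: one configuration, in equilibrium exactly for $0\le H\le H_f=\min(h^{EA}_{ij\text-k}(z_{ijk}),h^{EA}_{kj\text-i}(z_{ijk}))$.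 With $H_s=h^{TR}_{ijk}(z_{ijk})$ one has $0<H_s<H_f$; it is unstable for $H<H_s$ and stable for $H_s<H<H_f$. At $H_s$ it meets both TR$ijk$ families. * *TR$ijk$*: distance $d=d_{ki}$, $h=h^{TR}_{ijk}$, $D=\{d:\ d\ge r_i+r_j,\ d\ge r_j+r_k,\ r_i+r_k<d<z_{ijk}\}$. For TR123 and TR213, $h$ is strictly decreasing on $D$ and the family is never stable. For TR132, $h$ is V-shaped with a vertex $v>r_1+r_2$, and the member at $d$ is stable exactly if $d>v$. * *IS$ij$-$k$*: distance $d=d_{jk}=d_{ki}$, $h=h^{IS}_{ij\text-k}$, $D=\{d:\ d\ge r_i+r_j,\ d>r_j+r_k,\ d>r_i+r_k\}$. There is an H-bifurcation, $h(d)/\sqrt d\to m_k(m_i+m_j)$ as $d\to\infty$, and the family is never stable. * For each orientation, IS23-1 meets TR123 at $H=h^{TR}_{123}(r_1+r_2)$, IS13-2 meets TR213 at $H=h^{TR}_{213}(r_1+r_2)$, and IS12-3 meets LO at $H=h^{LO}(r_1+r_2)$. * *EA$ij$-$k$*: distance $x=d_{ki}$, $h=h^{EA}_{ij\text-k}$,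 and with $a=r_i+r_j$, $D=\{x>z_{ijk}:\ \Omega^2_{ij}(a,x)(m_ja+m_kx)\le m_j/a^2+m_k/x^2\}$. Here $h$ is V-shaped with some vertex $v$, $h(x)/\sqrt x\to m_k(m_i+m_j)$ as $x\to\infty$, stable members have $x>v$, and members with $x>v$ interior to $D$ are stable. For $j\ne3$ there is an H-bifurcation. If $h^{EA}_{ij\text-k}(z_{ijk})\le h^{EA}_{kj\text-i}(z_{ijk})$, then $D=(z_{ijk},\infty)$ and the family meets ER$ijk$ at $H=h^{EA}_{ij\text-k}(z_{ijk})$; otherwise $D=[x_0,\infty)$ with $x_0>z_{ijk}$, and it meets EO$ijk$ at $H=h^{EA}_{ij\text-k}(x_0)$. In case of equality EO$ijk$ meets ER$ijk$ at that $H$. If $r_2<r_1$, then $h^{EA}_{13\text-2}(z_{132})<h^{EA}_{23\text-1}(z_{132})$. * *EO$ijk$*: there is exactly one $\rho\in(0,1)$ with $\Omega^2_{ij}(\rho,1)=\Omega^2_{kj}(1-\rho,1)$. All members have $d_{ij}=\rho d_{ki}$; distance $d=d_{ki}$, $D=\bigl(\max\{\tfrac{r_i+r_j}{\rho},\tfrac{r_j+r_k}{1-\rho}\},\infty\bigr)$,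 $h(d)=I_{ijk}(\rho d,(1-\rho)d,d)\,\Omega_{ij}(\rho,1)\,d^{-3/2}$. Here $h$ is V-shaped with some vertex, tends to $\infty$, and the family is never stable. * *LO*: distance $d$ the common one, $D=(r_1+r_2,\infty)$, $h=h^{LO}$; $h$ is V-shaped with some vertex, tends to $\infty$, and the family is never stable. 4. Each of the following occurs for some radii: TR132 has an H-bifurcation; $h$ is strictly decreasing along TR132; EA13-2 has an H-bifurcation; $h$ is strictly increasing along EA13-2; likewise for EO132 and for LO an H-bifurcation and a strictly increasing $h$; each of the four combinations of [$h^{EA}_{12\text-3}(z_{123})<h^{EA}_{32\text-1}(z_{123})$ or the reverse strict inequality] with [EO123 has an H-bifurcation or a strictly increasing $h$]; $h^{EA}_{31\text-2}(z_{213})<h^{EA}_{21\text-3}(z_{213})$ together with EO213 having an H-bifurcation, and together with EO213 having a strictly increasing $h$; and $h^{EA}_{21\text-3}(z_{213})<h^{EA}_{31\text-2}(z_{213})$. -/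

import Mathlib

open Filter Topology Set

noncomputable section

namespace FullThreeBody

/-! Units: gravitational constant, total mass and sum of the three radii are all `1`.
The bodies are numbered `0, 1, 2`; equal density makes each mass proportional to the cube of
the radius. The plane of motion is `ℂ`. -/

/-- Admissible radii, listed from the largest body `0` to the smallest body `2`. -/
structure IsSizes (r : Fin 3 → ℝ) : Prop where
  pos : ∀ i, 0 < r i
  sum_eq_one : r 0 + r 1 + r 2 = 1
  le_left : r 1 ≤ r 0
  le_right : r 2 ≤ r 1

def mass (r : Fin 3 → ℝ) (i : Fin 3) : ℝ := r i ^ 3 / ∑ j, r j ^ 3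

/-- Moment of inertia of the homogeneous ball `i` about an axis through its centre. -/
def ballInertia (r : Fin 3 → ℝ) (i : Fin 3) : ℝ := 2 / 5 * mass r i * r i ^ 2

/-- Positions of the three centres. -/
abbrev Config := Fin 3 → ℂ

/-- The rigid balls do not overlap. -/
def Admissible (r : Fin 3 → ℝ) (q : Config) : Prop :=
  ∀ i j, i ≠ j → r i + r j ≤ ‖q i - q j‖

def Centered (r : Fin 3 → ℝ) (q : Config) : Prop := ∑ i, mass r i • q i = 0

/-- Gravitational potential energy (sum over unordered pairs). -/
def potential (r : Fin 3 → ℝ) (q : Config) : ℝ :=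
  -∑ i, ∑ j ∈ Finset.Ioi i, mass r i * mass r j / ‖q i - q j‖

/-- Total polar moment of inertia about the centre of mass, the axis being perpendicular to the
plane (the total mass is `1`). -/
def inertia (r : Fin 3 → ℝ) (q : Config) : ℝ :=
  (∑ i, ∑ j ∈ Finset.Ioi i, mass r i * mass r j * ‖q i - q j‖ ^ 2) + ∑ i, ballInertia r i

/-- The amended potential at angular momentum `H`. -/
def amended (r : Fin 3 → ℝ) (H : ℝ) (q : Config) : ℝ :=
  H ^ 2 / (2 * inertia r q) + potential r q

/-- Equality up to a translation and a rotation of the plane (reflections excluded). -/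
def Congruent (q q' : Config) : Prop :=
  ∃ u c : ℂ, ‖u‖ = 1 ∧ ∀ i, q' i = u * q i + c

/-- Positions and velocities of the centres, and spin rates of the balls, as functions of time. -/
structure Motion where
  pos : ℝ → Config
  vel : ℝ → Config
  spin : ℝ → Fin 3 → ℝ

def Motion.angularMomentum (r : Fin 3 → ℝ) (s : Motion) (t : ℝ) : ℝ :=
  (∑ i, mass r i * ((starRingEnd ℂ) (s.pos t i) * s.vel t i).im)
    + ∑ i, ballInertia r i * s.spin t i

def Motion.energy (r : Fin 3 → ℝ) (s : Motion) (t : ℝ) : ℝ :=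
  (∑ i, 1 / 2 * mass r i * ‖s.vel t i‖ ^ 2)
    + (∑ i, 1 / 2 * ballInertia r i * s.spin t i ^ 2) + potential r (s.pos t)

/-- Kinetic energy relative to the frame turning with angular velocity `H / I_H`: the total energy
minus the amended potential. -/
def Motion.internalKinetic (r : Fin 3 → ℝ) (s : Motion) (t : ℝ) : ℝ :=
  s.energy r t - amended r (s.angularMomentum r t) (s.pos t)

/-- `s` is a motion, on the time interval `[0, τ]` and in the centre-of-mass frame, of the three
balls under their mutual gravitation and the normal reactions at their (frictionless) contacts.
`f t i j` is the repulsive reaction between `i` and `j`; it vanishes for separated balls. -/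
structure Motion.IsSolution (r : Fin 3 → ℝ) (τ : ℝ) (s : Motion) : Prop where
  admissible : ∀ t ∈ Icc 0 τ, Admissible r (s.pos t)
  centered : ∀ t ∈ Icc 0 τ, Centered r (s.pos t)
  pos_deriv : ∀ t ∈ Icc 0 τ, ∀ i,
    HasDerivWithinAt (fun u => s.pos u i) (s.vel t i) (Icc 0 τ) t
  spin_deriv : ∀ t ∈ Icc 0 τ, ∀ i, HasDerivWithinAt (fun u => s.spin u i) 0 (Icc 0 τ) t
  newton : ∃ f : ℝ → Fin 3 → Fin 3 → ℝ, ∀ t ∈ Icc 0 τ,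
    (∀ i j, 0 ≤ f t i j ∧ f t i j = f t j i ∧
      (r i + r j < ‖s.pos t i - s.pos t j‖ → f t i j = 0)) ∧
    ∀ i, HasDerivWithinAt (fun u => mass r i • s.vel u i)
      (∑ j ∈ Finset.univ.erase i,
        (mass r i * mass r j / ‖s.pos t i - s.pos t j‖ ^ 3
          - f t i j / ‖s.pos t i - s.pos t j‖) • (s.pos t j - s.pos t i))
      (Icc 0 τ) t

/-- Relative equilibrium at angular momentum `H`: started in `q`, some motion of angular momentum
`H` keeps zero internal kinetic energy over a time interval of positive length. -/
def IsRelEq (r : Fin 3 → ℝ) (H : ℝ) (q : Config) : Prop :=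
  ∃ τ > 0, ∃ s : Motion, s.IsSolution r τ ∧ s.pos 0 = q ∧
    ∀ t ∈ Icc 0 τ, s.angularMomentum r t = H ∧ s.internalKinetic r t = 0

/-- Energetic stability: a relative equilibrium such that every nearby configuration that is not
the same up to a rigid displacement would, at the same energy and angular momentum, have negative
internal kinetic energy. -/
def IsStable (r : Fin 3 → ℝ) (H : ℝ) (q : Config) : Prop :=
  IsRelEq r H q ∧ ∀ᶠ q' in 𝓝 q, Admissible r q' → ¬ Congruent q q' →
    amended r H q - amended r H q' < 0

/-! ### The seven classes and the 28 families -/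

def Contact (r : Fin 3 → ℝ) (q : Config) (i j : Fin 3) : Prop := ‖q i - q j‖ = r i + r j

/-- The sense in which the triangle `0, 1, 2` is traversed (`true`: counterclockwise). In
particular the three centres are not collinear. -/
def Oriented (o : Bool) (q : Config) : Prop :=
  if o then 0 < ((starRingEnd ℂ) (q 1 - q 0) * (q 2 - q 0)).im
  else ((starRingEnd ℂ) (q 1 - q 0) * (q 2 - q 0)).im < 0

/-- Lagrange resting: mutual contact of all three. -/
def IsLR (r : Fin 3 → ℝ) (o : Bool) (q : Config) : Prop :=
  (∀ i j, i ≠ j → Contact r q i j) ∧ Oriented o q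

/-- Euler resting: aligned in the order `i, j, k`, both neighbours in contact. -/
def IsER (r : Fin 3 → ℝ) (i j k : Fin 3) (q : Config) : Prop :=
  Contact r q i j ∧ Contact r q j k ∧ Sbtw ℝ (q i) (q j) (q k)

/-- Transitional resting: `i` and `k` rest on `j`, not on each other, and are not aligned. -/
def IsTR (r : Fin 3 → ℝ) (i j k : Fin 3) (o : Bool) (q : Config) : Prop :=
  Contact r q i j ∧ Contact r q j k ∧ ¬ Contact r q k i ∧ Oriented o q

/-- Euler aligned: in the order `i, j, k`, with `i, j` in contact and `k` apart. -/
def IsEA (r : Fin 3 → ℝ) (i j k : Fin 3) (q : Config) : Prop :=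
  Contact r q i j ∧ ¬ Contact r q j k ∧ Sbtw ℝ (q i) (q j) (q k)

/-- Isosceles: `i, j` in contact, `k` apart from both and equidistant from them, not aligned. -/
def IsIS (r : Fin 3 → ℝ) (i j k : Fin 3) (o : Bool) (q : Config) : Prop :=
  Contact r q i j ∧ ¬ Contact r q j k ∧ ¬ Contact r q k i ∧
    ‖q k - q i‖ = ‖q k - q j‖ ∧ Oriented o q

/-- Euler orbital: aligned in the order `i, j, k`, no contact. -/
def IsEO (r : Fin 3 → ℝ) (i j k : Fin 3) (q : Config) : Prop :=
  ¬ Contact r q i j ∧ ¬ Contact r q j k ∧ Sbtw ℝ (q i) (q j) (q k)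

/-- Lagrange orbital: equilateral, no contact. -/
def IsLO (r : Fin 3 → ℝ) (o : Bool) (q : Config) : Prop :=
  (∀ i j, i ≠ j → ¬ Contact r q i j ∧ ‖q i - q j‖ = ‖q 0 - q 1‖) ∧ Oriented o q

inductive EqClass
  | LR | ER | TR | EA | IS | EO | LO

/-- The 28 families. `ER j`, `TR j o`, `EO j` have `j` as the middle body; `IS k o` has `k` as the
separated body; `EA σ` is aligned in the order `σ 0, σ 1, σ 2`, the body `σ 2` being separated. -/
inductive Family
  | LR (o : Bool)
  | ER (j : Fin 3)
  | TR (j : Fin 3) (o : Bool)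
  | EA (σ : Equiv.Perm (Fin 3))
  | IS (k : Fin 3) (o : Bool)
  | EO (j : Fin 3)
  | LO (o : Bool)

def Family.cls : Family → EqClass
  | .LR _ => .LR
  | .ER _ => .ER
  | .TR _ _ => .TR
  | .EA _ => .EA
  | .IS _ _ => .IS
  | .EO _ => .EO
  | .LO _ => .LO

/-- Configurations of the geometric type of the family (index addition is modulo `3`). -/
def Family.Mem (r : Fin 3 → ℝ) : Family → Config → Prop
  | .LR o => IsLR r o
  | .ER j => IsER r (j + 1) j (j + 2)
  | .TR j o => IsTR r (j + 1) j (j + 2) o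
  | .EA σ => IsEA r (σ 0) (σ 1) (σ 2)
  | .IS k o => IsIS r (k + 1) (k + 2) k o
  | .EO j => IsEO r (j + 1) j (j + 2)
  | .LO o => IsLO r o

/-- All pairs (configuration, angular momentum) forming a relative equilibrium of the family. -/
def branch (r : Fin 3 → ℝ) (F : Family) : Set (Config × ℝ) :=
  {p | 0 ≤ p.2 ∧ F.Mem r p.1 ∧ IsRelEq r p.2 p.1}

/-! ### Angular momentum along the families -/

/-- Moment of inertia as a function of the distances `x = d_ij`, `y = d_jk`, `z = d_ki`. -/
def inertiaOf (r : Fin 3 → ℝ) (i j k : Fin 3) (x y z : ℝ) : ℝ :=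
  mass r i * mass r j * x ^ 2 + mass r j * mass r k * y ^ 2 + mass r k * mass r i * z ^ 2
    + ∑ l, ballInertia r l

/-- Distance of the outer bodies in the aligned resting configuration `i, j, k`. -/
def restLength (r : Fin 3 → ℝ) (i j k : Fin 3) : ℝ := r i + 2 * r j + r k

/-- Transitional resting `i, j, k`, as a function of `d = d_ki`. -/
def hTR (r : Fin 3 → ℝ) (i j k : Fin 3) (d : ℝ) : ℝ :=
  inertiaOf r i j k (r i + r j) (r j + r k) d / d ^ (3 / 2 : ℝ)

def domTR (r : Fin 3 → ℝ) (i j k : Fin 3) : Set ℝ :=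
  {d | r i + r j ≤ d ∧ r j + r k ≤ d ∧ r k + r i < d ∧ d < restLength r i j k}

/-- Isosceles with `i, j` in contact, as a function of `d = d_jk = d_ki`. -/
def hIS (r : Fin 3 → ℝ) (i j k : Fin 3) (d : ℝ) : ℝ :=
  inertiaOf r i j k (r i + r j) d d / d ^ (3 / 2 : ℝ)

def domIS (r : Fin 3 → ℝ) (i j k : Fin 3) : Set ℝ :=
  {d | r i + r j ≤ d ∧ r j + r k < d ∧ r k + r i < d}

/-- Lagrange orbital, as a function of the common distance. -/
def hLO (r : Fin 3 → ℝ) (d : ℝ) : ℝ := inertiaOf r 0 1 2 d d d / d ^ (3 / 2 : ℝ)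

/-- Squared angular velocity of the aligned order `i, j, k`, with `d_ij = a` and `d_ki = x`,
that balances the forces on the outer body `k` (its mass cancels). -/
def rateSq (r : Fin 3 → ℝ) (i j : Fin 3) (a x : ℝ) : ℝ :=
  (mass r i / x ^ 2 + mass r j / (x - a) ^ 2) / (mass r i * x + mass r j * (x - a))

/-- Euler aligned `i, j, k` with `i, j` in contact, as a function of `x = d_ki`. -/
def hEA (r : Fin 3 → ℝ) (i j k : Fin 3) (x : ℝ) : ℝ :=
  inertiaOf r i j k (r i + r j) (x - (r i + r j)) x * √(rateSq r i j (r i + r j) x)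

/-- Separations for which body `i` is not pulled away from `j`. -/
def domEA (r : Fin 3 → ℝ) (i j k : Fin 3) : Set ℝ :=
  {x | restLength r i j k < x ∧
    rateSq r i j (r i + r j) x * (mass r j * (r i + r j) + mass r k * x)
      ≤ mass r j / (r i + r j) ^ 2 + mass r k / x ^ 2}

/-- `ρ = d_ij / d_ki` is a central-configuration ratio for the aligned order `i, j, k`: the forces
on `i` and on `k` are balanced by the same angular velocity. -/
def IsEulerRatio (r : Fin 3 → ℝ) (i j k : Fin 3) (ρ : ℝ) : Prop :=
  0 < ρ ∧ ρ < 1 ∧ rateSq r i j ρ 1 = rateSq r k j (1 - ρ) 1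

/-- Euler orbital `i, j, k`, as a function of `d = d_ki`. -/
def hEO (r : Fin 3 → ℝ) (i j k : Fin 3) (ρ d : ℝ) : ℝ :=
  inertiaOf r i j k (ρ * d) ((1 - ρ) * d) d * √(rateSq r i j ρ 1) / d ^ (3 / 2 : ℝ)

def domEO (r : Fin 3 → ℝ) (i j k : Fin 3) (ρ : ℝ) : Set ℝ :=
  Ioi (max ((r i + r j) / ρ) ((r j + r k) / (1 - ρ)))

/-! ### Vocabulary of bifurcation charts -/

/-- The family is one rigid configuration, in equilibrium exactly for `0 ≤ H ≤ T`. -/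
def IsRestingFamily (r : Fin 3 → ℝ) (F : Family) (T : ℝ) : Prop :=
  (∀ H, (∃ q, (q, H) ∈ branch r F) ↔ H ∈ Icc 0 T) ∧
  ∀ p ∈ branch r F, ∀ p' ∈ branch r F, Congruent p.1 p'.1

/-- Up to rigid displacement the family is a curve: there is one relative equilibrium for each
value `x ∈ D` of the coordinate `size`, at the angular momentum `h x`, and no other. -/
def IsCurveFamily (r : Fin 3 → ℝ) (F : Family) (size : Config → ℝ) (D : Set ℝ) (h : ℝ → ℝ) :
    Prop :=
  D.Nonempty ∧ D.OrdConnected ∧ ContinuousOn h D ∧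
  (∀ p ∈ branch r F, size p.1 ∈ D ∧ p.2 = h (size p.1)) ∧
  (∀ x ∈ D, ∃ q, (q, h x) ∈ branch r F ∧ size q = x) ∧
  ∀ p ∈ branch r F, ∀ p' ∈ branch r F, size p.1 = size p'.1 → Congruent p.1 p'.1

/-- No relative equilibrium of the family is energetically stable. -/
def NeverStable (r : Fin 3 → ℝ) (F : Family) : Prop := ∀ p ∈ branch r F, ¬ IsStable r p.2 p.1

/-- The two families meet at angular momentum `H`, in a common limiting relative equilibrium. -/
def Junction (r : Fin 3 → ℝ) (F G : Family) (H : ℝ) : Prop :=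
  ∃ q, IsRelEq r H q ∧ (q, H) ∈ closure (branch r F) ∧ (q, H) ∈ closure (branch r G)

/-- `h` decreases on `D` up to `v` and increases from `v` on (`v` may lie outside `D`). -/
def VShaped (h : ℝ → ℝ) (D : Set ℝ) (v : ℝ) : Prop :=
  StrictAntiOn h (D ∩ Iic v) ∧ StrictMonoOn h (D ∩ Ici v)

/-- The family appears, as `H` increases, as a pair of relative equilibria at an interior point of
the range of its coordinate, after which the two members move in opposite directions. -/
def HBifurcation (h : ℝ → ℝ) (D : Set ℝ) : Prop := ∃ v ∈ interior D, VShaped h D v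

end FullThreeBody

end

noncomputable section

namespace FullThreeBody

/-! Dynamics. With ω = H / I, twice the internal kinetic energy is a sum of squares, weighted by
masses and ball inertias, of the velocities and spins relative to the frame turning at rate ω
(`internalKinetic_eq`). If it vanishes over an interval, the bodies turn rigidly. Frictionless
contacts keep the spins constant, so ω is constant too, and Newton's law becomes an algebraic force
balance (`relEq_iff_force`). Centring the configuration distributes the centrifugal term over the
pairs (`relEq_iff`). In a proper triangle the two edge vectors at each body are independent, so
every pair balances by itself: ω² d³ ≤ 1, with equality unless the pair touches
(`relEq_noncollinear`). On a line there is one scalar equation for each outer body, comparing ω²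
with `rateSq` (`relEq_collinear`). Solving for H gives the functions h of the theorem. Listing the
possible contacts gives the classification: pairs that are apart in a proper triangle all have the
same length.

Stability. Up to rigid displacement a configuration is its three distances and an orientation, so
stability is a question of strict minima of E = H² / 2I + U in the distances, constrained by
non-overlap and the triangle inequalities (`isStable_of_distances`, `not_isStable_of_path`).
Differences of E factor exactly through `slope`, whose diagonal value 1/d² − ω² d is the net
attraction of a pair (`energyOf_sub`). Pressed contacts and, for a fast aligned chain, the triangle
inequality therefore contribute a gain of first order. In the one remaining free direction the
derivative of E has the sign of h(t)² − h(x)² (`IsCharted`): members on the increasing side of h are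
minima, those on the decreasing side are not. IS, LO and EO are excluded by convexity, by varying
the distances at constant moment of inertia; 1/d is convex in d² (IS, LO) and in d (EO).

Shape of h. Along TR, IS, EO and LO, h is a positive multiple of (A + B d²) / d^(3/2), which turns
once, at B d² = 3A. Along EA the derivative of h² has the sign of `alignedSign`, which can only pass
from negative to positive (`alignedSign_pos_of_nonneg`). Where EA exists is decided by the Euler
ratio ρ: the rates demanded by the two outer bodies, as functions of d_ij / d_ki, cross exactly
once, so the domain condition becomes r i + r j ≤ ρ x (`rateSq_le_iff`). Whether a vertex lies
inside its domain is a polynomial inequality in the radii. It is proved by covering the ordered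
radii with simplicial cones whose coordinates make all coefficients nonnegative.

Something is always stable because three windows of H overlap: the triangle LR below H_L, the chain
with middle body `1` from a threshold below H_L (`hTR_chain_lt_triangle`) up to its breaking point,
and after that the increasing part of the EA family of the outer body that leaves first, whose
vertex lies inside its domain (`exists_vertex_mem_interior`). Families meet because explicit
continuous curves of members converge to a common equilibrium. The alternatives of the last part are
realized by small integer ratios of radii, with rational bounds enclosing ρ. -/

/-- `i, j, k` enumerate the three bodies. -/
structure IsTriple (i j k : Fin 3) : Prop where
  ij : i ≠ j
  jk : j ≠ k
  ki : k ≠ i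

/-! ### Enumerations of the three bodies -/

namespace IsTriple

variable {i j k : Fin 3}

lemma rotate (h : IsTriple i j k) : IsTriple j k i := ⟨h.jk, h.ki, h.ij⟩
lemma swap (h : IsTriple i j k) : IsTriple k j i := ⟨h.jk.symm, h.ij.symm, h.ki.symm⟩
lemma swapLeft (h : IsTriple i j k) : IsTriple j i k := ⟨h.ij.symm, h.ki.symm, h.jk.symm⟩

lemma eq_or (h : IsTriple i j k) (l : Fin 3) : l = i ∨ l = j ∨ l = k := by
  obtain ⟨h1, h2, h3⟩ := h
  revert h1 h2 h3; revert i j k l; decide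

lemma forall_iff (h : IsTriple i j k) {p : Fin 3 → Prop} : (∀ l, p l) ↔ p i ∧ p j ∧ p k := by
  refine ⟨fun H => ⟨H i, H j, H k⟩, fun H l => ?_⟩
  rcases h.eq_or l with rfl | rfl | rfl
  exacts [H.1, H.2.1, H.2.2]

lemma univ_eq (h : IsTriple i j k) : (Finset.univ : Finset (Fin 3)) = {i, j, k} := by
  ext l; simpa using h.eq_or l

lemma sum_eq {M : Type*} [AddCommMonoid M] (h : IsTriple i j k) (f : Fin 3 → M) :
    ∑ l, f l = f i + f j + f k := by
  rw [h.univ_eq, Finset.sum_insert (by simp [h.ij, h.ki.symm]), Finset.sum_pair h.jk, add_assoc]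

lemma sum_erase {M : Type*} [AddCommMonoid M] (h : IsTriple i j k) (f : Fin 3 → M) :
    ∑ l ∈ Finset.univ.erase i, f l = f j + f k := by
  have : (Finset.univ.erase i : Finset (Fin 3)) = {j, k} := by
    ext l
    have := h.eq_or l
    have := h.ij
    have := h.ki
    simp only [Finset.mem_erase, Finset.mem_univ, and_true, Finset.mem_insert,
      Finset.mem_singleton]
    constructor
    · tauto
    · rintro (rfl | rfl)
      exacts [h.ij.symm, h.ki]
  rw [this, Finset.sum_pair h.jk]

lemma sum_pairs (h : IsTriple i j k) (f : Fin 3 → Fin 3 → ℝ) (hf : ∀ i j, f i j = f j i) :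
    ∑ i, ∑ j ∈ Finset.Ioi i, f i j = f i j + f j k + f k i := by
  have h0 : (Finset.Ioi (0 : Fin 3)) = {1, 2} := by decide
  have h1 : (Finset.Ioi (1 : Fin 3)) = {2} := by decide
  have h2 : (Finset.Ioi (2 : Fin 3)) = ∅ := by decide
  rw [Fin.sum_univ_three, h0, h1, h2, Finset.sum_pair (by decide)]
  simp only [Finset.sum_singleton, Finset.sum_empty]
  have e1 := hf 1 0
  have e2 := hf 2 0
  have e3 := hf 2 1
  obtain ⟨a, b, c⟩ := h
  fin_cases i <;> fin_cases j <;> fin_cases k <;>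
    first
    | exact absurd rfl a
    | exact absurd rfl b
    | exact absurd rfl c
    | (simp only [Fin.zero_eta, Fin.mk_one, Fin.reduceFinMk]; linarith)

end IsTriple

lemma isTriple_of_middle {i j k : Fin 3} (hi : i = j + 1) (hk : k = j + 2) : IsTriple i j k := by
  subst hi hk
  refine ⟨?_, ?_, ?_⟩ <;> revert j <;> decide

lemma isTriple_of_last {i j k : Fin 3} (hi : i = k + 1) (hj : j = k + 2) : IsTriple i j k := by
  subst hi hj
  refine ⟨?_, ?_, ?_⟩ <;> revert k <;> decide

lemma isTriple_perm (σ : Equiv.Perm (Fin 3)) : IsTriple (σ 0) (σ 1) (σ 2) :=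
  ⟨by simp, by simp, by simp⟩

lemma isTriple_zero_one_two : IsTriple 0 1 2 := ⟨by decide, by decide, by decide⟩

/-! ### Masses and moment of inertia -/

section sizes

variable {r : Fin 3 → ℝ} (hs : IsSizes r)
include hs

lemma IsSizes.cubes_pos : 0 < ∑ j, r j ^ 3 := by
  rw [Fin.sum_univ_three]
  have := hs.pos 0; have := hs.pos 1; have := hs.pos 2
  positivity

lemma IsSizes.mass_pos (i : Fin 3) : 0 < mass r i :=
  div_pos (pow_pos (hs.pos i) 3) hs.cubes_pos

lemma IsSizes.sum_mass : ∑ i, mass r i = 1 := by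
  unfold mass
  rw [← Finset.sum_div, div_self hs.cubes_pos.ne']

lemma IsSizes.mass_add {i j k : Fin 3} (h : IsTriple i j k) :
    mass r i + mass r j + mass r k = 1 := by
  rw [← hs.sum_mass, h.sum_eq]

lemma IsSizes.ballInertia_pos (i : Fin 3) : 0 < ballInertia r i := by
  have := hs.mass_pos i; have := hs.pos i
  unfold ballInertia; positivity

lemma IsSizes.sum_ballInertia_pos : 0 < ∑ i, ballInertia r i :=
  Finset.sum_pos (fun i _ => hs.ballInertia_pos i) Finset.univ_nonempty

lemma IsSizes.inertiaOf_pos (i j k : Fin 3) (x y z : ℝ) : 0 < inertiaOf r i j k x y z := by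
  have := hs.mass_pos i; have := hs.mass_pos j; have := hs.mass_pos k
  have := hs.sum_ballInertia_pos
  unfold inertiaOf; positivity

end sizes

lemma inertia_eq (r : Fin 3 → ℝ) {i j k : Fin 3} (h : IsTriple i j k) (q : Config) :
    inertia r q = inertiaOf r i j k ‖q i - q j‖ ‖q j - q k‖ ‖q k - q i‖ := by
  unfold inertia inertiaOf
  rw [h.sum_pairs (fun i j => mass r i * mass r j * ‖q i - q j‖ ^ 2)]
  intro i j
  rw [norm_sub_rev]; ring

lemma potential_eq (r : Fin 3 → ℝ) {i j k : Fin 3} (h : IsTriple i j k) (q : Config) :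
    potential r q = -(mass r i * mass r j / ‖q i - q j‖ + mass r j * mass r k / ‖q j - q k‖
      + mass r k * mass r i / ‖q k - q i‖) := by
  unfold potential
  rw [h.sum_pairs (fun i j => mass r i * mass r j / ‖q i - q j‖)]
  intro i j
  rw [norm_sub_rev]; ring

lemma IsSizes.inertia_pos {r : Fin 3 → ℝ} (hs : IsSizes r) (q : Config) : 0 < inertia r q := by
  rw [inertia_eq r isTriple_zero_one_two]; exact hs.inertiaOf_pos ..

/-- The amended potential as a function of the distances `x = d_ij`, `y = d_jk`, `z = d_ki`. -/
def energyOf (r : Fin 3 → ℝ) (i j k : Fin 3) (H x y z : ℝ) : ℝ :=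
  H ^ 2 / (2 * inertiaOf r i j k x y z)
    - (mass r i * mass r j / x + mass r j * mass r k / y + mass r k * mass r i / z)

lemma amended_eq (r : Fin 3 → ℝ) {i j k : Fin 3} (h : IsTriple i j k) (H : ℝ) (q : Config) :
    amended r H q = energyOf r i j k H ‖q i - q j‖ ‖q j - q k‖ ‖q k - q i‖ := by
  rw [amended, energyOf, inertia_eq r h, potential_eq r h, ← sub_eq_add_neg]

lemma inertiaOf_rotate (r : Fin 3 → ℝ) (i j k : Fin 3) (x y z : ℝ) :
    inertiaOf r i j k x y z = inertiaOf r j k i y z x := by unfold inertiaOf; ring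

lemma inertiaOf_swap (r : Fin 3 → ℝ) (i j k : Fin 3) (x y z : ℝ) :
    inertiaOf r i j k x y z = inertiaOf r k j i y x z := by unfold inertiaOf; ring

/-! ### Plane geometry: distances, orientation, congruence -/

/-- Signed (doubled) area of the triangle of centres `i, j, k`. -/
def cross (i j k : Fin 3) (q : Config) : ℝ :=
  ((starRingEnd ℂ) (q j - q i) * (q k - q i)).im

lemma cross_def (i j k : Fin 3) (q : Config) : cross i j k q =
    (q j - q i).re * (q k - q i).im - (q j - q i).im * (q k - q i).re := by
  simp [cross, Complex.mul_im]; ring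

lemma cross_rotate (i j k : Fin 3) (q : Config) : cross j k i q = cross i j k q := by
  simp [cross_def]; ring

lemma continuous_cross (i j k : Fin 3) : Continuous (cross i j k) := by
  unfold cross; fun_prop

/-- A permutation of the vertices multiplies the signed area by its sign. Recording that sign lets
orientation, defined in the order 0, 1, 2, be tested in whichever order of the bodies a proof uses.
-/
lemma exists_sign_cross {i j k : Fin 3} (h : IsTriple i j k) :
    ∃ ε : ℝ, (ε = 1 ∨ ε = -1) ∧ ∀ q, cross 0 1 2 q = ε * cross i j k q := by
  obtain ⟨a, b, c⟩ := h
  fin_cases i <;> fin_cases j <;> fin_cases k <;>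
    first
    | exact absurd rfl a
    | exact absurd rfl b
    | exact absurd rfl c
    | exact ⟨1, Or.inl rfl, fun q => by simp only [cross_def, Complex.sub_re, Complex.sub_im, Fin.zero_eta, Fin.mk_one, Fin.reduceFinMk]; ring1⟩
    | exact ⟨-1, Or.inr rfl, fun q => by simp only [cross_def, Complex.sub_re, Complex.sub_im, Fin.zero_eta, Fin.mk_one, Fin.reduceFinMk]; ring1⟩

lemma exists_sign_oriented {i j k : Fin 3} (h : IsTriple i j k) (o : Bool) :
    ∃ ε : ℝ, (ε = 1 ∨ ε = -1) ∧ ∀ q, Oriented o q ↔ 0 < ε * cross i j k q := by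
  obtain ⟨ε, hε, he⟩ := exists_sign_cross h
  cases o
  · refine ⟨-ε, by rcases hε with rfl | rfl <;> simp, fun q => ?_⟩
    have := he q
    simp only [Oriented, Bool.false_eq_true, if_false]
    rw [cross] at this
    rw [this]; constructor <;> intro h <;> linarith
  · refine ⟨ε, hε, fun q => ?_⟩
    have := he q
    simp only [Oriented, if_true]
    rw [cross] at this
    rw [this]

lemma Oriented.cross_ne {i j k : Fin 3} (h : IsTriple i j k) {o : Bool} {q : Config}
    (ho : Oriented o q) : cross i j k q ≠ 0 := by
  obtain ⟨ε, -, he⟩ := exists_sign_oriented h o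
  intro h0
  have := (he q).1 ho
  simp [h0] at this

lemma exists_oriented {i j k : Fin 3} (h : IsTriple i j k) {q : Config}
    (hq : cross i j k q ≠ 0) : ∃ o, Oriented o q := by
  obtain ⟨ε, hε, he⟩ := exists_sign_cross h
  have h0 : cross 0 1 2 q ≠ 0 := by
    rw [he q]; rcases hε with rfl | rfl <;> simpa using hq
  rcases lt_or_gt_of_ne h0 with h1 | h1
  · exact ⟨false, by simpa [Oriented, cross] using h1⟩
  · exact ⟨true, by simpa [Oriented, cross] using h1⟩

/-- Lagrange's identity: the distances determine the area up to sign. -/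
lemma cross_sq (i j k : Fin 3) (q : Config) :
    4 * cross i j k q ^ 2 = 4 * (‖q i - q j‖ ^ 2 * ‖q k - q i‖ ^ 2)
      - (‖q i - q j‖ ^ 2 + ‖q k - q i‖ ^ 2 - ‖q j - q k‖ ^ 2) ^ 2 := by
  rw [cross_def]
  simp only [Complex.sq_norm, Complex.normSq_apply, Complex.sub_re, Complex.sub_im]
  ring

lemma cross_eq_zero_of_add {i j k : Fin 3} {q : Config}
    (h : ‖q i - q j‖ + ‖q j - q k‖ = ‖q k - q i‖) : cross i j k q = 0 := by
  have := cross_sq i j k q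
  rw [← h] at this
  have : cross i j k q ^ 2 = 0 := by linear_combination this / 4
  simpa using this

lemma norm_add_of_sbtw {q : Config} {i j k : Fin 3} (h : Sbtw ℝ (q i) (q j) (q k)) :
    ‖q i - q j‖ + ‖q j - q k‖ = ‖q k - q i‖ := by
  have := dist_add_dist_eq_iff.2 h.wbtw
  rw [dist_eq_norm, dist_eq_norm, dist_eq_norm] at this
  rw [this, norm_sub_rev]

lemma sbtw_of_norm_add {q : Config} {i j k : Fin 3} (hij : q i ≠ q j) (hjk : q j ≠ q k)
    (h : ‖q i - q j‖ + ‖q j - q k‖ = ‖q k - q i‖) : Sbtw ℝ (q i) (q j) (q k) := by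
  refine ⟨dist_add_dist_eq_iff.1 ?_, hij.symm, hjk⟩
  rw [dist_eq_norm, dist_eq_norm, dist_eq_norm, h, norm_sub_rev]

/-- Collinear distinct centres: one lies strictly between the other two. -/
lemma exists_sbtw_of_cross {q : Config} {i j k : Fin 3} (hij : q i ≠ q j) (hjk : q j ≠ q k)
    (hki : q k ≠ q i) (h : cross i j k q = 0) :
    Sbtw ℝ (q i) (q j) (q k) ∨ Sbtw ℝ (q j) (q k) (q i) ∨ Sbtw ℝ (q k) (q i) (q j) := by
  have h0 := cross_sq i j k q
  rw [h] at h0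
  have p1 := norm_pos_iff.2 (sub_ne_zero.2 hij)
  have p2 := norm_pos_iff.2 (sub_ne_zero.2 hjk)
  have p3 := norm_pos_iff.2 (sub_ne_zero.2 hki)
  set x := ‖q i - q j‖
  set y := ‖q j - q k‖
  set z := ‖q k - q i‖
  -- Heron's factorization of four times the squared area; of its four factors only the three
  -- triangle defects can vanish.
  have h1 : (x + y - z) * ((y + z - x) * (z + x - y)) * (x + y + z) = 0 := by
    linear_combination (-1 : ℝ) * h0
  have h2 : (x + y - z) * ((y + z - x) * (z + x - y)) = 0 := by
    rcases mul_eq_zero.1 h1 with h | h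
    · exact h
    · linarith
  rcases mul_eq_zero.1 h2 with h3 | h3
  · exact Or.inl (sbtw_of_norm_add hij hjk (by change x + y = z; linarith))
  · rcases mul_eq_zero.1 h3 with h4 | h4
    · exact Or.inr (Or.inl (sbtw_of_norm_add hjk hki (by change y + z = x; linarith)))
    · exact Or.inr (Or.inr (sbtw_of_norm_add hki hij (by change z + x = y; linarith)))

/-- Same distances and same orientation: the configurations differ by a rigid displacement. -/
lemma congruent_of_dist {q q' : Config} {i j k : Fin 3} (h : IsTriple i j k) (hq : q i ≠ q j)
    (hx : ‖q' i - q' j‖ = ‖q i - q j‖) (hy : ‖q' j - q' k‖ = ‖q j - q k‖)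
    (hz : ‖q' k - q' i‖ = ‖q k - q i‖) (hc : cross i j k q' = cross i j k q) :
    Congruent q q' := by
  have hq0 : q j - q i ≠ 0 := sub_ne_zero.2 hq.symm
  have hx' : ‖q' j - q' i‖ = ‖q j - q i‖ := by rw [norm_sub_rev, hx, norm_sub_rev]
  -- The law of cosines fixes the real part of this product and `hc` is its imaginary part, so the
  -- complex number is the same for both triangles. The unit ratio of the edges `i j` then also
  -- carries the edge `i k` to its counterpart.
  have hre : ((starRingEnd ℂ) (q' j - q' i) * (q' k - q' i)).re
      = ((starRingEnd ℂ) (q j - q i) * (q k - q i)).re := by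
    have e : ∀ p : Config, 2 * ((starRingEnd ℂ) (p j - p i) * (p k - p i)).re
        = ‖p i - p j‖ ^ 2 + ‖p k - p i‖ ^ 2 - ‖p j - p k‖ ^ 2 := by
      intro p
      simp only [Complex.sq_norm, Complex.normSq_apply, Complex.sub_re, Complex.sub_im,
        Complex.mul_re, Complex.conj_re, Complex.conj_im]
      ring
    have := e q; have := e q'
    rw [hx, hy, hz] at this
    linarith
  have hmul : (starRingEnd ℂ) (q' j - q' i) * (q' k - q' i)
      = (starRingEnd ℂ) (q j - q i) * (q k - q i) := Complex.ext hre hc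
  have hq0' : q' j - q' i ≠ 0 := by
    rw [← norm_pos_iff, hx', norm_pos_iff]; exact hq0
  set u : ℂ := (q' j - q' i) / (q j - q i) with hu
  have hun : ‖u‖ = 1 := by
    rw [hu, norm_div, hx', div_self (norm_ne_zero_iff.2 hq0)]
  have huj : q' j - q' i = u * (q j - q i) := by rw [hu]; field_simp
  have huc : (starRingEnd ℂ) u * u = 1 := by
    rw [mul_comm, Complex.mul_conj, Complex.normSq_eq_norm_sq, hun]; simp
  have huk : q' k - q' i = u * (q k - q i) := by
    rw [huj, map_mul] at hmul
    have hc0 : (starRingEnd ℂ) (q j - q i) ≠ 0 := (map_ne_zero _).2 hq0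
    apply mul_left_cancel₀ hc0
    linear_combination u * hmul - (starRingEnd ℂ) (q j - q i) * (q' k - q' i) * huc
  refine ⟨u, q' i - u * q i, hun, h.forall_iff.2 ⟨?_, ?_, ?_⟩⟩
  · ring
  · linear_combination huj
  · linear_combination huk

lemma Congruent.dist_eq {q q' : Config} (h : Congruent q q') (i j : Fin 3) :
    ‖q' i - q' j‖ = ‖q i - q j‖ := by
  obtain ⟨u, c, hu, h⟩ := h
  rw [h i, h j, show u * q i + c - (u * q j + c) = u * (q i - q j) by ring, norm_mul, hu, one_mul]

lemma eq_of_sq_eq_of_sign {a b ε : ℝ} (h : a ^ 2 = b ^ 2) (ha : 0 < ε * a) (hb : 0 < ε * b) :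
    a = b := by
  rcases sq_eq_sq_iff_eq_or_eq_neg.1 h with h | h
  · exact h
  · rw [h] at ha; linarith

lemma cross_sq_eq {q q' : Config} {i j k : Fin 3}
    (hx : ‖q' i - q' j‖ = ‖q i - q j‖) (hy : ‖q' j - q' k‖ = ‖q j - q k‖)
    (hz : ‖q' k - q' i‖ = ‖q k - q i‖) : cross i j k q' ^ 2 = cross i j k q ^ 2 := by
  have h1 := cross_sq i j k q
  have h2 := cross_sq i j k q'
  rw [hx, hy, hz] at h2
  linarith

lemma congruent_of_oriented {q q' : Config} {i j k : Fin 3} (h : IsTriple i j k) (hq : q i ≠ q j)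
    (hx : ‖q' i - q' j‖ = ‖q i - q j‖) (hy : ‖q' j - q' k‖ = ‖q j - q k‖)
    (hz : ‖q' k - q' i‖ = ‖q k - q i‖) {o : Bool} (ho : Oriented o q) (ho' : Oriented o q') :
    Congruent q q' := by
  obtain ⟨ε, -, he⟩ := exists_sign_oriented h o
  exact congruent_of_dist h hq hx hy hz
    (eq_of_sq_eq_of_sign (cross_sq_eq hx hy hz) ((he _).1 ho') ((he _).1 ho))

lemma congruent_of_collinear {q q' : Config} {i j k : Fin 3} (h : IsTriple i j k) (hq : q i ≠ q j)
    (hx : ‖q' i - q' j‖ = ‖q i - q j‖) (hy : ‖q' j - q' k‖ = ‖q j - q k‖)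
    (hz : ‖q' k - q' i‖ = ‖q k - q i‖) (hc : cross i j k q = 0) : Congruent q q' := by
  refine congruent_of_dist h hq hx hy hz ?_
  have := cross_sq_eq hx hy hz
  rw [hc] at this ⊢
  simpa using this

/-! ### Realizing prescribed distances -/

/-- `x, y, z` are positive and satisfy the (weak) triangle inequalities. -/
structure IsTriangle (x y z : ℝ) : Prop where
  x_pos : 0 < x
  y_pos : 0 < y
  z_pos : 0 < z
  x_le : x ≤ y + z
  y_le : y ≤ z + x
  z_le : z ≤ x + y

/-- Abscissa of the third vertex of a triangle based on the real segment `[0, x]`. -/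
def apexRe (x y z : ℝ) : ℝ := (x ^ 2 + z ^ 2 - y ^ 2) / (2 * x)

/-- A triangle with `d_ij = x`, `d_jk = y`, `d_ki = z`. -/
def shape (i j : Fin 3) (ε x y z : ℝ) : Config := fun l =>
  if l = i then 0 else if l = j then (x : ℂ)
  else ⟨apexRe x y z, ε * √(z ^ 2 - apexRe x y z ^ 2)⟩

section shape

variable {i j k : Fin 3} (h : IsTriple i j k) (ε x y z : ℝ)

lemma shape_left : shape i j ε x y z i = 0 := by simp [shape]

include h in
lemma shape_middle : shape i j ε x y z j = x := by simp [shape, h.ij.symm]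

include h in
lemma shape_right :
    shape i j ε x y z k = ⟨apexRe x y z, ε * √(z ^ 2 - apexRe x y z ^ 2)⟩ := by
  simp [shape, h.ki, h.jk.symm]

/-- Heron's formula for the height over the base `x`: the triangle inequalities are what makes the
radicand in `shape` nonnegative. -/
lemma IsTriangle.apex_sq {x y z : ℝ} (t : IsTriangle x y z) :
    4 * x ^ 2 * (z ^ 2 - apexRe x y z ^ 2)
      = (x + y + z) * (x + y - z) * (y + z - x) * (z + x - y) := by
  have := t.x_pos
  unfold apexRe; field_simp; ring

lemma IsTriangle.apex_nonneg {x y z : ℝ} (t : IsTriangle x y z) :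
    0 ≤ z ^ 2 - apexRe x y z ^ 2 := by
  have h1 := t.apex_sq
  have h0 := t.x_pos
  have : 0 ≤ (x + y + z) * (x + y - z) * (y + z - x) * (z + x - y) := by
    refine mul_nonneg (mul_nonneg (mul_nonneg ?_ ?_) ?_) ?_
    · linarith [t.x_pos, t.y_pos, t.z_pos]
    · linarith [t.z_le]
    · linarith [t.x_le]
    · linarith [t.y_le]
  rw [← h1] at this
  exact nonneg_of_mul_nonneg_right this (by positivity)

lemma IsTriangle.apex_pos {x y z : ℝ} (t : IsTriangle x y z) (hx : x < y + z) (hy : y < z + x)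
    (hz : z < x + y) : 0 < z ^ 2 - apexRe x y z ^ 2 := by
  have h1 := t.apex_sq
  have h0 := t.x_pos
  have : 0 < (x + y + z) * (x + y - z) * (y + z - x) * (z + x - y) := by
    refine mul_pos (mul_pos (mul_pos ?_ ?_) ?_) ?_
    · linarith [t.x_pos, t.y_pos, t.z_pos]
    · linarith
    · linarith
    · linarith
  rw [← h1] at this
  exact pos_of_mul_pos_right this (by positivity)

variable {ε x y z}

include h in
lemma norm_shape (hε : ε = 1 ∨ ε = -1) (t : IsTriangle x y z) :
    ‖shape i j ε x y z i - shape i j ε x y z j‖ = x ∧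
    ‖shape i j ε x y z j - shape i j ε x y z k‖ = y ∧
    ‖shape i j ε x y z k - shape i j ε x y z i‖ = z := by
  have hx := t.x_pos
  have hs := Real.sq_sqrt t.apex_nonneg
  have hε2 : ε ^ 2 = 1 := by rcases hε with rfl | rfl <;> norm_num
  rw [shape_left, shape_middle h, shape_right h]
  refine ⟨?_, ?_, ?_⟩
  · simp [abs_of_pos hx]
  · rw [← sq_eq_sq₀ (norm_nonneg _) t.y_pos.le, Complex.sq_norm, Complex.normSq_apply]
    simp only [Complex.sub_re, Complex.sub_im, Complex.ofReal_re, Complex.ofReal_im]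
    have : x * apexRe x y z * 2 = x ^ 2 + z ^ 2 - y ^ 2 := by unfold apexRe; field_simp
    linear_combination hs * ε ^ 2 - this + (z ^ 2 - apexRe x y z ^ 2) * hε2
  · rw [← sq_eq_sq₀ (norm_nonneg _) t.z_pos.le, Complex.sq_norm, Complex.normSq_apply]
    simp only [sub_zero]
    linear_combination hs * ε ^ 2 + (z ^ 2 - apexRe x y z ^ 2) * hε2

include h in
lemma cross_shape :
    cross i j k (shape i j ε x y z) = ε * (x * √(z ^ 2 - apexRe x y z ^ 2)) := by
  rw [cross_def, shape_left, shape_middle h, shape_right h]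
  simp; ring

include h in
-- No nondegeneracy is required, because the real square root is continuous at zero. Triangles may
-- therefore flatten in the limit, as they must where TR meets ER.
lemma continuousAt_shape {p : ℝ × ℝ × ℝ} (hp : p.1 ≠ 0) :
    ContinuousAt (fun p : ℝ × ℝ × ℝ => shape i j ε p.1 p.2.1 p.2.2) p := by
  have hc : ContinuousAt (fun p : ℝ × ℝ × ℝ => apexRe p.1 p.2.1 p.2.2) p := by
    unfold apexRe
    exact ContinuousAt.div (by fun_prop) (by fun_prop) (by simpa using hp)
  rw [continuousAt_pi]
  refine h.forall_iff.2 ⟨?_, ?_, ?_⟩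
  · simp only [shape_left]; exact continuousAt_const
  · simp only [shape_middle h]; fun_prop
  · simp only [shape_right h]
    have : (fun p : ℝ × ℝ × ℝ => (⟨apexRe p.1 p.2.1 p.2.2,
        ε * √(p.2.2 ^ 2 - apexRe p.1 p.2.1 p.2.2 ^ 2)⟩ : ℂ))
        = fun p : ℝ × ℝ × ℝ => (apexRe p.1 p.2.1 p.2.2 : ℂ)
          + (ε * √(p.2.2 ^ 2 - apexRe p.1 p.2.1 p.2.2 ^ 2) : ℝ) * Complex.I := by
      funext p; exact Complex.mk_eq_add_mul_I _ _
    rw [this]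
    have h2 : ContinuousAt (fun p : ℝ × ℝ × ℝ =>
        ε * √(p.2.2 ^ 2 - apexRe p.1 p.2.1 p.2.2 ^ 2)) p :=
      continuousAt_const.mul ((ContinuousAt.sub (by fun_prop) (hc.pow 2)).sqrt)
    exact (Complex.continuous_ofReal.continuousAt.comp hc).add
      ((Complex.continuous_ofReal.continuousAt.comp h2).mul continuousAt_const)

end shape

/-- The configuration moved so that its centre of mass is the origin. -/
def centerAt (r : Fin 3 → ℝ) (q : Config) : Config := fun l => q l - ∑ m, mass r m • q m

lemma centered_centerAt {r : Fin 3 → ℝ} (hs : IsSizes r) (q : Config) :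
    Centered r (centerAt r q) := by
  unfold Centered centerAt
  simp only [smul_sub, Finset.sum_sub_distrib, ← Finset.sum_smul, hs.sum_mass, one_smul, sub_self]

lemma centerAt_sub (r : Fin 3 → ℝ) (q : Config) (a b : Fin 3) :
    centerAt r q a - centerAt r q b = q a - q b := by simp [centerAt]

lemma cross_centerAt (r : Fin 3 → ℝ) (i j k : Fin 3) (q : Config) :
    cross i j k (centerAt r q) = cross i j k q := by
  simp only [cross, centerAt_sub]

/-- The centred triangle with `d_ij = x`, `d_jk = y`, `d_ki = z`. -/
def placed (r : Fin 3 → ℝ) (i j : Fin 3) (ε x y z : ℝ) : Config :=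
  centerAt r (shape i j ε x y z)

lemma continuousAt_placed {r : Fin 3 → ℝ} {i j k : Fin 3} (h : IsTriple i j k) {ε : ℝ}
    {p : ℝ × ℝ × ℝ} (hp : p.1 ≠ 0) :
    ContinuousAt (fun p : ℝ × ℝ × ℝ => placed r i j ε p.1 p.2.1 p.2.2) p := by
  have := continuousAt_shape h (ε := ε) hp
  have hg : Continuous (centerAt r) := by unfold centerAt; fun_prop
  exact hg.continuousAt.comp (f := fun p : ℝ × ℝ × ℝ => shape i j ε p.1 p.2.1 p.2.2) this

section placed

variable {r : Fin 3 → ℝ} {i j k : Fin 3} (h : IsTriple i j k) {ε x y z : ℝ}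
  (hε : ε = 1 ∨ ε = -1) (t : IsTriangle x y z)
include h hε t

lemma norm_placed_ij : ‖placed r i j ε x y z i - placed r i j ε x y z j‖ = x := by
  rw [placed, centerAt_sub]; exact (norm_shape h hε t).1

lemma norm_placed_jk : ‖placed r i j ε x y z j - placed r i j ε x y z k‖ = y := by
  rw [placed, centerAt_sub]; exact (norm_shape h hε t).2.1

lemma norm_placed_ki : ‖placed r i j ε x y z k - placed r i j ε x y z i‖ = z := by
  rw [placed, centerAt_sub]; exact (norm_shape h hε t).2.2

lemma cross_placed_pos (hx : x < y + z) (hy : y < z + x) (hz : z < x + y) :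
    0 < ε * cross i j k (placed r i j ε x y z) := by
  rw [placed, cross_centerAt, cross_shape h]
  have := t.x_pos
  have := Real.sqrt_pos.2 (t.apex_pos hx hy hz)
  have : ε * (ε * (x * √(z ^ 2 - apexRe x y z ^ 2))) = x * √(z ^ 2 - apexRe x y z ^ 2) := by
    rcases hε with rfl | rfl <;> ring
  rw [this]; positivity

end placed

lemma isTriangle_of_config {q : Config} {i j k : Fin 3} (hij : q i ≠ q j) (hjk : q j ≠ q k)
    (hki : q k ≠ q i) : IsTriangle ‖q i - q j‖ ‖q j - q k‖ ‖q k - q i‖ := by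
  refine ⟨norm_pos_iff.2 (sub_ne_zero.2 hij), norm_pos_iff.2 (sub_ne_zero.2 hjk),
    norm_pos_iff.2 (sub_ne_zero.2 hki), ?_, ?_, ?_⟩
  · have := norm_sub_le_norm_sub_add_norm_sub (q i) (q k) (q j)
    rw [norm_sub_rev (q i) (q k), norm_sub_rev (q k) (q j)] at this; linarith
  · have := norm_sub_le_norm_sub_add_norm_sub (q j) (q i) (q k)
    rw [norm_sub_rev (q j) (q i), norm_sub_rev (q i) (q k)] at this; linarith
  · have := norm_sub_le_norm_sub_add_norm_sub (q k) (q j) (q i)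
    rw [norm_sub_rev (q k) (q j), norm_sub_rev (q j) (q i)] at this; linarith

/-- Every triple of distances close to those of `q` is realized by a configuration close to `q`. -/
lemma exists_local_realization {q : Config} {i j k : Fin 3} (h : IsTriple i j k)
    (hij : q i ≠ q j) (hjk : q j ≠ q k) (hki : q k ≠ q i) :
    ∃ Γ : ℝ × ℝ × ℝ → Config,
      ContinuousAt Γ (‖q i - q j‖, ‖q j - q k‖, ‖q k - q i‖) ∧
      Γ (‖q i - q j‖, ‖q j - q k‖, ‖q k - q i‖) = q ∧
      ∀ p : ℝ × ℝ × ℝ, IsTriangle p.1 p.2.1 p.2.2 →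
        ‖Γ p i - Γ p j‖ = p.1 ∧ ‖Γ p j - Γ p k‖ = p.2.1 ∧ ‖Γ p k - Γ p i‖ = p.2.2 := by
  have t := isTriangle_of_config hij hjk hki
  -- The apex is put on the side of the base where the third body of `q` lies; for aligned `q`
  -- either side will do.
  obtain ⟨ε, hε, hsgn⟩ : ∃ ε : ℝ, (ε = 1 ∨ ε = -1) ∧ 0 ≤ ε * cross i j k q := by
    rcases le_total 0 (cross i j k q) with h0 | h0
    · exact ⟨1, Or.inl rfl, by simpa using h0⟩
    · exact ⟨-1, Or.inr rfl, by simpa using h0⟩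
  set x := ‖q i - q j‖ with hx
  set y := ‖q j - q k‖ with hy
  set z := ‖q k - q i‖ with hz
  set p := shape i j ε x y z with hp
  obtain ⟨n1, n2, n3⟩ := norm_shape h hε t
  have hc : cross i j k q = cross i j k p := by
    have h2 : cross i j k q ^ 2 = cross i j k p ^ 2 :=
      cross_sq_eq (n1.symm ▸ rfl) (n2.symm ▸ rfl) (n3.symm ▸ rfl)
    have h3 : 0 ≤ ε * cross i j k p := by
      rw [cross_shape h, ← mul_assoc]
      have := t.x_pos
      have : ε * ε = 1 := by rcases hε with rfl | rfl <;> norm_num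
      rw [this]; positivity
    rcases sq_eq_sq_iff_eq_or_eq_neg.1 h2 with h | h
    · exact h
    · have h4 : ε * cross i j k p = 0 := by
        rw [h] at hsgn; linarith
      have h5 : cross i j k p = 0 := by
        rcases mul_eq_zero.1 h4 with h | h
        · rcases hε with rfl | rfl <;> norm_num at h
        · exact h
      rw [h, h5, neg_zero]
  have hpij : p i ≠ p j := by
    rw [← sub_ne_zero, ← norm_pos_iff, n1]; exact t.x_pos
  obtain ⟨u, c, hu, huc⟩ := congruent_of_dist (q := p) (q' := q) h hpij n1.symm n2.symm n3.symm hc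
  refine ⟨fun w l => u * shape i j ε w.1 w.2.1 w.2.2 l + c, ?_, ?_, ?_⟩
  · have hcs := continuousAt_shape h (ε := ε) (p := (x, y, z)) t.x_pos.ne'
    rw [continuousAt_pi] at hcs ⊢
    intro l
    exact (continuousAt_const.mul (hcs l)).add continuousAt_const
  · funext l; exact (huc l).symm
  · intro w hw
    have e : ∀ a b : Fin 3, ‖(u * shape i j ε w.1 w.2.1 w.2.2 a + c)
        - (u * shape i j ε w.1 w.2.1 w.2.2 b + c)‖
        = ‖shape i j ε w.1 w.2.1 w.2.2 a - shape i j ε w.1 w.2.1 w.2.2 b‖ := by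
      intro a b
      rw [show ∀ s t : ℂ, u * s + c - (u * t + c) = u * (s - t) by intros; ring, norm_mul, hu,
        one_mul]
    simp only [e]
    exact norm_shape h hε hw

/-! ### From motions to force balances -/

/-- Leibniz: for a centred configuration the moment of inertia is the sum of `m |q|²`. -/
lemma inertia_of_centered {r : Fin 3 → ℝ} (hs : IsSizes r) {q : Config} (hq : Centered r q) :
    inertia r q = (∑ i, mass r i * ‖q i‖ ^ 2) + ∑ i, ballInertia r i := by
  have hm := hs.mass_add isTriple_zero_one_two
  rw [inertia_eq r isTriple_zero_one_two, inertiaOf]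
  congr 1
  have h0 : mass r 0 • q 0 + mass r 1 • q 1 + mass r 2 • q 2 = 0 := by
    rw [← isTriple_zero_one_two.sum_eq (fun l => mass r l • q l)]; exact hq
  have hre := congrArg Complex.re h0
  have him := congrArg Complex.im h0
  simp only [Complex.add_re, Complex.add_im, Complex.real_smul, Complex.mul_re, Complex.mul_im,
    Complex.ofReal_re, Complex.ofReal_im, zero_mul, sub_zero, add_zero, Complex.zero_re,
    Complex.zero_im] at hre him
  rw [isTriple_zero_one_two.sum_eq]
  simp only [Complex.sq_norm, Complex.normSq_apply, Complex.sub_re, Complex.sub_im]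
  linear_combination (-(mass r 0 * (q 0).re + mass r 1 * (q 1).re + mass r 2 * (q 2).re)) * hre
    - (mass r 0 * (q 0).im + mass r 1 * (q 1).im + mass r 2 * (q 2).im) * him
    + (mass r 0 * ((q 0).re ^ 2 + (q 0).im ^ 2) + mass r 1 * ((q 1).re ^ 2 + (q 1).im ^ 2)
      + mass r 2 * ((q 2).re ^ 2 + (q 2).im ^ 2)) * hm

/-- The internal kinetic energy is the kinetic energy relative to the turning frame. -/
lemma internalKinetic_eq {r : Fin 3 → ℝ} (hs : IsSizes r) (s : Motion) (t : ℝ)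
    (hc : Centered r (s.pos t)) {ω : ℝ}
    (hω : ω * inertia r (s.pos t) = s.angularMomentum r t) :
    2 * s.internalKinetic r t = (∑ i, mass r i * ‖s.vel t i - ω * Complex.I * s.pos t i‖ ^ 2)
      + ∑ i, ballInertia r i * (s.spin t i - ω) ^ 2 := by
  have hI := hs.inertia_pos (s.pos t)
  have hIc := inertia_of_centered hs hc
  unfold Motion.internalKinetic Motion.energy amended
  have e1 : s.angularMomentum r t ^ 2 / (2 * inertia r (s.pos t))
      = ω * s.angularMomentum r t / 2 := by
    rw [← hω]; field_simp
  -- Completes the square: kinetic energy minus ωL / 2 becomes the kinetic energy of the velocities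
  -- relative to the frame with rate ω.
  have e2 : ω * s.angularMomentum r t
      = 2 * (ω * s.angularMomentum r t) - ω ^ 2 * inertia r (s.pos t) := by
    rw [← hω]; ring
  rw [e1, e2, hIc, Motion.angularMomentum]
  simp only [isTriple_zero_one_two.sum_eq, Complex.sq_norm, Complex.normSq_apply, Complex.sub_re,
    Complex.sub_im, Complex.mul_re, Complex.mul_im, Complex.ofReal_re, Complex.ofReal_im,
    Complex.I_re, Complex.I_im, Complex.conj_re, Complex.conj_im]
  ring

/-- Admissible systems of contact reactions. -/
def IsReaction (r : Fin 3 → ℝ) (q : Config) (f : Fin 3 → Fin 3 → ℝ) : Prop :=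
  ∀ i j, 0 ≤ f i j ∧ f i j = f j i ∧ (r i + r j < ‖q i - q j‖ → f i j = 0)

/-- A vanishing sum of positively weighted squares forces v = iωq and all spins equal to ω = H / I;
the acceleration is then −ω²q, which is the right-hand side of the balance. Conversely, rotating a
balanced configuration rigidly by exp(iωt), with constant reactions, solves the equations of motion.
-/
lemma relEq_iff_force {r : Fin 3 → ℝ} (hs : IsSizes r) {H : ℝ} {q : Config} :
    IsRelEq r H q ↔ Admissible r q ∧ Centered r q ∧ ∃ f, IsReaction r q f ∧
      ∀ i, ∑ j ∈ Finset.univ.erase i,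
        (mass r i * mass r j / ‖q i - q j‖ ^ 3 - f i j / ‖q i - q j‖) • (q j - q i)
        = -((mass r i * (H / inertia r q) ^ 2) • q i) := by
  constructor
  · rintro ⟨τ, hτ, s, hsol, h0, hH⟩
    have m0 : (0 : ℝ) ∈ Icc 0 τ := ⟨le_rfl, hτ.le⟩
    have ha := hsol.admissible 0 m0
    have hc := hsol.centered 0 m0
    have key : ∀ t ∈ Icc 0 τ, (∀ i, s.vel t i = s.spin t 0 * Complex.I * s.pos t i) ∧
        s.spin t 0 = H / inertia r (s.pos t) := by
      intro t ht
      have hI := hs.inertia_pos (s.pos t)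
      have e := internalKinetic_eq hs s t (hsol.centered t ht) (ω := H / inertia r (s.pos t))
        (by rw [(hH t ht).1]; field_simp)
      rw [(hH t ht).2, mul_zero] at e
      have n1 : 0 ≤ ∑ i, mass r i * ‖s.vel t i
          - (H / inertia r (s.pos t) : ℝ) * Complex.I * s.pos t i‖ ^ 2 :=
        Finset.sum_nonneg fun i _ => mul_nonneg (hs.mass_pos i).le (sq_nonneg _)
      have n2 : 0 ≤ ∑ i, ballInertia r i * (s.spin t i - H / inertia r (s.pos t)) ^ 2 :=
        Finset.sum_nonneg fun i _ => mul_nonneg (hs.ballInertia_pos i).le (sq_nonneg _)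
      have z1 := (Finset.sum_eq_zero_iff_of_nonneg
        (fun i _ => mul_nonneg (hs.mass_pos i).le (sq_nonneg _))).1 (by linarith :
          ∑ i, mass r i * ‖s.vel t i
          - (H / inertia r (s.pos t) : ℝ) * Complex.I * s.pos t i‖ ^ 2 = 0)
      have z2 := (Finset.sum_eq_zero_iff_of_nonneg
        (fun i _ => mul_nonneg (hs.ballInertia_pos i).le (sq_nonneg _))).1 (by linarith :
          ∑ i, ballInertia r i * (s.spin t i - H / inertia r (s.pos t)) ^ 2 = 0)
      have h2 : s.spin t 0 = H / inertia r (s.pos t) := by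
        have := z2 0 (Finset.mem_univ _)
        rcases mul_eq_zero.1 this with h | h
        · exact absurd h (hs.ballInertia_pos 0).ne'
        · exact sub_eq_zero.1 (pow_eq_zero_iff two_ne_zero |>.1 h)
      refine ⟨fun i => ?_, h2⟩
      have := z1 i (Finset.mem_univ _)
      rcases mul_eq_zero.1 this with h | h
      · exact absurd h (hs.mass_pos i).ne'
      · rw [h2]
        exact sub_eq_zero.1 (norm_eq_zero.1 (pow_eq_zero_iff two_ne_zero |>.1 h))
    obtain ⟨f, hf⟩ := hsol.newton
    obtain ⟨hf1, hf2⟩ := hf 0 m0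
    rw [h0] at ha hc
    refine ⟨ha, hc, f 0, ?_, fun i => ?_⟩
    · intro i j
      have := hf1 i j
      rwa [h0] at this
    · have d1 := hf2 i
      -- The rate is written as the spin of body `0`, whose derivative is zero by the equations of
      -- motion; nothing is known beforehand about the derivative of H / I. Comparison with Newton's
      -- law at t = 0 uses uniqueness of derivatives on a nondegenerate interval.
      have d2 : HasDerivWithinAt (fun u => mass r i • s.vel u i)
          (mass r i • (s.spin 0 0 * Complex.I * s.vel 0 i)) (Icc 0 τ) 0 := by
        have a1 := (hsol.spin_deriv 0 m0 0).ofReal_comp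
        have a2 := hsol.pos_deriv 0 m0 i
        have a3 := ((a1.mul_const Complex.I).mul a2).const_smul (mass r i)
        simp only [Complex.ofReal_zero, zero_mul, zero_add] at a3
        exact a3.congr (fun u hu => by rw [(key u hu).1 i]; rfl) (by rw [(key 0 m0).1 i]; rfl)
      have u := (uniqueDiffOn_Icc hτ 0 m0).eq_deriv _ d1 d2
      have k2 := (key 0 m0).2
      have k1 := (key 0 m0).1 i
      rw [h0] at u k2 k1
      rw [u, k1, k2]
      simp only [Complex.real_smul]
      push_cast
      linear_combination (mass r i : ℂ) * (H / inertia r q) ^ 2 * q i * Complex.I_sq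
  · rintro ⟨ha, hc, f, hf, hb⟩
    set ω := H / inertia r q with hω
    have hI := hs.inertia_pos q
    let e : ℝ → ℂ := fun t => Complex.exp (ω * Complex.I * t)
    have he : ∀ t, ‖e t‖ = 1 := by
      intro t
      have : (ω * Complex.I * t : ℂ) = ((ω * t : ℝ) : ℂ) * Complex.I := by push_cast; ring
      simp only [e, this, Complex.norm_exp_ofReal_mul_I]
    have hed : ∀ t, HasDerivAt e (ω * Complex.I * e t) t := by
      intro t
      have h1 : HasDerivAt (fun t : ℝ => (ω * Complex.I * t : ℂ)) (ω * Complex.I) t := by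
        simpa using (Complex.ofRealCLM.hasDerivAt (x := t)).const_mul (ω * Complex.I)
      have := h1.cexp
      simpa [e, mul_comm] using this
    let s : Motion :=
      { pos := fun t i => e t * q i
        vel := fun t i => ω * Complex.I * (e t * q i)
        spin := fun _ _ => ω }
    have hn : ∀ t i j, ‖s.pos t i - s.pos t j‖ = ‖q i - q j‖ := by
      intro t i j
      simp only [s]
      rw [← mul_sub, norm_mul, he, one_mul]
    have hcen : ∀ t, Centered r (s.pos t) := by
      intro t
      have : ∑ i, mass r i • s.pos t i = e t * ∑ i, mass r i • q i := by
        rw [Finset.mul_sum]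
        refine Finset.sum_congr rfl fun i _ => ?_
        simp only [s, Complex.real_smul]; ring
      unfold Centered
      rw [this, show ∑ i, mass r i • q i = 0 from hc, mul_zero]
    have hin : ∀ t, inertia r (s.pos t) = inertia r q := by
      intro t; unfold inertia; simp only [hn]
    have hL : ∀ t, s.angularMomentum r t = ω * inertia r (s.pos t) := by
      intro t
      rw [inertia_of_centered hs (hcen t), Motion.angularMomentum, mul_add, Finset.mul_sum,
        Finset.mul_sum]
      congr 1
      · refine Finset.sum_congr rfl fun i _ => ?_
        simp only [s, Complex.sq_norm, Complex.normSq_apply, Complex.mul_re, Complex.mul_im,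
          Complex.ofReal_re, Complex.ofReal_im, Complex.I_re, Complex.I_im, Complex.conj_re,
          Complex.conj_im]
        ring
      · refine Finset.sum_congr rfl fun i _ => ?_
        simp only [s]; ring
    refine ⟨1, one_pos, s, ⟨?_, fun t _ => hcen t, ?_, ?_, fun _ => f, ?_⟩, ?_, ?_⟩
    · intro t _ i j hij
      rw [hn]; exact ha i j hij
    · intro t _ i
      have := ((hed t).mul_const (q i)).hasDerivWithinAt (s := Icc 0 1)
      simpa only [s, mul_assoc] using this
    · intro t _ i
      exact hasDerivWithinAt_const _ _ _
    · intro t _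
      refine ⟨fun i j => ?_, fun i => ?_⟩
      · rw [hn]; exact hf i j
      · simp only [hn]
        have h1 : ∑ j ∈ Finset.univ.erase i, (mass r i * mass r j / ‖q i - q j‖ ^ 3
            - f i j / ‖q i - q j‖) • (s.pos t j - s.pos t i)
            = e t * -((mass r i * ω ^ 2) • q i) := by
          rw [← hb i, Finset.mul_sum]
          refine Finset.sum_congr rfl fun j _ => ?_
          simp only [s, Complex.real_smul]; ring
        rw [h1]
        have h2 := ((((hed t).mul_const (q i)).const_mul (ω * Complex.I : ℂ)).const_smul
          (mass r i)).hasDerivWithinAt (s := Icc 0 1)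
        have h3 : e t * -((mass r i * ω ^ 2) • q i)
            = mass r i • (ω * Complex.I * (ω * Complex.I * e t * q i)) := by
          rw [Complex.real_smul, Complex.real_smul]
          push_cast
          linear_combination (-(mass r i : ℂ)) * ω ^ 2 * q i * e t * Complex.I_sq
        rw [h3]
        exact h2
    · funext i
      simp [s, e]
    · intro t _
      have h1 : s.angularMomentum r t = H := by
        rw [hL, hin, hω]; field_simp
      refine ⟨h1, ?_⟩
      have := internalKinetic_eq hs s t (hcen t) (hL t).symm
      have z1 : ∀ i, s.vel t i - ω * Complex.I * s.pos t i = 0 := fun i => by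
        simp only [s]; ring
      have z2 : ∀ i, s.spin t i - ω = 0 := fun i => sub_self ω
      simpa only [z1, z2, norm_zero, ne_eq, OfNat.ofNat_ne_zero, not_false_eq_true, zero_pow,
        mul_zero, Finset.sum_const_zero, add_zero, mul_eq_zero, false_or] using this

/-- Net coefficient of `q j - q i` in the force balance of a body. -/
def coupling (r : Fin 3 → ℝ) (H : ℝ) (q : Config) (f : Fin 3 → Fin 3 → ℝ) (i j : Fin 3) : ℝ :=
  mass r i * mass r j / ‖q i - q j‖ ^ 3 - f i j / ‖q i - q j‖
    - mass r i * mass r j * (H / inertia r q) ^ 2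

lemma coupling_symm {r : Fin 3 → ℝ} {H : ℝ} {q : Config} {f : Fin 3 → Fin 3 → ℝ}
    (hf : IsReaction r q f) (i j : Fin 3) : coupling r H q f i j = coupling r H q f j i := by
  unfold coupling
  rw [(hf i j).2.1, norm_sub_rev]; ring

/-- With total mass one and the centre of mass at the origin, q_i is the sum of m_j (q_i − q_j). The
centrifugal force thus splits into pair terms along the edges, and the position of the origin drops
out of the balance. -/
lemma relEq_iff {r : Fin 3 → ℝ} (hs : IsSizes r) {H : ℝ} {q : Config} :
    IsRelEq r H q ↔ Admissible r q ∧ Centered r q ∧ ∃ f, IsReaction r q f ∧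
      ∀ i j k, IsTriple i j k →
        coupling r H q f i j • (q j - q i) + coupling r H q f i k • (q k - q i) = 0 := by
  rw [relEq_iff_force hs]
  refine and_congr_right fun ha => and_congr_right fun hc => exists_congr fun f =>
    and_congr_right fun hf => ?_
  have key : ∀ i j k, IsTriple i j k → (∑ j ∈ Finset.univ.erase i,
        (mass r i * mass r j / ‖q i - q j‖ ^ 3 - f i j / ‖q i - q j‖) • (q j - q i)
        = -((mass r i * (H / inertia r q) ^ 2) • q i) ↔
        coupling r H q f i j • (q j - q i) + coupling r H q f i k • (q k - q i) = 0) := by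
    intro i j k h
    have hm := hs.mass_add h
    have h0 : mass r i • q i + mass r j • q j + mass r k • q k = 0 := by
      rw [← h.sum_eq (fun l => mass r l • q l)]; exact hc
    rw [h.sum_erase, ← sub_eq_zero]
    unfold coupling
    simp only [Complex.real_smul] at h0 ⊢
    have hm' : (mass r i : ℂ) + mass r j + mass r k = 1 := by exact_mod_cast hm
    refine Eq.congr ?_ rfl
    push_cast
    linear_combination ((mass r i : ℂ) * (H / inertia r q) ^ 2) * h0
      - (mass r i : ℂ) * (H / inertia r q) ^ 2 * q i * hm'
  constructor
  · intro H i j k h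
    exact (key i j k h).1 (H i)
  · intro H i
    have h : IsTriple i (i + 1) (i + 2) :=
      ⟨by revert i; decide, by revert i; decide, by revert i; decide⟩
    exact (key i _ _ h).2 (H i _ _ h)

lemma Admissible.ne {r : Fin 3 → ℝ} (hs : IsSizes r) {q : Config} (ha : Admissible r q)
    {i j : Fin 3} (h : i ≠ j) : q i ≠ q j := by
  intro e
  have := ha i j h
  rw [e, sub_self, norm_zero] at this
  linarith [hs.pos i, hs.pos j]

lemma Admissible.dist_pos {r : Fin 3 → ℝ} (hs : IsSizes r) {q : Config} (ha : Admissible r q)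
    {i j : Fin 3} (h : i ≠ j) : 0 < ‖q i - q j‖ :=
  norm_pos_iff.2 (sub_ne_zero.2 (ha.ne hs h))

lemma Admissible.isTriangle {r : Fin 3 → ℝ} (hs : IsSizes r) {q : Config} (ha : Admissible r q)
    {i j k : Fin 3} (h : IsTriple i j k) : IsTriangle ‖q i - q j‖ ‖q j - q k‖ ‖q k - q i‖ :=
  isTriangle_of_config (ha.ne hs h.ij) (ha.ne hs h.jk) (ha.ne hs h.ki)

lemma contact_comm {r : Fin 3 → ℝ} {q : Config} {i j : Fin 3} :
    Contact r q i j ↔ Contact r q j i := by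
  unfold Contact; rw [norm_sub_rev, add_comm]

lemma Admissible.lt_of_not_contact {r : Fin 3 → ℝ} {q : Config} (ha : Admissible r q)
    {i j : Fin 3} (h : i ≠ j) (hc : ¬ Contact r q i j) : r i + r j < ‖q i - q j‖ :=
  lt_of_le_of_ne (ha i j h) (fun e => hc e.symm)

lemma eq_zero_of_cross_ne {u v : ℂ} (h : ((starRingEnd ℂ) u * v).im ≠ 0) {α β : ℝ}
    (e : α • u + β • v = 0) : α = 0 ∧ β = 0 := by
  have hre := congrArg Complex.re e
  have him := congrArg Complex.im e
  simp only [Complex.add_re, Complex.add_im, Complex.real_smul, Complex.mul_re, Complex.mul_im,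
    Complex.ofReal_re, Complex.ofReal_im, zero_mul, sub_zero, add_zero, Complex.zero_re,
    Complex.zero_im, Complex.conj_re, Complex.conj_im] at hre him h
  constructor
  · apply mul_left_cancel₀ h
    linear_combination v.im * hre - v.re * him
  · apply mul_left_cancel₀ h
    linear_combination u.re * him - u.im * hre

/-- The two edges at a body are linearly independent, so each `coupling` vanishes separately. This
forces the reaction m_a m_b (1/d² − ω² d), which must be nonnegative, and zero where there is no
contact. -/
lemma relEq_noncollinear {r : Fin 3 → ℝ} (hs : IsSizes r) {H : ℝ} {q : Config} {i j k : Fin 3}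
    (h : IsTriple i j k) (hq : cross i j k q ≠ 0) :
    IsRelEq r H q ↔ Admissible r q ∧ Centered r q ∧ ∀ a b, a ≠ b →
      (H / inertia r q) ^ 2 * ‖q a - q b‖ ^ 3 ≤ 1 ∧
      (¬ Contact r q a b → (H / inertia r q) ^ 2 * ‖q a - q b‖ ^ 3 = 1) := by
  rw [relEq_iff hs]
  refine and_congr_right fun ha => and_congr_right fun _ => ?_
  have hne : ∀ a b c, IsTriple a b c → cross a b c q ≠ 0 := by
    intro a b c h'
    obtain ⟨o, ho⟩ := exists_oriented h hq
    exact ho.cross_ne h'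
  constructor
  · rintro ⟨f, hf, hb⟩ a b hab
    obtain ⟨c, hc⟩ : ∃ c, IsTriple a b c := by
      have : ∃ c, a ≠ b ∧ b ≠ c ∧ c ≠ a := by revert a b; decide
      obtain ⟨c, h1, h2, h3⟩ := this
      exact ⟨c, h1, h2, h3⟩
    have h0 := (eq_zero_of_cross_ne (hne a b c hc) (hb a b c hc)).1
    have hd := ha.dist_pos hs hab
    have hm : 0 < mass r a * mass r b := mul_pos (hs.mass_pos a) (hs.mass_pos b)
    unfold coupling at h0
    set d := ‖q a - q b‖
    set w := (H / inertia r q) ^ 2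
    have h1 : f a b * d ^ 2 = mass r a * mass r b * (1 - w * d ^ 3) := by
      field_simp at h0
      linear_combination (-1 : ℝ) * h0
    have hf0 := (hf a b).1
    constructor
    · have : 0 ≤ mass r a * mass r b * (1 - w * d ^ 3) := by rw [← h1]; positivity
      have := nonneg_of_mul_nonneg_right this hm
      linarith
    · intro hcon
      rw [(hf a b).2.2 (ha.lt_of_not_contact hab hcon), zero_mul] at h1
      have := (mul_eq_zero.1 h1.symm).resolve_left hm.ne'
      linarith
  · intro hw
    refine ⟨fun a b => mass r a * mass r b * (1 / ‖q a - q b‖ ^ 3 - (H / inertia r q) ^ 2)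
      * ‖q a - q b‖, ?_, ?_⟩
    · intro a b
      refine ⟨?_, by dsimp only; rw [norm_sub_rev]; ring, ?_⟩
      all_goals dsimp only
      · by_cases hab : a = b
        · simp [hab]
        · have hd := ha.dist_pos hs hab
          have hm : 0 < mass r a * mass r b := mul_pos (hs.mass_pos a) (hs.mass_pos b)
          have := (hw a b hab).1
          have : (H / inertia r q) ^ 2 ≤ 1 / ‖q a - q b‖ ^ 3 := by
            rwa [le_div_iff₀ (by positivity)]
          have := sub_nonneg.2 this
          positivity
      · intro hlt
        by_cases hab : a = b
        · simp [hab]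
        · have hd := ha.dist_pos hs hab
          have := (hw a b hab).2 (fun e => hlt.ne' e)
          have : (H / inertia r q) ^ 2 = 1 / ‖q a - q b‖ ^ 3 := by
            rw [eq_div_iff (by positivity), this]
          rw [this]; ring
    · intro a b c habc
      have e : ∀ a b, a ≠ b → coupling r H q (fun a b => mass r a * mass r b *
          (1 / ‖q a - q b‖ ^ 3 - (H / inertia r q) ^ 2) * ‖q a - q b‖) a b = 0 := by
        intro a b hab
        have hd := ha.dist_pos hs hab
        unfold coupling
        field_simp
        ring
      rw [e a b habc.ij, e a c habc.ki.symm]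
      simp

lemma rateSq_sub {r : Fin 3 → ℝ} (i j : Fin 3) {x y z : ℝ} (h : x + y = z) :
    rateSq r i j x z = (mass r i / z ^ 2 + mass r j / y ^ 2) / (mass r i * z + mass r j * y) := by
  unfold rateSq
  rw [← h, add_sub_cancel_left]

lemma rateSq_sub' {r : Fin 3 → ℝ} (k j : Fin 3) {x y z : ℝ} (h : x + y = z) :
    rateSq r k j y z = (mass r k / z ^ 2 + mass r j / x ^ 2) / (mass r k * z + mass r j * x) := by
  rw [rateSq_sub k j (show y + x = z by linarith)]

lemma IsTriple.cases {i j k a b c : Fin 3} (h : IsTriple i j k) (h' : IsTriple a b c) :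
    (a = i ∧ b = j ∧ c = k) ∨ (a = j ∧ b = k ∧ c = i) ∨ (a = k ∧ b = i ∧ c = j) ∨
    (a = i ∧ b = k ∧ c = j) ∨ (a = j ∧ b = i ∧ c = k) ∨ (a = k ∧ b = j ∧ c = i) := by
  obtain ⟨h1, h2, h3⟩ := h
  obtain ⟨h4, h5, h6⟩ := h'
  rcases IsTriple.eq_or ⟨h1, h2, h3⟩ a with rfl | rfl | rfl <;>
    rcases IsTriple.eq_or ⟨h1, h2, h3⟩ b with rfl | rfl | rfl <;>
    rcases IsTriple.eq_or ⟨h1, h2, h3⟩ c with rfl | rfl | rfl <;> simp_all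

/-- Prescribed reactions at the two contacts of a chain `i, j, k`. -/
lemma exists_reaction {r : Fin 3 → ℝ} {q : Config} {i j k : Fin 3} (h : IsTriple i j k)
    {F G : ℝ} (F0 : 0 ≤ F) (G0 : 0 ≤ G) (F1 : ¬ Contact r q i j → F = 0)
    (G1 : ¬ Contact r q j k → G = 0) : ∃ f, IsReaction r q f ∧ f i j = F ∧ f j k = G := by
  let f : Fin 3 → Fin 3 → ℝ := fun a b =>
    if a = i ∧ b = j ∨ a = j ∧ b = i then F else if a = j ∧ b = k ∨ a = k ∧ b = j then G else 0
  refine ⟨f, fun a b => ⟨?_, ?_, ?_⟩, by simp [f], by simp [f, h.ij.symm, h.ki]⟩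
  · simp only [f]; split_ifs <;> first | assumption | exact le_rfl
  · simp only [f, and_comm, or_comm]
  · intro hl
    simp only [f]
    split_ifs with c1 c2
    · apply F1
      rcases c1 with ⟨rfl, rfl⟩ | ⟨rfl, rfl⟩
      · exact fun e => hl.ne' e
      · exact fun e => hl.ne' (contact_comm.1 e)
    · apply G1
      rcases c2 with ⟨rfl, rfl⟩ | ⟨rfl, rfl⟩
      · exact fun e => hl.ne' e
      · exact fun e => hl.ne' (contact_comm.1 e)
    · rfl

/-- On a line the balances are scalar and that of the middle body follows from the other two. The
outer bodies cannot touch, so the two outer balances determine the reactions at `i j` and `j k`,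
each as a positive multiple of a rate minus ω². The rate that balances `i` is `rateSq r k j`, the
one that balances `k` is `rateSq r i j`. -/
lemma relEq_collinear {r : Fin 3 → ℝ} (hs : IsSizes r) {H : ℝ} {q : Config} {i j k : Fin 3}
    (h : IsTriple i j k) (hq : Sbtw ℝ (q i) (q j) (q k)) :
    IsRelEq r H q ↔ Admissible r q ∧ Centered r q ∧
      ((H / inertia r q) ^ 2 ≤ rateSq r k j ‖q j - q k‖ ‖q k - q i‖ ∧
        (¬ Contact r q i j → (H / inertia r q) ^ 2 = rateSq r k j ‖q j - q k‖ ‖q k - q i‖)) ∧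
      ((H / inertia r q) ^ 2 ≤ rateSq r i j ‖q i - q j‖ ‖q k - q i‖ ∧
        (¬ Contact r q j k → (H / inertia r q) ^ 2 = rateSq r i j ‖q i - q j‖ ‖q k - q i‖)) := by
  rw [relEq_iff hs]
  refine and_congr_right fun ha => and_congr_right fun _ => ?_
  have hadd := norm_add_of_sbtw hq
  have hx := ha.dist_pos hs h.ij
  have hy := ha.dist_pos hs h.jk
  have hz := ha.dist_pos hs h.ki
  have hac := ha i j h.ij
  have hbc := ha j k h.jk
  have mi := hs.mass_pos i
  have mj := hs.mass_pos j
  have mk := hs.mass_pos k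
  obtain ⟨t, -, ht⟩ := hq.wbtw
  have h1 : q j - q i = t • (q k - q i) := by
    rw [← ht, AffineMap.lineMap_apply]; simp
  have hki0 : q k - q i ≠ 0 := sub_ne_zero.2 (ha.ne hs h.ki)
  have ht0 : 0 ≤ t := by
    obtain ⟨t', ht', e⟩ := hq.wbtw
    have : t' = t := by
      have h2 : q j - q i = t' • (q k - q i) := by
        rw [← e, AffineMap.lineMap_apply]; simp
      exact smul_left_injective ℝ hki0 (h2.symm.trans h1)
    exact this ▸ ht'.1
  have hxt : ‖q i - q j‖ = t * ‖q k - q i‖ := by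
    rw [norm_sub_rev, h1, norm_smul, Real.norm_of_nonneg ht0]
  have h2 : q k - q j = (1 - t) • (q k - q i) := by
    rw [sub_smul, one_smul, ← h1]; ring
  have hyt : ‖q j - q k‖ = (1 - t) * ‖q k - q i‖ := by linarith
  have hc : ∀ α β : ℝ, α • (q k - q i) + β • (q k - q i) = 0 ↔ α + β = 0 := by
    intro α β
    rw [← add_smul, smul_eq_zero, or_iff_left hki0]
  set x := ‖q i - q j‖
  set y := ‖q j - q k‖
  set z := ‖q k - q i‖
  set w := (H / inertia r q) ^ 2 with hw
  have bi : ∀ f, coupling r H q f i j • (q j - q i) + coupling r H q f i k • (q k - q i) = 0 ↔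
      coupling r H q f i j * x + coupling r H q f i k * z = 0 := by
    intro f
    rw [h1, smul_smul, hc, hxt]
    constructor
    · intro h; linear_combination z * h
    · intro h; apply mul_left_cancel₀ hz.ne'; linear_combination h
  have bk : ∀ f, coupling r H q f k j • (q j - q k) + coupling r H q f k i • (q i - q k) = 0 ↔
      coupling r H q f k j * y + coupling r H q f k i * z = 0 := by
    intro f
    rw [← neg_sub (q k) (q j), ← neg_sub (q k) (q i), smul_neg, smul_neg, ← neg_add, neg_eq_zero,
      h2, smul_smul, hc, hyt]
    constructor
    · intro h; linear_combination z * h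
    · intro h; apply mul_left_cancel₀ hz.ne'; linear_combination h
  have bj : ∀ f, coupling r H q f j k • (q k - q j) + coupling r H q f j i • (q i - q j) = 0 ↔
      coupling r H q f j k * y - coupling r H q f j i * x = 0 := by
    intro f
    rw [← neg_sub (q j) (q i), smul_neg, ← smul_neg, h1, h2, ← neg_smul, smul_smul, smul_smul, hc,
      hyt, hxt]
    constructor
    · intro h; linear_combination z * h
    · intro h; apply mul_left_cancel₀ hz.ne'; linear_combination h
  have hbal : ∀ f, IsReaction r q f → ((∀ a b c, IsTriple a b c →
        coupling r H q f a b • (q b - q a) + coupling r H q f a c • (q c - q a) = 0) ↔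
      coupling r H q f i j * x + coupling r H q f i k * z = 0 ∧
      coupling r H q f j k * y + coupling r H q f i k * z = 0) := by
    intro f hf
    constructor
    · intro hb
      refine ⟨(bi f).1 (hb i j k h), ?_⟩
      have := (bk f).1 (hb k j i h.swap)
      rwa [coupling_symm hf k j, coupling_symm hf k i] at this
    · rintro ⟨e1, e2⟩
      have ei := (bi f).2 e1
      have ek : coupling r H q f k j • (q j - q k) + coupling r H q f k i • (q i - q k) = 0 := by
        rw [bk, coupling_symm hf k j, coupling_symm hf k i]; exact e2
      have ej : coupling r H q f j k • (q k - q j) + coupling r H q f j i • (q i - q j) = 0 := by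
        rw [bj, coupling_symm hf j i]; linarith
      intro a b c habc
      rcases h.cases habc with ⟨rfl, rfl, rfl⟩ | ⟨rfl, rfl, rfl⟩ | ⟨rfl, rfl, rfl⟩ |
        ⟨rfl, rfl, rfl⟩ | ⟨rfl, rfl, rfl⟩ | ⟨rfl, rfl, rfl⟩
      · exact ei
      · exact ej
      · rw [add_comm]; exact ek
      · rw [add_comm]; exact ei
      · rw [add_comm]; exact ej
      · exact ek
  have hlt : r k + r i < z := by
    have := hs.pos j
    linarith
  have ri := rateSq_sub' (r := r) k j hadd
  have rk := rateSq_sub (r := r) i j hadd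
  rw [ri, rk]
  have di : 0 < mass r k * z + mass r j * x := by positivity
  have dk : 0 < mass r i * z + mass r j * y := by positivity
  have cij : ∀ f, coupling r H q f i j * x
      = mass r i * mass r j / x ^ 2 - f i j - mass r i * mass r j * w * x := by
    intro f; change (_ / x ^ 3 - f i j / x - _ * w) * x = _; field_simp
  have cjk : ∀ f, coupling r H q f j k * y
      = mass r j * mass r k / y ^ 2 - f j k - mass r j * mass r k * w * y := by
    intro f; change (_ / y ^ 3 - f j k / y - _ * w) * y = _; field_simp
  have cik : ∀ f, IsReaction r q f → coupling r H q f i k * z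
      = mass r k * mass r i / z ^ 2 - mass r k * mass r i * w * z := by
    intro f hf
    rw [coupling_symm hf, coupling, (hf k i).2.2 hlt]
    change (_ / z ^ 3 - 0 / z - _ * w) * z = _; field_simp; ring
  have fi : ∀ f, IsReaction r q f → (coupling r H q f i j * x + coupling r H q f i k * z = 0 ↔
      f i j = mass r i * (mass r k * z + mass r j * x)
        * ((mass r k / z ^ 2 + mass r j / x ^ 2) / (mass r k * z + mass r j * x) - w)) := by
    intro f hf
    rw [cij f, cik f hf]
    have e0 := mul_div_cancel₀ (mass r k / z ^ 2 + mass r j / x ^ 2) di.ne'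
    constructor <;> intro e <;> linear_combination (-1 : ℝ) * e - mass r i * e0
  have fk : ∀ f, IsReaction r q f → (coupling r H q f j k * y + coupling r H q f i k * z = 0 ↔
      f j k = mass r k * (mass r i * z + mass r j * y)
        * ((mass r i / z ^ 2 + mass r j / y ^ 2) / (mass r i * z + mass r j * y) - w)) := by
    intro f hf
    rw [cjk f, cik f hf]
    have e0 := mul_div_cancel₀ (mass r i / z ^ 2 + mass r j / y ^ 2) dk.ne'
    constructor <;> intro e <;> linear_combination (-1 : ℝ) * e - mass r k * e0
  set Ri := (mass r k / z ^ 2 + mass r j / x ^ 2) / (mass r k * z + mass r j * x)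
  set Rk := (mass r i / z ^ 2 + mass r j / y ^ 2) / (mass r i * z + mass r j * y)
  have ci : 0 < mass r i * (mass r k * z + mass r j * x) := by positivity
  have ck : 0 < mass r k * (mass r i * z + mass r j * y) := by positivity
  constructor
  · rintro ⟨f, hf, hb⟩
    obtain ⟨e1, e2⟩ := (hbal f hf).1 hb
    have g1 := (fi f hf).1 e1
    have g2 := (fk f hf).1 e2
    refine ⟨⟨?_, fun hcon => ?_⟩, ⟨?_, fun hcon => ?_⟩⟩
    · have := (hf i j).1
      rw [g1] at this
      linarith [nonneg_of_mul_nonneg_right this ci]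
    · have := (hf i j).2.2 (ha.lt_of_not_contact h.ij hcon)
      rw [g1] at this
      linarith [(mul_eq_zero.1 this).resolve_left ci.ne']
    · have := (hf j k).1
      rw [g2] at this
      linarith [nonneg_of_mul_nonneg_right this ck]
    · have := (hf j k).2.2 (ha.lt_of_not_contact h.jk hcon)
      rw [g2] at this
      linarith [(mul_eq_zero.1 this).resolve_left ck.ne']
  · rintro ⟨⟨a1, a2⟩, ⟨b1, b2⟩⟩
    set F := mass r i * (mass r k * z + mass r j * x) * (Ri - w) with hF
    set G := mass r k * (mass r i * z + mass r j * y) * (Rk - w) with hG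
    have F0 : 0 ≤ F := mul_nonneg ci.le (by linarith)
    have G0 : 0 ≤ G := mul_nonneg ck.le (by linarith)
    have F1 : ¬ Contact r q i j → F = 0 := fun hcon => by rw [hF, a2 hcon]; ring
    have G1 : ¬ Contact r q j k → G = 0 := fun hcon => by rw [hG, b2 hcon]; ring
    obtain ⟨f, hf, f1, f2⟩ := exists_reaction h F0 G0 F1 G1
    exact ⟨f, hf, (hbal f hf).2 ⟨(fi f hf).2 f1, (fk f hf).2 f2⟩⟩

lemma IsRelEq.admissible {r : Fin 3 → ℝ} {H : ℝ} {q : Config} (h : IsRelEq r H q) :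
    Admissible r q := by
  obtain ⟨τ, hτ, s, hsol, h0, -⟩ := h
  exact h0 ▸ hsol.admissible 0 ⟨le_rfl, hτ.le⟩

/-! ### The amended potential in the three distances -/

/-- Divided difference of the amended potential in one distance. -/
def slope (H I I' d d' : ℝ) : ℝ := 1 / (d * d') - H ^ 2 * (d + d') / (2 * I * I')

/-- On the diagonal this is gravity minus centrifugal repulsion, per unit of both masses, with ω = H
/ I: positive for a pair that is pressed together, negative for one that is driven apart. -/
lemma slope_self (H I d : ℝ) (hI : I ≠ 0) : slope H I I d d = 1 / d ^ 2 - (H / I) ^ 2 * d := by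
  unfold slope; field_simp; ring

/-- The differences of 1/d and of 1/I both contain the factor d' − d exactly, so there is no Taylor
remainder. Near an equilibrium the sign of each contribution follows from continuity of `slope`
alone. -/
lemma energyOf_sub {r : Fin 3 → ℝ} (hs : IsSizes r) (i j k : Fin 3) (H : ℝ)
    {x y z x' y' z' : ℝ} (hx : 0 < x) (hy : 0 < y) (hz : 0 < z) (hx' : 0 < x') (hy' : 0 < y')
    (hz' : 0 < z') : energyOf r i j k H x' y' z' - energyOf r i j k H x y z =
      mass r i * mass r j * (x' - x)
        * slope H (inertiaOf r i j k x y z) (inertiaOf r i j k x' y' z') x x'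
      + mass r j * mass r k * (y' - y)
        * slope H (inertiaOf r i j k x y z) (inertiaOf r i j k x' y' z') y y'
      + mass r k * mass r i * (z' - z)
        * slope H (inertiaOf r i j k x y z) (inertiaOf r i j k x' y' z') z z' := by
  have h1 := (hs.inertiaOf_pos i j k x y z).ne'
  have h2 := (hs.inertiaOf_pos i j k x' y' z').ne'
  have e : inertiaOf r i j k x' y' z' - inertiaOf r i j k x y z =
      mass r i * mass r j * ((x' - x) * (x + x')) + mass r j * mass r k * ((y' - y) * (y + y'))
      + mass r k * mass r i * ((z' - z) * (z + z')) := by unfold inertiaOf; ring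
  unfold energyOf slope
  set I := inertiaOf r i j k x y z
  set I' := inertiaOf r i j k x' y' z'
  have e1 : H ^ 2 / (2 * I') - H ^ 2 / (2 * I) = -(H ^ 2 / (2 * I * I')) * (I' - I) := by
    field_simp; ring
  have e2 : ∀ d d' : ℝ, 0 < d → 0 < d' → 1 / d' = 1 / d - (d' - d) * (1 / (d * d')) := by
    intro d d' h h'; field_simp; ring
  rw [e] at e1
  simp only [div_eq_mul_one_div (_ * _) x', div_eq_mul_one_div (_ * _) y',
    div_eq_mul_one_div (_ * _) z', e2 x x' hx hx', e2 y y' hy hy', e2 z z' hz hz']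
  linear_combination e1

lemma tendsto_slope {α : Type*} {l : Filter α} {I I' d d' : α → ℝ} (H : ℝ) {I₀ d₀ : ℝ}
    (hI₀ : 0 < I₀) (hd₀ : 0 < d₀) (hI : Tendsto I l (𝓝 I₀)) (hI' : Tendsto I' l (𝓝 I₀))
    (hd : Tendsto d l (𝓝 d₀)) (hd' : Tendsto d' l (𝓝 d₀)) :
    Tendsto (fun a => slope H (I a) (I' a) (d a) (d' a)) l (𝓝 (slope H I₀ I₀ d₀ d₀)) := by
  unfold slope
  exact (tendsto_const_nhds.div (hd.mul hd') (by positivity)).sub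
    ((tendsto_const_nhds.mul (hd.add hd')).div ((tendsto_const_nhds.mul hI).mul hI')
      (by positivity))

lemma continuous_inertiaOf (r : Fin 3 → ℝ) (i j k : Fin 3) :
    Continuous (fun p : ℝ × ℝ × ℝ => inertiaOf r i j k p.1 p.2.1 p.2.2) := by
  unfold inertiaOf; fun_prop

/-- The three distances of a configuration. -/
def distances (i j k : Fin 3) (q : Config) : ℝ × ℝ × ℝ :=
  (‖q i - q j‖, ‖q j - q k‖, ‖q k - q i‖)

lemma continuous_distances (i j k : Fin 3) : Continuous (distances i j k) := by
  unfold distances; fun_prop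

/-- Distances that do not make balls overlap. -/
def AdmissibleDist (r : Fin 3 → ℝ) (i j k : Fin 3) (p : ℝ × ℝ × ℝ) : Prop :=
  r i + r j ≤ p.1 ∧ r j + r k ≤ p.2.1 ∧ r k + r i ≤ p.2.2

lemma admissible_iff {r : Fin 3 → ℝ} {q : Config} {i j k : Fin 3} (h : IsTriple i j k) :
    Admissible r q ↔ AdmissibleDist r i j k (distances i j k q) := by
  constructor
  · intro ha; exact ⟨ha i j h.ij, ha j k h.jk, ha k i h.ki⟩
  · rintro ⟨a1, a2, a3⟩ a b hab
    simp only [distances] at a1 a2 a3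
    rcases h.eq_or a with rfl | rfl | rfl <;> rcases h.eq_or b with rfl | rfl | rfl <;>
      first
      | exact absurd rfl hab
      | assumption
      | (rw [norm_sub_rev, add_comm]; assumption)

/-- Distances leave only the mirror image undecided. For a proper triangle, closeness to `q`
excludes it; for an aligned configuration the mirror image is itself a rigid displacement. -/
lemma eventually_congruent {i j k : Fin 3} (h : IsTriple i j k) {q : Config} (hq : q i ≠ q j) :
    ∀ᶠ q' in 𝓝 q, distances i j k q' = distances i j k q → Congruent q q' := by
  by_cases hc : cross i j k q = 0
  · refine Eventually.of_forall fun q' e => ?_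
    simp only [distances, Prod.mk.injEq] at e
    exact congruent_of_collinear h hq e.1 e.2.1 e.2.2 hc
  · obtain ⟨o, ho⟩ := exists_oriented h hc
    obtain ⟨ε, -, he⟩ := exists_sign_oriented h o
    have : ∀ᶠ q' in 𝓝 q, 0 < ε * cross i j k q' :=
      (continuous_const.mul (continuous_cross i j k)).continuousAt.eventually
        (lt_mem_nhds ((he q).1 ho))
    filter_upwards [this] with q' h' e
    simp only [distances, Prod.mk.injEq] at e
    exact congruent_of_oriented h hq e.1 e.2.1 e.2.2 ho ((he q').2 h')

/-- Distances depend continuously on the configuration and always form a triangle, so only triples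
satisfying the triangle inequalities have to be compared. -/
lemma isStable_of_distances {r : Fin 3 → ℝ} (hs : IsSizes r) {i j k : Fin 3}
    (h : IsTriple i j k) {H : ℝ} {q : Config} (hrel : IsRelEq r H q)
    (hE : ∀ᶠ p in 𝓝 (distances i j k q), IsTriangle p.1 p.2.1 p.2.2 → AdmissibleDist r i j k p →
      p ≠ distances i j k q → energyOf r i j k H ‖q i - q j‖ ‖q j - q k‖ ‖q k - q i‖
        < energyOf r i j k H p.1 p.2.1 p.2.2) : IsStable r H q := by
  have ha := hrel.admissible
  refine ⟨hrel, ?_⟩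
  filter_upwards [eventually_congruent h (ha.ne hs h.ij),
    (continuous_distances i j k).continuousAt.eventually hE] with q' h1 h2 ha' hn
  rw [amended_eq r h, amended_eq r h]
  exact sub_neg.2 (h2 (ha'.isTriangle hs h) ((admissible_iff h).1 ha') fun e => hn (h1 e))

/-- A path of realizable distances lifts, by `exists_local_realization`, to configurations
approaching `q`. Energy that does not rise along it is enough, since stability asks for a strict
increase. -/
lemma not_isStable_of_path {r : Fin 3 → ℝ} (hs : IsSizes r) {i j k : Fin 3}
    (h : IsTriple i j k) {H : ℝ} {q : Config} (p : ℝ → ℝ × ℝ × ℝ)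
    (hp : Tendsto p (𝓝[>] 0) (𝓝 (distances i j k q)))
    (hE : Admissible r q → ∀ᶠ s in 𝓝[>] (0 : ℝ), IsTriangle (p s).1 (p s).2.1 (p s).2.2 ∧
      AdmissibleDist r i j k (p s) ∧ p s ≠ distances i j k q ∧
      energyOf r i j k H (p s).1 (p s).2.1 (p s).2.2
        ≤ energyOf r i j k H ‖q i - q j‖ ‖q j - q k‖ ‖q k - q i‖) : ¬ IsStable r H q := by
  rintro ⟨hrel, hst⟩
  have ha := hrel.admissible
  obtain ⟨Γ, hΓ, hΓq, hΓd⟩ :=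
    exists_local_realization h (ha.ne hs h.ij) (ha.ne hs h.jk) (ha.ne hs h.ki)
  have ht : Tendsto (fun s => Γ (p s)) (𝓝[>] 0) (𝓝 q) := by
    have := hΓ.tendsto.comp hp
    rwa [hΓq] at this
  obtain ⟨s, hs1, ht1, ha1, hne, hE1⟩ := ((ht.eventually hst).and (hE ha)).exists
  obtain ⟨e1, e2, e3⟩ := hΓd _ ht1
  have ed : distances i j k (Γ (p s)) = p s := by
    simp only [distances, e1, e2, e3]
  have := hs1 ((admissible_iff h).2 (by rw [ed]; exact ha1)) (fun hcong => hne (by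
    rw [← ed]
    simp only [distances, hcong.dist_eq]))
  rw [amended_eq r h, amended_eq r h, e1, e2, e3] at this
  linarith

/-! ### Strict minima under contact constraints -/

section minima

variable {r : Fin 3 → ℝ} (hs : IsSizes r) {i j k : Fin 3} {H x y z : ℝ}
  (hx : 0 < x) (hy : 0 < y) (hz : 0 < z)
include hs hx hy hz

/-- Two contacts pressed together, the third distance at a strict local minimum. -/
lemma energyOf_lt_of_contacts {C : ℝ → Prop}
    (sx : 0 < slope H (inertiaOf r i j k x y z) (inertiaOf r i j k x y z) x x)
    (sy : 0 < slope H (inertiaOf r i j k x y z) (inertiaOf r i j k x y z) y y)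
    (hmin : ∀ᶠ z' in 𝓝 z, C z' → z' ≠ z →
      energyOf r i j k H x y z < energyOf r i j k H x y z') :
    ∀ᶠ p : ℝ × ℝ × ℝ in 𝓝 (x, y, z), x ≤ p.1 → y ≤ p.2.1 → C p.2.2 → p ≠ (x, y, z) →
      energyOf r i j k H x y z < energyOf r i j k H p.1 p.2.1 p.2.2 := by
  have hI := hs.inertiaOf_pos i j k x y z
  have c1 : ContinuousAt (fun p : ℝ × ℝ × ℝ => p.1) (x, y, z) := by fun_prop
  have c2 : ContinuousAt (fun p : ℝ × ℝ × ℝ => p.2.1) (x, y, z) := by fun_prop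
  have c3 : ContinuousAt (fun p : ℝ × ℝ × ℝ => p.2.2) (x, y, z) := by fun_prop
  have cI := (continuous_inertiaOf r i j k).continuousAt (x := (x, y, z))
  -- The comparison passes through an intermediate point: first the third distance changes with both
  -- contacts kept, then the contacts open. Hence one of the two inertias is taken at (x, y, p.2.2).
  have cI' : ContinuousAt (fun p : ℝ × ℝ × ℝ => inertiaOf r i j k x y p.2.2) (x, y, z) := by
    unfold inertiaOf; fun_prop
  have ex := (tendsto_slope H hI hx cI' cI tendsto_const_nhds c1).eventually (lt_mem_nhds sx)
  have ey := (tendsto_slope H hI hy cI' cI tendsto_const_nhds c2).eventually (lt_mem_nhds sy)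
  filter_upwards [ex, ey, c3.eventually hmin, c3.eventually (lt_mem_nhds hz)]
    with p kx ky km p3 lx ly hC hne
  have p1 : 0 < p.1 := hx.trans_le lx
  have p2 : 0 < p.2.1 := hy.trans_le ly
  have e := energyOf_sub hs i j k H hx hy p3 p1 p2 p3
  rw [sub_self, mul_zero, zero_mul, add_zero] at e
  have mi := hs.mass_pos i; have mj := hs.mass_pos j; have mk := hs.mass_pos k
  have n1 : 0 ≤ mass r i * mass r j * (p.1 - x) := mul_nonneg (by positivity) (by linarith)
  have n2 : 0 ≤ mass r j * mass r k * (p.2.1 - y) := mul_nonneg (by positivity) (by linarith)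
  by_cases h3 : p.2.2 = z
  · rw [h3] at e kx ky ⊢
    have : 0 < p.1 - x ∨ 0 < p.2.1 - y := by
      by_contra hcon
      push Not at hcon
      exact hne (Prod.ext (by dsimp only; linarith)
        (Prod.ext (by dsimp only; linarith) h3))
    rcases this with h | h
    · have := mul_pos (mul_pos (mul_pos mi mj) h) kx
      have := mul_nonneg n2 ky.le
      linarith
    · have := mul_pos (mul_pos (mul_pos mj mk) h) ky
      have := mul_nonneg n1 kx.le
      linarith
  · have := km hC h3
    have := mul_nonneg n1 kx.le
    have := mul_nonneg n2 ky.le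
    linarith

/-- An aligned chain of two contacts that is pressed together and does not bend. -/
lemma energyOf_lt_of_chain (hxyz : x + y = z)
    (sx : 0 < mass r j * slope H (inertiaOf r i j k x y z) (inertiaOf r i j k x y z) x x
      + mass r k * slope H (inertiaOf r i j k x y z) (inertiaOf r i j k x y z) z z)
    (sy : 0 < mass r j * slope H (inertiaOf r i j k x y z) (inertiaOf r i j k x y z) y y
      + mass r i * slope H (inertiaOf r i j k x y z) (inertiaOf r i j k x y z) z z)
    (sz : slope H (inertiaOf r i j k x y z) (inertiaOf r i j k x y z) z z < 0) :
    ∀ᶠ p : ℝ × ℝ × ℝ in 𝓝 (x, y, z), x ≤ p.1 → y ≤ p.2.1 → p.2.2 ≤ p.1 + p.2.1 →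
      p ≠ (x, y, z) → energyOf r i j k H x y z < energyOf r i j k H p.1 p.2.1 p.2.2 := by
  have hI := hs.inertiaOf_pos i j k x y z
  have c1 : ContinuousAt (fun p : ℝ × ℝ × ℝ => p.1) (x, y, z) := by fun_prop
  have c2 : ContinuousAt (fun p : ℝ × ℝ × ℝ => p.2.1) (x, y, z) := by fun_prop
  have c3 : ContinuousAt (fun p : ℝ × ℝ × ℝ => p.2.2) (x, y, z) := by fun_prop
  have cI := (continuous_inertiaOf r i j k).continuousAt (x := (x, y, z))
  have tx := tendsto_slope H hI hx tendsto_const_nhds cI tendsto_const_nhds c1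
  have ty := tendsto_slope H hI hy tendsto_const_nhds cI tendsto_const_nhds c2
  have tz := tendsto_slope H hI hz tendsto_const_nhds cI tendsto_const_nhds c3
  have ex := ((tx.const_mul (mass r j)).add (tz.const_mul (mass r k))).eventually (lt_mem_nhds sx)
  have ey := ((ty.const_mul (mass r j)).add (tz.const_mul (mass r i))).eventually (lt_mem_nhds sy)
  have ez := tz.eventually (gt_mem_nhds sz)
  filter_upwards [ex, ey, ez, c3.eventually (lt_mem_nhds hz)]
    with p kx ky kz p3 lx ly lz hne
  have p1 : 0 < p.1 := hx.trans_le lx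
  have p2 : 0 < p.2.1 := hy.trans_le ly
  have e := energyOf_sub hs i j k H hx hy hz p1 p2 p3
  set I' := inertiaOf r i j k p.1 p.2.1 p.2.2
  set I := inertiaOf r i j k x y z
  have mi := hs.mass_pos i; have mj := hs.mass_pos j; have mk := hs.mass_pos k
  -- Since x + y = z, the change of z is the sum of the two openings minus the triangle defect of
  -- `p`. Regrouping by these three nonnegative quantities gives each of them a coefficient of known
  -- sign.
  have e2 : energyOf r i j k H p.1 p.2.1 p.2.2 - energyOf r i j k H x y z =
      mass r i * (p.1 - x) * (mass r j * slope H I I' x p.1 + mass r k * slope H I I' z p.2.2)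
      + mass r k * (p.2.1 - y) * (mass r j * slope H I I' y p.2.1 + mass r i * slope H I I' z p.2.2)
      + mass r k * mass r i * (p.1 + p.2.1 - p.2.2) * (-slope H I I' z p.2.2) := by
    rw [e]; linear_combination (mass r k * mass r i * slope H I I' z p.2.2) * hxyz
  have n1 : 0 ≤ mass r i * (p.1 - x) := mul_nonneg mi.le (by linarith)
  have n2 : 0 ≤ mass r k * (p.2.1 - y) := mul_nonneg mk.le (by linarith)
  have n3 : 0 ≤ mass r k * mass r i * (p.1 + p.2.1 - p.2.2) :=
    mul_nonneg (by positivity) (by linarith)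
  have kz' : 0 < -slope H I I' z p.2.2 := neg_pos.2 kz
  have m1 := mul_nonneg n1 kx.le
  have m2 := mul_nonneg n2 ky.le
  have m3 := mul_nonneg n3 kz'.le
  have : 0 < p.1 - x ∨ 0 < p.2.1 - y ∨ 0 < p.1 + p.2.1 - p.2.2 := by
    by_contra hcon
    push Not at hcon
    have a1 : p.1 = x := by linarith
    have a2 : p.2.1 = y := by linarith
    exact hne (Prod.ext a1 (Prod.ext a2 (by dsimp only; linarith)))
  rcases this with h | h | h
  · have := mul_pos (mul_pos mi h) kx; linarith
  · have := mul_pos (mul_pos mk h) ky; linarith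
  · have := mul_pos (mul_pos (mul_pos mk mi) h) kz'; linarith

/-- An aligned configuration with one pressed contact `i, j`, not bending, and at a strict local
minimum with respect to the distance of the third body. -/
lemma energyOf_lt_of_aligned (hxyz : x + y = z)
    (sx : 0 < mass r i * slope H (inertiaOf r i j k x y z) (inertiaOf r i j k x y z) x x
      - mass r k * slope H (inertiaOf r i j k x y z) (inertiaOf r i j k x y z) y y)
    (sy : 0 < slope H (inertiaOf r i j k x y z) (inertiaOf r i j k x y z) y y)
    (hmin : ∀ᶠ z' in 𝓝 z, z' ≠ z →
      energyOf r i j k H x y z < energyOf r i j k H x (z' - x) z') :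
    ∀ᶠ p : ℝ × ℝ × ℝ in 𝓝 (x, y, z), x ≤ p.1 → p.2.2 ≤ p.1 + p.2.1 →
      p ≠ (x, y, z) → energyOf r i j k H x y z < energyOf r i j k H p.1 p.2.1 p.2.2 := by
  have hI := hs.inertiaOf_pos i j k x y z
  have hy0 : z - x = y := by linarith
  have c1 : ContinuousAt (fun p : ℝ × ℝ × ℝ => p.1) (x, y, z) := by fun_prop
  have c2 : ContinuousAt (fun p : ℝ × ℝ × ℝ => p.2.1) (x, y, z) := by fun_prop
  have c3 : ContinuousAt (fun p : ℝ × ℝ × ℝ => p.2.2) (x, y, z) := by fun_prop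
  have c4 : Tendsto (fun p : ℝ × ℝ × ℝ => p.2.2 - x) (𝓝 (x, y, z)) (𝓝 y) := by
    have : ContinuousAt (fun p : ℝ × ℝ × ℝ => p.2.2 - x) (x, y, z) := by fun_prop
    simpa only [ContinuousAt, hy0] using this
  have cI := (continuous_inertiaOf r i j k).continuousAt (x := (x, y, z))
  have cI' : Tendsto (fun p : ℝ × ℝ × ℝ => inertiaOf r i j k x (p.2.2 - x) p.2.2) (𝓝 (x, y, z))
      (𝓝 (inertiaOf r i j k x y z)) := by
    have := (continuous_inertiaOf r i j k).continuousAt (x := (x, y, z)) |>.tendsto.comp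
      ((tendsto_const_nhds (x := x) (f := 𝓝 (x, y, z))).prodMk_nhds
        (c4.prodMk_nhds (c3 : Tendsto _ _ (𝓝 z))))
    exact this
  have tx := tendsto_slope H hI hx cI' cI tendsto_const_nhds c1
  have ty := tendsto_slope H hI hy cI' cI c4 c2
  have ex := ((tx.const_mul (mass r i)).sub (ty.const_mul (mass r k))).eventually (lt_mem_nhds sx)
  have ey := ty.eventually (lt_mem_nhds sy)
  filter_upwards [ex, ey, c3.eventually hmin, c3.eventually (lt_mem_nhds hz),
    c2.eventually (lt_mem_nhds hy), c4.eventually (lt_mem_nhds hy)]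
    with p kx ky km p3 p2 p4 lx lz hne
  have p1 : 0 < p.1 := hx.trans_le lx
  have e := energyOf_sub hs i j k H hx p4 p3 p1 p2 p3
  set I' := inertiaOf r i j k p.1 p.2.1 p.2.2
  set I := inertiaOf r i j k x (p.2.2 - x) p.2.2
  have mi := hs.mass_pos i; have mj := hs.mass_pos j; have mk := hs.mass_pos k
  -- Relative to the aligned point with the same third distance, the change of y is the triangle
  -- defect minus the opening of the contact; regrouping leaves two nonnegative quantities.
  have e2 : energyOf r i j k H p.1 p.2.1 p.2.2 - energyOf r i j k H x (p.2.2 - x) p.2.2 =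
      mass r j * (p.1 - x) * (mass r i * slope H I I' x p.1
        - mass r k * slope H I I' (p.2.2 - x) p.2.1)
      + mass r j * mass r k * (p.1 + p.2.1 - p.2.2) * slope H I I' (p.2.2 - x) p.2.1 := by
    rw [e]; ring
  have n1 : 0 ≤ mass r j * (p.1 - x) := mul_nonneg mj.le (by linarith)
  have n3 : 0 ≤ mass r j * mass r k * (p.1 + p.2.1 - p.2.2) :=
    mul_nonneg (by positivity) (by linarith)
  have m1 := mul_nonneg n1 kx.le
  have m3 := mul_nonneg n3 ky.le
  by_cases h3 : p.2.2 = z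
  · have e3 : energyOf r i j k H x (p.2.2 - x) p.2.2 = energyOf r i j k H x y z := by
      rw [h3, hy0]
    have : 0 < p.1 - x ∨ 0 < p.1 + p.2.1 - p.2.2 := by
      by_contra hcon
      push Not at hcon
      have a1 : p.1 = x := by linarith
      exact hne (Prod.ext a1 (Prod.ext (by dsimp only; linarith) h3))
    rcases this with h | h
    · have := mul_pos (mul_pos mj h) kx; linarith
    · have := mul_pos (mul_pos (mul_pos mj mk) h) ky; linarith
  · have := km h3
    linarith

end minima

/-! ### Minima read off the angular momentum curve -/

/-- A function whose derivative has the sign of `h(t)² - h(x)²`. -/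
structure IsCharted (φ h : ℝ → ℝ) (x l u : ℝ) : Prop where
  nonneg : ∀ t ∈ Ioo l u, 0 ≤ h t
  deriv : ∀ t ∈ Ioo l u, ∃ w > 0, HasDerivAt φ (w * (h t ^ 2 - h x ^ 2)) t

lemma IsCharted.mono {φ h : ℝ → ℝ} {x l u l' u' : ℝ} (hc : IsCharted φ h x l u) (hl : l ≤ l')
    (hu : u' ≤ u) : IsCharted φ h x l' u' :=
  ⟨fun t ht => hc.nonneg t ⟨hl.trans_lt ht.1, ht.2.trans_le hu⟩,
    fun t ht => hc.deriv t ⟨hl.trans_lt ht.1, ht.2.trans_le hu⟩⟩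

lemma IsCharted.lt_of_lt {φ h : ℝ → ℝ} {x l u a b : ℝ} (hc : IsCharted φ h x l u) (ha : l < a)
    (hb : b < u) (hab : a < b) (hx : x ∈ Ioo l u) (hh : ∀ t ∈ Ioo a b, h x < h t) : φ a < φ b := by
  have hmem : ∀ t ∈ Icc a b, t ∈ Ioo l u := fun t ht => ⟨ha.trans_le ht.1, ht.2.trans_lt hb⟩
  have hcont : ContinuousOn φ (Icc a b) := fun t ht => by
    obtain ⟨w, _, hd⟩ := hc.deriv t (hmem t ht)
    exact hd.continuousAt.continuousWithinAt
  refine strictMonoOn_of_deriv_pos (convex_Icc a b) hcont (fun t ht => ?_) (left_mem_Icc.2 hab.le)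
    (right_mem_Icc.2 hab.le) hab
  rw [interior_Icc] at ht
  obtain ⟨w, hw, hd⟩ := hc.deriv t (hmem t (Ioo_subset_Icc_self ht))
  rw [hd.deriv]
  have := hc.nonneg x hx
  have := hh t ht
  exact mul_pos hw (by nlinarith)

lemma IsCharted.gt_of_lt {φ h : ℝ → ℝ} {x l u a b : ℝ} (hc : IsCharted φ h x l u) (ha : l < a)
    (hb : b < u) (hab : a < b) (hh : ∀ t ∈ Ioo a b, h t < h x) : φ b < φ a := by
  have hmem : ∀ t ∈ Icc a b, t ∈ Ioo l u := fun t ht => ⟨ha.trans_le ht.1, ht.2.trans_lt hb⟩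
  have hcont : ContinuousOn φ (Icc a b) := fun t ht => by
    obtain ⟨w, _, hd⟩ := hc.deriv t (hmem t ht)
    exact hd.continuousAt.continuousWithinAt
  refine strictAntiOn_of_deriv_neg (convex_Icc a b) hcont (fun t ht => ?_) (left_mem_Icc.2 hab.le)
    (right_mem_Icc.2 hab.le) hab
  rw [interior_Icc] at ht
  obtain ⟨w, hw, hd⟩ := hc.deriv t (hmem t (Ioo_subset_Icc_self ht))
  rw [hd.deriv]
  have := hc.nonneg t (hmem t (Ioo_subset_Icc_self ht))
  have := hh t ht
  exact mul_neg_of_pos_of_neg hw (by nlinarith)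

/-- Where `h` increases, `φ` has a strict local minimum. -/
lemma IsCharted.eventually_lt {φ h : ℝ → ℝ} {x l u : ℝ} (hc : IsCharted φ h x l u)
    (hx : x ∈ Ioo l u) (hm : StrictMonoOn h (Ioo l u)) : ∀ᶠ t in 𝓝 x, t ≠ x → φ x < φ t := by
  filter_upwards [Ioo_mem_nhds hx.1 hx.2] with t ht hne
  rcases lt_or_gt_of_ne hne with hlt | hgt
  · exact hc.gt_of_lt ht.1 hx.2 hlt fun s hs => hm ⟨ht.1.trans hs.1, hs.2.trans hx.2⟩ hx hs.2
  · exact hc.lt_of_lt hx.1 ht.2 hgt hx fun s hs => hm hx ⟨hx.1.trans hs.1, hs.2.trans ht.2⟩ hs.1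

/-- To the right of a point from which `h` decreases, `φ` decreases. -/
lemma IsCharted.eventually_right {φ h : ℝ → ℝ} {x l u v : ℝ} (hc : IsCharted φ h x l u)
    (hx : x ∈ Ioo l u) (hv : x < v) (hm : StrictAntiOn h (Icc x v)) :
    ∀ᶠ s in 𝓝[>] (0 : ℝ), φ (x + s) < φ x := by
  have : Ioo 0 (min v u - x) ∈ 𝓝[>] (0 : ℝ) :=
    Ioo_mem_nhdsGT (by rw [sub_pos]; exact lt_min hv hx.2)
  filter_upwards [this] with s hs
  have h1 : x + s < min v u := by linarith [hs.2]
  exact hc.gt_of_lt hx.1 (h1.trans_le (min_le_right _ _)) (by linarith [hs.1]) fun t ht =>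
    hm ⟨le_rfl, hv.le⟩ ⟨ht.1.le, (ht.2.trans h1).le.trans (min_le_left _ _)⟩ ht.1

/-- To the left of a point up to which `h` decreases, `φ` is smaller. -/
lemma IsCharted.eventually_left {φ h : ℝ → ℝ} {x l u v : ℝ} (hc : IsCharted φ h x l u)
    (hx : x ∈ Ioo l u) (hv : v < x) (hm : StrictAntiOn h (Icc v x)) :
    ∀ᶠ s in 𝓝[>] (0 : ℝ), φ (x - s) < φ x := by
  have : Ioo 0 (x - max v l) ∈ 𝓝[>] (0 : ℝ) :=
    Ioo_mem_nhdsGT (by rw [sub_pos]; exact max_lt hv hx.1)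
  filter_upwards [this] with s hs
  have h1 : max v l < x - s := by linarith [hs.2]
  exact hc.lt_of_lt ((le_max_right _ _).trans_lt h1) hx.2 (by linarith [hs.1]) hx fun t ht =>
    hm ⟨(le_max_left _ _).trans (h1.trans ht.1).le, ht.2.le⟩ ⟨hv.le, le_rfl⟩ ht.2

lemma rpow_three_halves {d : ℝ} (hd : 0 < d) : (d ^ (3 / 2 : ℝ)) ^ 2 = d ^ 3 := by
  rw [← Real.rpow_natCast, ← Real.rpow_mul hd.le, ← Real.rpow_natCast]; norm_num

lemma rpow_three_halves_eq {d : ℝ} (hd : 0 < d) : d ^ (3 / 2 : ℝ) = d * √d := by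
  rw [show (3 / 2 : ℝ) = 1 + 1 / 2 by norm_num, Real.rpow_add hd, Real.rpow_one,
    Real.sqrt_eq_rpow]

/-- Bending a chain `i, j, k` with fixed `d_ij`, `d_jk`. -/
lemma isCharted_bend {r : Fin 3 → ℝ} (hs : IsSizes r) (i j k : Fin 3) (x y z : ℝ) :
    IsCharted (fun t => energyOf r i j k (inertiaOf r i j k x y z / z ^ (3 / 2 : ℝ)) x y t)
      (fun t => inertiaOf r i j k x y t / t ^ (3 / 2 : ℝ)) z 0 (z + 1) := by
  have mi := hs.mass_pos i; have mk := hs.mass_pos k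
  constructor
  · intro t ht
    exact div_nonneg (hs.inertiaOf_pos i j k x y t).le (Real.rpow_nonneg ht.1.le _)
  · intro t ht
    have ht0 : 0 < t := ht.1
    have hI := hs.inertiaOf_pos i j k x y t
    set H := inertiaOf r i j k x y z / z ^ (3 / 2 : ℝ)
    have d1 : HasDerivAt (fun t => inertiaOf r i j k x y t) (mass r k * mass r i * (2 * t)) t := by
      have := ((hasDerivAt_pow 2 t).const_mul (mass r k * mass r i)).const_add
        (mass r i * mass r j * x ^ 2 + mass r j * mass r k * y ^ 2) |>.add_const
          (∑ l, ballInertia r l)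
      simpa [inertiaOf] using this
    have d2 := (hasDerivAt_const t (H ^ 2)).div (d1.const_mul 2) (by positivity)
    have d3 := ((hasDerivAt_const t (mass r k * mass r i)).div (hasDerivAt_id t) ht0.ne').const_add
      (mass r i * mass r j / x + mass r j * mass r k / y)
    -- The derivative m_k m_i (1/t² − H² t / I²) equals (m_k m_i t / I²)(I² / t³ − H²), and I /
    -- t^(3/2) is the h of the chain.
    refine ⟨mass r k * mass r i * t / inertiaOf r i j k x y t ^ 2, by positivity, ?_⟩
    refine (d2.sub d3).congr_deriv ?_
    clear_value H
    rw [div_pow, rpow_three_halves ht0]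
    simp only [id]
    field_simp
    ring

/-- Moving the outer body `k` of an aligned configuration with fixed `d_ij = a`. -/
lemma isCharted_aligned {r : Fin 3 → ℝ} (hs : IsSizes r) (i j k : Fin 3) {a : ℝ} (ha : 0 < a)
    (z : ℝ) :
    IsCharted (fun t => energyOf r i j k
        (inertiaOf r i j k a (z - a) z * √(rateSq r i j a z)) a (t - a) t)
      (fun t => inertiaOf r i j k a (t - a) t * √(rateSq r i j a t)) z a (z + 1) := by
  have mi := hs.mass_pos i; have mk := hs.mass_pos k; have mj := hs.mass_pos j
  constructor
  · intro t ht
    exact mul_nonneg (hs.inertiaOf_pos i j k a _ t).le (Real.sqrt_nonneg _)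
  · intro t ht
    have ht0 : 0 < t := ha.trans ht.1
    have hta : 0 < t - a := sub_pos.2 ht.1
    have hI := hs.inertiaOf_pos i j k a (t - a) t
    set H := inertiaOf r i j k a (z - a) z * √(rateSq r i j a z)
    have d0 : HasDerivAt (fun t : ℝ => t - a) 1 t := (hasDerivAt_id t).sub_const a
    have d1 : HasDerivAt (fun t => inertiaOf r i j k a (t - a) t)
        (mass r j * mass r k * (2 * (t - a)) + mass r k * mass r i * (2 * t)) t := by
      have := ((((d0.pow 2).const_mul (mass r j * mass r k)).const_add
        (mass r i * mass r j * a ^ 2)).add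
          ((hasDerivAt_pow 2 t).const_mul (mass r k * mass r i))).add_const
          (∑ l, ballInertia r l)
      simpa [inertiaOf] using this
    have d2 := (hasDerivAt_const t (H ^ 2)).div (d1.const_mul 2) (by positivity)
    have d3 := (((hasDerivAt_const t (mass r j * mass r k)).div d0 hta.ne').const_add
      (mass r i * mass r j / a)).add
      ((hasDerivAt_const t (mass r k * mass r i)).div (hasDerivAt_id t) ht0.ne')
    -- Here the derivative is m_k (m_i t + m_j (t − a)) times `rateSq` − H² / I², and I² times
    -- `rateSq` is the square of h.
    refine ⟨mass r k * (mass r i * t + mass r j * (t - a)) / inertiaOf r i j k a (t - a) t ^ 2,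
      by positivity, ?_⟩
    refine (d2.sub d3).congr_deriv ?_
    clear_value H
    have hP : mass r i * t + mass r j * (t - a) ≠ 0 := by positivity
    have hr : √(rateSq r i j a t) ^ 2 = rateSq r i j a t :=
      Real.sq_sqrt (by unfold rateSq; positivity)
    rw [mul_pow (inertiaOf r i j k a (t - a) t), hr]
    unfold rateSq
    simp only [id]
    field_simp
    ring

/-! ### Criteria for stability and instability -/

lemma slope_self_pos {H I d : ℝ} (hI : 0 < I) (hd : 0 < d) (h : (H / I) ^ 2 * d ^ 3 < 1) :
    0 < slope H I I d d := by
  rw [slope_self _ _ _ hI.ne', sub_pos, lt_div_iff₀ (by positivity)]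
  linarith

lemma slope_self_neg {H I d : ℝ} (hI : 0 < I) (hd : 0 < d) (h : 1 < (H / I) ^ 2 * d ^ 3) :
    slope H I I d d < 0 := by
  rw [slope_self _ _ _ hI.ne', sub_neg, div_lt_iff₀ (by positivity)]
  linarith

lemma eventually_slope_third {r : Fin 3 → ℝ} (hs : IsSizes r) (i j k : Fin 3) (H : ℝ)
    {x y z : ℝ} (hx : 0 < x) (hy : 0 < y) (hz : 0 < z) : ∀ᶠ t in 𝓝 z,
      0 < t ∧ energyOf r i j k H x y t - energyOf r i j k H x y z = mass r k * mass r i * (t - z)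
        * slope H (inertiaOf r i j k x y z) (inertiaOf r i j k x y t) z t ∧
      (0 < slope H (inertiaOf r i j k x y z) (inertiaOf r i j k x y z) z z →
        0 < slope H (inertiaOf r i j k x y z) (inertiaOf r i j k x y t) z t) := by
  have c : ContinuousAt (fun t => inertiaOf r i j k x y t) z := by unfold inertiaOf; fun_prop
  have ts := tendsto_slope H (hs.inertiaOf_pos i j k x y z) hz tendsto_const_nhds c
    tendsto_const_nhds tendsto_id
  have e2 : ∀ᶠ t in 𝓝 z, (0 < slope H (inertiaOf r i j k x y z) (inertiaOf r i j k x y z) z z →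
        0 < slope H (inertiaOf r i j k x y z) (inertiaOf r i j k x y t) z t) := by
    by_cases hp : 0 < slope H (inertiaOf r i j k x y z) (inertiaOf r i j k x y z) z z
    · filter_upwards [ts.eventually (lt_mem_nhds hp)] with t ht _ using ht
    · exact Eventually.of_forall fun t h => absurd h hp
  filter_upwards [lt_mem_nhds hz, e2] with t ht h2
  refine ⟨ht, ?_, h2⟩
  have := energyOf_sub hs i j k H hx hy hz hx hy ht
  simpa using this

section config

variable {r : Fin 3 → ℝ} (hs : IsSizes r) {i j k : Fin 3} (h : IsTriple i j k) {H : ℝ}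
  {q : Config}
include hs h

/-- Three contacts, all pressed together. -/
lemma isStable_of_three_contacts (hrel : IsRelEq r H q) (cij : Contact r q i j)
    (cjk : Contact r q j k) (cki : Contact r q k i)
    (wx : (H / inertia r q) ^ 2 * ‖q i - q j‖ ^ 3 < 1)
    (wy : (H / inertia r q) ^ 2 * ‖q j - q k‖ ^ 3 < 1)
    (wz : (H / inertia r q) ^ 2 * ‖q k - q i‖ ^ 3 < 1) : IsStable r H q := by
  have ha := hrel.admissible
  have hx := ha.dist_pos hs h.ij
  have hy := ha.dist_pos hs h.jk
  have hz := ha.dist_pos hs h.ki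
  rw [inertia_eq r h] at wx wy wz
  have hI := hs.inertiaOf_pos i j k ‖q i - q j‖ ‖q j - q k‖ ‖q k - q i‖
  refine isStable_of_distances hs h hrel ?_
  have := energyOf_lt_of_contacts hs hx hy hz (C := fun t => ‖q k - q i‖ ≤ t)
    (slope_self_pos hI hx wx) (slope_self_pos hI hy wy) ?_
  · filter_upwards [this] with p hp _ hA hne
    exact hp (cij.trans_le hA.1) (cjk.trans_le hA.2.1) (cki.trans_le hA.2.2) hne
  · filter_upwards [eventually_slope_third hs i j k H hx hy hz] with t ⟨_, e, hp⟩ hle hne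
    have hp := hp (slope_self_pos hI hz wz)
    have mi := hs.mass_pos i; have mk := hs.mass_pos k
    have : 0 < t - ‖q k - q i‖ := sub_pos.2 (lt_of_le_of_ne hle hne.symm)
    have : 0 < energyOf r i j k H ‖q i - q j‖ ‖q j - q k‖ t
      - energyOf r i j k H ‖q i - q j‖ ‖q j - q k‖ ‖q k - q i‖ := by rw [e]; positivity
    linarith

/-- Two pressed contacts, and `h` increasing in the third distance. -/
lemma isStable_of_two_contacts (hrel : IsRelEq r H q) (cij : Contact r q i j)
    (cjk : Contact r q j k) (wx : (H / inertia r q) ^ 2 * ‖q i - q j‖ ^ 3 < 1)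
    (wy : (H / inertia r q) ^ 2 * ‖q j - q k‖ ^ 3 < 1)
    (hH : H = hTR r i j k ‖q k - q i‖) {l u : ℝ} (hl : 0 ≤ l) (hlu : ‖q k - q i‖ ∈ Ioo l u)
    (hm : StrictMonoOn (hTR r i j k) (Ioo l u)) : IsStable r H q := by
  have ha := hrel.admissible
  have hx := ha.dist_pos hs h.ij
  have hy := ha.dist_pos hs h.jk
  have hz := ha.dist_pos hs h.ki
  rw [inertia_eq r h] at wx wy
  have hI := hs.inertiaOf_pos i j k ‖q i - q j‖ ‖q j - q k‖ ‖q k - q i‖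
  refine isStable_of_distances hs h hrel ?_
  have := energyOf_lt_of_contacts hs hx hy hz (C := fun _ => True)
    (slope_self_pos hI hx wx) (slope_self_pos hI hy wy) ?_
  · filter_upwards [this] with p hp _ hA hne
    exact hp (cij.trans_le hA.1) (cjk.trans_le hA.2.1) trivial hne
  · have hc := isCharted_bend hs i j k (r i + r j) (r j + r k) ‖q k - q i‖
    have hc' := hc.mono (l' := l) (u' := min u (‖q k - q i‖ + 1)) hl (min_le_right _ _)
    have := hc'.eventually_lt ⟨hlu.1, lt_min hlu.2 (by linarith)⟩
      (hm.mono (Ioo_subset_Ioo_right (min_le_left _ _)))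
    rw [hH, show ‖q i - q j‖ = r i + r j from cij, show ‖q j - q k‖ = r j + r k from cjk]
    filter_upwards [this] with t ht _ hne using ht hne

/-- Opening the angle of a chain whose `h` decreases to the right. -/
lemma not_isStable_of_open (hcr : cross i j k q ≠ 0)
    (hH : H = inertiaOf r i j k ‖q i - q j‖ ‖q j - q k‖ ‖q k - q i‖ / ‖q k - q i‖ ^ (3 / 2 : ℝ))
    {v : ℝ} (hv : ‖q k - q i‖ < v) (hm : StrictAntiOn
      (fun t => inertiaOf r i j k ‖q i - q j‖ ‖q j - q k‖ t / t ^ (3 / 2 : ℝ))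
      (Icc ‖q k - q i‖ v)) : ¬ IsStable r H q := by
  refine not_isStable_of_path hs h
    (fun s => (‖q i - q j‖, ‖q j - q k‖, ‖q k - q i‖ + s)) ?_ fun ha => ?_
  · have : ContinuousAt (fun s : ℝ => (‖q i - q j‖, ‖q j - q k‖, ‖q k - q i‖ + s)) 0 := by
      fun_prop
    have := this.tendsto.mono_left (nhdsWithin_le_nhds (s := Ioi 0))
    simpa [distances] using this
  · have hz := ha.dist_pos hs h.ki
    have t := ha.isTriangle hs h
    have hlt : ‖q k - q i‖ < ‖q i - q j‖ + ‖q j - q k‖ :=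
      lt_of_le_of_ne t.z_le fun e => hcr (cross_eq_zero_of_add e.symm)
    have hc := isCharted_bend hs i j k ‖q i - q j‖ ‖q j - q k‖ ‖q k - q i‖
    have e1 := hc.eventually_right ⟨hz, by linarith⟩ hv hm
    rw [← hH] at e1
    filter_upwards [e1, Ioo_mem_nhdsGT (sub_pos.2 hlt)] with s hs1 hs2
    have a := (admissible_iff h).1 ha
    refine ⟨⟨t.x_pos, t.y_pos, ?_, ?_, ?_, ?_⟩, ⟨a.1, a.2.1, ?_⟩, ?_, hs1.le⟩
    · have := hs2.1; linarith
    · have := hs2.1; have := t.x_le; linarith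
    · have := hs2.1; have := t.y_le; linarith
    · have := hs2.2; linarith
    · have := a.2.2; have := hs2.1; simp only [distances] at *; linarith
    · have := hs2.1
      simp only [distances, ne_eq, Prod.mk.injEq, true_and]; intro e; linarith

/-- Closing the angle of a chain without contact of its ends. -/
lemma not_isStable_of_close (hpx : ‖q i - q j‖ < ‖q j - q k‖ + ‖q k - q i‖)
    (hpy : ‖q j - q k‖ < ‖q k - q i‖ + ‖q i - q j‖) (hki : r k + r i < ‖q k - q i‖)
    (hE : ∀ᶠ s in 𝓝[>] (0 : ℝ), energyOf r i j k H ‖q i - q j‖ ‖q j - q k‖ (‖q k - q i‖ - s)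
      ≤ energyOf r i j k H ‖q i - q j‖ ‖q j - q k‖ ‖q k - q i‖) : ¬ IsStable r H q := by
  refine not_isStable_of_path hs h
    (fun s => (‖q i - q j‖, ‖q j - q k‖, ‖q k - q i‖ - s)) ?_ fun ha => ?_
  · have : ContinuousAt (fun s : ℝ => (‖q i - q j‖, ‖q j - q k‖, ‖q k - q i‖ - s)) 0 := by
      fun_prop
    have := this.tendsto.mono_left (nhdsWithin_le_nhds (s := Ioi 0))
    simpa [distances] using this
  · have hz := ha.dist_pos hs h.ki
    have t := ha.isTriangle hs h
    filter_upwards [hE, Ioo_mem_nhdsGT (sub_pos.2 hki), Ioo_mem_nhdsGT (sub_pos.2 hpx),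
      Ioo_mem_nhdsGT (sub_pos.2 hpy)] with s hs1 hs2 hs3 hs4
    have a := (admissible_iff h).1 ha
    have := hs.pos k; have := hs.pos i
    refine ⟨⟨t.x_pos, t.y_pos, ?_, ?_, ?_, ?_⟩, ⟨a.1, a.2.1, ?_⟩, ?_, hs1⟩
    · have := hs2.2; linarith
    · have := hs3.2; linarith
    · have := hs4.2; linarith
    · have := hs2.1; have := t.z_le; linarith
    · have := hs2.2; linarith
    · have := hs2.1
      simp only [distances, ne_eq, Prod.mk.injEq, true_and]; intro e; linarith

/-- Two equal distances from a body without contacts. -/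
lemma not_isStable_of_isosceles (hcr : cross i j k q ≠ 0) (hyz : ‖q j - q k‖ = ‖q k - q i‖)
    (hjk : r j + r k < ‖q j - q k‖) (hki : r k + r i < ‖q k - q i‖) : ¬ IsStable r H q := by
  have mi := hs.mass_pos i; have mj := hs.mass_pos j; have mk := hs.mass_pos k
  set d := ‖q k - q i‖ with hd
  have hd0 : 0 < d := by linarith [hs.pos k, hs.pos i]
  -- The squares of the two free distances change by s m_i and −s m_j; weighted by m_j m_k and m_k
  -- m_i these changes cancel, so the moment of inertia stays constant along the path.
  have ct : Tendsto (fun s : ℝ => (‖q i - q j‖, √(d ^ 2 + s * mass r i), √(d ^ 2 - s * mass r j)))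
      (𝓝[>] 0) (𝓝 (distances i j k q)) := by
    have : ContinuousAt (fun s : ℝ =>
        (‖q i - q j‖, √(d ^ 2 + s * mass r i), √(d ^ 2 - s * mass r j))) 0 := by fun_prop
    have := this.tendsto.mono_left (nhdsWithin_le_nhds (s := Ioi 0))
    simpa [distances, Real.sqrt_sq hd0.le, hyz, ← hd] using this
  refine not_isStable_of_path hs h _ ct fun ha => ?_
  have t := ha.isTriangle hs h
  rw [hyz] at t hjk
  have hlt : ‖q i - q j‖ < d + d :=
    lt_of_le_of_ne t.x_le fun e => hcr (by
      have := cross_eq_zero_of_add (i := j) (j := k) (k := i) (q := q) (by rw [hyz, e])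
      rwa [cross_rotate] at this)
  have a := (admissible_iff h).1 ha
  have t2 := (continuous_fst.comp continuous_snd).continuousAt.tendsto.comp ct
  have t3 := (continuous_snd.comp continuous_snd).continuousAt.tendsto.comp ct
  simp only [Function.comp_def, distances, hyz] at t2 t3
  rw [← hd] at t3
  have tx := (t2.add t3).eventually (lt_mem_nhds hlt)
  have ty := ((t3.add_const ‖q i - q j‖).sub t2).eventually
    (lt_mem_nhds (show 0 < d + ‖q i - q j‖ - d by linarith [t.x_pos]))
  have tz := ((t2.add_const ‖q i - q j‖).sub t3).eventually
    (lt_mem_nhds (show 0 < d + ‖q i - q j‖ - d by linarith [t.x_pos]))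
  filter_upwards [tx, ty, tz, t2.eventually (lt_mem_nhds hjk), t3.eventually (lt_mem_nhds hki),
    t2.eventually (lt_mem_nhds hd0), t3.eventually (lt_mem_nhds hd0), self_mem_nhdsWithin]
    with s sx sy sz s2 s3 p2 p3 s0
  have s0 : 0 < s := s0
  set u := √(d ^ 2 + s * mass r i) with hu
  set w := √(d ^ 2 - s * mass r j) with hw
  have u2 : u ^ 2 = d ^ 2 + s * mass r i := Real.sq_sqrt (by positivity)
  have w2 : w ^ 2 = d ^ 2 - s * mass r j := Real.sq_sqrt (Real.sqrt_pos.1 p3).le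
  refine ⟨⟨t.x_pos, p2, p3, sx.le, by linarith, by linarith⟩,
    ⟨a.1, s2.le, s3.le⟩, ?_, ?_⟩
  · simp only [distances, ne_eq, Prod.mk.injEq, true_and, hyz]
    rintro ⟨e, -⟩
    have := u2
    rw [e] at this
    have : 0 < s * mass r i := by positivity
    linarith
  · have eI : inertiaOf r i j k ‖q i - q j‖ u w = inertiaOf r i j k ‖q i - q j‖ d d := by
      unfold inertiaOf; linear_combination mass r j * mass r k * u2 + mass r k * mass r i * w2
    -- 1/v is convex as a function of v², and this is its tangent bound at `d`. The tangent terms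
    -- cancel for the same reason as the changes of inertia, so the potential energy does not rise.
    have conv : ∀ v : ℝ, 0 < v → 1 / d - (v ^ 2 - d ^ 2) / (2 * d ^ 3) ≤ 1 / v := by
      intro v hv
      have : 1 / v - (1 / d - (v ^ 2 - d ^ 2) / (2 * d ^ 3))
          = (v - d) ^ 2 * (v + 2 * d) / (2 * d ^ 3 * v) := by field_simp; ring
      have : 0 ≤ (v - d) ^ 2 * (v + 2 * d) / (2 * d ^ 3 * v) := by positivity
      linarith
    have c1 := mul_le_mul_of_nonneg_left (conv u p2) (mul_pos mj mk).le
    have c2 := mul_le_mul_of_nonneg_left (conv w p3) (mul_pos mk mi).le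
    rw [u2] at c1
    rw [w2] at c2
    have c3 : mass r j * mass r k * ((d ^ 2 + s * mass r i - d ^ 2) / (2 * d ^ 3))
      + mass r k * mass r i * ((d ^ 2 - s * mass r j - d ^ 2) / (2 * d ^ 3)) = 0 := by ring
    unfold energyOf
    rw [hyz, ← hd, eI]
    simp only [div_eq_mul_one_div (_ * _) u, div_eq_mul_one_div (_ * _) w,
      div_eq_mul_one_div (_ * _) d]
    linarith

end config

lemma rateSq_pos {r : Fin 3 → ℝ} (hs : IsSizes r) (i j : Fin 3) {a x : ℝ} (ha : 0 < a)
    (hx : a < x) : 0 < rateSq r i j a x := by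
  have := hs.mass_pos i; have := hs.mass_pos j
  have : 0 < x - a := sub_pos.2 hx
  have : 0 < x := ha.trans hx
  unfold rateSq; positivity

/-- The rate balancing an outer body lies strictly between the two Kepler rates. -/
lemma rateSq_bounds {r : Fin 3 → ℝ} (hs : IsSizes r) (i j : Fin 3) {a x : ℝ} (ha : 0 < a)
    (hx : a < x) : 1 < rateSq r i j a x * x ^ 3 ∧ rateSq r i j a x * (x - a) ^ 3 < 1 := by
  have mi := hs.mass_pos i; have mj := hs.mass_pos j
  have y0 : 0 < x - a := sub_pos.2 hx
  have x0 : 0 < x := ha.trans hx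
  have hyx : x - a < x := by linarith
  unfold rateSq
  generalize x - a = y at *
  have h3 : y ^ 3 < x ^ 3 := pow_lt_pow_left₀ hyx y0.le (by norm_num)
  constructor
  · rw [div_mul_eq_mul_div, lt_div_iff₀ (by positivity)]
    have e : (mass r i / x ^ 2 + mass r j / y ^ 2) * x ^ 3 - 1 * (mass r i * x + mass r j * y)
        = mass r j * (x ^ 3 - y ^ 3) / y ^ 2 := by field_simp; ring
    have : 0 < mass r j * (x ^ 3 - y ^ 3) / y ^ 2 :=
      div_pos (mul_pos mj (by linarith)) (by positivity)
    linarith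
  · rw [div_mul_eq_mul_div, div_lt_iff₀ (by positivity)]
    have e : 1 * (mass r i * x + mass r j * y) - (mass r i / x ^ 2 + mass r j / y ^ 2) * y ^ 3
        = mass r i * (x ^ 3 - y ^ 3) / x ^ 2 := by field_simp; ring
    have : 0 < mass r i * (x ^ 3 - y ^ 3) / x ^ 2 :=
      div_pos (mul_pos mi (by linarith)) (by positivity)
    linarith

/-- Force on the outer body `k` of an aligned configuration, in terms of the rates. -/
lemma slope_add_slope {r : Fin 3 → ℝ} (hs : IsSizes r) (i j : Fin 3) {H I a x : ℝ} (hI : 0 < I)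
    (ha : 0 < a) (hx : a < x) :
    mass r j * slope H I I (x - a) (x - a) + mass r i * slope H I I x x
      = (mass r i * x + mass r j * (x - a)) * (rateSq r i j a x - (H / I) ^ 2) := by
  have mi := hs.mass_pos i; have mj := hs.mass_pos j
  have y0 : 0 < x - a := sub_pos.2 hx
  have x0 : 0 < x := ha.trans hx
  rw [slope_self _ _ _ hI.ne', slope_self _ _ _ hI.ne']
  unfold rateSq
  generalize (H / I) ^ 2 = w
  generalize x - a = y at *
  field_simp
  ring

section config

variable {r : Fin 3 → ℝ} (hs : IsSizes r) {i j k : Fin 3} (h : IsTriple i j k) {H : ℝ}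
  {q : Config}
include hs h

/-- An aligned chain, both contacts pressed, turning fast enough not to bend. -/
lemma isStable_of_chain (hrel : IsRelEq r H q) (hadd : ‖q i - q j‖ + ‖q j - q k‖ = ‖q k - q i‖)
    (cij : Contact r q i j) (cjk : Contact r q j k)
    (wi : (H / inertia r q) ^ 2 < rateSq r k j ‖q j - q k‖ ‖q k - q i‖)
    (wk : (H / inertia r q) ^ 2 < rateSq r i j ‖q i - q j‖ ‖q k - q i‖)
    (wz : 1 < (H / inertia r q) ^ 2 * ‖q k - q i‖ ^ 3) : IsStable r H q := by
  have ha := hrel.admissible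
  have hx := ha.dist_pos hs h.ij
  have hy := ha.dist_pos hs h.jk
  have hz := ha.dist_pos hs h.ki
  rw [inertia_eq r h] at wi wk wz
  have mi := hs.mass_pos i; have mj := hs.mass_pos j; have mk := hs.mass_pos k
  have hI := hs.inertiaOf_pos i j k ‖q i - q j‖ ‖q j - q k‖ ‖q k - q i‖
  have e1 := slope_add_slope hs i j (H := H) hI hx (show ‖q i - q j‖ < ‖q k - q i‖ by linarith)
  have e2 := slope_add_slope hs k j (H := H) hI hy (show ‖q j - q k‖ < ‖q k - q i‖ by linarith)
  have hzx : ‖q k - q i‖ - ‖q i - q j‖ = ‖q j - q k‖ := by linarith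
  have hzy : ‖q k - q i‖ - ‖q j - q k‖ = ‖q i - q j‖ := by linarith
  rw [hzx] at e1
  rw [hzy] at e2
  have p1 := sub_pos.2 wk
  have p2 := sub_pos.2 wi
  refine isStable_of_distances hs h hrel ?_
  have := energyOf_lt_of_chain hs hx hy hz hadd (H := H)
    (by rw [e2]; positivity) (by rw [e1]; positivity) (slope_self_neg hI hz wz)
  filter_upwards [this] with p hp tri hA hne
  exact hp (cij.trans_le hA.1) (cjk.trans_le hA.2.1) tri.z_le hne

/-- An aligned chain turning too slowly: it bends. -/
lemma not_isStable_of_chain (hadd : ‖q i - q j‖ + ‖q j - q k‖ = ‖q k - q i‖)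
    (wz : (H / inertia r q) ^ 2 * ‖q k - q i‖ ^ 3 < 1) : ¬ IsStable r H q := by
  intro hst
  have ha := hst.1.admissible
  have hx := ha.dist_pos hs h.ij
  have hy := ha.dist_pos hs h.jk
  have hz := ha.dist_pos hs h.ki
  rw [inertia_eq r h] at wz
  have mi := hs.mass_pos i; have mk := hs.mass_pos k
  have hI := hs.inertiaOf_pos i j k ‖q i - q j‖ ‖q j - q k‖ ‖q k - q i‖
  refine not_isStable_of_close hs h (by linarith) (by linarith) ?_ ?_ hst
  · have := ha i j h.ij; have := ha j k h.jk; have := hs.pos j; linarith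
  · have t : Tendsto (fun s : ℝ => ‖q k - q i‖ - s) (𝓝[>] 0) (𝓝 ‖q k - q i‖) := by
      have : ContinuousAt (fun s : ℝ => ‖q k - q i‖ - s) 0 := by fun_prop
      simpa using this.tendsto.mono_left (nhdsWithin_le_nhds (s := Ioi 0))
    filter_upwards [t.eventually (eventually_slope_third hs i j k H hx hy hz),
      self_mem_nhdsWithin] with s ⟨_, e, hp⟩ hs0
    have := hp (slope_self_pos hI hz wz)
    have hs0 : 0 < s := hs0
    have : 0 ≤ mass r k * mass r i * s * slope H
      (inertiaOf r i j k ‖q i - q j‖ ‖q j - q k‖ ‖q k - q i‖)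
      (inertiaOf r i j k ‖q i - q j‖ ‖q j - q k‖ (‖q k - q i‖ - s)) ‖q k - q i‖
        (‖q k - q i‖ - s) := by positivity
    linarith

/-- One pressed contact, aligned, `h` increasing in the distance of the outer body. -/
lemma isStable_of_aligned (hrel : IsRelEq r H q) (cij : Contact r q i j)
    (hadd : ‖q i - q j‖ + ‖q j - q k‖ = ‖q k - q i‖)
    (wk : (H / inertia r q) ^ 2 = rateSq r i j ‖q i - q j‖ ‖q k - q i‖)
    (wi : (H / inertia r q) ^ 2 < rateSq r k j ‖q j - q k‖ ‖q k - q i‖)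
    (hH : H = hEA r i j k ‖q k - q i‖) {l u : ℝ} (hl : r i + r j ≤ l)
    (hlu : ‖q k - q i‖ ∈ Ioo l u) (hm : StrictMonoOn (hEA r i j k) (Ioo l u)) :
    IsStable r H q := by
  have ha := hrel.admissible
  have hx := ha.dist_pos hs h.ij
  have hy := ha.dist_pos hs h.jk
  have hz := ha.dist_pos hs h.ki
  rw [inertia_eq r h] at wi wk
  have mi := hs.mass_pos i; have mj := hs.mass_pos j; have mk := hs.mass_pos k
  have hI := hs.inertiaOf_pos i j k ‖q i - q j‖ ‖q j - q k‖ ‖q k - q i‖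
  have hxz : ‖q i - q j‖ < ‖q k - q i‖ := by linarith
  have e1 := slope_add_slope hs i j (H := H) hI hx hxz
  have e2 := slope_add_slope hs k j (H := H) hI hy (show ‖q j - q k‖ < ‖q k - q i‖ by linarith)
  have b := (rateSq_bounds hs i j hx hxz).2
  have hzx : ‖q k - q i‖ - ‖q i - q j‖ = ‖q j - q k‖ := by linarith
  have hzy : ‖q k - q i‖ - ‖q j - q k‖ = ‖q i - q j‖ := by linarith
  rw [hzx, ← wk, sub_self, mul_zero] at e1
  rw [hzx, ← wk] at b
  rw [hzy] at e2
  have p2 := sub_pos.2 wi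
  refine isStable_of_distances hs h hrel ?_
  have := energyOf_lt_of_aligned hs hx hy hz hadd (H := H) ?_ (slope_self_pos hI hy b) ?_
  · filter_upwards [this] with p hp tri hA hne
    exact hp (cij.trans_le hA.1) tri.z_le hne
  -- Balance of `k` gives m_j s_y = −m_i s_z for the slopes. Multiplied by m_i, the positive
  -- compression m_j s_x + m_k s_z at `i` becomes m_j (m_i s_x − m_k s_y).
  · have p3 := mul_pos mi (mul_pos (show 0 < mass r k * ‖q k - q i‖ + mass r j * ‖q i - q j‖
      by positivity) p2)
    rw [← e2] at p3
    have : 0 < mass r j * (mass r i * slope H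
      (inertiaOf r i j k ‖q i - q j‖ ‖q j - q k‖ ‖q k - q i‖)
      (inertiaOf r i j k ‖q i - q j‖ ‖q j - q k‖ ‖q k - q i‖) ‖q i - q j‖ ‖q i - q j‖
      - mass r k * slope H
      (inertiaOf r i j k ‖q i - q j‖ ‖q j - q k‖ ‖q k - q i‖)
      (inertiaOf r i j k ‖q i - q j‖ ‖q j - q k‖ ‖q k - q i‖) ‖q j - q k‖ ‖q j - q k‖) := by
      refine p3.trans_eq ?_
      linear_combination mass r k * e1
    exact pos_of_mul_pos_right this mj.le
  · have hc := isCharted_aligned hs i j k hx ‖q k - q i‖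
    rw [show ‖q i - q j‖ = r i + r j from cij] at hc hzx ⊢
    have hc' := hc.mono (l' := l) (u' := min u (‖q k - q i‖ + 1)) hl (min_le_right _ _)
    have := hc'.eventually_lt ⟨hlu.1, lt_min hlu.2 (by linarith)⟩
      (hm.mono (Ioo_subset_Ioo_right (min_le_left _ _)))
    rw [hH]
    unfold hEA
    filter_upwards [this] with t ht hne
    simpa only [hzx] using ht hne

/-- Moving the outer body of an aligned configuration along the line. -/
lemma not_isStable_of_slide (c : ℝ) (hc : c ^ 2 = 1)
    (hadd : ‖q i - q j‖ + ‖q j - q k‖ = ‖q k - q i‖)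
    (hd : 0 < c ∨ r j + r k < ‖q j - q k‖)
    (hE : ∀ᶠ s in 𝓝[>] (0 : ℝ), energyOf r i j k H ‖q i - q j‖ (‖q j - q k‖ + c * s)
        (‖q k - q i‖ + c * s)
      ≤ energyOf r i j k H ‖q i - q j‖ ‖q j - q k‖ ‖q k - q i‖) : ¬ IsStable r H q := by
  refine not_isStable_of_path hs h
    (fun s => (‖q i - q j‖, ‖q j - q k‖ + c * s, ‖q k - q i‖ + c * s)) ?_ fun ha => ?_
  · have : ContinuousAt (fun s : ℝ =>
        (‖q i - q j‖, ‖q j - q k‖ + c * s, ‖q k - q i‖ + c * s)) 0 := by fun_prop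
    have := this.tendsto.mono_left (nhdsWithin_le_nhds (s := Ioi 0))
    simpa [distances] using this
  · have a := (admissible_iff h).1 ha
    have hx := ha.dist_pos hs h.ij
    have t : Tendsto (fun s : ℝ => ‖q j - q k‖ + c * s) (𝓝[>] 0) (𝓝 ‖q j - q k‖) := by
      have : ContinuousAt (fun s : ℝ => ‖q j - q k‖ + c * s) 0 := by fun_prop
      simpa using this.tendsto.mono_left (nhdsWithin_le_nhds (s := Ioi 0))
    have hy : ∀ᶠ s in 𝓝[>] (0 : ℝ), r j + r k ≤ ‖q j - q k‖ + c * s := by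
      rcases hd with hd | hd
      · filter_upwards [self_mem_nhdsWithin] with s hs0
        have := a.2.1
        have hs0 : 0 < s := hs0
        have : 0 < c * s := by positivity
        simp only [distances] at *; linarith
      · filter_upwards [t.eventually (lt_mem_nhds hd)] with s hs1 using hs1.le
    filter_upwards [hE, hy, self_mem_nhdsWithin] with s hs1 hs2 hs0
    have hs0 : 0 < s := hs0
    have := hs.pos k; have := hs.pos i; have := hs.pos j
    have a1 := a.1
    simp only [distances] at a1
    refine ⟨⟨hx, by linarith, by linarith, by linarith, by linarith, by linarith⟩,
      ⟨a.1, hs2, by simp only; linarith⟩, ?_, hs1⟩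
    simp only [distances, ne_eq, Prod.mk.injEq, true_and]
    rintro ⟨e, -⟩
    have : c * s = 0 := by linarith
    rcases mul_eq_zero.1 this with e | e
    · rw [e] at hc; norm_num at hc
    · exact hs0.ne' e

lemma not_isStable_of_slide_right (hadd : ‖q i - q j‖ + ‖q j - q k‖ = ‖q k - q i‖)
    (cij : Contact r q i j) (hjk : 0 < ‖q j - q k‖)
    (hH : H = hEA r i j k ‖q k - q i‖) {v : ℝ} (hv : ‖q k - q i‖ < v)
    (hm : StrictAntiOn (hEA r i j k) (Icc ‖q k - q i‖ v)) : ¬ IsStable r H q := by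
  refine not_isStable_of_slide hs h 1 (by norm_num) hadd (Or.inl one_pos) ?_
  have hx : 0 < ‖q i - q j‖ := by
    rw [show ‖q i - q j‖ = r i + r j from cij]; linarith [hs.pos i, hs.pos j]
  have hzx : ‖q k - q i‖ - ‖q i - q j‖ = ‖q j - q k‖ := by linarith
  have hc := isCharted_aligned hs i j k hx ‖q k - q i‖
  have hm' : StrictAntiOn (fun t => inertiaOf r i j k ‖q i - q j‖ (t - ‖q i - q j‖) t
      * √(rateSq r i j ‖q i - q j‖ t)) (Icc ‖q k - q i‖ v) := by
    rw [show ‖q i - q j‖ = r i + r j from cij]; exact hm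
  have := hc.eventually_right ⟨by linarith, by linarith⟩ hv hm'
  filter_upwards [this] with s hs'
  have e : H = inertiaOf r i j k ‖q i - q j‖ (‖q k - q i‖ - ‖q i - q j‖) ‖q k - q i‖
      * √(rateSq r i j ‖q i - q j‖ ‖q k - q i‖) := by
    rw [hH, hEA, show ‖q i - q j‖ = r i + r j from cij]
  rw [← e, hzx, show ‖q k - q i‖ + s - ‖q i - q j‖ = ‖q j - q k‖ + s by linarith] at hs'
  simpa only [one_mul] using hs'.le

lemma not_isStable_of_slide_left (hadd : ‖q i - q j‖ + ‖q j - q k‖ = ‖q k - q i‖)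
    (cij : Contact r q i j) (hjk : r j + r k < ‖q j - q k‖)
    (hH : H = hEA r i j k ‖q k - q i‖) {v : ℝ} (hv : v < ‖q k - q i‖)
    (hm : StrictAntiOn (hEA r i j k) (Icc v ‖q k - q i‖)) : ¬ IsStable r H q := by
  refine not_isStable_of_slide hs h (-1) (by norm_num) hadd (Or.inr hjk) ?_
  have hx : 0 < ‖q i - q j‖ := by
    rw [show ‖q i - q j‖ = r i + r j from cij]; linarith [hs.pos i, hs.pos j]
  have hzx : ‖q k - q i‖ - ‖q i - q j‖ = ‖q j - q k‖ := by linarith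
  have hc := isCharted_aligned hs i j k hx ‖q k - q i‖
  have hm' : StrictAntiOn (fun t => inertiaOf r i j k ‖q i - q j‖ (t - ‖q i - q j‖) t
      * √(rateSq r i j ‖q i - q j‖ t)) (Icc v ‖q k - q i‖) := by
    rw [show ‖q i - q j‖ = r i + r j from cij]; exact hm
  have := hc.eventually_left ⟨by linarith [hs.pos j, hs.pos k], by linarith⟩ hv hm'
  filter_upwards [this] with s hs'
  have e : H = inertiaOf r i j k ‖q i - q j‖ (‖q k - q i‖ - ‖q i - q j‖) ‖q k - q i‖
      * √(rateSq r i j ‖q i - q j‖ ‖q k - q i‖) := by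
    rw [hH, hEA, show ‖q i - q j‖ = r i + r j from cij]
  rw [← e, hzx, show ‖q k - q i‖ - s - ‖q i - q j‖ = ‖q j - q k‖ - s by linarith] at hs'
  simpa only [neg_one_mul, ← sub_eq_add_neg] using hs'.le

/-- An aligned configuration without contact is not a minimum: on the line, with the moment of
inertia fixed, the potential energy has a strict maximum there. -/
lemma not_isStable_of_collinear_free (hadd : ‖q i - q j‖ + ‖q j - q k‖ = ‖q k - q i‖)
    (hij : r i + r j < ‖q i - q j‖) (hjk : r j + r k < ‖q j - q k‖)
    (wi : (H / inertia r q) ^ 2 = rateSq r k j ‖q j - q k‖ ‖q k - q i‖)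
    (wk : (H / inertia r q) ^ 2 = rateSq r i j ‖q i - q j‖ ‖q k - q i‖) : ¬ IsStable r H q := by
  have mi := hs.mass_pos i; have mj := hs.mass_pos j; have mk := hs.mass_pos k
  have ri := hs.pos i; have rj := hs.pos j; have rk := hs.pos k
  have hx : 0 < ‖q i - q j‖ := by linarith
  have hy : 0 < ‖q j - q k‖ := by linarith
  have hz : 0 < ‖q k - q i‖ := by linarith
  rw [inertia_eq r h] at wi wk
  have hI := hs.inertiaOf_pos i j k ‖q i - q j‖ ‖q j - q k‖ ‖q k - q i‖
  have e1 := slope_add_slope hs i j (H := H) hI hx (show ‖q i - q j‖ < ‖q k - q i‖ by linarith)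
  have e2 := slope_add_slope hs k j (H := H) hI hy (show ‖q j - q k‖ < ‖q k - q i‖ by linarith)
  have hzx : ‖q k - q i‖ - ‖q i - q j‖ = ‖q j - q k‖ := by linarith
  have hzy : ‖q k - q i‖ - ‖q j - q k‖ = ‖q i - q j‖ := by linarith
  rw [hzx, ← wk, sub_self, mul_zero] at e1
  rw [hzy, ← wi, sub_self, mul_zero] at e2
  simp only [slope_self _ _ _ hI.ne'] at e1 e2
  set w := (H / inertiaOf r i j k ‖q i - q j‖ ‖q j - q k‖ ‖q k - q i‖) ^ 2 with hw
  have w0 : 0 ≤ w := sq_nonneg _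
  set x := ‖q i - q j‖ with hxd
  set y := ‖q j - q k‖ with hyd
  set z := ‖q k - q i‖ with hzd
  -- The gap `i j` is widened by `s` and the whole line is rescaled by `lam s`. As `N` is the moment
  -- of inertia without the constant ball terms, the factor √(N 0 / N s) restores it.
  set N : ℝ → ℝ := fun s => mass r i * mass r j * (x + s) ^ 2 + mass r j * mass r k * y ^ 2
    + mass r k * mass r i * (z + s) ^ 2 with hN
  have N0 : ∀ s, 0 < N s := fun s => by simp only [hN]; positivity
  set lam : ℝ → ℝ := fun s => √(N 0 / N s) with hlam
  have lam0 : lam 0 = 1 := by simp only [hlam, div_self (N0 0).ne', Real.sqrt_one]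
  have lamp : ∀ s, 0 < lam s := fun s => Real.sqrt_pos.2 (div_pos (N0 0) (N0 s))
  have lamsq : ∀ s, lam s ^ 2 * N s = N 0 := fun s => by
    simp only [hlam]
    rw [Real.sq_sqrt (div_pos (N0 0) (N0 s)).le, div_mul_cancel₀ _ (N0 s).ne']
  have lamc : Continuous lam := by
    simp only [hlam]
    exact (continuous_const.div (by simp only [hN]; fun_prop) fun s => (N0 s).ne').sqrt
  have hct : Continuous fun s => (lam s * (x + s), lam s * y, lam s * (z + s)) := by fun_prop
  have ct : Tendsto (fun s => (lam s * (x + s), lam s * y, lam s * (z + s)))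
      (𝓝[>] 0) (𝓝 (distances i j k q)) := by
    have := hct.continuousAt (x := 0) |>.tendsto.mono_left (nhdsWithin_le_nhds (s := Ioi 0))
    simpa [distances, lam0, ← hxd, ← hyd, ← hzd] using this
  refine not_isStable_of_path hs h _ ct fun ha => ?_
  have hki : r k + r i < z := by linarith
  have t1 := continuous_fst.continuousAt.tendsto.comp ct
  have t2 := (continuous_fst.comp continuous_snd).continuousAt.tendsto.comp ct
  have t3 := (continuous_snd.comp continuous_snd).continuousAt.tendsto.comp ct
  filter_upwards [t1.eventually (lt_mem_nhds hij), t2.eventually (lt_mem_nhds hjk),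
    t3.eventually (lt_mem_nhds hki), self_mem_nhdsWithin] with s s1 s2 s3 s0
  have s0 : 0 < s := s0
  simp only [Function.comp] at s1 s2 s3
  have hl := lamp s
  have hls := lamsq s
  set l := lam s
  have hz' : l * (x + s) + l * y = l * (z + s) := by rw [← hadd]; ring
  have px : 0 < l * (x + s) := by positivity
  have py : 0 < l * y := by positivity
  have pz : 0 < l * (z + s) := by positivity
  refine ⟨⟨px, py, pz, ?_, ?_, ?_⟩, ⟨s1.le, s2.le, s3.le⟩, ?_, ?_⟩
  · linarith
  · linarith
  · linarith
  · simp only [distances, ne_eq, Prod.mk.injEq]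
    rintro ⟨e, e', -⟩
    rw [← hyd] at e'
    have : l = 1 := mul_right_cancel₀ hy.ne' (by rw [e', one_mul])
    rw [this, ← hxd] at e
    linarith
  · have eI : inertiaOf r i j k (l * (x + s)) (l * y) (l * (z + s)) = inertiaOf r i j k x y z := by
      simp only [hN, add_zero] at hls
      unfold inertiaOf
      linear_combination hls
    unfold energyOf
    rw [eI]
    have hq : mass r i * mass r j * (l * (x + s)) ^ 2 + mass r j * mass r k * (l * y) ^ 2
        + mass r k * mass r i * (l * (z + s)) ^ 2 = mass r i * mass r j * x ^ 2
        + mass r j * mass r k * y ^ 2 + mass r k * mass r i * z ^ 2 := by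
      simp only [hN, add_zero] at hls
      linear_combination hls
    generalize l * (x + s) = X at *
    generalize l * y = Y at *
    generalize l * (z + s) = Z at *
    have conv : ∀ d v : ℝ, 0 < d → 0 < v → 1 / d - (v - d) * (1 / d ^ 2) ≤ 1 / v := by
      intro d v hd hv
      have : 1 / v - (1 / d - (v - d) * (1 / d ^ 2)) = (v - d) ^ 2 / (d ^ 2 * v) := by
        field_simp; ring
      have : 0 ≤ (v - d) ^ 2 / (d ^ 2 * v) := by positivity
      linarith
    have c1 := mul_le_mul_of_nonneg_left (conv x _ hx px) (mul_pos mi mj).le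
    have c2 := mul_le_mul_of_nonneg_left (conv y _ hy py) (mul_pos mj mk).le
    have c3 := mul_le_mul_of_nonneg_left (conv z _ hz pz) (mul_pos mk mi).le
    have c4 : 0 ≤ w / 2 * (mass r i * mass r j * (X - x) ^ 2
      + mass r j * mass r k * (Y - y) ^ 2 + mass r k * mass r i * (Z - z) ^ 2) := by
      positivity
    -- By the two balances the first-order change of potential energy is ω² times the sum of m m d
    -- (D − d) over the pairs. At equal inertia this is −ω²/2 times the sum of m m (D − d)², so it
    -- does not raise the energy, and neither does the convexity error in `c1`, `c2`, `c3`.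
    have c5 : mass r i * mass r j * ((X - x) * (1 / x ^ 2))
      + mass r j * mass r k * ((Y - y) * (1 / y ^ 2))
      + mass r k * mass r i * ((Z - z) * (1 / z ^ 2))
      = -(w / 2 * (mass r i * mass r j * (X - x) ^ 2
      + mass r j * mass r k * (Y - y) ^ 2 + mass r k * mass r i * (Z - z) ^ 2)) := by
      have ez : Z - z = (X - x) + (Y - y) := by linarith
      linear_combination mass r i * (X - x) * e2 + mass r k * (Y - y) * e1
        + w / 2 * hq + mass r k * mass r i * (1 / z ^ 2 - w * z) * ez
    rw [mul_sub] at c1 c2 c3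
    simp only [mul_one_div] at c1 c2 c3 c5
    linarith

end config

/-! ### The curves (A + B d²) / d^(3/2) -/

section chart

variable {A B v : ℝ}

/-- Along TR, IS, EO and LO the angular momentum is a positive multiple of this function: B d² is
the part of the inertia that varies along the family, A the constant part. The only turning point is
at B d² = 3A. -/
lemma hasDerivAt_chart (A B : ℝ) {d : ℝ} (hd : 0 < d) :
    HasDerivAt (fun d : ℝ => (A + B * d ^ 2) / d ^ (3 / 2 : ℝ))
      ((B * d ^ 2 - 3 * A) / (2 * d * d ^ (3 / 2 : ℝ))) d := by
  have h1 : HasDerivAt (fun d : ℝ => A + B * d ^ 2) (B * (2 * d)) d := by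
    simpa using ((hasDerivAt_pow 2 d).const_mul B).const_add A
  have h2 := Real.hasDerivAt_rpow_const (p := 3 / 2) (Or.inl hd.ne')
  have p1 : 0 < d ^ (3 / 2 : ℝ) := Real.rpow_pos_of_pos hd _
  refine (h1.div h2 p1.ne').congr_deriv ?_
  have e : d ^ (3 / 2 - 1 : ℝ) = d ^ (3 / 2 : ℝ) / d := by rw [Real.rpow_sub_one hd.ne']
  rw [e]
  field_simp
  ring

lemma strictAntiOn_chart (hB : 0 < B) (hv : B * v ^ 2 = 3 * A) :
    StrictAntiOn (fun d : ℝ => (A + B * d ^ 2) / d ^ (3 / 2 : ℝ)) (Ioc 0 v) := by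
  refine strictAntiOn_of_deriv_neg (convex_Ioc 0 v)
    (fun d hd => (hasDerivAt_chart A B hd.1).continuousAt.continuousWithinAt) fun d hd => ?_
  rw [interior_Ioc] at hd
  have p1 : 0 < d ^ (3 / 2 : ℝ) := Real.rpow_pos_of_pos hd.1 _
  have p2 := hd.1
  rw [(hasDerivAt_chart A B hd.1).deriv]
  have : d ^ 2 < v ^ 2 := pow_lt_pow_left₀ hd.2 hd.1.le two_ne_zero
  have : B * d ^ 2 < B * v ^ 2 := by gcongr
  exact div_neg_of_neg_of_pos (by linarith) (by positivity)

lemma strictMonoOn_chart (hB : 0 < B) (hv0 : 0 < v) (hv : B * v ^ 2 = 3 * A) :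
    StrictMonoOn (fun d : ℝ => (A + B * d ^ 2) / d ^ (3 / 2 : ℝ)) (Ici v) := by
  refine strictMonoOn_of_deriv_pos (convex_Ici v) (fun d hd =>
    (hasDerivAt_chart A B (hv0.trans_le hd)).continuousAt.continuousWithinAt) fun d hd => ?_
  rw [interior_Ici] at hd
  have p2 : 0 < d := hv0.trans hd
  have p1 : 0 < d ^ (3 / 2 : ℝ) := Real.rpow_pos_of_pos p2 _
  rw [(hasDerivAt_chart A B p2).deriv]
  have : v ^ 2 < d ^ 2 := pow_lt_pow_left₀ hd hv0.le two_ne_zero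
  have : B * v ^ 2 < B * d ^ 2 := by gcongr
  exact div_pos (by linarith) (by positivity)

lemma vertex_sq (hA : 0 < A) (hB : 0 < B) : B * √(3 * A / B) ^ 2 = 3 * A := by
  rw [Real.sq_sqrt (by positivity)]; field_simp

lemma vertex_pos (hA : 0 < A) (hB : 0 < B) : 0 < √(3 * A / B) := Real.sqrt_pos.2 (by positivity)

lemma lt_vertex_iff (hB : 0 < B) {d : ℝ} (hd : 0 < d) :
    d < √(3 * A / B) ↔ B * d ^ 2 < 3 * A := by
  rw [Real.lt_sqrt hd.le, lt_div_iff₀ hB, mul_comm]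

lemma vShaped_of_chart {h : ℝ → ℝ} {D : Set ℝ} {C : ℝ} (hB : 0 < B) (hC : 0 < C) (hv0 : 0 < v)
    (hv : B * v ^ 2 = 3 * A) (hD : D ⊆ Ioi 0)
    (hh : ∀ d ∈ D, h d = C * ((A + B * d ^ 2) / d ^ (3 / 2 : ℝ))) : VShaped h D v := by
  constructor
  · intro d hd e he hde
    rw [hh d hd.1, hh e he.1]
    exact mul_lt_mul_of_pos_left (strictAntiOn_chart hB hv ⟨hD hd.1, hd.2⟩ ⟨hD he.1, he.2⟩ hde) hC
  · intro d hd e he hde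
    rw [hh d hd.1, hh e he.1]
    exact mul_lt_mul_of_pos_left (strictMonoOn_chart hB hv0 hv hd.2 he.2 hde) hC

lemma tendsto_chart_div_sqrt (A B : ℝ) :
    Tendsto (fun d : ℝ => (A + B * d ^ 2) / d ^ (3 / 2 : ℝ) / √d) atTop (𝓝 B) := by
  have h1 : Tendsto (fun d : ℝ => A * (d⁻¹) ^ 2 + B) atTop (𝓝 (A * 0 ^ 2 + B)) :=
    ((tendsto_inv_atTop_zero.pow 2).const_mul A).add_const B
  rw [zero_pow two_ne_zero, mul_zero, zero_add] at h1
  refine h1.congr' ?_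
  filter_upwards [eventually_gt_atTop 0] with d hd
  rw [rpow_three_halves_eq hd, div_div, mul_assoc, Real.mul_self_sqrt hd.le]
  field_simp

lemma tendsto_atTop_of_div_sqrt {h : ℝ → ℝ} {c : ℝ} (hc : 0 < c)
    (hh : Tendsto (fun d => h d / √d) atTop (𝓝 c)) : Tendsto h atTop atTop := by
  have h1 := hh.pos_mul_atTop hc Real.tendsto_sqrt_atTop
  refine h1.congr' ?_
  filter_upwards [eventually_gt_atTop 0] with d hd
  have := Real.sqrt_pos.2 hd
  field_simp

lemma tendsto_chart (hB : 0 < B) (A : ℝ) :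
    Tendsto (fun d : ℝ => (A + B * d ^ 2) / d ^ (3 / 2 : ℝ)) atTop atTop :=
  tendsto_atTop_of_div_sqrt hB (tendsto_chart_div_sqrt A B)

end chart

/-! ### The aligned family -/

section aligned

/-- `μ` times the excess of the ratio `P T / (μ W)` over `1`, divided by `m_i m_j`. -/
def skew (m n a x : ℝ) : ℝ :=
  a / x * ((x ^ 3 - (x - a) ^ 3) / ((x - a) * (m * (x - a) ^ 2 + n * x ^ 2)))

lemma skew_pos {m n a x : ℝ} (hm : 0 < m) (hn : 0 < n) (ha : 0 < a) (hx : a < x) :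
    0 < skew m n a x := by
  have hy : 0 < x - a := sub_pos.2 hx
  have hx0 : 0 < x := ha.trans hx
  have : (x - a) ^ 3 < x ^ 3 := pow_lt_pow_left₀ (by linarith) hy.le (by norm_num)
  have := sub_pos.2 this
  unfold skew; positivity

/-- Of the two factors, a / x clearly decreases. The other is homogeneous of degree zero: with t = x
/ (x − a) it equals (t³ − 1) / (m + n t²), which increases in t, while t falls as x grows. -/
lemma skew_anti {m n a x x' : ℝ} (hm : 0 < m) (hn : 0 < n) (ha : 0 < a) (hx : a < x)
    (hxx : x < x') : skew m n a x' ≤ skew m n a x := by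
  have hy : 0 < x - a := sub_pos.2 hx
  have hx0 : 0 < x := ha.trans hx
  have hx0' : 0 < x' := hx0.trans hxx
  have hy' : 0 < x' - a := by linarith
  have c1 : (x - a) ^ 3 < x ^ 3 := pow_lt_pow_left₀ (by linarith) hy.le (by norm_num)
  have c2 : (x' - a) ^ 3 < x' ^ 3 := pow_lt_pow_left₀ (by linarith) hy'.le (by norm_num)
  unfold skew
  refine mul_le_mul ?_ ?_ ?_ (by positivity)
  · exact div_le_div_of_nonneg_left ha.le hx0 hxx.le
  · rw [div_le_div_iff₀ (by positivity) (by positivity)]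
    have hyx : x' * (x - a) ≤ x * (x' - a) := by nlinarith
    generalize x - a = y at *
    generalize x' - a = y' at *
    obtain ⟨t, ht⟩ : ∃ t, t = x / y := ⟨_, rfl⟩
    obtain ⟨u, hu⟩ : ∃ u, u = x' / y' := ⟨_, rfl⟩
    have ex : x = t * y := by rw [ht]; field_simp
    have ex' : x' = u * y' := by rw [hu]; field_simp
    have hut : u ≤ t := by
      rw [ht, hu, div_le_div_iff₀ hy' hy]; linarith
    have hu0 : 0 < u := hu ▸ div_pos hx0' hy'
    rw [ex, ex']
    have key : 0 ≤ m * (t ^ 3 - u ^ 3) + n * (t ^ 2 * u ^ 2 * (t - u) + (t ^ 2 - u ^ 2)) := by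
      have p2 : u ^ 2 ≤ t ^ 2 := pow_le_pow_left₀ hu0.le hut 2
      have p3 : u ^ 3 ≤ t ^ 3 := pow_le_pow_left₀ hu0.le hut 3
      have := sub_nonneg.2 hut; have := sub_nonneg.2 p2; have := sub_nonneg.2 p3
      positivity
    have : 0 ≤ y ^ 3 * y' ^ 3
        * (m * (t ^ 3 - u ^ 3) + n * (t ^ 2 * u ^ 2 * (t - u) + (t ^ 2 - u ^ 2))) := by
      positivity
    linarith
  · have := sub_pos.2 c2
    positivity

/-- Its sign is that of the derivative of the angular momentum along the aligned family. -/
def alignedSign (m n k S a x : ℝ) : ℝ :=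
  k * (m * x + n * (x - a)) ^ 2 - 3 * (m * n * a ^ 2 + (m + n) * S)
    - 2 * (m * n / (m + n) * skew m n a x)
      * (k * (m * x + n * (x - a)) ^ 2 + (m * n * a ^ 2 + (m + n) * S))

variable {m n k S a : ℝ} (hm : 0 < m) (hn : 0 < n) (hk : 0 < k) (hS : 0 < S) (ha : 0 < a)
include hm hn hk hS ha

/-- Put N for the orbital term, R for the constant inertia term and δ for the multiple of `skew`.
The expression is N(1 − 2δ) − R(3 + 2δ), where N increases and δ does not increase with x. A
nonnegative value forces 1 − 2δ > 0, and from there on moving right only raises it. Hence the sign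
changes at most once. -/
lemma alignedSign_pos_of_nonneg {x x' : ℝ} (hx : a < x) (hxx : x < x')
    (h : 0 ≤ alignedSign m n k S a x) : 0 < alignedSign m n k S a x' := by
  unfold alignedSign at *
  have s1 := skew_pos hm hn ha hx
  have s2 := skew_pos hm hn ha (hx.trans hxx)
  have s3 := skew_anti hm hn ha hx hxx
  have c : 0 < m * n / (m + n) := by positivity
  set δ := m * n / (m + n) * skew m n a x
  set δ' := m * n / (m + n) * skew m n a x'
  have d1 : 0 < δ := by positivity
  have d3 : δ' ≤ δ := mul_le_mul_of_nonneg_left s3 c.le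
  have hy : 0 < x - a := sub_pos.2 hx
  have hx0 : 0 < x := ha.trans hx
  have R : 0 < m * n * a ^ 2 + (m + n) * S := by positivity
  set R' := m * n * a ^ 2 + (m + n) * S
  have P0 : 0 < m * x + n * (x - a) := by positivity
  have PP : m * x + n * (x - a) < m * x' + n * (x' - a) := by gcongr
  have Q := mul_lt_mul_of_pos_left (pow_lt_pow_left₀ PP P0.le two_ne_zero) hk
  have Q0 : 0 < k * (m * x + n * (x - a)) ^ 2 := by positivity
  set N := k * (m * x + n * (x - a)) ^ 2
  set N' := k * (m * x' + n * (x' - a)) ^ 2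
  have h4 : 0 < 1 - 2 * δ := by
    by_contra hcon
    push Not at hcon
    have : N * (1 - 2 * δ) ≤ 0 := mul_nonpos_of_nonneg_of_nonpos Q0.le hcon
    have : 0 < δ * R' := by positivity
    linarith
  have h5 := mul_lt_mul_of_pos_right Q h4
  have h6 : 0 ≤ (δ - δ') * (N' + R') := mul_nonneg (by linarith) (by linarith)
  linarith

lemma exists_alignedSign_nonneg : ∃ x, a < x ∧ 0 ≤ alignedSign m n k S a x := by
  have R : 0 < m * n * a ^ 2 + (m + n) * S := by positivity
  set R' := m * n * a ^ 2 + (m + n) * S with hR'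
  -- For y ≥ 4a the correction is at most 3/16. The sign is then nonnegative as soon as (5/8) N ≥
  -- (27/8) R, and `c` is the length that makes 5N ≥ 27R hold.
  set c := √(27 * R' / (5 * k * (m + n) ^ 2)) with hc
  have c0 : 0 < c := Real.sqrt_pos.2 (by positivity)
  have c2 : c ^ 2 = 27 * R' / (5 * k * (m + n) ^ 2) := Real.sq_sqrt (by positivity)
  set y := 4 * a + c with hy
  have y0 : 0 < y := by positivity
  refine ⟨a + y, by linarith, ?_⟩
  unfold alignedSign
  rw [← hR', add_sub_cancel_left]
  have hδ : m * n / (m + n) * skew m n a (a + y) ≤ 3 / 16 := by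
    unfold skew
    rw [add_sub_cancel_left]
    set x := a + y
    have x0 : 0 < x := by positivity
    have hxy : y ≤ x := by simp only [x]; linarith
    have e1 : x ^ 3 - y ^ 3 ≤ 3 * a * x ^ 2 := by
      have : x ^ 3 - y ^ 3 = a * (x ^ 2 + x * y + y ^ 2) := by simp only [x]; ring
      rw [this]
      have : x * y ≤ x ^ 2 := by nlinarith
      have : y ^ 2 ≤ x ^ 2 := by nlinarith
      nlinarith
    have e2 : y * (n * x ^ 2) ≤ y * (m * y ^ 2 + n * x ^ 2) := by
      have : 0 < m * y ^ 2 := by positivity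
      gcongr; linarith
    have e3 : (x ^ 3 - y ^ 3) / (y * (m * y ^ 2 + n * x ^ 2)) ≤ 3 * a * x ^ 2 / (y * (n * x ^ 2)) :=
      div_le_div₀ (by positivity) e1 (by positivity) e2
    have e4 : m * n / (m + n) * (a / x * ((x ^ 3 - y ^ 3) / (y * (m * y ^ 2 + n * x ^ 2))))
        ≤ m * n / (m + n) * (a / x * (3 * a * x ^ 2 / (y * (n * x ^ 2)))) := by gcongr
    refine e4.trans ?_
    have e5 : m * n / (m + n) * (a / x * (3 * a * x ^ 2 / (y * (n * x ^ 2))))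
        = m / (m + n) * (3 * a ^ 2 / (x * y)) := by field_simp
    rw [e5]
    have e6 : m / (m + n) ≤ 1 := by rw [div_le_one (by positivity)]; linarith
    have e7 : 3 * a ^ 2 / (x * y) ≤ 3 / 16 := by
      rw [div_le_div_iff₀ (by positivity) (by norm_num)]
      have : 4 * a ≤ y := by linarith
      have : 4 * a * (4 * a) ≤ x * y := by gcongr; linarith
      linarith
    calc m / (m + n) * (3 * a ^ 2 / (x * y)) ≤ 1 * (3 / 16) := by gcongr
      _ = 3 / 16 := one_mul _
  have hN : 27 * R' ≤ 5 * (k * (m * (a + y) + n * y) ^ 2) := by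
    have h1 : (m + n) * c ≤ m * (a + y) + n * y := by
      have : 0 < m * a := by positivity
      have : 0 < (m + n) * (4 * a) := by positivity
      rw [hy]; linarith
    have h2 : ((m + n) * c) ^ 2 ≤ (m * (a + y) + n * y) ^ 2 :=
      pow_le_pow_left₀ (by positivity) h1 2
    have h3 : 5 * (k * ((m + n) * c) ^ 2) = 27 * R' := by
      rw [mul_pow, c2]; field_simp
    rw [← h3]; gcongr
  set N := k * (m * (a + y) + n * y) ^ 2
  have N0 : 0 < N := by positivity
  have := mul_le_mul_of_nonneg_right hδ (show 0 ≤ N + R' by positivity)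
  linarith

omit hk hS in
lemma continuousAt_alignedSign {x : ℝ} (hx : a < x) :
    ContinuousAt (alignedSign m n k S a) x := by
  have hy : 0 < x - a := sub_pos.2 hx
  have hx0 : 0 < x := ha.trans hx
  have h1 : ContinuousAt (skew m n a) x := by
    unfold skew
    refine ContinuousAt.mul (ContinuousAt.div (by fun_prop) (by fun_prop) hx0.ne')
      (ContinuousAt.div (by fun_prop) (by fun_prop) (by positivity))
  unfold alignedSign
  fun_prop

/-- The vertex is the infimum of the points with nonnegative sign, a set closed upwards; it is `a`
itself if the sign is never negative. Continuity rules out a negative value at the vertex, which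
yields the last clause, used to place the vertex from a single evaluation. -/
lemma exists_alignedSign_vertex : ∃ v, a ≤ v ∧ (∀ x, a < x → x < v → alignedSign m n k S a x < 0) ∧
    (∀ x, v < x → 0 < alignedSign m n k S a x) ∧
    ∀ x, a < x → alignedSign m n k S a x < 0 → x < v := by
  set Z := {x | a < x ∧ 0 ≤ alignedSign m n k S a x}
  have hne : Z.Nonempty := exists_alignedSign_nonneg hm hn hk hS ha
  have hbd : BddBelow Z := ⟨a, fun x hx => hx.1.le⟩
  have hpos : ∀ x, sInf Z < x → 0 < alignedSign m n k S a x := by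
    intro x hx
    obtain ⟨x', hx', hlt⟩ := exists_lt_of_csInf_lt hne hx
    exact alignedSign_pos_of_nonneg hm hn hk hS ha hx'.1 hlt hx'.2
  refine ⟨sInf Z, le_csInf hne fun x hx => hx.1.le, fun x hx hlt => ?_, hpos, fun x hx hneg => ?_⟩
  · by_contra hcon
    exact (notMem_of_lt_csInf hlt hbd) ⟨hx, not_lt.1 hcon⟩
  · by_contra hcon
    push Not at hcon
    have := (continuousAt_alignedSign hm hn ha hx).eventually (gt_mem_nhds hneg)
    obtain ⟨x', h1, h2⟩ := (this.filter_mono nhdsWithin_le_nhds |>.and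
      (self_mem_nhdsWithin (s := Ioi x))).exists
    exact (hpos x' (hcon.trans_lt h2)).not_gt h1

/-- Sufficient condition with an improvement `δ₀ ≤ δ`. -/
lemma alignedSign_neg {x δ₀ : ℝ} (hx : a < x)
    (hδ : δ₀ ≤ m * n / (m + n) * skew m n a x)
    (h : k * (m * x + n * (x - a)) ^ 2 ≤ (3 + 8 * δ₀) * (m * n * a ^ 2 + (m + n) * S)) :
    alignedSign m n k S a x < 0 := by
  have R : 0 < m * n * a ^ 2 + (m + n) * S := by positivity
  have s1 := skew_pos hm hn ha hx
  have d1 : 0 < m * n / (m + n) * skew m n a x := by positivity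
  unfold alignedSign
  set δ := m * n / (m + n) * skew m n a x
  set R' := m * n * a ^ 2 + (m + n) * S
  set N := k * (m * x + n * (x - a)) ^ 2
  have N0 : 0 ≤ N := by positivity
  -- For N > 3R the term 2δ(N + R) exceeds 8δR ≥ 8δ₀R: this is where the 8 in the hypothesis comes
  -- from. For N ≤ 3R any positive δ suffices.
  by_cases hc : N ≤ 3 * R'
  · have : 0 < δ * (N + R') := by positivity
    linarith
  · push Not at hc
    have h1 : δ₀ * R' ≤ δ * R' := by gcongr
    have : 0 < δ * (N - 3 * R') := mul_pos d1 (by linarith)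
    linarith

end aligned

/-! ### Angular momentum of the aligned family -/

section aligned_momentum

lemma hEA_eq_sqrt {r : Fin 3 → ℝ} (hs : IsSizes r) (i j k : Fin 3) (x : ℝ) : hEA r i j k x
    = √(inertiaOf r i j k (r i + r j) (x - (r i + r j)) x ^ 2 * rateSq r i j (r i + r j) x) := by
  rw [Real.sqrt_mul (sq_nonneg _), Real.sqrt_sq (hs.inertiaOf_pos ..).le]; rfl

variable {r : Fin 3 → ℝ} (hs : IsSizes r) {i j k : Fin 3} (h : IsTriple i j k)
include hs h

/-- The square of the angular momentum along the aligned family is increasing exactly where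
`alignedSign` is positive. -/
lemma hasDerivAt_aligned {a x : ℝ} (ha : 0 < a) (hx : a < x) : ∃ c, 0 < c ∧
    HasDerivAt (fun x => inertiaOf r i j k a (x - a) x ^ 2 * rateSq r i j a x)
      (c * alignedSign (mass r i) (mass r j) (mass r k) (∑ l, ballInertia r l) a x) x := by
  have mi := hs.mass_pos i; have mj := hs.mass_pos j; have mk := hs.mass_pos k
  have hsum : mass r i + mass r j + mass r k = 1 := by rw [← h.sum_eq, hs.sum_mass]
  have hI := hs.inertiaOf_pos i j k a (x - a) x
  have hy : 0 < x - a := sub_pos.2 hx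
  have hx0 : 0 < x := ha.trans hx
  set m := mass r i; set n := mass r j; set K := mass r k; set S := ∑ l, ballInertia r l with hS
  have hIe : ∀ x, inertiaOf r i j k a (x - a) x
      = m * n * a ^ 2 + n * K * (x - a) ^ 2 + K * m * x ^ 2 + S := fun x => rfl
  have hr : ∀ x, rateSq r i j a x
      = (m / x ^ 2 + n / (x - a) ^ 2) / (m * x + n * (x - a)) := fun x => rfl
  have P0 : 0 < m * x + n * (x - a) := by positivity
  have W0 : 0 < m / x ^ 2 + n / (x - a) ^ 2 := by positivity
  have d1 : HasDerivAt (fun x => inertiaOf r i j k a (x - a) x)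
      (2 * K * (m * x + n * (x - a))) x := by
    simp only [hIe]
    have e1 := ((((hasDerivAt_id x).sub_const a).pow 2).const_mul (n * K)).const_add (m * n * a ^ 2)
    have e2 := ((hasDerivAt_id x).pow 2).const_mul (K * m)
    refine ((e1.add e2).add_const S).congr_deriv ?_
    simp; ring
  have d2 : HasDerivAt (fun x => rateSq r i j a x)
      (((-2 * (m / x ^ 3 + n / (x - a) ^ 3)) * (m * x + n * (x - a))
        - (m / x ^ 2 + n / (x - a) ^ 2) * (m + n)) / (m * x + n * (x - a)) ^ 2) x := by
    simp only [hr]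
    have e1 : HasDerivAt (fun x : ℝ => m / x ^ 2 + n / (x - a) ^ 2)
        (-2 * (m / x ^ 3 + n / (x - a) ^ 3)) x := by
      have f1 := (hasDerivAt_const x m).div ((hasDerivAt_id x).pow 2) (pow_ne_zero 2 hx0.ne')
      have f2 := (hasDerivAt_const x n).div (((hasDerivAt_id x).sub_const a).pow 2)
        (pow_ne_zero 2 hy.ne')
      refine (f1.add f2).congr_deriv ?_
      simp
      field_simp
      ring
    have e2 : HasDerivAt (fun x : ℝ => m * x + n * (x - a)) (m + n) x := by
      have f1 := ((hasDerivAt_id x).const_mul m).add (((hasDerivAt_id x).sub_const a).const_mul n)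
      exact f1.congr_deriv (by simp)
    exact e1.div e2 P0.ne'
  refine ⟨inertiaOf r i j k a (x - a) x * (m / x ^ 2 + n / (x - a) ^ 2)
    / (m * x + n * (x - a)) ^ 2, by positivity, ?_⟩
  refine ((d1.pow 2).mul d2).congr_deriv ?_
  -- This identity is what `skew` was made for: it measures by how much the product on the left
  -- exceeds its value for two equal distances.
  have k1 : (m * x + n * (x - a)) * (m / x ^ 3 + n / (x - a) ^ 3)
      = (m + n) * (m / x ^ 2 + n / (x - a) ^ 2) * (1 + m * n / (m + n) * skew m n a x) := by
    have q : 0 < m * (x - a) ^ 2 + n * x ^ 2 := by positivity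
    have : skew m n a x * (m / x ^ 2 + n / (x - a) ^ 2)
        = a * (x ^ 3 - (x - a) ^ 3) / (x ^ 3 * (x - a) ^ 3) := by
      unfold skew; field_simp
    have e : (m + n) * (m / x ^ 2 + n / (x - a) ^ 2) * (1 + m * n / (m + n) * skew m n a x)
        = (m + n) * (m / x ^ 2 + n / (x - a) ^ 2)
          + m * n * (skew m n a x * (m / x ^ 2 + n / (x - a) ^ 2)) := by field_simp
    rw [e, this]; field_simp; ring
  -- Total mass one enters here: the inertia splits into that of the pair `i j` about its own centre
  -- and that of the third body relative to this centre.
  have k2 : (m + n) * inertiaOf r i j k a (x - a) x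
      = m * n * a ^ 2 + (m + n) * S + K * (m * x + n * (x - a)) ^ 2 := by
    rw [hIe]; have : K = 1 - m - n := by linarith
    rw [this]; ring
  unfold alignedSign
  simp only [Nat.cast_ofNat, Nat.add_one_sub_one, pow_one, Pi.pow_apply, hr]
  set δ := m * n / (m + n) * skew m n a x
  set T := m / x ^ 3 + n / (x - a) ^ 3
  set W := m / x ^ 2 + n / (x - a) ^ 2
  set P := m * x + n * (x - a)
  set I := inertiaOf r i j k a (x - a) x
  set R := m * n * a ^ 2 + (m + n) * S
  clear_value δ T W P I R
  field_simp
  have k1' : T * P = (m + n) * W * (1 + δ) := by rw [mul_comm]; exact k1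
  have e1 : 2 * (2 * K * P) * W * P - I * (2 * (T * P) + W * (m + n))
      = W * (4 * K * P ^ 2 - ((m + n) * I) * (3 + 2 * δ)) := by rw [k1']; ring
  rw [k2] at e1
  linear_combination e1

lemma continuousOn_hEA : ContinuousOn (hEA r i j k) (Ioi (r i + r j)) := by
  have ha := add_pos (hs.pos i) (hs.pos j)
  intro x hx
  obtain ⟨c, -, hc⟩ := hasDerivAt_aligned hs h ha hx
  have := hc.continuousAt.sqrt
  rw [funext (hEA_eq_sqrt hs i j k)]
  exact this.continuousWithinAt

lemma exists_hEA_vertex : ∃ v, StrictAntiOn (hEA r i j k) (Ioc (r i + r j) v) ∧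
    StrictMonoOn (hEA r i j k) (Ioi (r i + r j) ∩ Ici v) ∧
    ∀ x, r i + r j < x → (alignedSign (mass r i) (mass r j) (mass r k) (∑ l, ballInertia r l)
      (r i + r j) x < 0 ↔ x < v) := by
  have ha := add_pos (hs.pos i) (hs.pos j)
  obtain ⟨v, hav, hneg, hpos, hlt⟩ := exists_alignedSign_vertex (hs.mass_pos i) (hs.mass_pos j)
    (hs.mass_pos k) hs.sum_ballInertia_pos ha
  have key : ∀ x, r i + r j < x →
      0 < inertiaOf r i j k (r i + r j) (x - (r i + r j)) x ^ 2 * rateSq r i j (r i + r j) x :=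
    fun x hx => mul_pos (pow_pos (hs.inertiaOf_pos ..) 2) (rateSq_pos hs i j ha hx)
  refine ⟨v, ?_, ?_, fun x hx => ⟨hlt x hx, hneg x hx⟩⟩
  · have : StrictAntiOn (fun x => inertiaOf r i j k (r i + r j) (x - (r i + r j)) x ^ 2
        * rateSq r i j (r i + r j) x) (Ioc (r i + r j) v) := by
      refine strictAntiOn_of_deriv_neg (convex_Ioc _ _) (fun x hx => ?_) fun x hx => ?_
      · obtain ⟨c, -, hc⟩ := hasDerivAt_aligned hs h ha hx.1
        exact hc.continuousAt.continuousWithinAt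
      · rw [interior_Ioc] at hx
        obtain ⟨c, c0, hc⟩ := hasDerivAt_aligned hs h ha hx.1
        rw [hc.deriv]
        exact mul_neg_of_pos_of_neg c0 (hneg x hx.1 hx.2)
    intro x hx y hy hxy
    rw [hEA_eq_sqrt hs i j k, hEA_eq_sqrt hs i j k]
    exact Real.sqrt_lt_sqrt (key y hy.1).le (this hx hy hxy)
  · have : StrictMonoOn (fun x => inertiaOf r i j k (r i + r j) (x - (r i + r j)) x ^ 2
        * rateSq r i j (r i + r j) x) (Ioi (r i + r j) ∩ Ici v) := by
      refine strictMonoOn_of_deriv_pos ((convex_Ioi _).inter (convex_Ici _))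
        (fun x hx => ?_) fun x hx => ?_
      · obtain ⟨c, -, hc⟩ := hasDerivAt_aligned hs h ha hx.1
        exact hc.continuousAt.continuousWithinAt
      · rw [interior_inter, interior_Ioi, interior_Ici] at hx
        obtain ⟨c, c0, hc⟩ := hasDerivAt_aligned hs h ha hx.1
        rw [hc.deriv]
        exact mul_pos c0 (hpos x hx.2)
    intro x hx y hy hxy
    rw [hEA_eq_sqrt hs i j k, hEA_eq_sqrt hs i j k]
    exact Real.sqrt_lt_sqrt (key x hx.1).le (this hx hy hxy)

omit h in
lemma tendsto_hEA_div_sqrt : Tendsto (fun x => hEA r i j k x / √x) atTop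
    (𝓝 (mass r k * (mass r i + mass r j))) := by
  have mi := hs.mass_pos i; have mj := hs.mass_pos j; have mk := hs.mass_pos k
  have ha := add_pos (hs.pos i) (hs.pos j)
  set a := r i + r j
  set m := mass r i; set n := mass r j; set K := mass r k; set S := ∑ l, ballInertia r l with hS
  have ti : Tendsto (fun x : ℝ => x⁻¹) atTop (𝓝 0) := tendsto_inv_atTop_zero
  have ty : Tendsto (fun x : ℝ => 1 - a * x⁻¹) atTop (𝓝 1) := by
    simpa using (ti.const_mul a).const_sub 1
  have t1 : Tendsto (fun x : ℝ => (m * n * a ^ 2 + S) * (x⁻¹) ^ 2 + n * K * (1 - a * x⁻¹) ^ 2 + K * m)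
      atTop (𝓝 (K * (m + n))) := by
    have := (((ti.pow 2).const_mul (m * n * a ^ 2 + S)).add ((ty.pow 2).const_mul (n * K))).add_const
      (K * m)
    convert this using 2
    ring
  have t2 : Tendsto (fun x : ℝ => (m + n / (1 - a * x⁻¹) ^ 2) / (m + n * (1 - a * x⁻¹)))
      atTop (𝓝 1) := by
    have := ((tendsto_const_nhds (x := n)).div (ty.pow 2) (by norm_num)).const_add m |>.div
      ((ty.const_mul n).const_add m) (by positivity)
    have e : (m + n / 1 ^ 2) / (m + n * 1) = 1 := by
      rw [one_pow, div_one, mul_one, div_self (by positivity)]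
    rw [e] at this
    exact this
  have t3 := t1.mul t2.sqrt
  rw [Real.sqrt_one, mul_one] at t3
  refine t3.congr' ?_
  filter_upwards [eventually_gt_atTop a] with x hx
  have hy : 0 < x - a := sub_pos.2 hx
  have hx0 : 0 < x := ha.trans hx
  have e1 : 1 - a * x⁻¹ = (x - a) / x := by field_simp
  have e2 : (m + n / (1 - a * x⁻¹) ^ 2) / (m + n * (1 - a * x⁻¹))
      = x ^ 3 * rateSq r i j a x := by
    rw [e1]
    change _ = x ^ 3 * ((m / x ^ 2 + n / (x - a) ^ 2) / (m * x + n * (x - a)))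
    have : 0 < m * x + n * (x - a) := by positivity
    field_simp
  have e3 : (m * n * a ^ 2 + S) * (x⁻¹) ^ 2 + n * K * (1 - a * x⁻¹) ^ 2 + K * m
      = inertiaOf r i j k a (x - a) x / x ^ 2 := by
    rw [e1]
    change _ = (m * n * a ^ 2 + n * K * (x - a) ^ 2 + K * m * x ^ 2 + S) / x ^ 2
    field_simp
    ring
  rw [e2, e3, Real.sqrt_mul (by positivity)]
  have e4 : √(x ^ 3) = x * √x := by
    rw [show x ^ 3 = x ^ 2 * x by ring, Real.sqrt_mul (by positivity), Real.sqrt_sq hx0.le]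
  have e5 : √x * √x = x := Real.mul_self_sqrt hx0.le
  have := Real.sqrt_pos.2 hx0
  rw [e4]
  change _ = inertiaOf r i j k a (x - a) x * √(rateSq r i j a x) / √x
  set I := inertiaOf r i j k a (x - a) x
  have e6 : √x / x = 1 / √x := by rw [div_eq_div_iff hx0.ne' this.ne', e5, one_mul]
  calc I / x ^ 2 * (x * √x * √(rateSq r i j a x)) = I * √(rateSq r i j a x) * (√x / x) := by
        field_simp
    _ = _ := by rw [e6, mul_one_div]

omit h in
lemma tendsto_hEA : Tendsto (hEA r i j k) atTop atTop :=
  tendsto_atTop_of_div_sqrt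
    (mul_pos (hs.mass_pos k) (add_pos (hs.mass_pos i) (hs.mass_pos j)))
    (tendsto_hEA_div_sqrt hs)

omit h in
lemma hEA_pos {x : ℝ} (hx : r i + r j < x) : 0 < hEA r i j k x :=
  mul_pos (hs.inertiaOf_pos ..) (Real.sqrt_pos.2
    (rateSq_pos hs i j (add_pos (hs.pos i) (hs.pos j)) hx))

omit h in
lemma sq_hEA_div {x : ℝ} (hx : r i + r j < x) :
    (hEA r i j k x / inertiaOf r i j k (r i + r j) (x - (r i + r j)) x) ^ 2
      = rateSq r i j (r i + r j) x := by
  unfold hEA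
  rw [mul_div_cancel_left₀ _ (hs.inertiaOf_pos ..).ne',
    Real.sq_sqrt (rateSq_pos hs i j (add_pos (hs.pos i) (hs.pos j)) hx).le]

end aligned_momentum

/-! ### The Euler ratio and the domain of the aligned family -/

section euler

variable {r : Fin 3 → ℝ} (hs : IsSizes r)
include hs

/-- A middle body closer to the outer one pulls it harder, and the centrifugal lever arm in the
denominator gets shorter. -/
lemma rateSq_lt_rateSq (i j : Fin 3) {a a' x : ℝ} (ha : 0 < a) (haa : a < a') (hx : a' < x) :
    rateSq r i j a x < rateSq r i j a' x := by
  have mi := hs.mass_pos i; have mj := hs.mass_pos j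
  have h1 : 0 < x - a' := sub_pos.2 hx
  have hx0 : 0 < x := by linarith
  have h2 : x - a' < x - a := by linarith
  have h3 : 0 < x - a := h1.trans h2
  unfold rateSq
  refine div_lt_div₀ ?_ ?_ (by positivity) (by positivity)
  · gcongr
  · gcongr

lemma rateSq_mul (i j : Fin 3) {ρ d : ℝ} (hρ : ρ < 1) (hd : 0 < d) :
    rateSq r i j (ρ * d) d = rateSq r i j ρ 1 / d ^ 3 := by
  have mi := hs.mass_pos i; have mj := hs.mass_pos j
  have h1 : 0 < 1 - ρ := by linarith
  have e : d - ρ * d = (1 - ρ) * d := by ring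
  unfold rateSq
  rw [e]
  field_simp

lemma strictMonoOn_rate_sub (i j k : Fin 3) :
    StrictMonoOn (fun ρ => rateSq r i j ρ 1 - rateSq r k j (1 - ρ) 1) (Ioo 0 1) := by
  intro ρ hρ ρ' hρ' hlt
  have h1 := rateSq_lt_rateSq hs i j hρ.1 hlt hρ'.2
  have h2 := rateSq_lt_rateSq hs k j (a := 1 - ρ') (a' := 1 - ρ) (x := 1)
    (by linarith [hρ'.2]) (by linarith) (by linarith [hρ.1])
  change rateSq r i j ρ 1 - rateSq r k j (1 - ρ) 1 < rateSq r i j ρ' 1 - rateSq r k j (1 - ρ') 1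
  linarith

lemma continuousOn_rate_sub (i j k : Fin 3) :
    ContinuousOn (fun ρ => rateSq r i j ρ 1 - rateSq r k j (1 - ρ) 1) (Ioo 0 1) := by
  intro ρ hρ
  have mi := hs.mass_pos i; have mj := hs.mass_pos j; have mk := hs.mass_pos k
  have h1 := hρ.1
  have h2 : 0 < 1 - ρ := sub_pos.2 hρ.2
  have h3 : 0 < 1 - (1 - ρ) := by linarith
  refine ContinuousAt.continuousWithinAt ?_
  unfold rateSq
  refine ContinuousAt.sub (ContinuousAt.div (ContinuousAt.add (by fun_prop)
    (ContinuousAt.div (by fun_prop) (by fun_prop) (by positivity))) (by fun_prop) (by positivity))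
    (ContinuousAt.div (ContinuousAt.add (by fun_prop)
    (ContinuousAt.div (by fun_prop) (by fun_prop) (by positivity))) (by fun_prop) (by positivity))

/-- As ρ → 0 the pull of `j` on `i` grows like 1/ρ². Multiplying both rates by ρ² removes the
singularity, and the comparison at ρ = 0 is 0 < m_j / m_k; continuity carries it to small positive
ρ. -/
lemma exists_rateSq_lt (i j k : Fin 3) :
    ∃ ρ, 0 < ρ ∧ ρ < 1 / 2 ∧ rateSq r i j ρ 1 < rateSq r k j (1 - ρ) 1 := by
  have mi := hs.mass_pos i; have mj := hs.mass_pos j; have mk := hs.mass_pos k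
  have c : ContinuousAt (fun ρ : ℝ => ρ ^ 2 * rateSq r i j ρ 1
      - (mass r k * ρ ^ 2 + mass r j) / (mass r k + mass r j * ρ)) 0 := by
    unfold rateSq
    refine ContinuousAt.sub (ContinuousAt.mul (by fun_prop) (ContinuousAt.div
      (ContinuousAt.add (by fun_prop) (ContinuousAt.div (by fun_prop) (by fun_prop) (by norm_num)))
      (by fun_prop) ?_)) (ContinuousAt.div (by fun_prop) (by fun_prop) ?_)
    · rw [sub_zero]; positivity
    · rw [mul_zero, add_zero]; positivity
  have hneg : (0 : ℝ) ^ 2 * rateSq r i j 0 1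
      - (mass r k * 0 ^ 2 + mass r j) / (mass r k + mass r j * 0) < 0 := by
    have : 0 < mass r j / mass r k := by positivity
    simpa using this
  obtain ⟨ρ, ⟨h1, h2⟩, h3⟩ := (((c.eventually (gt_mem_nhds hneg)).and
    (gt_mem_nhds (show (0 : ℝ) < 1 / 2 by norm_num))).filter_mono
      (nhdsWithin_le_nhds (s := Ioi 0))).and self_mem_nhdsWithin |>.exists
  have h0 : 0 < ρ := h3
  refine ⟨ρ, h3, h2, ?_⟩
  have e : (mass r k * ρ ^ 2 + mass r j) / (mass r k + mass r j * ρ)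
      = ρ ^ 2 * rateSq r k j (1 - ρ) 1 := by
    unfold rateSq
    rw [show (1 : ℝ) - (1 - ρ) = ρ by ring]
    field_simp
  rw [e, ← mul_sub] at h1
  by_contra hcon
  have : 0 ≤ rateSq r i j ρ 1 - rateSq r k j (1 - ρ) 1 := by linarith
  have : 0 ≤ ρ ^ 2 * (rateSq r i j ρ 1 - rateSq r k j (1 - ρ) 1) := by positivity
  linarith

/-- The preceding lemma fixes the sign of the difference of rates near 0 and, with `i` and `k`
exchanged, the opposite sign near 1; the bounds by 1/2 put the two points in order. Existence is the
intermediate value theorem, uniqueness strict monotonicity. -/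
lemma existsUnique_isEulerRatio (i j k : Fin 3) : ∃! ρ, IsEulerRatio r i j k ρ := by
  obtain ⟨ρ₁, h1, h2, h3⟩ := exists_rateSq_lt hs i j k
  obtain ⟨ρ₂, h4, h5, h6⟩ := exists_rateSq_lt hs k j i
  have hsub : Icc ρ₁ (1 - ρ₂) ⊆ Ioo 0 1 := fun x hx =>
    ⟨h1.trans_le hx.1, hx.2.trans_lt (by linarith)⟩
  obtain ⟨ρ, hρ, h0⟩ := intermediate_value_Icc (show ρ₁ ≤ 1 - ρ₂ by linarith)
    ((continuousOn_rate_sub hs i j k).mono hsub) (show (0 : ℝ) ∈ Icc _ _ from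
      ⟨by linarith, by simp only [sub_sub_cancel]; linarith⟩)
  have hρ' := hsub hρ
  refine ⟨ρ, ⟨hρ'.1, hρ'.2, sub_eq_zero.1 h0⟩, fun ρ' hr => ?_⟩
  exact (strictMonoOn_rate_sub hs i j k).injOn ⟨hr.1, hr.2.1⟩ hρ'
    ((sub_eq_zero.2 hr.2.2).trans h0.symm)

variable {i j k : Fin 3} {ρ : ℝ} (hρ : IsEulerRatio r i j k ρ)
include hρ

/-- Scaling to d_ki = 1 multiplies both rates by the same power of x, after which strict
monotonicity compares a / x with ρ. The nonlinear condition defining `domEA` thereby becomes linear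
in x. -/
lemma rateSq_le_iff {a x : ℝ} (ha : 0 < a) (hx : a < x) :
    rateSq r i j a x ≤ rateSq r k j (x - a) x ↔ a ≤ ρ * x := by
  have hx0 : 0 < x := ha.trans hx
  have h1 : a / x < 1 := (div_lt_one hx0).2 hx
  have h0 : 0 < a / x := div_pos ha hx0
  have e1 : rateSq r i j a x = rateSq r i j (a / x) 1 / x ^ 3 := by
    rw [← rateSq_mul hs i j h1 hx0, div_mul_cancel₀ _ hx0.ne']
  have e2 : rateSq r k j (x - a) x = rateSq r k j (1 - a / x) 1 / x ^ 3 := by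
    rw [← rateSq_mul hs k j (by linarith) hx0, sub_mul, div_mul_cancel₀ _ hx0.ne', one_mul]
  have e3 := (strictMonoOn_rate_sub hs i j k).le_iff_le ⟨h0, h1⟩ ⟨hρ.1, hρ.2.1⟩
  simp only [hρ.2.2, sub_self] at e3
  rw [e1, e2, div_le_div_iff_of_pos_right (by positivity), ← div_le_iff₀ hx0, ← e3, sub_nonpos]

omit hs in
lemma IsEulerRatio.swap : IsEulerRatio r k j i (1 - ρ) := by
  refine ⟨by linarith [hρ.2.1], by linarith [hρ.1], ?_⟩
  rw [sub_sub_cancel, hρ.2.2]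

lemma rateSq_ge_iff {a x : ℝ} (ha : 0 < a) (hx : a < x) :
    rateSq r k j (x - a) x ≤ rateSq r i j a x ↔ ρ * x ≤ a := by
  have := rateSq_le_iff hs hρ.swap (a := x - a) (x := x) (sub_pos.2 hx) (by linarith)
  rw [sub_sub_cancel] at this
  rw [this]
  constructor <;> intro <;> linarith

lemma rateSq_lt_iff {a x : ℝ} (ha : 0 < a) (hx : a < x) :
    rateSq r i j a x < rateSq r k j (x - a) x ↔ a < ρ * x := by
  rw [← not_le, rateSq_ge_iff hs hρ ha hx, not_le]

lemma rateSq_eq_iff {a x : ℝ} (ha : 0 < a) (hx : a < x) :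
    rateSq r i j a x = rateSq r k j (x - a) x ↔ a = ρ * x := by
  rw [le_antisymm_iff, le_antisymm_iff, rateSq_le_iff hs hρ ha hx, rateSq_ge_iff hs hρ ha hx]

omit hρ hs in
lemma restLength_comm : restLength r i j k = restLength r k j i := by unfold restLength; ring

omit hρ hs in
lemma restLength_eq : restLength r i j k = (r i + r j) + (r j + r k) := by unfold restLength; ring

omit hρ in
lemma lt_restLength : r i + r j < restLength r i j k := by
  unfold restLength; linarith [hs.pos j, hs.pos k]

omit hρ hs in
lemma hEA_rest_eq : hEA r i j k (restLength r i j k)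
    = inertiaOf r i j k (r i + r j) (r j + r k) (restLength r i j k)
      * √(rateSq r i j (r i + r j) (restLength r i j k)) ∧
    hEA r k j i (restLength r i j k)
    = inertiaOf r i j k (r i + r j) (r j + r k) (restLength r i j k)
      * √(rateSq r k j (restLength r i j k - (r i + r j)) (restLength r i j k)) := by
  unfold hEA
  have e : restLength r i j k - (r k + r j) = r i + r j := by unfold restLength; ring
  have e2 : restLength r i j k - (r i + r j) = r j + r k := by unfold restLength; ring
  rw [e, e2, inertiaOf_swap r k j i, add_comm (r k) (r j)]
  exact ⟨rfl, rfl⟩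

/-- At the resting length both angular momenta contain the same inertia, so their order is that of
the rates: the position of ρ tells which outer body detaches first. -/
lemma hEA_rest_le_iff : hEA r i j k (restLength r i j k) ≤ hEA r k j i (restLength r i j k)
    ↔ r i + r j ≤ ρ * restLength r i j k := by
  have ha := add_pos (hs.pos i) (hs.pos j)
  have hz := lt_restLength hs (i := i) (j := j) (k := k)
  rw [hEA_rest_eq.1, hEA_rest_eq.2, mul_le_mul_iff_right₀ (hs.inertiaOf_pos ..),
    Real.sqrt_le_sqrt_iff, rateSq_le_iff hs hρ ha hz]
  exact (rateSq_pos hs k j (sub_pos.2 hz) (by linarith)).le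

lemma hEA_rest_ge_iff : hEA r k j i (restLength r i j k) ≤ hEA r i j k (restLength r i j k)
    ↔ ρ * restLength r i j k ≤ r i + r j := by
  have := hEA_rest_le_iff hs hρ.swap
  rw [restLength_comm] at this
  rw [this]
  have e := restLength_eq (r := r) (i := i) (j := j) (k := k)
  constructor <;> intro <;> linarith

lemma hEA_rest_lt_iff : hEA r i j k (restLength r i j k) < hEA r k j i (restLength r i j k)
    ↔ r i + r j < ρ * restLength r i j k := by
  rw [← not_le, hEA_rest_ge_iff hs hρ, not_le]

lemma hEA_rest_gt_iff : hEA r k j i (restLength r i j k) < hEA r i j k (restLength r i j k)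
    ↔ ρ * restLength r i j k < r i + r j := by
  rw [← not_le, hEA_rest_le_iff hs hρ, not_le]

omit hρ in
lemma mem_domEA {x : ℝ} : x ∈ domEA r i j k ↔ restLength r i j k < x ∧
    rateSq r i j (r i + r j) x ≤ rateSq r k j (x - (r i + r j)) x := by
  have ha := add_pos (hs.pos i) (hs.pos j)
  have mj := hs.mass_pos j; have mk := hs.mass_pos k
  refine and_congr_right fun hx => ?_
  have hx0 : 0 < x := ha.trans ((lt_restLength hs).trans hx)
  have : rateSq r k j (x - (r i + r j)) x = (mass r k / x ^ 2 + mass r j / (r i + r j) ^ 2)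
      / (mass r k * x + mass r j * (r i + r j)) := by
    unfold rateSq; rw [sub_sub_cancel]
  rw [this, le_div_iff₀ (by positivity), add_comm (mass r k / x ^ 2), add_comm (mass r k * x)]

lemma mem_domEA_iff {x : ℝ} :
    x ∈ domEA r i j k ↔ restLength r i j k < x ∧ r i + r j ≤ ρ * x := by
  rw [mem_domEA hs]
  exact and_congr_right fun hx => rateSq_le_iff hs hρ (add_pos (hs.pos i) (hs.pos j))
    ((lt_restLength hs).trans hx)

lemma domEA_eq_Ioi (hle : r i + r j ≤ ρ * restLength r i j k) :
    domEA r i j k = Ioi (restLength r i j k) := by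
  ext x
  rw [mem_domEA_iff hs hρ]
  exact ⟨fun h => h.1, fun h => ⟨h, hle.trans (mul_le_mul_of_nonneg_left (le_of_lt h) hρ.1.le)⟩⟩

lemma domEA_eq_Ici (hlt : ρ * restLength r i j k < r i + r j) :
    restLength r i j k < (r i + r j) / ρ ∧ domEA r i j k = Ici ((r i + r j) / ρ) := by
  have h1 : restLength r i j k < (r i + r j) / ρ := by
    rw [lt_div_iff₀ hρ.1, mul_comm]; exact hlt
  refine ⟨h1, ?_⟩
  ext x
  rw [mem_domEA_iff hs hρ, mem_Ici, div_le_iff₀ hρ.1, mul_comm x]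
  refine ⟨fun h => h.2, fun h => ⟨h1.trans_le ?_, h⟩⟩
  rw [div_le_iff₀ hρ.1, mul_comm x]; exact h

lemma interior_domEA_eq : interior (domEA r i j k)
    = {x | restLength r i j k < x ∧ r i + r j < ρ * x} := by
  rcases le_or_gt (r i + r j) (ρ * restLength r i j k) with hle | hlt
  · rw [domEA_eq_Ioi hs hρ hle, interior_Ioi]
    ext x
    exact ⟨fun h => ⟨h, hle.trans_lt (mul_lt_mul_of_pos_left h hρ.1)⟩, fun h => h.1⟩
  · obtain ⟨h1, h2⟩ := domEA_eq_Ici hs hρ hlt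
    rw [h2, interior_Ici]
    ext x
    rw [mem_Ioi, div_lt_iff₀ hρ.1, mul_comm x]
    refine ⟨fun h => ⟨h1.trans ?_, h⟩, fun h => h.2⟩
    rw [div_lt_iff₀ hρ.1, mul_comm x]; exact h

/-- The coefficient of the square of the size in the moment of inertia of an orbital Euler
configuration. -/
def eulerCoeff (r : Fin 3 → ℝ) (i j k : Fin 3) (ρ : ℝ) : ℝ :=
  mass r i * mass r j * ρ ^ 2 + mass r j * mass r k * (1 - ρ) ^ 2 + mass r k * mass r i

omit hρ in
lemma eulerCoeff_pos (i j k : Fin 3) (ρ : ℝ) : 0 < eulerCoeff r i j k ρ := by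
  have := hs.mass_pos i; have := hs.mass_pos j; have := hs.mass_pos k
  unfold eulerCoeff; positivity

omit hs hρ in
lemma hEO_eq (i j k : Fin 3) (ρ d : ℝ) : hEO r i j k ρ d = √(rateSq r i j ρ 1)
    * ((∑ l, ballInertia r l + eulerCoeff r i j k ρ * d ^ 2) / d ^ (3 / 2 : ℝ)) := by
  unfold hEO inertiaOf eulerCoeff; ring

lemma hEO_pos {d : ℝ} (hd : 0 < d) : 0 < hEO r i j k ρ d :=
  div_pos (mul_pos (hs.inertiaOf_pos ..) (Real.sqrt_pos.2 (rateSq_pos hs i j hρ.1 hρ.2.1)))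
    (Real.rpow_pos_of_pos hd _)

lemma sq_hEO_div {d : ℝ} (hd : 0 < d) :
    (hEO r i j k ρ d / inertiaOf r i j k (ρ * d) ((1 - ρ) * d) d) ^ 2
      = rateSq r i j (ρ * d) d := by
  rw [rateSq_mul hs i j hρ.2.1 hd]
  unfold hEO
  have := hs.inertiaOf_pos i j k (ρ * d) ((1 - ρ) * d) d
  have p := Real.rpow_pos_of_pos hd (3 / 2 : ℝ)
  rw [mul_div_assoc, mul_div_cancel_left₀ _ this.ne', div_pow, rpow_three_halves hd,
    Real.sq_sqrt (rateSq_pos hs i j hρ.1 hρ.2.1).le]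

omit hs hρ in
lemma mem_domEO (h0 : 0 < ρ) (h1 : ρ < 1) {d : ℝ} :
    d ∈ domEO r i j k ρ ↔ r i + r j < ρ * d ∧ r j + r k < (1 - ρ) * d := by
  rw [domEO, mem_Ioi, max_lt_iff, div_lt_iff₀ h0, div_lt_iff₀ (by linarith), mul_comm d,
    mul_comm d]

end euler

/-! ### Polynomial inequalities for the radii -/

/-- For radii `p, q, s` of the aligned bodies `i, j, k` at gap `y = d_jk` (`i, j` in contact), this is
nonnegative exactly if `i` is not pulled away from `j`. -/
def holdPoly (p q s y : ℝ) : ℝ :=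
  p ^ 3 * y ^ 2 * ((p + q + y) ^ 3 - (p + q) ^ 3) + q ^ 3 * (p + q + y) ^ 2 * (y ^ 3 - (p + q) ^ 3)
    - s ^ 3 * (p + q) ^ 2 * ((p + q + y) ^ 3 - y ^ 3)

/-- The inertia side of the sign condition in `alignedSign`, cleared of denominators. -/
def inertiaPoly (p q s : ℝ) : ℝ :=
  (p ^ 3 + q ^ 3 + s ^ 3)
    * (p ^ 3 * q ^ 3 * (p + q) ^ 2 + (p ^ 3 + q ^ 3) * (2 / 5 * (p ^ 5 + q ^ 5 + s ^ 5)))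

/-- The orbital side of the sign condition in `alignedSign`, cleared of denominators. -/
def orbitPoly (p q s y : ℝ) : ℝ := s ^ 3 * (p ^ 3 * (p + q + y) + q ^ 3 * y) ^ 2

section cones

variable {c s t : ℝ} (hc : 0 ≤ c) (hs : 0 ≤ s) (ht : 0 ≤ t)
include hc hs ht

/-- The digits name the order `i, j, k`. Each pair of lemmas, for holding and for orbit, exhibits a
gap y, as a combination of the radii, at which the contact still holds while h still decreases. In
cone coordinates c, s, t the chosen y makes every coefficient of the expanded polynomial
nonnegative, which is all that `positivity` verifies after `ring_nf`. -/
lemma holdPoly_102 : 0 ≤ holdPoly (c + s) (c + s + t) c ((c + s + t) + 5 / 4 * (c + s)) := by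
  unfold holdPoly; ring_nf; positivity

lemma orbitPoly_102 : 0 ≤ 3 * inertiaPoly (c + s) (c + s + t) c
    - orbitPoly (c + s) (c + s + t) c ((c + s + t) + 5 / 4 * (c + s)) := by
  unfold inertiaPoly orbitPoly; ring_nf; positivity

lemma holdPoly_201 : 0 ≤ holdPoly c (c + s + t) (c + s) (53 / 50 * ((c + s + t) + (c + s))) := by
  unfold holdPoly; ring_nf; positivity

lemma orbitPoly_201 : 0 ≤ 3 * inertiaPoly c (c + s + t) (c + s)
    - orbitPoly c (c + s + t) (c + s) (53 / 50 * ((c + s + t) + (c + s))) := by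
  unfold inertiaPoly orbitPoly; ring_nf; positivity

lemma holdPoly_012 : 0 ≤ holdPoly (c + s + t) (c + s) c (3 / 2 * (c + s) + 1 / 2 * c) := by
  unfold holdPoly; ring_nf; positivity

lemma orbitPoly_012 : 0 ≤ 3 * inertiaPoly (c + s + t) (c + s) c
    - orbitPoly (c + s + t) (c + s) c (3 / 2 * (c + s) + 1 / 2 * c) := by
  unfold inertiaPoly orbitPoly; ring_nf; positivity

/-- Order `2, 1, 0`, body `0` at least twice as large as body `1`. -/
lemma holdPoly_210_large : 0 ≤ holdPoly c (c + s) (2 * c + 2 * s + t)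
    (12 / 5 * (2 * c + 2 * s + t) - 1 / 2 * (c + s)) := by
  unfold holdPoly; ring_nf; positivity

lemma orbitPoly_210_large : 0 ≤ 3 * inertiaPoly c (c + s) (2 * c + 2 * s + t)
    - orbitPoly c (c + s) (2 * c + 2 * s + t) (12 / 5 * (2 * c + 2 * s + t) - 1 / 2 * (c + s)) := by
  unfold inertiaPoly orbitPoly; ring_nf; positivity

/-- Order 2, 1, 0 with r 0 ≤ 2 r 1 and 5 r 2 ≤ 3 r 1. This cone has four faces; the plane 5 r 2 = 3
(r 0 − r 1) cuts it into two simplicial cones, one for each conjunct. -/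
lemma holdPoly_210_small : 0 ≤ holdPoly (3 * t) (c + s + 5 * t) (c + 2 * s + 10 * t)
      (9 / 5 * (c + 2 * s + 10 * t) + 3 / 10 * (c + s + 5 * t)) ∧
    0 ≤ holdPoly (3 * s + 3 * t) (c + 5 * s + 5 * t) (c + 5 * s + 10 * t)
      (9 / 5 * (c + 5 * s + 10 * t) + 3 / 10 * (c + 5 * s + 5 * t)) := by
  unfold holdPoly; constructor <;> ring_nf <;> positivity

lemma orbitPoly_210_small : 0 ≤ 3 * inertiaPoly (3 * t) (c + s + 5 * t) (c + 2 * s + 10 * t)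
      - orbitPoly (3 * t) (c + s + 5 * t) (c + 2 * s + 10 * t)
        (9 / 5 * (c + 2 * s + 10 * t) + 3 / 10 * (c + s + 5 * t)) ∧
    0 ≤ 3 * inertiaPoly (3 * s + 3 * t) (c + 5 * s + 5 * t) (c + 5 * s + 10 * t)
      - orbitPoly (3 * s + 3 * t) (c + 5 * s + 5 * t) (c + 5 * s + 10 * t)
        (9 / 5 * (c + 5 * s + 10 * t) + 3 / 10 * (c + 5 * s + 5 * t)) := by
  unfold inertiaPoly orbitPoly; constructor <;> ring_nf <;> positivity

end cones

section cones

variable {c s t : ℝ} (hc : 0 ≤ c) (hs : 0 ≤ s) (ht : 0 ≤ t)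
include hc hs ht

/-- Order 2, 1, 0 in the remaining cone r 0 ≤ 2 r 1, 3 r 1 ≤ 5 r 2, again cut into two simplicial
pieces, now along 5/2 (r 1 − r 2) = 2 r 1 − r 0. -/
lemma holdPoly_210_mid : 0 ≤ holdPoly (c + s + 3 * t) (c + s + 5 * t) (c + 2 * s + 5 * t)
      (9 / 5 * (c + 2 * s + 5 * t) + 7 / 10 * (c + s + 5 * t) - 2 / 5 * (c + s + 3 * t)) ∧
    0 ≤ holdPoly (c + 3 * s + 3 * t) (c + 5 * s + 5 * t) (2 * c + 5 * s + 10 * t)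
      (9 / 5 * (2 * c + 5 * s + 10 * t) + 7 / 10 * (c + 5 * s + 5 * t)
        - 2 / 5 * (c + 3 * s + 3 * t)) := by
  unfold holdPoly; constructor <;> ring_nf <;> positivity

/-- In this region the sharper form of `alignedSign_neg` is used. The additional 58/25 (p + q)² is 8
· 29/100 (p + q)², with the 29/100 of `skew_lower`, after multiplication by x y. -/
lemma orbitPoly_210_mid_left {p q u y : ℝ} (hp : p = c + s + 3 * t) (hq : q = c + s + 5 * t)
    (hu : u = c + 2 * s + 5 * t) (hy : y = 9 / 5 * u + 7 / 10 * q - 2 / 5 * p) :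
    0 ≤ (3 * ((p + q + y) * y) + 58 / 25 * (p + q) ^ 2) * inertiaPoly p q u
      - (p + q + y) * y * orbitPoly p q u y := by
  subst hy hp hq hu
  unfold inertiaPoly orbitPoly; ring_nf; positivity

lemma orbitPoly_210_mid_right {p q u y : ℝ} (hp : p = c + 3 * s + 3 * t)
    (hq : q = c + 5 * s + 5 * t) (hu : u = 2 * c + 5 * s + 10 * t)
    (hy : y = 9 / 5 * u + 7 / 10 * q - 2 / 5 * p) :
    0 ≤ (3 * ((p + q + y) * y) + 58 / 25 * (p + q) ^ 2) * inertiaPoly p q u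
      - (p + q + y) * y * orbitPoly p q u y := by
  subst hy hp hq hu
  unfold inertiaPoly orbitPoly; ring_nf; positivity

end cones

/-- Lower bound for the relative excess of `P T` over `μ W`. -/
lemma skew_lower {m n x y : ℝ} (hn : 0 < n) (hm : 27 / 125 * n ≤ m) (hmn : m ≤ n) (hy : 0 < y)
    (hyx : y ≤ x) (hx : x ≤ 2 * y) :
    29 / 100 * ((m + n) * (m * y ^ 2 + n * x ^ 2)) ≤ m * n * (x ^ 2 + x * y + y ^ 2) := by
  obtain ⟨w, rfl⟩ : ∃ w, x = y + w := ⟨x - y, by ring⟩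
  obtain ⟨v, rfl⟩ : ∃ v, y = w + v := ⟨y - w, by ring⟩
  have hw : 0 ≤ w := by linarith
  have hv : 0 ≤ v := by linarith
  -- `A` and `B` are the slacks in 27/125 n ≤ m ≤ n, and n is eliminated in their favour; 27/125 =
  -- (3/5)³ is the mass ratio for radii in ratio 3/5.
  obtain ⟨A, rfl⟩ : ∃ A, m = A + 27 / 125 * n := ⟨m - 27 / 125 * n, by ring⟩
  obtain ⟨B, hB⟩ : ∃ B, A + B = 98 / 125 * n := ⟨98 / 125 * n - A, by ring⟩
  have hn' : n = 125 / 98 * (A + B) := by linarith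
  have hA : 0 ≤ A := by linarith
  have hB : 0 ≤ B := by linarith
  subst hn'
  rw [← sub_nonneg]
  ring_nf
  positivity

section strict

variable {c s t : ℝ} (hc : 0 < c) (hs : 0 ≤ s) (ht : 0 ≤ t)
include hc hs ht

/-- `3 A > B d²` at the resting size for the transitional families with middle body `0`, `1`. -/
lemma restPoly_pos {p q u : ℝ} (hp : p = c + s + t) (hq : q = c + s) (hu : u = c) :
    0 < 3 * (q ^ 3 * p ^ 3 * (q + p) ^ 2 + p ^ 3 * u ^ 3 * (p + u) ^ 2
        + 2 / 5 * (p ^ 3 + q ^ 3 + u ^ 3) * (p ^ 5 + q ^ 5 + u ^ 5))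
        - u ^ 3 * q ^ 3 * (q + 2 * p + u) ^ 2 ∧
    0 < 3 * (u ^ 3 * q ^ 3 * (u + q) ^ 2 + q ^ 3 * p ^ 3 * (q + p) ^ 2
        + 2 / 5 * (p ^ 3 + q ^ 3 + u ^ 3) * (p ^ 5 + q ^ 5 + u ^ 5))
        - p ^ 3 * u ^ 3 * (u + 2 * q + p) ^ 2 := by
  subst hp hq hu
  constructor <;> ring_nf <;> positivity

/-- The transitional family with middle body `2` starts on its decreasing side. -/
lemma contactPoly_pos {p q u : ℝ} (hp : p = c + s + t) (hq : q = c + s) (hu : u = c) :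
    0 < 3 * (p ^ 3 * u ^ 3 * (p + u) ^ 2 + u ^ 3 * q ^ 3 * (u + q) ^ 2
        + 2 / 5 * (p ^ 3 + q ^ 3 + u ^ 3) * (p ^ 5 + q ^ 5 + u ^ 5))
        - q ^ 3 * p ^ 3 * (p + q) ^ 2 := by
  subst hp hq hu
  ring_nf; positivity

/-- The isosceles families start on their decreasing side. -/
lemma isoscelesPoly_pos {p q u : ℝ} (hp : p = c + s + t) (hq : q = c + s) (hu : u = c) :
    0 < 3 * (u ^ 3 * p ^ 3 * (u + p) ^ 2
        + 2 / 5 * (p ^ 3 + q ^ 3 + u ^ 3) * (p ^ 5 + q ^ 5 + u ^ 5))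
        - q ^ 3 * (u ^ 3 + p ^ 3) * (p + q) ^ 2 ∧
    0 < 3 * (p ^ 3 * q ^ 3 * (p + q) ^ 2
        + 2 / 5 * (p ^ 3 + q ^ 3 + u ^ 3) * (p ^ 5 + q ^ 5 + u ^ 5))
        - u ^ 3 * (p ^ 3 + q ^ 3) * (p + q) ^ 2 := by
  subst hp hq hu
  constructor <;> ring_nf <;> positivity

/-- The isosceles family with the largest body apart needs two cones: here p ≥ q + u with slack t,
and in the next lemma p < q + u with slack c. -/
lemma isoscelesPoly_pos_of_large {p q u : ℝ} (hp : p = 2 * c + s + t) (hq : q = c + s)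
    (hu : u = c) :
    0 < 3 * (q ^ 3 * u ^ 3 * (q + u) ^ 2
        + 2 / 5 * (p ^ 3 + q ^ 3 + u ^ 3) * (p ^ 5 + q ^ 5 + u ^ 5))
        - p ^ 3 * (q ^ 3 + u ^ 3) * (p + q) ^ 2 := by
  subst hp hq hu
  ring_nf; positivity

lemma isoscelesPoly_pos_of_small {p q u : ℝ} (hp : p = c + s + 2 * t) (hq : q = c + s + t)
    (hu : u = c + t) :
    0 < 3 * (q ^ 3 * u ^ 3 * (q + u) ^ 2
        + 2 / 5 * (p ^ 3 + q ^ 3 + u ^ 3) * (p ^ 5 + q ^ 5 + u ^ 5))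
        - p ^ 3 * (q ^ 3 + u ^ 3) * (p + q) ^ 2 := by
  subst hp hq hu
  ring_nf; positivity

omit ht in
/-- The aligned configuration `1, 2, 0` needs a faster rotation than `0, 2, 1` to detach. -/
lemma detachPoly_pos {p q u : ℝ} (hp : p = c + s + t) (hq : q = c + s) (hu : u = c) (ht' : 0 < t) :
    0 < p ^ 3 * (q + u) ^ 3 * (3 * (p + u) ^ 2 + 3 * (p + u) * (q + u) + (q + u) ^ 2)
      - q ^ 3 * (p + u) ^ 3 * (3 * (q + u) ^ 2 + 3 * (p + u) * (q + u) + (p + u) ^ 2)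
      - u ^ 3 * (p + q + 2 * u) ^ 2 * ((p + u) ^ 3 - (q + u) ^ 3) := by
  subst hp hq hu
  ring_nf; positivity

/-- Comparison of the resting thresholds of the triangle and of the chain with middle body `1`. -/
lemma chainPoly_pos {p q u : ℝ} (hp : p = c + s + t) (hq : q = c + s) (hu : u = c) :
    0 < 3 * (q + u) * (p ^ 3 * q ^ 3 * (p + q) ^ 2 + q ^ 3 * u ^ 3 * (q + u) ^ 2
        + u ^ 3 * p ^ 3 * (u + p) ^ 2
        + 2 / 5 * (p ^ 3 + q ^ 3 + u ^ 3) * (p ^ 5 + q ^ 5 + u ^ 5))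
      - 8 * p ^ 3 * u ^ 3 * q * (p + q + u) * (p + q) := by
  subst hp hq hu
  ring_nf; positivity

end strict

/-! ### From masses to polynomials in the radii -/

section radii

variable {r : Fin 3 → ℝ} (hs : IsSizes r) {i j k : Fin 3} (h : IsTriple i j k)
include hs h

lemma IsTriple.mass_eq (l : Fin 3) : mass r l = r l ^ 3 / (r i ^ 3 + r j ^ 3 + r k ^ 3) ∧
    0 < r i ^ 3 + r j ^ 3 + r k ^ 3 := by
  have hi := hs.pos i; have hj := hs.pos j; have hk := hs.pos k
  refine ⟨?_, by positivity⟩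
  unfold mass
  rw [h.sum_eq]

lemma IsTriple.sum_ballInertia_eq : ∑ l, ballInertia r l
    = 2 / 5 * (r i ^ 5 + r j ^ 5 + r k ^ 5) / (r i ^ 3 + r j ^ 3 + r k ^ 3) := by
  obtain ⟨-, hM⟩ := h.mass_eq hs i
  rw [h.sum_eq]
  unfold ballInertia
  rw [(h.mass_eq hs i).1, (h.mass_eq hs j).1, (h.mass_eq hs k).1]
  field_simp

lemma orbit_term_eq (y : ℝ) : mass r k * (mass r i * (r i + r j + y) + mass r j * y) ^ 2
    = orbitPoly (r i) (r j) (r k) y / (r i ^ 3 + r j ^ 3 + r k ^ 3) ^ 3 := by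
  obtain ⟨-, hM⟩ := h.mass_eq hs i
  unfold orbitPoly
  rw [(h.mass_eq hs i).1, (h.mass_eq hs j).1, (h.mass_eq hs k).1]
  field_simp

lemma inertia_term_eq : mass r i * mass r j * (r i + r j) ^ 2
      + (mass r i + mass r j) * ∑ l, ballInertia r l
    = inertiaPoly (r i) (r j) (r k) / (r i ^ 3 + r j ^ 3 + r k ^ 3) ^ 3 := by
  obtain ⟨-, hM⟩ := h.mass_eq hs i
  unfold inertiaPoly
  rw [h.sum_ballInertia_eq hs, (h.mass_eq hs i).1, (h.mass_eq hs j).1]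
  field_simp

lemma alignedSign_neg_of_poly {y : ℝ} (hy : 0 < y)
    (hp : 0 ≤ 3 * inertiaPoly (r i) (r j) (r k) - orbitPoly (r i) (r j) (r k) y) :
    alignedSign (mass r i) (mass r j) (mass r k) (∑ l, ballInertia r l) (r i + r j)
      (r i + r j + y) < 0 := by
  have ha := add_pos (hs.pos i) (hs.pos j)
  obtain ⟨-, hM⟩ := h.mass_eq hs i
  refine alignedSign_neg (δ₀ := 0) (hs.mass_pos i) (hs.mass_pos j) (hs.mass_pos k)
    hs.sum_ballInertia_pos ha (by linarith) ?_ ?_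
  · have := skew_pos (hs.mass_pos i) (hs.mass_pos j) ha (x := r i + r j + y) (by linarith)
    have := hs.mass_pos i; have := hs.mass_pos j
    positivity
  · rw [add_sub_cancel_left, orbit_term_eq hs h, inertia_term_eq hs h, ← mul_div_assoc]
    gcongr
    linarith

lemma alignedSign_neg_of_poly' {y : ℝ} (hy : 0 < y) (hij : r i ≤ r j) (hij' : 3 / 5 * r j ≤ r i)
    (hay : r i + r j ≤ y)
    (hp : 0 ≤ (3 * ((r i + r j + y) * y) + 58 / 25 * (r i + r j) ^ 2)
      * inertiaPoly (r i) (r j) (r k) - (r i + r j + y) * y * orbitPoly (r i) (r j) (r k) y) :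
    alignedSign (mass r i) (mass r j) (mass r k) (∑ l, ballInertia r l) (r i + r j)
      (r i + r j + y) < 0 := by
  have ha := add_pos (hs.pos i) (hs.pos j)
  have hi := hs.pos i; have hj := hs.pos j
  have mi := hs.mass_pos i; have mj := hs.mass_pos j
  obtain ⟨-, hM⟩ := h.mass_eq hs i
  set x := r i + r j + y with hx
  have hx0 : 0 < x := by positivity
  -- Since x³ − y³ = a (x² + x y + y²), the correction is a² / (x y) times the quotient that
  -- `skew_lower` bounds below by 29/100.
  refine alignedSign_neg (δ₀ := 29 / 100 * (r i + r j) ^ 2 / (x * y)) mi mj (hs.mass_pos k)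
    hs.sum_ballInertia_pos ha (by linarith) ?_ ?_
  · have m1 : mass r i ≤ mass r j := by
      rw [(h.mass_eq hs i).1, (h.mass_eq hs j).1]
      gcongr
    have m2 : 27 / 125 * mass r j ≤ mass r i := by
      rw [(h.mass_eq hs i).1, (h.mass_eq hs j).1, ← mul_div_assoc]
      gcongr
      calc 27 / 125 * r j ^ 3 = (3 / 5 * r j) ^ 3 := by ring
        _ ≤ r i ^ 3 := by gcongr
    have key := skew_lower mj m2 m1 hy (show y ≤ x by linarith) (by linarith)
    unfold skew
    rw [show x - (r i + r j) = y by rw [hx]; ring]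
    have e : x ^ 3 - y ^ 3 = (r i + r j) * (x ^ 2 + x * y + y ^ 2) := by rw [hx]; ring
    rw [e]
    set a := r i + r j
    set m := mass r i; set n := mass r j
    have e2 : m * n / (m + n) * (a / x * (a * (x ^ 2 + x * y + y ^ 2) / (y * (m * y ^ 2 + n * x ^ 2))))
        = a ^ 2 / (x * y) * (m * n * (x ^ 2 + x * y + y ^ 2)
          / ((m + n) * (m * y ^ 2 + n * x ^ 2))) := by field_simp
    have e3 : 29 / 100 ≤ m * n * (x ^ 2 + x * y + y ^ 2)
          / ((m + n) * (m * y ^ 2 + n * x ^ 2)) := by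
      rw [le_div_iff₀ (by positivity)]; exact key
    rw [e2]
    calc 29 / 100 * a ^ 2 / (x * y) = a ^ 2 / (x * y) * (29 / 100) := by ring
      _ ≤ _ := by gcongr
  · rw [show x - (r i + r j) = y by rw [hx]; ring, orbit_term_eq hs h, inertia_term_eq hs h,
      ← mul_div_assoc]
    gcongr
    rw [← sub_nonneg]
    have : (3 + 8 * (29 / 100 * (r i + r j) ^ 2 / (x * y))) * inertiaPoly (r i) (r j) (r k)
        - orbitPoly (r i) (r j) (r k) y = ((3 * (x * y) + 58 / 25 * (r i + r j) ^ 2)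
      * inertiaPoly (r i) (r j) (r k) - x * y * orbitPoly (r i) (r j) (r k) y) / (x * y) := by
      field_simp; ring
    rw [this]
    positivity

lemma rateSq_poly {y : ℝ} (hy : 0 < y) : (0 ≤ holdPoly (r i) (r j) (r k) y →
    rateSq r i j (r i + r j) (r i + r j + y)
      ≤ rateSq r k j (r i + r j + y - (r i + r j)) (r i + r j + y)) ∧
    (0 < holdPoly (r i) (r j) (r k) y → rateSq r i j (r i + r j) (r i + r j + y)
      < rateSq r k j (r i + r j + y - (r i + r j)) (r i + r j + y)) := by
  have ha := add_pos (hs.pos i) (hs.pos j)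
  have hi := hs.pos i; have hj := hs.pos j; have hk := hs.pos k
  obtain ⟨-, hM⟩ := h.mass_eq hs i
  unfold holdPoly rateSq
  rw [(h.mass_eq hs i).1, (h.mass_eq hs j).1, (h.mass_eq hs k).1, add_sub_cancel_left,
    add_sub_cancel_right]
  set M := r i ^ 3 + r j ^ 3 + r k ^ 3
  set a := r i + r j
  set A := r i ^ 3 with hA; set B := r j ^ 3 with hB; set C := r k ^ 3 with hC
  have hA0 : 0 < A := by positivity
  have hB0 : 0 < B := by positivity
  have hC0 : 0 < C := by positivity
  clear_value A B C
  rw [div_le_div_iff₀ (by positivity) (by positivity), div_lt_div_iff₀ (by positivity)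
    (by positivity)]
  have : (C / M / (a + y) ^ 2 + B / M / a ^ 2) * (A / M * (a + y) + B / M * y)
      - (A / M / (a + y) ^ 2 + B / M / y ^ 2) * (C / M * (a + y) + B / M * a)
      = B * (A * y ^ 2 * ((a + y) ^ 3 - a ^ 3) + B * (a + y) ^ 2 * (y ^ 3 - a ^ 3)
          - C * a ^ 2 * ((a + y) ^ 3 - y ^ 3)) / (M ^ 2 * a ^ 2 * y ^ 2 * (a + y) ^ 2) := by
    field_simp; ring
  refine ⟨fun hp => sub_nonneg.1 ?_, fun hp => sub_pos.1 ?_⟩ <;> rw [this] <;> positivity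

end radii

/-! ### Position of the vertices in their domains -/

section sizes

variable {r : Fin 3 → ℝ} (hs : IsSizes r)
include hs

/-- A gap at which the contact holds and h is still decreasing; the vertex lies beyond it and is
therefore interior to the domain. Three of the four orders are settled by one cone each, the order
2, 1, 0 by several. -/
lemma exists_alignedSign_neg {i j k : Fin 3} (h : IsTriple i j k) (hj : j ≠ 2) :
    ∃ y, r j + r k ≤ y ∧ 0 ≤ holdPoly (r i) (r j) (r k) y ∧
    alignedSign (mass r i) (mass r j) (mass r k) (∑ l, ballInertia r l) (r i + r j)
      (r i + r j + y) < 0 := by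
  have h0 := hs.pos 0; have h1 := hs.pos 1; have h2 := hs.pos 2
  have h01 := hs.le_left; have h12 := hs.le_right
  have simple : ∀ y, r j + r k ≤ y → 0 ≤ holdPoly (r i) (r j) (r k) y →
      0 ≤ 3 * inertiaPoly (r i) (r j) (r k) - orbitPoly (r i) (r j) (r k) y →
      ∃ y, r j + r k ≤ y ∧ 0 ≤ holdPoly (r i) (r j) (r k) y ∧
      alignedSign (mass r i) (mass r j) (mass r k) (∑ l, ballInertia r l) (r i + r j)
      (r i + r j + y) < 0 := fun y hy h1 h2 =>
    ⟨y, hy, h1, alignedSign_neg_of_poly hs h (by linarith [hs.pos j, hs.pos k]) h2⟩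
  obtain ⟨c, hc⟩ : ∃ c, c = r 2 := ⟨_, rfl⟩
  obtain ⟨s, hs'⟩ : ∃ s, s = r 1 - r 2 := ⟨_, rfl⟩
  obtain ⟨t, ht'⟩ : ∃ t, t = r 0 - r 1 := ⟨_, rfl⟩
  have e2 : r 2 = c := hc.symm
  have e1 : r 1 = c + s := by linarith
  have e0 : r 0 = c + s + t := by linarith
  have c0 : 0 ≤ c := by linarith
  have s0 : 0 ≤ s := by linarith
  have t0 : 0 ≤ t := by linarith
  have hcases : (i = 1 ∧ j = 0 ∧ k = 2) ∨ (i = 2 ∧ j = 0 ∧ k = 1) ∨ (i = 0 ∧ j = 1 ∧ k = 2) ∨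
      (i = 2 ∧ j = 1 ∧ k = 0) := by
    obtain ⟨a, b, d⟩ := h
    clear simple
    revert i j k
    decide
  rcases hcases with ⟨rfl, rfl, rfl⟩ | ⟨rfl, rfl, rfl⟩ | ⟨rfl, rfl, rfl⟩ | ⟨rfl, rfl, rfl⟩
  · refine simple (r 0 + 5 / 4 * r 1) (by linarith) ?_ ?_
    · rw [e0, e1, e2]; exact holdPoly_102 c0 s0 t0
    · rw [e0, e1, e2]; exact orbitPoly_102 c0 s0 t0
  · refine simple (53 / 50 * (r 0 + r 1)) (by linarith) ?_ ?_
    · rw [e0, e1, e2]; exact holdPoly_201 c0 s0 t0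
    · rw [e0, e1, e2]; exact orbitPoly_201 c0 s0 t0
  · refine simple (3 / 2 * r 1 + 1 / 2 * r 2) (by linarith) ?_ ?_
    · rw [e0, e1, e2]; exact holdPoly_012 c0 s0 t0
    · rw [e0, e1, e2]; exact orbitPoly_012 c0 s0 t0
  clear e0 e1 e2 c0 s0 t0 hc hs' ht' c s t
  -- Order 2, 1, 0 is divided into r 0 ≥ 2 r 1, then 5 r 2 ≤ 3 r 1, then the rest, each with its own
  -- formula for the gap.
  rcases le_total (2 * r 1) (r 0) with hl | hl
  · obtain ⟨t, ht⟩ : ∃ t, t = r 0 - 2 * r 1 := ⟨_, rfl⟩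
    obtain ⟨s, hs'⟩ : ∃ s, s = r 1 - r 2 := ⟨_, rfl⟩
    have e1 : r 1 = r 2 + s := by linarith
    have e0 : r 0 = 2 * r 2 + 2 * s + t := by linarith
    refine simple (12 / 5 * r 0 - 1 / 2 * r 1) (by linarith) ?_ ?_
    · rw [e0, e1]; exact holdPoly_210_large h2.le (by linarith) (by linarith)
    · rw [e0, e1]; exact orbitPoly_210_large h2.le (by linarith) (by linarith)
  rcases le_total (5 * r 2) (3 * r 1) with hm | hm
  · have key : 0 ≤ holdPoly (r 2) (r 1) (r 0) (9 / 5 * r 0 + 3 / 10 * r 1) ∧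
        0 ≤ 3 * inertiaPoly (r 2) (r 1) (r 0)
          - orbitPoly (r 2) (r 1) (r 0) (9 / 5 * r 0 + 3 / 10 * r 1) := by
      rcases le_total (5 * r 2) (3 * (r 0 - r 1)) with hk | hk
      · obtain ⟨t, ht⟩ : ∃ t, t = r 2 / 3 := ⟨_, rfl⟩
        obtain ⟨s, hs'⟩ : ∃ s, s = r 0 - r 1 - 5 * t := ⟨_, rfl⟩
        obtain ⟨c, hc⟩ : ∃ c, c = 2 * r 1 - r 0 := ⟨_, rfl⟩
        have e2 : r 2 = 3 * t := by linarith
        have e1 : r 1 = c + s + 5 * t := by linarith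
        have e0 : r 0 = c + 2 * s + 10 * t := by linarith
        have c0 : 0 ≤ c := by linarith
        have s0 : 0 ≤ s := by linarith
        have t0 : 0 ≤ t := by linarith
        rw [e0, e1, e2]
        exact ⟨(holdPoly_210_small c0 s0 t0).1, (orbitPoly_210_small c0 s0 t0).1⟩
      · obtain ⟨t, ht⟩ : ∃ t, t = (r 0 - r 1) / 5 := ⟨_, rfl⟩
        obtain ⟨s, hs'⟩ : ∃ s, s = r 2 / 3 - t := ⟨_, rfl⟩
        obtain ⟨c, hc⟩ : ∃ c, c = r 1 - 5 / 3 * r 2 := ⟨_, rfl⟩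
        have e2 : r 2 = 3 * s + 3 * t := by linarith
        have e1 : r 1 = c + 5 * s + 5 * t := by linarith
        have e0 : r 0 = c + 5 * s + 10 * t := by linarith
        have c0 : 0 ≤ c := by linarith
        have s0 : 0 ≤ s := by linarith
        have t0 : 0 ≤ t := by linarith
        rw [e0, e1, e2]
        exact ⟨(holdPoly_210_small c0 s0 t0).2, (orbitPoly_210_small c0 s0 t0).2⟩
    exact simple _ (by linarith) key.1 key.2
  · obtain ⟨y, hy⟩ : ∃ y, y = 9 / 5 * r 0 + 7 / 10 * r 1 - 2 / 5 * r 2 := ⟨_, rfl⟩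
    have key : 0 ≤ holdPoly (r 2) (r 1) (r 0) y ∧
        0 ≤ (3 * ((r 2 + r 1 + y) * y) + 58 / 25 * (r 2 + r 1) ^ 2) * inertiaPoly (r 2) (r 1) (r 0)
          - (r 2 + r 1 + y) * y * orbitPoly (r 2) (r 1) (r 0) y := by
      rcases le_total (5 / 2 * (r 1 - r 2)) (2 * r 1 - r 0) with hk | hk
      · obtain ⟨t, ht⟩ : ∃ t, t = (r 1 - r 2) / 2 := ⟨_, rfl⟩
        obtain ⟨s, hs'⟩ : ∃ s, s = r 0 - r 1 := ⟨_, rfl⟩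
        obtain ⟨c, hc⟩ : ∃ c, c = r 1 - s - 5 * t := ⟨_, rfl⟩
        have e2 : r 2 = c + s + 3 * t := by linarith
        have e1 : r 1 = c + s + 5 * t := by linarith
        have e0 : r 0 = c + 2 * s + 5 * t := by linarith
        have c0 : 0 ≤ c := by linarith
        have s0 : 0 ≤ s := by linarith
        have t0 : 0 ≤ t := by linarith
        refine ⟨?_, orbitPoly_210_mid_left c0 s0 t0 e2 e1 e0 hy⟩
        rw [hy, e0, e1, e2]
        exact (holdPoly_210_mid c0 s0 t0).1
      · obtain ⟨s, hs'⟩ : ∃ s, s = (2 * r 1 - r 0) / 5 := ⟨_, rfl⟩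
        obtain ⟨t, ht⟩ : ∃ t, t = (r 1 - r 2) / 2 - s := ⟨_, rfl⟩
        obtain ⟨c, hc⟩ : ∃ c, c = r 1 - 5 / 2 * (r 1 - r 2) := ⟨_, rfl⟩
        have e2 : r 2 = c + 3 * s + 3 * t := by linarith
        have e1 : r 1 = c + 5 * s + 5 * t := by linarith
        have e0 : r 0 = 2 * c + 5 * s + 10 * t := by linarith
        have c0 : 0 ≤ c := by linarith
        have s0 : 0 ≤ s := by linarith
        have t0 : 0 ≤ t := by linarith
        refine ⟨?_, orbitPoly_210_mid_right c0 s0 t0 e2 e1 e0 hy⟩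
        rw [hy, e0, e1, e2]
        exact (holdPoly_210_mid c0 s0 t0).2
    exact ⟨y, by linarith, key.1,
      alignedSign_neg_of_poly' hs h (by linarith) h12 (by linarith) (by linarith) key.2⟩

/-- If the middle body is not the smallest, the angular momentum along the aligned family
decreases at first. -/
lemma exists_vertex_mem_interior {i j k : Fin 3} (h : IsTriple i j k) (hj : j ≠ 2) {v : ℝ}
    (hv : ∀ x, r i + r j < x → alignedSign (mass r i) (mass r j) (mass r k)
      (∑ l, ballInertia r l) (r i + r j) x < 0 → x < v) : v ∈ interior (domEA r i j k) := by
  obtain ⟨ρ, hρ, -⟩ := existsUnique_isEulerRatio hs i j k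
  obtain ⟨y, hy, hp, hneg⟩ := exists_alignedSign_neg hs h hj
  have hy0 : 0 < y := by linarith [hs.pos j, hs.pos k]
  have hlt := hv _ (by linarith) hneg
  rw [interior_domEA_eq hs hρ]
  have e := restLength_eq (r := r) (i := i) (j := j) (k := k)
  refine ⟨by linarith, ?_⟩
  have := (rateSq_le_iff hs hρ (add_pos (hs.pos i) (hs.pos j)) (by linarith)).1
    ((rateSq_poly hs h hy0).1 hp)
  exact this.trans_lt (mul_lt_mul_of_pos_left hlt hρ.1)

/-- This is B d² < 3A at the upper end of the domain: for middle body `0` or `1` the vertex lies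
past the aligned position and is never reached. -/
lemma hTR_coeff_transitional {i j k : Fin 3} (h : IsTriple i j k) (hj : j ≠ 2) :
    mass r k * mass r i * restLength r i j k ^ 2 < 3 * (mass r i * mass r j * (r i + r j) ^ 2
      + mass r j * mass r k * (r j + r k) ^ 2 + ∑ l, ballInertia r l) := by
  have h2 := hs.pos 2
  have h01 := hs.le_left; have h12 := hs.le_right
  obtain ⟨p1, p2⟩ := restPoly_pos h2 (sub_nonneg.2 h12) (sub_nonneg.2 h01)
    (p := r 0) (q := r 1) (u := r 2) (by ring) (by ring) rfl
  have hcases : (i = 1 ∧ j = 0 ∧ k = 2) ∨ (i = 2 ∧ j = 0 ∧ k = 1) ∨ (i = 0 ∧ j = 1 ∧ k = 2) ∨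
      (i = 2 ∧ j = 1 ∧ k = 0) := by
    obtain ⟨a, b, d⟩ := h
    revert i j k
    decide
  have hM := (h.mass_eq hs i).2
  rw [h.sum_ballInertia_eq hs, (h.mass_eq hs i).1, (h.mass_eq hs j).1, (h.mass_eq hs k).1,
    ← sub_pos]
  unfold restLength
  have key : 0 < (3 * (r i ^ 3 * r j ^ 3 * (r i + r j) ^ 2 + r j ^ 3 * r k ^ 3 * (r j + r k) ^ 2
      + 2 / 5 * (r i ^ 3 + r j ^ 3 + r k ^ 3) * (r i ^ 5 + r j ^ 5 + r k ^ 5))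
      - r k ^ 3 * r i ^ 3 * (r i + 2 * r j + r k) ^ 2) / (r i ^ 3 + r j ^ 3 + r k ^ 3) ^ 2 := by
    refine div_pos ?_ (by positivity)
    clear hM
    rcases hcases with ⟨rfl, rfl, rfl⟩ | ⟨rfl, rfl, rfl⟩ | ⟨rfl, rfl, rfl⟩ | ⟨rfl, rfl, rfl⟩ <;>
      linarith
  refine key.trans_eq ?_
  field_simp

lemma hTR_coeff_contact : mass r 1 * mass r 0 * (r 0 + r 1) ^ 2
    < 3 * (mass r 0 * mass r 2 * (r 0 + r 2) ^ 2
      + mass r 2 * mass r 1 * (r 2 + r 1) ^ 2 + ∑ l, ballInertia r l) := by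
  have h2 := hs.pos 2
  have h01 := hs.le_left; have h12 := hs.le_right
  have p1 := contactPoly_pos h2 (sub_nonneg.2 h12) (sub_nonneg.2 h01)
    (p := r 0) (q := r 1) (u := r 2) (by ring) (by ring) rfl
  have h := isTriple_zero_one_two
  have hM := (h.mass_eq hs 0).2
  rw [h.sum_ballInertia_eq hs, (h.mass_eq hs 0).1, (h.mass_eq hs 1).1, (h.mass_eq hs 2).1,
    ← sub_pos]
  refine (div_pos p1 (show 0 < (r 0 ^ 3 + r 1 ^ 3 + r 2 ^ 3) ^ 2 by positivity)).trans_eq ?_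
  field_simp

/-- All three isosceles domains begin at the largest contact distance r 0 + r 1. The inequality is B
d² < 3A there, so each family starts on its decreasing side. -/
lemma hIS_coeff {i j k : Fin 3} (h : IsTriple i j k) :
    mass r k * (mass r i + mass r j) * (r 0 + r 1) ^ 2
      < 3 * (mass r i * mass r j * (r i + r j) ^ 2 + ∑ l, ballInertia r l) := by
  have h2 := hs.pos 2
  have h01 := hs.le_left; have h12 := hs.le_right
  obtain ⟨p1, p2⟩ := isoscelesPoly_pos h2 (sub_nonneg.2 h12) (sub_nonneg.2 h01)
    (p := r 0) (q := r 1) (u := r 2) (by ring) (by ring) rfl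
  have p0 : 0 < 3 * (r 1 ^ 3 * r 2 ^ 3 * (r 1 + r 2) ^ 2
        + 2 / 5 * (r 0 ^ 3 + r 1 ^ 3 + r 2 ^ 3) * (r 0 ^ 5 + r 1 ^ 5 + r 2 ^ 5))
        - r 0 ^ 3 * (r 1 ^ 3 + r 2 ^ 3) * (r 0 + r 1) ^ 2 := by
    rcases le_or_gt (r 1 + r 2) (r 0) with hl | hl
    · exact isoscelesPoly_pos_of_large h2 (sub_nonneg.2 h12) (sub_nonneg.2 hl)
        (by ring) (by ring) rfl
    · exact isoscelesPoly_pos_of_small (sub_pos.2 hl) (sub_nonneg.2 h12) (sub_nonneg.2 h01)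
        (by ring) (by ring) (by ring)
  have hcases := isTriple_zero_one_two.cases h
  have hM := (h.mass_eq hs i).2
  rw [h.sum_ballInertia_eq hs, (h.mass_eq hs i).1, (h.mass_eq hs j).1, (h.mass_eq hs k).1,
    ← sub_pos]
  have key : 0 < (3 * (r i ^ 3 * r j ^ 3 * (r i + r j) ^ 2
      + 2 / 5 * (r i ^ 3 + r j ^ 3 + r k ^ 3) * (r i ^ 5 + r j ^ 5 + r k ^ 5))
      - r k ^ 3 * (r i ^ 3 + r j ^ 3) * (r 0 + r 1) ^ 2) / (r i ^ 3 + r j ^ 3 + r k ^ 3) ^ 2 := by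
    refine div_pos ?_ (by positivity)
    clear hM
    rcases hcases with ⟨rfl, rfl, rfl⟩ | ⟨rfl, rfl, rfl⟩ | ⟨rfl, rfl, rfl⟩ | ⟨rfl, rfl, rfl⟩ |
      ⟨rfl, rfl, rfl⟩ | ⟨rfl, rfl, rfl⟩ <;> linarith
  refine key.trans_eq ?_
  field_simp

/-- The chain with middle body `2` detaches first at the smaller of its ends. -/
lemma hEA_middle_two (hlt : r 1 < r 0) :
    hEA r 0 2 1 (restLength r 0 2 1) < hEA r 1 2 0 (restLength r 0 2 1) := by
  have h0 := hs.pos 0; have h1 := hs.pos 1; have h2 := hs.pos 2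
  have h01 := hs.le_left; have h12 := hs.le_right
  have p1 := detachPoly_pos h2 (sub_nonneg.2 h12) (p := r 0) (q := r 1) (u := r 2) (t := r 0 - r 1)
    (by ring) (by ring) rfl (sub_pos.2 hlt)
  have h : IsTriple 0 2 (1 : Fin 3) := isTriple_zero_one_two.swapLeft.rotate
  rw [(hEA_rest_eq (i := 0) (j := 2) (k := 1)).1, (hEA_rest_eq (i := 0) (j := 2) (k := 1)).2]
  refine mul_lt_mul_of_pos_left (Real.sqrt_lt_sqrt (rateSq_pos hs 0 2 (by linarith)
    (lt_restLength hs)).le ?_) (hs.inertiaOf_pos ..)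
  rw [restLength_eq]
  refine (rateSq_poly hs h (by linarith)).2 ?_
  unfold holdPoly
  linarith

/-- The chain with middle body `1` becomes stable before the triangle loses equilibrium. -/
lemma hTR_chain_lt_triangle {i k : Fin 3} (h : IsTriple i 1 k) :
    hTR r i 1 k (restLength r i 1 k) < hTR r 0 2 1 (r 0 + r 1) := by
  have h0 := hs.pos 0; have h1 := hs.pos 1; have h2 := hs.pos 2
  have h01 := hs.le_left; have h12 := hs.le_right
  have p1 := chainPoly_pos h2 (sub_nonneg.2 h12) (sub_nonneg.2 h01)
    (p := r 0) (q := r 1) (u := r 2) (by ring) (by ring) rfl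
  have h' := isTriple_zero_one_two
  set L := inertiaOf r 0 2 1 (r 0 + r 2) (r 2 + r 1) (r 0 + r 1) with hL
  have hM := (h'.mass_eq hs 0).2
  have key : 8 * (mass r 0 * mass r 2) * r 1 * (r 0 + r 1 + r 2) * (r 0 + r 1)
      < 3 * (r 1 + r 2) * L := by
    rw [hL]
    unfold inertiaOf
    rw [h'.sum_ballInertia_eq hs, (h'.mass_eq hs 0).1, (h'.mass_eq hs 1).1, (h'.mass_eq hs 2).1,
      ← sub_pos]
    refine (div_pos p1 (show 0 < (r 0 ^ 3 + r 1 ^ 3 + r 2 ^ 3) ^ 2 by positivity)).trans_eq ?_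
    field_simp
    ring
  set d := r 0 + r 1 with hd
  set w := r 1 + r 2 with hw
  have hz : restLength r i 1 k = d + w := by
    rcases h'.cases h with ⟨rfl, hj, rfl⟩ | ⟨rfl, hj, rfl⟩ | ⟨rfl, hj, rfl⟩ | ⟨rfl, hj, rfl⟩ |
      ⟨rfl, hj, rfl⟩ | ⟨rfl, hj, rfl⟩ <;> first | exact absurd hj (by decide) | skip
    all_goals unfold restLength; rw [hd, hw]; ring
  have hI : inertiaOf r i 1 k (r i + r 1) (r 1 + r k) (d + w)
      = L + 4 * (mass r 0 * mass r 2) * r 1 * (r 0 + r 1 + r 2) := by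
    rcases h'.cases h with ⟨rfl, hj, rfl⟩ | ⟨rfl, hj, rfl⟩ | ⟨rfl, hj, rfl⟩ | ⟨rfl, hj, rfl⟩ |
      ⟨rfl, hj, rfl⟩ | ⟨rfl, hj, rfl⟩ <;> first | exact absurd hj (by decide) | skip
    all_goals unfold inertiaOf at hL ⊢; rw [hL, hd, hw]; ring
  have hd0 : 0 < d := by positivity
  have hw0 : 0 < w := by positivity
  have hL0 : 0 < L := hs.inertiaOf_pos ..
  unfold hTR
  rw [hz, hI, ← hL]
  have e : d + w = d * (1 + w / d) := by field_simp
  have hu : 0 < w / d := by positivity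
  -- Bernoulli's inequality replaces the power 3/2 by a linear bound; what remains is the polynomial
  -- inequality `key`.
  have b := one_add_mul_self_le_rpow_one_add (s := w / d) (by linarith)
    (show (1 : ℝ) ≤ 3 / 2 by norm_num)
  have hdp : 0 < d ^ (3 / 2 : ℝ) := Real.rpow_pos_of_pos hd0 _
  rw [e, Real.mul_rpow hd0.le (by positivity), div_lt_div_iff₀ (by positivity) hdp]
  have k2 : 4 * (mass r 0 * mass r 2) * r 1 * (r 0 + r 1 + r 2) < L * (3 / 2 * (w / d)) := by
    rw [show L * (3 / 2 * (w / d)) = L * (3 / 2 * w) / d by field_simp, lt_div_iff₀ hd0]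
    linarith
  have k3 : L * (1 + 3 / 2 * (w / d)) ≤ L * (1 + w / d) ^ (3 / 2 : ℝ) := by gcongr
  have k4 := mul_lt_mul_of_pos_right (show L + 4 * (mass r 0 * mass r 2) * r 1 * (r 0 + r 1 + r 2)
    < L * (1 + w / d) ^ (3 / 2 : ℝ) by linarith) hdp
  linarith

end sizes

/-! ### Equilibrium conditions as bounds for the angular momentum -/

section momentum

variable {H I d : ℝ} (hH : 0 ≤ H) (hI : 0 < I)
include hH hI

omit hH hI in
lemma sq_div_eq (hd : 0 < d) : (H / I) ^ 2 * d ^ 3 = (H * d ^ (3 / 2 : ℝ) / I) ^ 2 := by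
  rw [← rpow_three_halves hd]; ring

lemma kepler_le_iff (hd : 0 < d) : (H / I) ^ 2 * d ^ 3 ≤ 1 ↔ H ≤ I / d ^ (3 / 2 : ℝ) := by
  have p := Real.rpow_pos_of_pos hd (3 / 2 : ℝ)
  rw [sq_div_eq hd, sq_le_one_iff₀ (by positivity), div_le_one hI, le_div_iff₀ p]

lemma kepler_lt_iff (hd : 0 < d) : (H / I) ^ 2 * d ^ 3 < 1 ↔ H < I / d ^ (3 / 2 : ℝ) := by
  have p := Real.rpow_pos_of_pos hd (3 / 2 : ℝ)
  rw [sq_div_eq hd, sq_lt_one_iff₀ (by positivity), div_lt_one hI, lt_div_iff₀ p]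

lemma kepler_eq_iff (hd : 0 < d) : (H / I) ^ 2 * d ^ 3 = 1 ↔ H = I / d ^ (3 / 2 : ℝ) := by
  rw [le_antisymm_iff, kepler_le_iff hH hI hd, le_antisymm_iff, ← not_lt (a := (H / I) ^ 2 * _),
    kepler_lt_iff hH hI hd, not_lt]

lemma rate_le_iff {R : ℝ} (hR : 0 < R) : (H / I) ^ 2 ≤ R ↔ H ≤ I * √R := by
  rw [← Real.le_sqrt (show 0 ≤ H / I by positivity) hR.le, div_le_iff₀ hI, mul_comm]

lemma rate_lt_iff {R : ℝ} : (H / I) ^ 2 < R ↔ H < I * √R := by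
  rw [← Real.lt_sqrt (by positivity), div_lt_iff₀ hI, mul_comm]

lemma rate_eq_iff {R : ℝ} (hR : 0 < R) : (H / I) ^ 2 = R ↔ H = I * √R := by
  rw [le_antisymm_iff, rate_le_iff hH hI hR, le_antisymm_iff, ← not_lt (a := (H / I) ^ 2), rate_lt_iff hH hI,
    not_lt]

end momentum

lemma div_rpow_le_iff {I d e : ℝ} (hI : 0 < I) (hd : 0 < d) (he : 0 < e) :
    I / d ^ (3 / 2 : ℝ) ≤ I / e ^ (3 / 2 : ℝ) ↔ e ≤ d := by
  rw [div_le_div_iff_of_pos_left hI (Real.rpow_pos_of_pos hd _) (Real.rpow_pos_of_pos he _),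
    Real.rpow_le_rpow_iff he.le hd.le (by norm_num)]

lemma IsTriple.forall_ne {i j k : Fin 3} (h : IsTriple i j k) {P : Fin 3 → Fin 3 → Prop}
    (hP : ∀ a b, P a b → P b a) : (∀ a b, a ≠ b → P a b) ↔ P i j ∧ P j k ∧ P k i := by
  refine ⟨fun H => ⟨H _ _ h.ij, H _ _ h.jk, H _ _ h.ki⟩, fun ⟨h1, h2, h3⟩ a b hab => ?_⟩
  rcases h.eq_or a with rfl | rfl | rfl <;> rcases h.eq_or b with rfl | rfl | rfl <;>
    first
    | exact absurd rfl hab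
    | assumption
    | exact hP _ _ (by assumption)

section criteria

variable {r : Fin 3 → ℝ} (hs : IsSizes r) {i j k : Fin 3} (h : IsTriple i j k) {q : Config} {H : ℝ}
include hs h

/-- The conditions ω² d³ ≤ 1 solved for H. The distances are passed as separate variables so that
contact values can be put into `inertiaOf` directly. -/
lemma relEq_oriented_iff {o : Bool} (ho : Oriented o q) (hH : 0 ≤ H) {x y z : ℝ}
    (ex : ‖q i - q j‖ = x) (ey : ‖q j - q k‖ = y) (ez : ‖q k - q i‖ = z) :
    IsRelEq r H q ↔ Admissible r q ∧ Centered r q ∧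
      (H ≤ inertiaOf r i j k x y z / x ^ (3 / 2 : ℝ) ∧
        (¬ Contact r q i j → H = inertiaOf r i j k x y z / x ^ (3 / 2 : ℝ))) ∧
      (H ≤ inertiaOf r i j k x y z / y ^ (3 / 2 : ℝ) ∧
        (¬ Contact r q j k → H = inertiaOf r i j k x y z / y ^ (3 / 2 : ℝ))) ∧
      (H ≤ inertiaOf r i j k x y z / z ^ (3 / 2 : ℝ) ∧
        (¬ Contact r q k i → H = inertiaOf r i j k x y z / z ^ (3 / 2 : ℝ))) := by
  subst ex ey ez
  rw [relEq_noncollinear hs h (ho.cross_ne h)]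
  refine and_congr_right fun ha => and_congr_right fun _ => ?_
  rw [h.forall_ne (fun a b => by rw [norm_sub_rev, contact_comm]; exact id), inertia_eq r h]
  have hI := hs.inertiaOf_pos i j k ‖q i - q j‖ ‖q j - q k‖ ‖q k - q i‖
  rw [kepler_le_iff hH hI (ha.dist_pos hs h.ij), kepler_eq_iff hH hI (ha.dist_pos hs h.ij),
    kepler_le_iff hH hI (ha.dist_pos hs h.jk), kepler_eq_iff hH hI (ha.dist_pos hs h.jk),
    kepler_le_iff hH hI (ha.dist_pos hs h.ki), kepler_eq_iff hH hI (ha.dist_pos hs h.ki)]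

lemma relEq_sbtw_iff (hq : Sbtw ℝ (q i) (q j) (q k)) (hH : 0 ≤ H) {x y z : ℝ}
    (ex : ‖q i - q j‖ = x) (ey : ‖q j - q k‖ = y) (ez : ‖q k - q i‖ = z) :
    IsRelEq r H q ↔ Admissible r q ∧ Centered r q ∧
      (H ≤ inertiaOf r i j k x y z * √(rateSq r k j y z) ∧
        (¬ Contact r q i j → H = inertiaOf r i j k x y z * √(rateSq r k j y z))) ∧
      (H ≤ inertiaOf r i j k x y z * √(rateSq r i j x z) ∧
        (¬ Contact r q j k → H = inertiaOf r i j k x y z * √(rateSq r i j x z))) := by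
  have hadd := norm_add_of_sbtw hq
  rw [relEq_collinear hs h hq]
  refine and_congr_right fun ha => and_congr_right fun _ => ?_
  have hx := ha.dist_pos hs h.ij
  have hy := ha.dist_pos hs h.jk
  subst ex ey ez
  rw [inertia_eq r h]
  have hI := hs.inertiaOf_pos i j k ‖q i - q j‖ ‖q j - q k‖ ‖q k - q i‖
  have R1 : 0 < rateSq r k j ‖q j - q k‖ ‖q k - q i‖ := rateSq_pos hs k j hy (by linarith)
  have R2 : 0 < rateSq r i j ‖q i - q j‖ ‖q k - q i‖ := rateSq_pos hs i j hx (by linarith)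
  rw [rate_le_iff hH hI R1, rate_eq_iff hH hI R1, rate_le_iff hH hI R2, rate_eq_iff hH hI R2]

omit hs in
lemma admissible_of_norms (hx : r i + r j ≤ ‖q i - q j‖) (hy : r j + r k ≤ ‖q j - q k‖)
    (hz : r k + r i ≤ ‖q k - q i‖) : Admissible r q := (admissible_iff h).2 ⟨hx, hy, hz⟩

lemma norm_lt_of_oriented {o : Bool} (ho : Oriented o q) (ha : Admissible r q) :
    ‖q k - q i‖ < ‖q i - q j‖ + ‖q j - q k‖ :=
  lt_of_le_of_ne (ha.isTriangle hs h).z_le fun e => ho.cross_ne h (cross_eq_zero_of_add e.symm)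

omit hs in
variable (r) in
lemma exists_placed_oriented (o : Bool) : ∃ ε : ℝ, (ε = 1 ∨ ε = -1) ∧ ∀ x y z, IsTriangle x y z →
    x < y + z → y < z + x → z < x + y → Oriented o (placed r i j ε x y z) := by
  obtain ⟨ε, hε, he⟩ := exists_sign_oriented h o
  exact ⟨ε, hε, fun x y z t hx hy hz => (he _).2 (cross_placed_pos h hε t hx hy hz)⟩

omit hs in
lemma sbtw_placed {x y z : ℝ} (hx : 0 < x) (hy : 0 < y) (hz : x + y = z) {ε : ℝ}
    (hε : ε = 1 ∨ ε = -1) : IsTriangle x y z ∧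
      Sbtw ℝ (placed r i j ε x y z i) (placed r i j ε x y z j) (placed r i j ε x y z k) := by
  have t : IsTriangle x y z := ⟨hx, hy, by linarith, by linarith, by linarith, by linarith⟩
  have e1 := norm_placed_ij h hε t (r := r)
  have e2 := norm_placed_jk h hε t (r := r)
  have e3 := norm_placed_ki h hε t (r := r)
  refine ⟨t, sbtw_of_norm_add ?_ ?_ (by rw [e1, e2, e3, hz])⟩
  · rw [← sub_ne_zero, ← norm_pos_iff, e1]; exact hx
  · rw [← sub_ne_zero, ← norm_pos_iff, e2]; exact hy

end criteria

/-! ### Equilibria of each geometric type -/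

section types

variable {r : Fin 3 → ℝ} (hs : IsSizes r) {i j k : Fin 3} (h : IsTriple i j k) {q : Config} {H : ℝ}
include hs h

lemma IsTriple.add_le : r i + r j ≤ r 0 + r 1 ∧ r j + r k ≤ r 0 + r 1 ∧ r k + r i ≤ r 0 + r 1 := by
  have h01 := hs.le_left; have h12 := hs.le_right
  rcases isTriple_zero_one_two.cases h with ⟨rfl, rfl, rfl⟩ | ⟨rfl, rfl, rfl⟩ | ⟨rfl, rfl, rfl⟩ |
      ⟨rfl, rfl, rfl⟩ | ⟨rfl, rfl, rfl⟩ | ⟨rfl, rfl, rfl⟩ <;> refine ⟨?_, ?_, ?_⟩ <;> linarith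

omit hs h in
lemma not_contact_of_lt (hij : r i + r j < ‖q i - q j‖) : ¬ Contact r q i j := fun e => by
  rw [Contact] at e; linarith

omit h in
lemma hTR_pos {d : ℝ} (hd : 0 < d) : 0 < hTR r i j k d :=
  div_pos (hs.inertiaOf_pos ..) (Real.rpow_pos_of_pos hd _)

omit h in
lemma hIS_pos {d : ℝ} (hd : 0 < d) : 0 < hIS r i j k d :=
  div_pos (hs.inertiaOf_pos ..) (Real.rpow_pos_of_pos hd _)

lemma IsTR.relEq {o : Bool} (hm : IsTR r i j k o q) (hH : 0 ≤ H) (hr : IsRelEq r H q) :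
    ‖q k - q i‖ ∈ domTR r i j k ∧ H = hTR r i j k ‖q k - q i‖ := by
  obtain ⟨cx, cy, cz, ho⟩ := hm
  have ha := hr.admissible
  obtain ⟨-, -, h1, h2, h3⟩ := (relEq_oriented_iff hs h ho hH cx cy rfl).1 hr
  have e := h3.2 cz
  have hz := ha.dist_pos hs h.ki
  have lt := norm_lt_of_oriented hs h ho ha
  rw [show ‖q i - q j‖ = _ from cx, show ‖q j - q k‖ = _ from cy] at lt
  have hI := hs.inertiaOf_pos i j k (r i + r j) (r j + r k) ‖q k - q i‖
  refine ⟨⟨?_, ?_, ha.lt_of_not_contact h.ki cz, by rw [restLength_eq]; exact lt⟩, e⟩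
  · have := h1.1
    rwa [e, div_rpow_le_iff hI hz (add_pos (hs.pos i) (hs.pos j))] at this
  · have := h2.1
    rwa [e, div_rpow_le_iff hI hz (add_pos (hs.pos j) (hs.pos k))] at this

lemma isTR_of_norms {o : Bool} (hc : Centered r q) (ho : Oriented o q) {d : ℝ}
    (ex : ‖q i - q j‖ = r i + r j) (ey : ‖q j - q k‖ = r j + r k) (ez : ‖q k - q i‖ = d)
    (hd : d ∈ domTR r i j k) : 0 ≤ hTR r i j k d ∧ IsTR r i j k o q ∧
      IsRelEq r (hTR r i j k d) q := by
  obtain ⟨d1, d2, d3, d4⟩ := hd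
  have hij := add_pos (hs.pos i) (hs.pos j)
  have hjk := add_pos (hs.pos j) (hs.pos k)
  have hd0 : 0 < d := by linarith
  have hH : 0 ≤ hTR r i j k d := (hTR_pos hs hd0).le
  have hI := hs.inertiaOf_pos i j k (r i + r j) (r j + r k) d
  refine ⟨hH, ⟨ex, ey, not_contact_of_lt (ez.symm ▸ d3), ho⟩, ?_⟩
  refine (relEq_oriented_iff hs h ho hH ex ey ez).2 ⟨admissible_of_norms h ex.ge ey.ge
    (ez.symm ▸ d3.le), hc, ⟨?_, fun hn => absurd ex hn⟩, ⟨?_, fun hn => absurd ey hn⟩, le_rfl,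
    fun _ => rfl⟩
  · exact (div_rpow_le_iff hI hd0 hij).2 d1
  · exact (div_rpow_le_iff hI hd0 hjk).2 d2

lemma IsIS.relEq {o : Bool} (hm : IsIS r i j k o q) (hH : 0 ≤ H) (hr : IsRelEq r H q) :
    ‖q k - q i‖ ∈ domIS r i j k ∧ H = hIS r i j k ‖q k - q i‖ := by
  obtain ⟨cx, cy, cz, hyz, ho⟩ := hm
  have ha := hr.admissible
  have hyz' : ‖q j - q k‖ = ‖q k - q i‖ := by rw [norm_sub_rev, hyz]
  obtain ⟨-, -, h1, h2, h3⟩ := (relEq_oriented_iff hs h ho hH cx hyz' rfl).1 hr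
  have e := h3.2 cz
  have hz := ha.dist_pos hs h.ki
  have hI := hs.inertiaOf_pos i j k (r i + r j) ‖q k - q i‖ ‖q k - q i‖
  refine ⟨⟨?_, ?_, ha.lt_of_not_contact h.ki cz⟩, e⟩
  · have := h1.1
    rwa [e, div_rpow_le_iff hI hz (add_pos (hs.pos i) (hs.pos j))] at this
  · rw [← hyz']; exact ha.lt_of_not_contact h.jk cy

lemma isIS_of_norms {o : Bool} (hc : Centered r q) (ho : Oriented o q) {d : ℝ}
    (ex : ‖q i - q j‖ = r i + r j) (ey : ‖q j - q k‖ = d) (ez : ‖q k - q i‖ = d)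
    (hd : d ∈ domIS r i j k) : 0 ≤ hIS r i j k d ∧ IsIS r i j k o q ∧
      IsRelEq r (hIS r i j k d) q := by
  obtain ⟨d1, d2, d3⟩ := hd
  have hij := add_pos (hs.pos i) (hs.pos j)
  have hd0 : 0 < d := by linarith
  have hH : 0 ≤ hIS r i j k d := (hIS_pos hs hd0).le
  have hI := hs.inertiaOf_pos i j k (r i + r j) d d
  refine ⟨hH, ⟨ex, not_contact_of_lt (ey.symm ▸ d2),
    not_contact_of_lt (ez.symm ▸ d3), by rw [ez, norm_sub_rev, ey], ho⟩, ?_⟩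
  exact (relEq_oriented_iff hs h ho hH ex ey ez).2 ⟨admissible_of_norms h ex.ge
    (ey.symm ▸ d2.le) (ez.symm ▸ d3.le), hc, ⟨(div_rpow_le_iff hI hd0 hij).2 d1,
    fun hn => absurd ex hn⟩, ⟨le_rfl, fun _ => rfl⟩, le_rfl, fun _ => rfl⟩

lemma IsER.relEq_iff (hm : IsER r i j k q) (hH : 0 ≤ H) : IsRelEq r H q ↔ Centered r q ∧
    H ≤ min (hEA r i j k (restLength r i j k)) (hEA r k j i (restLength r i j k)) := by
  obtain ⟨cx, cy, hq⟩ := hm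
  have hz := norm_add_of_sbtw hq
  rw [show ‖q i - q j‖ = _ from cx, show ‖q j - q k‖ = _ from cy, ← restLength_eq] at hz
  rw [relEq_sbtw_iff hs h hq hH cx cy hz.symm, hEA_rest_eq.1, hEA_rest_eq.2, le_min_iff,
    show restLength r i j k - (r i + r j) = r j + r k by rw [restLength_eq]; ring]
  constructor
  · rintro ⟨-, hc, h1, h2⟩
    exact ⟨hc, h2.1, h1.1⟩
  · rintro ⟨hc, h1, h2⟩
    refine ⟨admissible_of_norms h cx.ge cy.ge ?_, hc, ⟨h2, fun hn => absurd cx hn⟩, h1,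
      fun hn => absurd cy hn⟩
    rw [← hz]; unfold restLength; linarith [hs.pos j]

lemma IsEA.relEq (hm : IsEA r i j k q) (hH : 0 ≤ H) (hr : IsRelEq r H q) :
    ‖q k - q i‖ ∈ domEA r i j k ∧ H = hEA r i j k ‖q k - q i‖ := by
  obtain ⟨cx, cy, hq⟩ := hm
  have ha := hr.admissible
  have hz := norm_add_of_sbtw hq
  rw [show ‖q i - q j‖ = _ from cx] at hz
  have hy : ‖q j - q k‖ = ‖q k - q i‖ - (r i + r j) := by linarith
  obtain ⟨-, hc, h1, h2⟩ := (relEq_sbtw_iff hs h hq hH cx hy rfl).1 hr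
  have e := h2.2 cy
  have lt := ha.lt_of_not_contact h.jk cy
  have hlt : restLength r i j k < ‖q k - q i‖ := by rw [restLength_eq]; linarith
  refine ⟨(mem_domEA hs).2 ⟨hlt, ?_⟩, e⟩
  have h3 := h1.1
  have y0 := ha.dist_pos hs h.jk
  rw [e, mul_le_mul_iff_right₀ (hs.inertiaOf_pos ..), Real.sqrt_le_sqrt_iff] at h3
  · exact h3
  · exact (rateSq_pos hs k j (hy ▸ y0) (by linarith [hs.pos i, hs.pos j])).le

lemma isEA_of_norms (hc : Centered r q) {x : ℝ} (hq : Sbtw ℝ (q i) (q j) (q k))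
    (ex : ‖q i - q j‖ = r i + r j) (ez : ‖q k - q i‖ = x) (hd : x ∈ domEA r i j k) :
    0 ≤ hEA r i j k x ∧ IsEA r i j k q ∧ IsRelEq r (hEA r i j k x) q := by
  obtain ⟨h1, h2⟩ := (mem_domEA hs).1 hd
  have hz := norm_add_of_sbtw hq
  have ey : ‖q j - q k‖ = x - (r i + r j) := by linarith
  have hH := (hEA_pos hs (k := k) ((lt_restLength hs).trans h1)).le
  rw [restLength_eq] at h1
  have hi := hs.pos i; have hj := hs.pos j
  refine ⟨hH, ⟨ex, not_contact_of_lt (by rw [ey]; linarith), hq⟩, ?_⟩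
  refine (relEq_sbtw_iff hs h hq hH ex ey ez).2 ⟨admissible_of_norms h ex.ge
    (by rw [ey]; linarith) (by rw [ez]; linarith), hc, ⟨?_, fun hn => absurd ex hn⟩, le_rfl,
    fun _ => rfl⟩
  unfold hEA
  have := hs.inertiaOf_pos i j k (r i + r j) (x - (r i + r j)) x
  gcongr

omit h in
lemma hEO_eq_iff {ρ : ℝ} (hρ : IsEulerRatio r i j k ρ) {d : ℝ} (hd : 0 < d) :
    hEO r i j k ρ d = inertiaOf r i j k (ρ * d) ((1 - ρ) * d) d * √(rateSq r i j (ρ * d) d) := by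
  have hx : 0 < ρ * d := mul_pos hρ.1 hd
  have hx' : ρ * d < d := by nlinarith [hρ.2.1]
  exact (rate_eq_iff (hEO_pos hs hρ hd).le (hs.inertiaOf_pos ..) (rateSq_pos hs i j hx hx')).1
    (sq_hEO_div hs hρ hd)

lemma IsEO.relEq {ρ : ℝ} (hρ : IsEulerRatio r i j k ρ) (hm : IsEO r i j k q) (hH : 0 ≤ H)
    (hr : IsRelEq r H q) : ‖q i - q j‖ = ρ * ‖q k - q i‖ ∧ ‖q k - q i‖ ∈ domEO r i j k ρ ∧
      H = hEO r i j k ρ ‖q k - q i‖ := by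
  obtain ⟨cx, cy, hq⟩ := hm
  have ha := hr.admissible
  have hz := norm_add_of_sbtw hq
  have hy : ‖q j - q k‖ = ‖q k - q i‖ - ‖q i - q j‖ := by linarith
  have x0 := ha.dist_pos hs h.ij
  have y0 := ha.dist_pos hs h.jk
  obtain ⟨-, hc, h1, h2⟩ := (relEq_sbtw_iff hs h hq hH rfl hy rfl).1 hr
  have e1 := h1.2 cx
  have e2 := h2.2 cy
  have hR1 := rateSq_pos hs k j (hy ▸ y0) (show ‖q k - q i‖ - ‖q i - q j‖ < ‖q k - q i‖ by linarith)
  have hR2 := rateSq_pos hs i j x0 (show ‖q i - q j‖ < ‖q k - q i‖ by linarith)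
  have hI := hs.inertiaOf_pos i j k ‖q i - q j‖ (‖q k - q i‖ - ‖q i - q j‖) ‖q k - q i‖
  have e3 := ((rate_eq_iff hH hI hR2).2 e2).symm.trans ((rate_eq_iff hH hI hR1).2 e1)
  have e4 := (rateSq_eq_iff hs hρ x0 (by linarith)).1 e3
  refine ⟨e4, (mem_domEO hρ.1 hρ.2.1).2 ⟨?_, ?_⟩, ?_⟩
  · rw [← e4]; exact ha.lt_of_not_contact h.ij cx
  · rw [sub_mul, one_mul, ← e4, ← hy]; exact ha.lt_of_not_contact h.jk cy
  · rw [hEO_eq_iff hs hρ (ha.dist_pos hs h.ki), sub_mul, one_mul, ← e4]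
    exact e2

lemma isEO_of_norms {ρ : ℝ} (hρ : IsEulerRatio r i j k ρ) (hc : Centered r q) {d : ℝ}
    (hq : Sbtw ℝ (q i) (q j) (q k)) (ex : ‖q i - q j‖ = ρ * d) (ez : ‖q k - q i‖ = d)
    (hd : d ∈ domEO r i j k ρ) :
    0 ≤ hEO r i j k ρ d ∧ IsEO r i j k q ∧ IsRelEq r (hEO r i j k ρ d) q := by
  obtain ⟨h1, h2⟩ := (mem_domEO hρ.1 hρ.2.1).1 hd
  have hz := norm_add_of_sbtw hq
  have ey : ‖q j - q k‖ = (1 - ρ) * d := by linarith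
  have hi := hs.pos i; have hj := hs.pos j; have hk := hs.pos k
  have hd0 : 0 < d := by linarith
  have hH := (hEO_pos hs hρ hd0).le
  refine ⟨hH, ⟨not_contact_of_lt (by rw [ex]; exact h1), not_contact_of_lt
    (by rw [ey]; exact h2), hq⟩, ?_⟩
  have e : rateSq r k j ((1 - ρ) * d) d = rateSq r i j (ρ * d) d := by
    rw [rateSq_mul hs i j hρ.2.1 hd0, rateSq_mul hs k j (by linarith [hρ.1]) hd0, hρ.2.2]
  have e2 := hEO_eq_iff hs hρ hd0
  refine (relEq_sbtw_iff hs h hq hH ex ey ez).2 ⟨admissible_of_norms h (by rw [ex]; exact h1.le)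
    (by rw [ey]; exact h2.le) (by rw [ez]; linarith), hc, ⟨?_, fun _ => ?_⟩, e2.le, fun _ => e2⟩
  · rw [e]; exact e2.le
  · rw [e]; exact e2

end types

section symmetric

variable {r : Fin 3 → ℝ} (hs : IsSizes r) {q : Config} {H : ℝ}

lemma isLR_iff {o : Bool} : IsLR r o q ↔
    (Contact r q 0 2 ∧ Contact r q 2 1 ∧ Contact r q 1 0) ∧ Oriented o q := by
  have h := isTriple_zero_one_two.swapLeft.rotate
  exact and_congr_left fun _ => h.forall_ne fun a b => contact_comm.1

lemma isLO_iff {o : Bool} : IsLO r o q ↔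
    (¬ Contact r q 0 1 ∧ ¬ Contact r q 1 2 ∧ ¬ Contact r q 2 0) ∧
    (‖q 1 - q 2‖ = ‖q 0 - q 1‖ ∧ ‖q 2 - q 0‖ = ‖q 0 - q 1‖) ∧ Oriented o q := by
  have h := isTriple_zero_one_two
  unfold IsLO
  rw [h.forall_ne (P := fun i j => ¬ Contact r q i j ∧ ‖q i - q j‖ = ‖q 0 - q 1‖)
    (fun a b => by rw [contact_comm, norm_sub_rev]; exact id)]
  tauto

include hs

/-- The three bounds I / d^(3/2) share the same inertia, so the longest contact distance, r 0 + r 1,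
gives the binding one. -/
lemma IsLR.relEq_iff {o : Bool} (hm : IsLR r o q) (hH : 0 ≤ H) :
    IsRelEq r H q ↔ Centered r q ∧ H ≤ hTR r 0 2 1 (r 0 + r 1) := by
  obtain ⟨⟨c1, c2, c3⟩, ho⟩ := isLR_iff.1 hm
  have h : IsTriple 0 2 (1 : Fin 3) := isTriple_zero_one_two.swapLeft.rotate
  have c3' : ‖q 1 - q 0‖ = r 0 + r 1 := by rw [add_comm]; exact c3
  rw [relEq_oriented_iff hs h ho hH c1 c2 c3']
  have h0 := hs.pos 0; have h1 := hs.pos 1; have h2 := hs.pos 2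
  have h01 := hs.le_left; have h12 := hs.le_right
  have hI := hs.inertiaOf_pos 0 2 1 (r 0 + r 2) (r 2 + r 1) (r 0 + r 1)
  constructor
  · rintro ⟨-, hc, -, -, h3⟩
    exact ⟨hc, h3.1⟩
  · rintro ⟨hc, h3⟩
    refine ⟨admissible_of_norms h c1.ge c2.ge c3.ge, hc, ⟨h3.trans ?_, fun hn => absurd c1 hn⟩,
      ⟨h3.trans ?_, fun hn => absurd c2 hn⟩, h3, fun hn => absurd c3 hn⟩
    · exact (div_rpow_le_iff hI (by linarith) (by linarith)).2 (by linarith)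
    · exact (div_rpow_le_iff hI (by linarith) (by linarith)).2 (by linarith)

lemma hLO_pos {d : ℝ} (hd : 0 < d) : 0 < hLO r d :=
  div_pos (hs.inertiaOf_pos ..) (Real.rpow_pos_of_pos hd _)

lemma IsLO.relEq {o : Bool} (hm : IsLO r o q) (hH : 0 ≤ H) (hr : IsRelEq r H q) :
    ‖q 0 - q 1‖ ∈ Ioi (r 0 + r 1) ∧ H = hLO r ‖q 0 - q 1‖ := by
  obtain ⟨⟨c1, c2, c3⟩, ⟨e1, e2⟩, ho⟩ := isLO_iff.1 hm
  have h := isTriple_zero_one_two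
  have ha := hr.admissible
  obtain ⟨-, -, h1, -⟩ := (relEq_oriented_iff hs h ho hH rfl e1 e2).1 hr
  exact ⟨ha.lt_of_not_contact h.ij c1, h1.2 c1⟩

lemma isLO_of_norms {o : Bool} (hc : Centered r q) (ho : Oriented o q) {d : ℝ}
    (ex : ‖q 0 - q 1‖ = d) (ey : ‖q 1 - q 2‖ = d) (ez : ‖q 2 - q 0‖ = d)
    (hd : d ∈ Ioi (r 0 + r 1)) : 0 ≤ hLO r d ∧ IsLO r o q ∧ IsRelEq r (hLO r d) q := by
  have hd : r 0 + r 1 < d := hd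
  have h := isTriple_zero_one_two
  obtain ⟨h1, h2, h3⟩ := h.add_le hs
  have h0 := hs.pos 0; have h0' := hs.pos 1
  have hH := (hLO_pos hs (show 0 < d by linarith)).le
  refine ⟨hH, isLO_iff.2 ⟨⟨not_contact_of_lt (by linarith), not_contact_of_lt
    (by linarith), not_contact_of_lt (by linarith)⟩, ⟨by rw [ex, ey],
    by rw [ex, ez]⟩, ho⟩, ?_⟩
  exact (relEq_oriented_iff hs h ho hH ex ey ez).2 ⟨admissible_of_norms h (by linarith)
    (by linarith) (by linarith), hc, ⟨le_rfl, fun _ => rfl⟩, ⟨le_rfl, fun _ => rfl⟩, le_rfl,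
    fun _ => rfl⟩

end symmetric

/-! ### The 28 families -/

def familyEquiv : Family ≃ Bool ⊕ Fin 3 ⊕ (Fin 3 × Bool) ⊕ Equiv.Perm (Fin 3) ⊕ (Fin 3 × Bool)
    ⊕ Fin 3 ⊕ Bool where
  toFun
    | .LR o => .inl o
    | .ER j => .inr (.inl j)
    | .TR j o => .inr (.inr (.inl (j, o)))
    | .EA σ => .inr (.inr (.inr (.inl σ)))
    | .IS k o => .inr (.inr (.inr (.inr (.inl (k, o)))))
    | .EO j => .inr (.inr (.inr (.inr (.inr (.inl j)))))
    | .LO o => .inr (.inr (.inr (.inr (.inr (.inr o)))))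
  invFun
    | .inl o => .LR o
    | .inr (.inl j) => .ER j
    | .inr (.inr (.inl (j, o))) => .TR j o
    | .inr (.inr (.inr (.inl σ))) => .EA σ
    | .inr (.inr (.inr (.inr (.inl (k, o))))) => .IS k o
    | .inr (.inr (.inr (.inr (.inr (.inl j))))) => .EO j
    | .inr (.inr (.inr (.inr (.inr (.inr o))))) => .LO o
  left_inv F := by cases F <;> rfl
  right_inv x := by rcases x with _ | _ | ⟨_, _⟩ | _ | ⟨_, _⟩ | _ | _ <;> rfl

lemma card_family : Nat.card Family = 28 := by
  rw [Nat.card_congr familyEquiv, Nat.card_eq_fintype_card]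
  simp [Fintype.card_perm, Nat.factorial]

lemma ncard_range_of_injective {α : Type*} [Fintype α] {f : α → Family}
    (hf : Function.Injective f) {S : Set Family} (hS : ∀ F, F ∈ S ↔ ∃ a, f a = F) :
    S.ncard = Fintype.card α := by
  have : S = f '' univ := by ext F; simp [hS]
  rw [this, ncard_image_of_injective _ hf, ncard_univ, Nat.card_eq_fintype_card]

lemma ncard_classes : {F : Family | F.cls = .LR}.ncard = 2 ∧ {F : Family | F.cls = .ER}.ncard = 3 ∧
    {F : Family | F.cls = .TR}.ncard = 6 ∧ {F : Family | F.cls = .EA}.ncard = 6 ∧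
    {F : Family | F.cls = .IS}.ncard = 6 ∧ {F : Family | F.cls = .EO}.ncard = 3 ∧
    {F : Family | F.cls = .LO}.ncard = 2 := by
  refine ⟨?_, ?_, ?_, ?_, ?_, ?_, ?_⟩
  · exact ncard_range_of_injective (f := Family.LR) (fun a b e => by simpa using e)
      fun F => by cases F <;> simp [Family.cls]
  · exact ncard_range_of_injective (f := Family.ER) (fun a b e => by simpa using e)
      fun F => by cases F <;> simp [Family.cls]
  · exact ncard_range_of_injective (f := fun p : Fin 3 × Bool => Family.TR p.1 p.2)
      (fun a b e => by simpa [Prod.ext_iff] using e) fun F => by cases F <;> simp [Family.cls]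
  · exact (ncard_range_of_injective (f := Family.EA) (fun a b e => by simpa using e)
      fun F => by cases F <;> simp [Family.cls]).trans (by simp [Fintype.card_perm, Nat.factorial])
  · exact ncard_range_of_injective (f := fun p : Fin 3 × Bool => Family.IS p.1 p.2)
      (fun a b e => by simpa [Prod.ext_iff] using e) fun F => by cases F <;> simp [Family.cls]
  · exact ncard_range_of_injective (f := Family.EO) (fun a b e => by simpa using e)
      fun F => by cases F <;> simp [Family.cls]
  · exact ncard_range_of_injective (f := Family.LO) (fun a b e => by simpa using e)
      fun F => by cases F <;> simp [Family.cls]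

lemma IsTriple.exists_perm {i j k : Fin 3} (h : IsTriple i j k) :
    ∃ σ : Equiv.Perm (Fin 3), σ 0 = i ∧ σ 1 = j ∧ σ 2 = k := by
  have hinj : Function.Injective ![i, j, k] := by
    obtain ⟨h1, h2, h3⟩ := h
    intro a b hab
    fin_cases a <;> fin_cases b <;> simp_all
  exact ⟨Equiv.ofBijective _ (Finite.injective_iff_bijective.1 hinj), rfl, rfl, rfl⟩

section members

variable {r : Fin 3 → ℝ} {i j k : Fin 3} (h : IsTriple i j k) {q : Config} {o : Bool}

lemma IsTriple.eq_succ (h : IsTriple i j k) : (i = j + 1 ∧ k = j + 2) ∨ (i = j + 2 ∧ k = j + 1) := by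
  rcases isTriple_zero_one_two.cases h with ⟨rfl, rfl, rfl⟩ | ⟨rfl, rfl, rfl⟩ | ⟨rfl, rfl, rfl⟩ |
      ⟨rfl, rfl, rfl⟩ | ⟨rfl, rfl, rfl⟩ | ⟨rfl, rfl, rfl⟩ <;> decide

include h

lemma mem_TR_iff : (Family.TR j o).Mem r q ↔ IsTR r i j k o q := by
  rcases h.eq_succ with ⟨rfl, rfl⟩ | ⟨rfl, rfl⟩
  · rfl
  · change IsTR r (j + 1) j (j + 2) o q ↔ _
    unfold IsTR
    rw [contact_comm (i := j + 1), contact_comm (i := j) (j := j + 2),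
      contact_comm (i := j + 2) (j := j + 1)]
    tauto

lemma mem_ER_iff : (Family.ER j).Mem r q ↔ IsER r i j k q := by
  rcases h.eq_succ with ⟨rfl, rfl⟩ | ⟨rfl, rfl⟩
  · rfl
  · change IsER r (j + 1) j (j + 2) q ↔ _
    unfold IsER
    rw [contact_comm (i := j + 1), contact_comm (i := j) (j := j + 2), sbtw_comm]
    tauto

lemma mem_EO_iff : (Family.EO j).Mem r q ↔ IsEO r i j k q := by
  rcases h.eq_succ with ⟨rfl, rfl⟩ | ⟨rfl, rfl⟩
  · rfl
  · change IsEO r (j + 1) j (j + 2) q ↔ _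
    unfold IsEO
    rw [contact_comm (i := j + 1), contact_comm (i := j) (j := j + 2), sbtw_comm]
    tauto

lemma mem_IS_iff : (Family.IS k o).Mem r q ↔ IsIS r i j k o q := by
  rcases h.rotate.eq_succ with ⟨rfl, rfl⟩ | ⟨rfl, rfl⟩
  · change IsIS r (k + 1) (k + 2) k o q ↔ _
    unfold IsIS
    rw [contact_comm (i := k + 1) (j := k + 2), contact_comm (i := k + 2) (j := k),
      contact_comm (i := k) (j := k + 1), eq_comm (a := ‖q k - q (k + 1)‖)]
    tauto
  · rfl

omit h in
lemma mem_EA_iff {σ : Equiv.Perm (Fin 3)} (h0 : σ 0 = i) (h1 : σ 1 = j) (h2 : σ 2 = k) :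
    (Family.EA σ).Mem r q ↔ IsEA r i j k q := by
  subst h0 h1 h2; rfl

end members

/-! ### Every relative equilibrium lies in exactly one family -/

section classification

variable {r : Fin 3 → ℝ} (hs : IsSizes r) {q : Config} {H : ℝ}

/-- The pair of bodies opposite to `l` is in contact. -/
def Family.contacts : Family → Fin 3 → Bool
  | .LR _ => fun _ => true
  | .ER j => fun l => l ≠ j
  | .TR j _ => fun l => l ≠ j
  | .EA σ => fun l => l = σ 2
  | .IS k _ => fun l => l = k
  | .EO _ => fun _ => false
  | .LO _ => fun _ => false

def Family.orient : Family → Option Bool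
  | .LR o | .TR _ o | .IS _ o | .LO o => some o
  | _ => none

def Family.middle : Family → Option (Fin 3)
  | .ER j | .EO j => some j
  | .EA σ => some (σ 1)
  | _ => none

/-- Contact pattern, orientation and middle body can all be read off an admissible configuration. As
they separate the 28 families, a configuration belongs to at most one. -/
lemma family_ext {F G : Family} (h1 : F.contacts = G.contacts) (h2 : F.orient = G.orient)
    (h3 : F.middle = G.middle) : F = G := by
  have c0 := congrFun h1 0
  have c1 := congrFun h1 1
  have c2 := congrFun h1 2
  clear h1
  have k1 : ∀ j j' : Fin 3, decide (0 = j) = decide (0 = j') → decide (1 = j) = decide (1 = j') →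
      decide (2 = j) = decide (2 = j') → j = j' := by decide
  have k2 : ∀ j j' : Fin 3, decide (0 ≠ j) = decide (0 ≠ j') → decide (1 ≠ j) = decide (1 ≠ j') →
      decide (2 ≠ j) = decide (2 ≠ j') → j = j' := by decide
  have k3 : ∀ j j' : Fin 3, decide (0 ≠ j) = decide (0 = j') → decide (1 ≠ j) = decide (1 = j') →
      decide (2 ≠ j) = decide (2 = j') → False := by decide
  have k4 : ∀ (b : Bool) (j : Fin 3), decide (0 ≠ j) = b → decide (1 ≠ j) = b →
      decide (2 ≠ j) = b → False := by decide
  have k5 : ∀ (b : Bool) (j : Fin 3), decide (0 = j) = b → decide (1 = j) = b →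
      decide (2 = j) = b → False := by decide
  cases F <;> cases G <;> simp only [Family.orient, Family.middle, Family.contacts, reduceCtorEq,
    Option.some.injEq] at h2 h3 c0 c1 c2
  case EA.EA σ τ =>
    have e2 := k1 _ _ c0 c1 c2
    congr 1
    ext l : 1
    have : ∀ l : Fin 3, l = 0 ∨ l = 1 ∨ l = 2 := by decide
    rcases this l with rfl | rfl | rfl
    · have t : IsTriple (σ 0) (σ 1) (σ 2) := ⟨σ.injective.ne (by decide),
        σ.injective.ne (by decide), σ.injective.ne (by decide)⟩
      rcases t.eq_or (τ 0) with h | h | h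
      · exact h.symm
      · exact absurd (h.trans h3) (τ.injective.ne (by decide))
      · exact absurd (h.trans e2) (τ.injective.ne (by decide))
    · exact h3
    · exact e2
  all_goals first
    | (subst h2; rfl)
    | (subst h3; rfl)
    | exact (k3 _ _ c0 c1 c2).elim
    | exact (k3 _ _ c0.symm c1.symm c2.symm).elim
    | exact (k4 _ _ c0 c1 c2).elim
    | exact (k4 _ _ c0.symm c1.symm c2.symm).elim
    | exact (k5 _ _ c0 c1 c2).elim
    | exact (k5 _ _ c0.symm c1.symm c2.symm).elim
    | (subst h2; rw [k1 _ _ c0 c1 c2])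
    | (subst h2; rw [k2 _ _ c0 c1 c2])

omit hs in
lemma contact_iff_of_triple {a b c i j k : Fin 3} {p : Fin 3 → Prop} (h : IsTriple a b c)
    (h1 : Contact r q a b ↔ p c) (h2 : Contact r q b c ↔ p a) (h3 : Contact r q c a ↔ p b)
    (h' : IsTriple i j k) : Contact r q i j ↔ p k := by
  rcases h.cases h' with ⟨rfl, rfl, rfl⟩ | ⟨rfl, rfl, rfl⟩ | ⟨rfl, rfl, rfl⟩ |
    ⟨rfl, rfl, rfl⟩ | ⟨rfl, rfl, rfl⟩ | ⟨rfl, rfl, rfl⟩ <;>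
  first
  | assumption
  | (rw [contact_comm]; assumption)

include hs

lemma sbtw_not_contact {a b c : Fin 3} (h : IsTriple a b c) (ha : Admissible r q)
    (hq : Sbtw ℝ (q a) (q b) (q c)) : ¬ Contact r q c a := by
  refine not_contact_of_lt ?_
  have := norm_add_of_sbtw hq
  linarith [ha a b h.ij, ha b c h.jk, hs.pos b]

lemma Family.Mem.contact_iff {F : Family} (hm : F.Mem r q) (ha : Admissible r q)
    {i j k : Fin 3} (h : IsTriple i j k) : Contact r q i j ↔ F.contacts k = true := by
  cases F with
  | LR o => exact iff_of_true (hm.1 i j h.ij) rfl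
  | ER j' =>
    have t := isTriple_of_middle (i := j' + 1) (j := j') (k := j' + 2) rfl rfl
    obtain ⟨c1, c2, hq⟩ := hm
    refine contact_iff_of_triple (p := fun k => Family.contacts (.ER j') k = true) t
      (iff_of_true c1 ?_) (iff_of_true c2 ?_) (iff_of_false (sbtw_not_contact hs t ha hq) ?_) h
    · simp [Family.contacts]
    · simp [Family.contacts]
    · simp [Family.contacts]
  | TR j' o =>
    have t := isTriple_of_middle (i := j' + 1) (j := j') (k := j' + 2) rfl rfl
    obtain ⟨c1, c2, c3, ho⟩ := hm
    refine contact_iff_of_triple (p := fun k => Family.contacts (.TR j' o) k = true) t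
      (iff_of_true c1 ?_) (iff_of_true c2 ?_) (iff_of_false c3 ?_) h
    · simp [Family.contacts]
    · simp [Family.contacts]
    · simp [Family.contacts]
  | EA σ =>
    have t : IsTriple (σ 0) (σ 1) (σ 2) := ⟨σ.injective.ne (by decide), σ.injective.ne (by decide),
      σ.injective.ne (by decide)⟩
    obtain ⟨c1, c2, hq⟩ := hm
    refine contact_iff_of_triple (p := fun k => Family.contacts (.EA σ) k = true) t
      (iff_of_true c1 ?_) (iff_of_false c2 ?_) (iff_of_false (sbtw_not_contact hs t ha hq) ?_) h
    · simp [Family.contacts]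
    · simp [Family.contacts]
    · simp [Family.contacts]
  | IS k' o =>
    have t := isTriple_of_last (i := k' + 1) (j := k' + 2) (k := k') rfl rfl
    obtain ⟨c1, c2, c3, -, ho⟩ := hm
    refine contact_iff_of_triple (p := fun k => Family.contacts (.IS k' o) k = true) t
      (iff_of_true c1 ?_) (iff_of_false c2 ?_) (iff_of_false c3 ?_) h
    · simp [Family.contacts]
    · simp [Family.contacts]
    · simp [Family.contacts]
  | EO j' =>
    have t := isTriple_of_middle (i := j' + 1) (j := j') (k := j' + 2) rfl rfl
    obtain ⟨c1, c2, hq⟩ := hm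
    refine contact_iff_of_triple (p := fun k => Family.contacts (.EO j') k = true) t
      (iff_of_false c1 ?_) (iff_of_false c2 ?_) (iff_of_false (sbtw_not_contact hs t ha hq) ?_) h
    all_goals simp [Family.contacts]
  | LO o => exact iff_of_false (hm.1 i j h.ij).1 (by simp [Family.contacts])

omit hs in
lemma oriented_unique {o o' : Bool} (h : Oriented o q) (h' : Oriented o' q) : o = o' := by
  cases o <;> cases o' <;> simp only [Oriented] at h h' <;> first | rfl | (simp at h h'; linarith)

omit hs in
lemma not_oriented_of_sbtw {i j k : Fin 3} (h : IsTriple i j k) (hq : Sbtw ℝ (q i) (q j) (q k))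
    {o : Bool} (ho : Oriented o q) : False :=
  ho.cross_ne h (cross_eq_zero_of_add (norm_add_of_sbtw hq))

/-- The middle body is determined by the configuration. -/
lemma sbtw_unique {i j k i' j' k' : Fin 3} (h : IsTriple i j k) (h' : IsTriple i' j' k')
    (ha : Admissible r q)
    (hq : Sbtw ℝ (q i) (q j) (q k)) (hq' : Sbtw ℝ (q i') (q j') (q k')) : j = j' := by
  have e := norm_add_of_sbtw hq
  have e' := norm_add_of_sbtw hq'
  have p1 := ha.dist_pos hs h.ij
  have p2 := ha.dist_pos hs h.jk
  rcases h.cases h' with ⟨rfl, rfl, rfl⟩ | ⟨rfl, rfl, rfl⟩ | ⟨rfl, rfl, rfl⟩ |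
    ⟨rfl, rfl, rfl⟩ | ⟨rfl, rfl, rfl⟩ | ⟨rfl, rfl, rfl⟩
  all_goals first
    | rfl
    | linarith [norm_sub_rev (q i') (q j'), norm_sub_rev (q j') (q k'), norm_sub_rev (q k') (q i')]

omit hs in
lemma Family.Mem.frame {F : Family} (hm : F.Mem r q) :
    (∃ o, F.orient = some o ∧ F.middle = none ∧ Oriented o q) ∨
    (∃ i j k, IsTriple i j k ∧ F.orient = none ∧ F.middle = some j ∧
      Sbtw ℝ (q i) (q j) (q k)) := by
  cases F with
  | LR o => exact Or.inl ⟨o, rfl, rfl, hm.2⟩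
  | TR j o => exact Or.inl ⟨o, rfl, rfl, hm.2.2.2⟩
  | IS k o => exact Or.inl ⟨o, rfl, rfl, hm.2.2.2.2⟩
  | LO o => exact Or.inl ⟨o, rfl, rfl, hm.2⟩
  | ER j => exact Or.inr ⟨_, j, _, isTriple_of_middle rfl rfl, rfl, rfl, hm.2.2⟩
  | EO j => exact Or.inr ⟨_, j, _, isTriple_of_middle rfl rfl, rfl, rfl, hm.2.2⟩
  | EA σ => exact Or.inr ⟨σ 0, σ 1, σ 2, ⟨σ.injective.ne (by decide), σ.injective.ne (by decide),
      σ.injective.ne (by decide)⟩, rfl, rfl, hm.2.2⟩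

lemma family_unique {F G : Family} (hF : F.Mem r q) (hG : G.Mem r q) (ha : Admissible r q) :
    F = G := by
  have h1 : F.contacts = G.contacts := by
    funext l
    have t := isTriple_of_last (i := l + 1) (j := l + 2) (k := l) rfl rfl
    rw [Bool.eq_iff_iff, ← hF.contact_iff hs ha t, ← hG.contact_iff hs ha t]
  rcases hF.frame with ⟨o, e1, e2, ho⟩ | ⟨i, j, k, t, e1, e2, hq⟩ <;>
    rcases hG.frame with ⟨o', e1', e2', ho'⟩ | ⟨i', j', k', t', e1', e2', hq'⟩
  · refine family_ext h1 ?_ (e2.trans e2'.symm)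
    rw [e1, e1', oriented_unique ho ho']
  · exact (not_oriented_of_sbtw t' hq' ho).elim
  · exact (not_oriented_of_sbtw t hq ho').elim
  · refine family_ext h1 (e1.trans e1'.symm) ?_
    rw [e2, e2', sbtw_unique hs t t' ha hq hq']

/-- Aligned configurations are sorted by their contacts alone. In a proper triangle a pair apart
satisfies H = I / d^(3/2), so all pairs apart are equally long: one contact leaves an isosceles
triangle, none an equilateral one. -/
lemma exists_family (hH : 0 ≤ H) (hr : IsRelEq r H q) : ∃ F : Family, F.Mem r q := by
  have ha := hr.admissible
  have t := isTriple_zero_one_two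
  have iso : ∀ {i j k : Fin 3} {o : Bool}, IsTriple i j k → Oriented o q → ¬ Contact r q j k →
      ¬ Contact r q k i → ‖q k - q i‖ = ‖q k - q j‖ := by
    intro i j k o h ho c1 c2
    obtain ⟨-, -, -, h2, h3⟩ := (relEq_oriented_iff hs h ho hH rfl rfl rfl).1 hr
    have e := (h2.2 c1).symm.trans (h3.2 c2)
    have hI := hs.inertiaOf_pos i j k ‖q i - q j‖ ‖q j - q k‖ ‖q k - q i‖
    have p1 := ha.dist_pos hs h.jk
    have p2 := ha.dist_pos hs h.ki
    rw [norm_sub_rev (q k) (q j)]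
    exact le_antisymm ((div_rpow_le_iff hI p1 p2).1 e.le) ((div_rpow_le_iff hI p2 p1).1 e.ge)
  by_cases hc : cross 0 1 2 q = 0
  · have key : ∀ {i j k : Fin 3}, IsTriple i j k → Sbtw ℝ (q i) (q j) (q k) →
        ∃ F : Family, F.Mem r q := by
      intro i j k h hq
      by_cases c1 : Contact r q i j <;> by_cases c2 : Contact r q j k
      · exact ⟨.ER j, (mem_ER_iff h).2 ⟨c1, c2, hq⟩⟩
      · obtain ⟨σ, h0, h1, h2⟩ := h.exists_perm
        exact ⟨.EA σ, (mem_EA_iff h0 h1 h2).2 ⟨c1, c2, hq⟩⟩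
      · obtain ⟨σ, h0, h1, h2⟩ := h.swap.exists_perm
        exact ⟨.EA σ, (mem_EA_iff h0 h1 h2).2 ⟨contact_comm.1 c2, fun c => c1 (contact_comm.1 c),
          sbtw_comm.1 hq⟩⟩
      · exact ⟨.EO j, (mem_EO_iff h).2 ⟨c1, c2, hq⟩⟩
    rcases exists_sbtw_of_cross (ha.ne hs t.ij) (ha.ne hs t.jk) (ha.ne hs t.ki) hc with hq | hq | hq
    · exact key t hq
    · exact key t.rotate hq
    · exact key t.rotate.rotate hq
  · obtain ⟨o, ho⟩ := exists_oriented t hc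
    have two : ∀ {i j k : Fin 3}, IsTriple i j k → Contact r q i j → Contact r q j k →
        ¬ Contact r q k i → ∃ F : Family, F.Mem r q := fun h c1 c2 c3 =>
      ⟨.TR _ o, (mem_TR_iff h).2 ⟨c1, c2, c3, ho⟩⟩
    have one : ∀ {i j k : Fin 3}, IsTriple i j k → Contact r q i j → ¬ Contact r q j k →
        ¬ Contact r q k i → ∃ F : Family, F.Mem r q := fun h c1 c2 c3 =>
      ⟨.IS _ o, (mem_IS_iff h).2 ⟨c1, c2, c3, iso h ho c2 c3, ho⟩⟩
    by_cases c1 : Contact r q 0 1 <;> by_cases c2 : Contact r q 1 2 <;> by_cases c3 : Contact r q 2 0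
    · exact ⟨.LR o, isLR_iff.2 ⟨⟨contact_comm.1 c3, contact_comm.1 c2, contact_comm.1 c1⟩, ho⟩⟩
    · exact two t c1 c2 c3
    · exact two t.rotate.rotate c3 c1 c2
    · exact one t c1 c2 c3
    · exact two t.rotate c2 c3 c1
    · exact one t.rotate c2 c3 c1
    · exact one t.rotate.rotate c3 c1 c2
    · have e1 := iso t.rotate.rotate ho c1 c2
      have e2 := iso t ho c2 c3
      rw [norm_sub_rev (q 1) (q 0)] at e1
      rw [norm_sub_rev (q 2) (q 1)] at e2
      exact ⟨.LO o, isLO_iff.2 ⟨⟨c1, c2, c3⟩, ⟨e1, e2.trans e1⟩, ho⟩⟩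

end classification

/-! ### The families as curves -/

/-- All meetings of families are obtained this way: an explicit continuous curve of members over
`D`, evaluated at a boundary point of `D`. -/
lemma mem_closure_branch {r : Fin 3 → ℝ} {F : Family} {γ : ℝ → Config} {g : ℝ → ℝ} {D : Set ℝ}
    {d : ℝ} (hγ : ContinuousAt γ d) (hg : ContinuousAt g d) (hd : d ∈ closure D)
    (hD : ∀ t ∈ D, (γ t, g t) ∈ branch r F) : (γ d, g d) ∈ closure (branch r F) :=
  ((hγ.prodMk hg).continuousWithinAt (s := D)).mem_closure hd hD

lemma continuousAt_placed_comp {r : Fin 3 → ℝ} {i j k : Fin 3} (h : IsTriple i j k) {ε : ℝ}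
    {x y z : ℝ → ℝ} {d : ℝ} (hx : ContinuousAt x d) (hy : ContinuousAt y d)
    (hz : ContinuousAt z d) (h0 : x d ≠ 0) :
    ContinuousAt (fun t => placed r i j ε (x t) (y t) (z t)) d :=
  (continuousAt_placed h (ε := ε) (p := (x d, y d, z d)) h0).comp
    (f := fun t => (x t, y t, z t)) (hx.prodMk (hy.prodMk hz))

lemma placed_centered {r : Fin 3 → ℝ} (hs : IsSizes r) (i j : Fin 3) (ε x y z : ℝ) :
    Centered r (placed r i j ε x y z) := centered_centerAt hs _

section curves

variable {r : Fin 3 → ℝ} (hs : IsSizes r) {i j k : Fin 3} (h : IsTriple i j k)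
include hs h

omit hs h in
lemma hTR_eq_chart (r : Fin 3 → ℝ) (i j k : Fin 3) (d : ℝ) : hTR r i j k d
    = (mass r i * mass r j * (r i + r j) ^ 2 + mass r j * mass r k * (r j + r k) ^ 2
      + ∑ l, ballInertia r l + mass r k * mass r i * d ^ 2) / d ^ (3 / 2 : ℝ) := by
  unfold hTR inertiaOf; ring

omit hs h in
lemma hIS_eq_chart (r : Fin 3 → ℝ) (i j k : Fin 3) (d : ℝ) : hIS r i j k d
    = (mass r i * mass r j * (r i + r j) ^ 2 + ∑ l, ballInertia r l
      + mass r k * (mass r i + mass r j) * d ^ 2) / d ^ (3 / 2 : ℝ) := by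
  unfold hIS inertiaOf; ring

omit hs h in
lemma hLO_eq_chart (r : Fin 3 → ℝ) (d : ℝ) : hLO r d
    = (∑ l, ballInertia r l + (mass r 0 * mass r 1 + mass r 1 * mass r 2 + mass r 2 * mass r 0)
      * d ^ 2) / d ^ (3 / 2 : ℝ) := by
  unfold hLO inertiaOf; ring

omit hs h in
lemma continuousAt_hTR {d : ℝ} (hd : 0 < d) : ContinuousAt (hTR r i j k) d := by
  rw [funext (hTR_eq_chart r i j k)]
  exact (hasDerivAt_chart _ _ hd).continuousAt

omit hs h in
lemma continuousAt_hIS {d : ℝ} (hd : 0 < d) : ContinuousAt (hIS r i j k) d := by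
  rw [funext (hIS_eq_chart r i j k)]
  exact (hasDerivAt_chart _ _ hd).continuousAt

omit hs h in
lemma continuousAt_hLO {d : ℝ} (hd : 0 < d) : ContinuousAt (hLO r) d := by
  rw [funext (hLO_eq_chart r)]
  exact (hasDerivAt_chart _ _ hd).continuousAt

omit hs h in
lemma continuousAt_hEO {ρ d : ℝ} (hd : 0 < d) : ContinuousAt (hEO r i j k ρ) d := by
  rw [funext (hEO_eq i j k ρ)]
  exact continuousAt_const.mul (hasDerivAt_chart _ _ hd).continuousAt

lemma branch_TR_of_norms {o : Bool} {q : Config} (hc : Centered r q) (ho : Oriented o q) {d : ℝ}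
    (ex : ‖q i - q j‖ = r i + r j) (ey : ‖q j - q k‖ = r j + r k) (ez : ‖q k - q i‖ = d)
    (hd : d ∈ domTR r i j k) : (q, hTR r i j k d) ∈ branch r (.TR j o) := by
  obtain ⟨h1, h2, h3⟩ := isTR_of_norms hs h hc ho ex ey ez hd
  exact ⟨h1, (mem_TR_iff h).2 h2, h3⟩

lemma branch_IS_of_norms {o : Bool} {q : Config} (hc : Centered r q) (ho : Oriented o q) {d : ℝ}
    (ex : ‖q i - q j‖ = r i + r j) (ey : ‖q j - q k‖ = d) (ez : ‖q k - q i‖ = d)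
    (hd : d ∈ domIS r i j k) : (q, hIS r i j k d) ∈ branch r (.IS k o) := by
  obtain ⟨h1, h2, h3⟩ := isIS_of_norms hs h hc ho ex ey ez hd
  exact ⟨h1, (mem_IS_iff h).2 h2, h3⟩

lemma branch_EO_of_norms {ρ : ℝ} (hρ : IsEulerRatio r i j k ρ) {q : Config} (hc : Centered r q)
    {d : ℝ} (hq : Sbtw ℝ (q i) (q j) (q k)) (ex : ‖q i - q j‖ = ρ * d) (ez : ‖q k - q i‖ = d)
    (hd : d ∈ domEO r i j k ρ) : (q, hEO r i j k ρ d) ∈ branch r (.EO j) := by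
  obtain ⟨h1, h2, h3⟩ := isEO_of_norms hs h hρ hc hq ex ez hd
  exact ⟨h1, (mem_EO_iff h).2 h2, h3⟩

lemma branch_EA_of_norms {σ : Equiv.Perm (Fin 3)} (h0 : σ 0 = i) (h1 : σ 1 = j) (h2 : σ 2 = k)
    {q : Config} (hc : Centered r q) {x : ℝ} (hq : Sbtw ℝ (q i) (q j) (q k))
    (ex : ‖q i - q j‖ = r i + r j) (ez : ‖q k - q i‖ = x) (hd : x ∈ domEA r i j k) :
    (q, hEA r i j k x) ∈ branch r (.EA σ) := by
  obtain ⟨e1, e2, e3⟩ := isEA_of_norms hs h hc hq ex ez hd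
  exact ⟨e1, (mem_EA_iff h0 h1 h2).2 e2, e3⟩

omit h in
lemma branch_LO_of_norms {o : Bool} {q : Config} (hc : Centered r q) (ho : Oriented o q) {d : ℝ}
    (ex : ‖q 0 - q 1‖ = d) (ey : ‖q 1 - q 2‖ = d) (ez : ‖q 2 - q 0‖ = d)
    (hd : d ∈ Ioi (r 0 + r 1)) : (q, hLO r d) ∈ branch r (.LO o) :=
  isLO_of_norms hs hc ho ex ey ez hd

omit h in
lemma domTR_pos {d : ℝ} (hd : d ∈ domTR r i j k) : IsTriangle (r i + r j) (r j + r k) d ∧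
    r i + r j < r j + r k + d ∧ r j + r k < d + (r i + r j) ∧ d < r i + r j + (r j + r k) := by
  have hi := hs.pos i; have hj := hs.pos j; have hk := hs.pos k
  obtain ⟨d1, d2, d3, d4⟩ := hd
  rw [restLength_eq] at d4
  refine ⟨⟨?_, ?_, ?_, ?_, ?_, ?_⟩, ?_, ?_, ?_⟩ <;> linarith

lemma isCurveFamily_TR (o : Bool) : IsCurveFamily r (.TR j o) (fun q => ‖q k - q i‖)
    (domTR r i j k) (hTR r i j k) := by
  have hi := hs.pos i; have hj := hs.pos j; have hk := hs.pos k
  refine ⟨?_, ?_, ?_, ?_, ?_, ?_⟩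
  · obtain ⟨d, h1, h2⟩ := exists_between (show max (max (r i + r j) (r j + r k)) (r k + r i)
      < restLength r i j k by rw [max_lt_iff, max_lt_iff]; unfold restLength
                              refine ⟨⟨?_, ?_⟩, ?_⟩ <;> linarith)
    rw [max_lt_iff, max_lt_iff] at h1
    exact ⟨d, h1.1.1.le, h1.1.2.le, h1.2, h2⟩
  · exact ⟨fun x hx y hy t ht => ⟨hx.1.trans ht.1, hx.2.1.trans ht.1, hx.2.2.1.trans_le ht.1,
      ht.2.trans_lt hy.2.2.2⟩⟩
  · exact fun d hd => (continuousAt_hTR (by linarith [hd.1])).continuousWithinAt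
  · rintro ⟨q, H⟩ ⟨hH, hm, hr⟩
    exact ((mem_TR_iff h).1 hm).relEq hs h hH hr
  · intro d hd
    obtain ⟨ε, hε, ho⟩ := exists_placed_oriented r h o
    obtain ⟨t, t1, t2, t3⟩ := domTR_pos hs hd
    exact ⟨_, branch_TR_of_norms hs h (placed_centered hs ..) (ho _ _ _ t t1 t2 t3)
      (norm_placed_ij h hε t) (norm_placed_jk h hε t) (norm_placed_ki h hε t) hd,
      norm_placed_ki h hε t⟩
  · rintro ⟨q, H⟩ ⟨hH, hm, hr⟩ ⟨q', H'⟩ ⟨hH', hm', hr'⟩ e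
    obtain ⟨c1, c2, -, ho⟩ := (mem_TR_iff h).1 hm
    obtain ⟨c1', c2', -, ho'⟩ := (mem_TR_iff h).1 hm'
    exact congruent_of_oriented h (hr.admissible.ne hs h.ij) (c1'.trans c1.symm)
      (c2'.trans c2.symm) e.symm ho ho'

omit h in
lemma domIS_pos {d : ℝ} (hd : r i + r j ≤ d) : IsTriangle (r i + r j) d d ∧
    r i + r j < d + d ∧ d < d + (r i + r j) ∧ d < r i + r j + d := by
  have hi := hs.pos i; have hj := hs.pos j
  refine ⟨⟨?_, ?_, ?_, ?_, ?_, ?_⟩, ?_, ?_, ?_⟩ <;> linarith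

omit hs h in
lemma isTriangle_equilateral {d : ℝ} (hd : 0 < d) : IsTriangle d d d := by
  refine ⟨?_, ?_, ?_, ?_, ?_, ?_⟩ <;> linarith

omit hs h in
lemma IsIS.norm_eq {o : Bool} {q : Config} (hm : IsIS r i j k o q) :
    ‖q j - q k‖ = ‖q k - q i‖ := by rw [norm_sub_rev, hm.2.2.2.1]

lemma isCurveFamily_IS (o : Bool) : IsCurveFamily r (.IS k o) (fun q => ‖q k - q i‖)
    (domIS r i j k) (hIS r i j k) := by
  have hi := hs.pos i; have hj := hs.pos j; have hk := hs.pos k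
  refine ⟨?_, ?_, ?_, ?_, ?_, ?_⟩
  · exact ⟨r i + r j + r k, by linarith, by linarith, by linarith⟩
  · exact ⟨fun x hx y hy t ht => ⟨hx.1.trans ht.1, hx.2.1.trans_le ht.1, hx.2.2.trans_le ht.1⟩⟩
  · exact fun d hd => (continuousAt_hIS (by linarith [hd.1])).continuousWithinAt
  · rintro ⟨q, H⟩ ⟨hH, hm, hr⟩
    exact ((mem_IS_iff h).1 hm).relEq hs h hH hr
  · intro d hd
    obtain ⟨ε, hε, ho⟩ := exists_placed_oriented r h o
    obtain ⟨t, t1, t2, t3⟩ := domIS_pos hs hd.1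
    exact ⟨_, branch_IS_of_norms hs h (placed_centered hs ..) (ho _ _ _ t t1 t2 t3)
      (norm_placed_ij h hε t) (norm_placed_jk h hε t) (norm_placed_ki h hε t) hd,
      norm_placed_ki h hε t⟩
  · rintro ⟨q, H⟩ ⟨hH, hm, hr⟩ ⟨q', H'⟩ ⟨hH', hm', hr'⟩ e
    have m := (mem_IS_iff h).1 hm
    have m' := (mem_IS_iff h).1 hm'
    have e : ‖q k - q i‖ = ‖q' k - q' i‖ := e
    refine congruent_of_oriented h (hr.admissible.ne hs h.ij) (m'.1.trans m.1.symm) ?_ e.symm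
      m.2.2.2.2 m'.2.2.2.2
    rw [m.norm_eq, m'.norm_eq, e]

omit h in
lemma isCurveFamily_LO (o : Bool) : IsCurveFamily r (.LO o) (fun q => ‖q 0 - q 1‖)
    (Ioi (r 0 + r 1)) (hLO r) := by
  have h0 := hs.pos 0; have h1 := hs.pos 1
  have h := isTriple_zero_one_two
  refine ⟨nonempty_Ioi, ordConnected_Ioi, ?_, ?_, ?_, ?_⟩
  · intro d hd
    have : r 0 + r 1 < d := hd
    exact (continuousAt_hLO (by linarith)).continuousWithinAt
  · rintro ⟨q, H⟩ ⟨hH, hm, hr⟩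
    exact IsLO.relEq hs hm hH hr
  · intro d hd
    have hd' : r 0 + r 1 < d := hd
    have hd0 : 0 < d := by linarith
    obtain ⟨ε, hε, ho⟩ := exists_placed_oriented r h o
    have t := isTriangle_equilateral hd0
    exact ⟨_, branch_LO_of_norms hs (placed_centered hs ..) (ho _ _ _ t (by linarith) (by linarith)
      (by linarith)) (norm_placed_ij h hε t) (norm_placed_jk h hε t) (norm_placed_ki h hε t) hd,
      norm_placed_ij h hε t⟩
  · rintro ⟨q, H⟩ ⟨hH, hm, hr⟩ ⟨q', H'⟩ ⟨hH', hm', hr'⟩ e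
    have e : ‖q 0 - q 1‖ = ‖q' 0 - q' 1‖ := e
    obtain ⟨-, ⟨e1, e2⟩, ho⟩ := isLO_iff.1 hm
    obtain ⟨-, ⟨e1', e2'⟩, ho'⟩ := isLO_iff.1 hm'
    exact congruent_of_oriented h (hr.admissible.ne hs h.ij) e.symm (by rw [e1, e1', e])
      (by rw [e2, e2', e]) ho ho'

lemma isCurveFamily_EA {σ : Equiv.Perm (Fin 3)} (h0 : σ 0 = i) (h1 : σ 1 = j) (h2 : σ 2 = k) :
    IsCurveFamily r (.EA σ) (fun q => ‖q k - q i‖) (domEA r i j k) (hEA r i j k) := by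
  have hi := hs.pos i; have hj := hs.pos j; have hk := hs.pos k
  obtain ⟨ρ, hρ, -⟩ := existsUnique_isEulerRatio hs i j k
  refine ⟨?_, ?_, ?_, ?_, ?_, ?_⟩
  · rcases le_or_gt (r i + r j) (ρ * restLength r i j k) with hle | hlt
    · rw [domEA_eq_Ioi hs hρ hle]; exact nonempty_Ioi
    · rw [(domEA_eq_Ici hs hρ hlt).2]; exact nonempty_Ici
  · rcases le_or_gt (r i + r j) (ρ * restLength r i j k) with hle | hlt
    · rw [domEA_eq_Ioi hs hρ hle]; exact ordConnected_Ioi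
    · rw [(domEA_eq_Ici hs hρ hlt).2]; exact ordConnected_Ici
  · exact (continuousOn_hEA hs h).mono fun x hx => (lt_restLength hs).trans hx.1
  · rintro ⟨q, H⟩ ⟨hH, hm, hr⟩
    exact ((mem_EA_iff h0 h1 h2).1 hm).relEq hs h hH hr
  · intro x hx
    have hx' : restLength r i j k < x := hx.1
    rw [restLength_eq] at hx'
    obtain ⟨t, hq⟩ := sbtw_placed (r := r) h (x := r i + r j) (y := x - (r i + r j)) (z := x)
      (by linarith) (by linarith) (by ring) (Or.inl rfl)
    exact ⟨_, branch_EA_of_norms hs h h0 h1 h2 (placed_centered hs ..) hq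
      (norm_placed_ij h (Or.inl rfl) t) (norm_placed_ki h (Or.inl rfl) t) hx,
      norm_placed_ki h (Or.inl rfl) t⟩
  · rintro ⟨q, H⟩ ⟨hH, hm, hr⟩ ⟨q', H'⟩ ⟨hH', hm', hr'⟩ e
    have e : ‖q k - q i‖ = ‖q' k - q' i‖ := e
    obtain ⟨c, -, hq⟩ := (mem_EA_iff h0 h1 h2).1 hm
    obtain ⟨c', -, hq'⟩ := (mem_EA_iff h0 h1 h2).1 hm'
    have n := norm_add_of_sbtw hq
    have n' := norm_add_of_sbtw hq'
    have c2 := c'.trans c.symm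
    exact congruent_of_collinear h (hr.admissible.ne hs h.ij) c2 (by linarith) e.symm
      (cross_eq_zero_of_add n)

lemma isCurveFamily_EO {ρ : ℝ} (hρ : IsEulerRatio r i j k ρ) :
    IsCurveFamily r (.EO j) (fun q => ‖q k - q i‖) (domEO r i j k ρ) (hEO r i j k ρ) := by
  have hi := hs.pos i; have hj := hs.pos j; have hk := hs.pos k
  have hpos : ∀ d ∈ domEO r i j k ρ, 0 < ρ * d ∧ 0 < (1 - ρ) * d ∧ 0 < d := by
    intro d hd
    obtain ⟨h1, h2⟩ := (mem_domEO hρ.1 hρ.2.1).1 hd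
    refine ⟨?_, ?_, ?_⟩ <;> linarith
  refine ⟨nonempty_Ioi, ordConnected_Ioi, ?_, ?_, ?_, ?_⟩
  · exact fun d hd => (continuousAt_hEO (hpos d hd).2.2).continuousWithinAt
  · rintro ⟨q, H⟩ ⟨hH, hm, hr⟩
    exact (((mem_EO_iff h).1 hm).relEq hs h hρ hH hr).2
  · intro d hd
    obtain ⟨p1, p2, p3⟩ := hpos d hd
    obtain ⟨t, hq⟩ := sbtw_placed (r := r) h (z := d) p1 p2 (by ring) (Or.inl rfl)
    exact ⟨_, branch_EO_of_norms hs h hρ (placed_centered hs ..) hq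
      (norm_placed_ij h (Or.inl rfl) t) (norm_placed_ki h (Or.inl rfl) t) hd,
      norm_placed_ki h (Or.inl rfl) t⟩
  · rintro ⟨q, H⟩ ⟨hH, hm, hr⟩ ⟨q', H'⟩ ⟨hH', hm', hr'⟩ e
    have e : ‖q k - q i‖ = ‖q' k - q' i‖ := e
    have m := (mem_EO_iff h).1 hm
    have m' := (mem_EO_iff h).1 hm'
    have n := norm_add_of_sbtw m.2.2
    have n' := norm_add_of_sbtw m'.2.2
    have x := (m.relEq hs h hρ hH hr).1
    have x' := (m'.relEq hs h hρ hH' hr').1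
    rw [← e, ← x] at x'
    exact congruent_of_collinear h (hr.admissible.ne hs h.ij) x' (by linarith) e.symm
      (cross_eq_zero_of_add n)

end curves

/-! ### Shape of the angular momentum and stability along the families -/

section vertices

variable {r : Fin 3 → ℝ} (hs : IsSizes r) {i j k : Fin 3} (h : IsTriple i j k)
include hs

lemma bend_const_pos (i j k : Fin 3) : 0 < mass r i * mass r j * (r i + r j) ^ 2
    + mass r j * mass r k * (r j + r k) ^ 2 + ∑ l, ballInertia r l := by
  have := hs.mass_pos i; have := hs.mass_pos j; have := hs.mass_pos k
  have := hs.sum_ballInertia_pos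
  positivity

/-- The turning point of the angular momentum along a transitional family. -/
def vertexTR (r : Fin 3 → ℝ) (i j k : Fin 3) : ℝ :=
  √(3 * (mass r i * mass r j * (r i + r j) ^ 2 + mass r j * mass r k * (r j + r k) ^ 2
    + ∑ l, ballInertia r l) / (mass r k * mass r i))

lemma vertexTR_spec (i j k : Fin 3) : 0 < vertexTR r i j k ∧
    StrictAntiOn (hTR r i j k) (Ioc 0 (vertexTR r i j k)) ∧
    StrictMonoOn (hTR r i j k) (Ici (vertexTR r i j k)) ∧
    ∀ d, 0 < d → (d < vertexTR r i j k ↔ mass r k * mass r i * d ^ 2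
      < 3 * (mass r i * mass r j * (r i + r j) ^ 2 + mass r j * mass r k * (r j + r k) ^ 2
        + ∑ l, ballInertia r l)) := by
  have hA := bend_const_pos hs i j k
  have hB := mul_pos (hs.mass_pos k) (hs.mass_pos i)
  rw [funext (hTR_eq_chart r i j k)]
  exact ⟨vertex_pos hA hB, strictAntiOn_chart hB (vertex_sq hA hB),
    strictMonoOn_chart hB (vertex_pos hA hB) (vertex_sq hA hB), fun d hd => lt_vertex_iff hB hd⟩

lemma pos_of_mem_domTR {d : ℝ} (hd : d ∈ domTR r i j k) : 0 < d := by
  have := hd.1; linarith [hs.pos i, hs.pos j]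

lemma vShaped_hTR (i j k : Fin 3) : VShaped (hTR r i j k) (domTR r i j k) (vertexTR r i j k) := by
  obtain ⟨hv, h1, h2, -⟩ := vertexTR_spec hs i j k
  exact ⟨h1.mono fun d hd => ⟨pos_of_mem_domTR hs hd.1, hd.2⟩, h2.mono fun d hd => hd.2⟩

lemma restLength_lt_vertexTR (h : IsTriple i j k) (hj : j ≠ 2) :
    restLength r i j k < vertexTR r i j k :=
  ((vertexTR_spec hs i j k).2.2.2 _ ((add_pos (hs.pos i) (hs.pos j)).trans (lt_restLength hs))).2
    (hTR_coeff_transitional hs h hj)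

lemma contact_lt_vertexTR : r 0 + r 1 < vertexTR r 0 2 1 := by
  refine ((vertexTR_spec hs 0 2 1).2.2.2 _ (add_pos (hs.pos 0) (hs.pos 1))).2 ?_
  exact hTR_coeff_contact hs

lemma strictAntiOn_hTR (h : IsTriple i j k) (hj : j ≠ 2) :
    StrictAntiOn (hTR r i j k) (domTR r i j k) :=
  (vertexTR_spec hs i j k).2.1.mono fun _ hd =>
    ⟨pos_of_mem_domTR hs hd, (hd.2.2.2.trans (restLength_lt_vertexTR hs h hj)).le⟩

lemma hBifurcation_hIS (h : IsTriple i j k) : HBifurcation (hIS r i j k) (domIS r i j k) := by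
  have mi := hs.mass_pos i; have mj := hs.mass_pos j
  have hA : 0 < mass r i * mass r j * (r i + r j) ^ 2 + ∑ l, ballInertia r l := by
    have := hs.sum_ballInertia_pos; positivity
  have hB := mul_pos (hs.mass_pos k) (add_pos mi mj)
  obtain ⟨a1, a2, a3⟩ := h.add_le hs
  refine ⟨_, ?_, vShaped_of_chart hB one_pos (vertex_pos hA hB) (vertex_sq hA hB) (fun d hd => ?_)
    fun d _ => by rw [hIS_eq_chart, one_mul]⟩
  · refine interior_maximal (t := Ioi (r 0 + r 1)) (fun d hd => ?_) isOpen_Ioi ?_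
    · have hd : r 0 + r 1 < d := hd
      exact ⟨by linarith, by linarith, by linarith⟩
    · exact (lt_vertex_iff hB (add_pos (hs.pos 0) (hs.pos 1))).2 (hIS_coeff hs h)
  · have := hd.1
    exact lt_of_lt_of_le (add_pos (hs.pos i) (hs.pos j)) this

omit hs in
lemma tendsto_hIS_div_sqrt (i j k : Fin 3) : Tendsto (fun d => hIS r i j k d / √d) atTop
    (𝓝 (mass r k * (mass r i + mass r j))) := by
  rw [funext fun d => congrArg (· / √d) (hIS_eq_chart r i j k d)]
  exact tendsto_chart_div_sqrt _ _

lemma hLO_coeff_pos : 0 < mass r 0 * mass r 1 + mass r 1 * mass r 2 + mass r 2 * mass r 0 := by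
  have := hs.mass_pos 0; have := hs.mass_pos 1; have := hs.mass_pos 2
  positivity

lemma vShaped_hLO : VShaped (hLO r) (Ioi (r 0 + r 1)) (√(3 * (∑ l, ballInertia r l)
    / (mass r 0 * mass r 1 + mass r 1 * mass r 2 + mass r 2 * mass r 0))) :=
  vShaped_of_chart (hLO_coeff_pos hs) one_pos (vertex_pos hs.sum_ballInertia_pos (hLO_coeff_pos hs))
    (vertex_sq hs.sum_ballInertia_pos (hLO_coeff_pos hs))
    (fun _ hd => (add_pos (hs.pos 0) (hs.pos 1)).trans hd)
    fun d _ => by rw [hLO_eq_chart, one_mul]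

lemma tendsto_hLO : Tendsto (hLO r) atTop atTop := by
  rw [funext (hLO_eq_chart r)]
  exact tendsto_chart (hLO_coeff_pos hs) _

variable {ρ : ℝ} (hρ : IsEulerRatio r i j k ρ)
include hρ

lemma pos_of_mem_domEO {d : ℝ} (hd : d ∈ domEO r i j k ρ) : 0 < d := by
  obtain ⟨h1, h2⟩ := (mem_domEO hρ.1 hρ.2.1).1 hd
  linarith [hs.pos i, hs.pos j, hs.pos k]

lemma vShaped_hEO : VShaped (hEO r i j k ρ) (domEO r i j k ρ)
    (√(3 * (∑ l, ballInertia r l) / eulerCoeff r i j k ρ)) :=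
  vShaped_of_chart (eulerCoeff_pos hs i j k ρ)
    (Real.sqrt_pos.2 (rateSq_pos hs i j hρ.1 hρ.2.1))
    (vertex_pos hs.sum_ballInertia_pos (eulerCoeff_pos hs i j k ρ))
    (vertex_sq hs.sum_ballInertia_pos (eulerCoeff_pos hs i j k ρ))
    (fun _ hd => pos_of_mem_domEO hs hρ hd) fun d _ => hEO_eq i j k ρ d

lemma tendsto_hEO : Tendsto (hEO r i j k ρ) atTop atTop := by
  rw [funext (hEO_eq i j k ρ)]
  exact (tendsto_chart (eulerCoeff_pos hs i j k ρ) _).const_mul_atTop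
    (Real.sqrt_pos.2 (rateSq_pos hs i j hρ.1 hρ.2.1))

end vertices

section stability

variable {r : Fin 3 → ℝ} (hs : IsSizes r) {i j k : Fin 3} (h : IsTriple i j k) {q : Config} {H : ℝ}
include hs

/-- Below the threshold all three contacts are pressed. At the threshold the contact of bodies `0`
and `1` carries no reaction, and h of the chain 0, 2, 1 decreases from there on, so letting these
two separate lowers the energy. -/
lemma IsLR.isStable_iff {o : Bool} (hm : IsLR r o q) (hH : 0 ≤ H) (hr : IsRelEq r H q) :
    IsStable r H q ↔ H < hTR r 0 2 1 (r 0 + r 1) := by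
  obtain ⟨⟨c1, c2, c3⟩, ho⟩ := isLR_iff.1 hm
  have h : IsTriple 0 2 (1 : Fin 3) := isTriple_zero_one_two.swapLeft.rotate
  have c1' : ‖q 0 - q 2‖ = r 0 + r 2 := c1
  have c2' : ‖q 2 - q 1‖ = r 2 + r 1 := c2
  have c3' : ‖q 1 - q 0‖ = r 0 + r 1 := by rw [add_comm]; exact c3
  have h0 := hs.pos 0; have h1 := hs.pos 1; have h2 := hs.pos 2
  have h01 := hs.le_left; have h12 := hs.le_right
  have hI := hs.inertiaOf_pos 0 2 1 (r 0 + r 2) (r 2 + r 1) (r 0 + r 1)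
  have hle := ((hm.relEq_iff hs hH).1 hr).2
  constructor
  · intro hst
    refine lt_of_le_of_ne hle fun e => ?_
    obtain ⟨hv, hanti, -, -⟩ := vertexTR_spec hs 0 2 1
    refine not_isStable_of_open hs h (ho.cross_ne h) (v := vertexTR r 0 2 1) ?_ ?_ ?_ hst
    · rw [c1', c2', c3']; exact e
    · rw [c3']; exact contact_lt_vertexTR hs
    · rw [c1', c2', c3']
      exact hanti.mono fun t ht => ⟨by linarith [ht.1], ht.2⟩
  · intro hlt
    have key : ∀ d, 0 < d → d ≤ r 0 + r 1 → (H / inertia r q) ^ 2 * d ^ 3 < 1 := by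
      intro d hd hle
      rw [inertia_eq r h, c1', c2', c3', kepler_lt_iff hH hI hd]
      exact hlt.trans_le ((div_rpow_le_iff hI (by linarith) hd).2 hle)
    refine isStable_of_three_contacts hs h hr c1 c2 c3 ?_ ?_ ?_
    · rw [c1']; exact key _ (by linarith) (by linarith)
    · rw [c2']; exact key _ (by linarith) (by linarith)
    · rw [c3']; exact key _ (by linarith) le_rfl

include h

/-- Before the vertex, opening the angle lowers the energy. At the vertex h is minimal, so E
increases on the way up to it from the left, and closing the angle lowers the energy. -/
lemma IsTR.not_isStable {o : Bool} (hm : IsTR r i j k o q) (hH : 0 ≤ H)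
    (hv : ‖q k - q i‖ ≤ vertexTR r i j k) : ¬ IsStable r H q := by
  intro hst
  obtain ⟨hd, e⟩ := hm.relEq hs h hH hst.1
  obtain ⟨c1, c2, -, ho⟩ := hm
  have c1' : ‖q i - q j‖ = r i + r j := c1
  have c2' : ‖q j - q k‖ = r j + r k := c2
  obtain ⟨v0, hanti, -, -⟩ := vertexTR_spec hs i j k
  have d0 := pos_of_mem_domTR hs hd
  have e' : H = inertiaOf r i j k ‖q i - q j‖ ‖q j - q k‖ ‖q k - q i‖
      / ‖q k - q i‖ ^ (3 / 2 : ℝ) := by rw [c1', c2']; exact e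
  rcases hv.lt_or_eq with hlt | heq
  · refine not_isStable_of_open hs h (ho.cross_ne h) e' hlt ?_ hst
    rw [c1', c2']
    exact hanti.mono fun t ht => ⟨d0.trans_le ht.1, ht.2⟩
  · obtain ⟨-, t1, t2, t3⟩ := domTR_pos hs hd
    refine not_isStable_of_close hs h (by rw [c1', c2']; exact t1) (by rw [c1', c2']; exact t2)
      hd.2.2.1 ?_ hst
    have hc := isCharted_bend hs i j k ‖q i - q j‖ ‖q j - q k‖ ‖q k - q i‖
    rw [← e'] at hc
    refine (hc.eventually_left ⟨d0, by linarith⟩ (half_lt_self d0) ?_).mono fun s => le_of_lt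
    rw [c1', c2']
    exact hanti.mono fun t ht => ⟨by linarith [ht.1], by rw [← heq]; exact ht.2⟩

/-- Both contact distances lie below the vertex and hence below d_ki, for which ω² d³ = 1; the
contacts are therefore pressed, and bending is controlled by the increasing h. -/
lemma IsTR.isStable {o : Bool} (hm : IsTR r i j k o q) (hH : 0 ≤ H) (hr : IsRelEq r H q)
    (hij : r i + r j < vertexTR r i j k) (hjk : r j + r k < vertexTR r i j k)
    (hv : vertexTR r i j k < ‖q k - q i‖) : IsStable r H q := by
  obtain ⟨hd, e⟩ := hm.relEq hs h hH hr
  obtain ⟨c1, c2, -, ho⟩ := hm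
  have c1' : ‖q i - q j‖ = r i + r j := c1
  have c2' : ‖q j - q k‖ = r j + r k := c2
  obtain ⟨v0, -, hmono, -⟩ := vertexTR_spec hs i j k
  have hI := hs.inertiaOf_pos i j k (r i + r j) (r j + r k) ‖q k - q i‖
  have d0 := pos_of_mem_domTR hs hd
  have key : ∀ d, 0 < d → d < ‖q k - q i‖ → (H / inertia r q) ^ 2 * d ^ 3 < 1 := by
    intro d hd hlt
    rw [inertia_eq r h, c1', c2', kepler_lt_iff hH hI hd, e]
    exact lt_of_le_not_ge ((div_rpow_le_iff hI d0 hd).2 hlt.le)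
      fun hn => hlt.not_ge ((div_rpow_le_iff hI hd d0).1 hn)
  have hi := hs.pos i; have hj := hs.pos j; have hk := hs.pos k
  refine isStable_of_two_contacts hs h hr c1 c2 ?_ ?_ e v0.le ⟨hv, lt_add_one _⟩
    (hmono.mono fun t ht => ht.1.le)
  · rw [c1']; exact key _ (by linarith) (by linarith)
  · rw [c2']; exact key _ (by linarith) (by linarith)

lemma IsIS.not_isStable {o : Bool} (hm : IsIS r i j k o q) (ha : Admissible r q) :
    ¬ IsStable r H q :=
  not_isStable_of_isosceles hs h (hm.2.2.2.2.cross_ne h) hm.norm_eq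
    (ha.lt_of_not_contact h.jk hm.2.1) (ha.lt_of_not_contact h.ki hm.2.2.1)

omit h in
lemma IsLO.not_isStable {o : Bool} (hm : IsLO r o q) (ha : Admissible r q) : ¬ IsStable r H q := by
  obtain ⟨⟨c1, c2, c3⟩, ⟨e1, e2⟩, ho⟩ := isLO_iff.1 hm
  have h := isTriple_zero_one_two
  exact not_isStable_of_isosceles hs h (ho.cross_ne h) (e1.trans e2.symm)
    (ha.lt_of_not_contact h.jk c2) (ha.lt_of_not_contact h.ki c3)

lemma IsEO.not_isStable (hm : IsEO r i j k q) (hr : IsRelEq r H q) : ¬ IsStable r H q := by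
  obtain ⟨c1, c2, hq⟩ := hm
  have ha := hr.admissible
  obtain ⟨-, -, h1, h2⟩ := (relEq_collinear hs h hq).1 hr
  exact not_isStable_of_collinear_free hs h (norm_add_of_sbtw hq) (ha.lt_of_not_contact h.ij c1)
    (ha.lt_of_not_contact h.jk c2) (h1.2 c1) (h2.2 c2)

lemma IsER.not_isStable (hm : IsER r i j k q) (hH : 0 ≤ H)
    (hlt : H < hTR r i j k (restLength r i j k)) : ¬ IsStable r H q := by
  obtain ⟨c1, c2, hq⟩ := hm
  have c1' : ‖q i - q j‖ = r i + r j := c1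
  have c2' : ‖q j - q k‖ = r j + r k := c2
  have hadd := norm_add_of_sbtw hq
  have hz : ‖q k - q i‖ = restLength r i j k := by rw [← hadd, c1', c2', restLength_eq]
  have hz0 := (add_pos (hs.pos i) (hs.pos j)).trans (lt_restLength hs (k := k))
  refine not_isStable_of_chain hs h hadd ?_
  rw [inertia_eq r h, c1', c2', hz, kepler_lt_iff hH (hs.inertiaOf_pos ..) hz0]
  exact hlt

lemma IsER.isStable (hm : IsER r i j k q) (hr : IsRelEq r H q)
    (hgt : hTR r i j k (restLength r i j k) < H)
    (hlt : H < min (hEA r i j k (restLength r i j k)) (hEA r k j i (restLength r i j k))) :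
    IsStable r H q := by
  obtain ⟨c1, c2, hq⟩ := hm
  have c1' : ‖q i - q j‖ = r i + r j := c1
  have c2' : ‖q j - q k‖ = r j + r k := c2
  have hadd := norm_add_of_sbtw hq
  have hz : ‖q k - q i‖ = restLength r i j k := by rw [← hadd, c1', c2', restLength_eq]
  have hz0 := (add_pos (hs.pos i) (hs.pos j)).trans (lt_restLength hs (k := k))
  have hH : 0 ≤ H := (hTR_pos hs hz0).le.trans hgt.le
  have hI := hs.inertiaOf_pos i j k (r i + r j) (r j + r k) (restLength r i j k)
  rw [hEA_rest_eq.1, hEA_rest_eq.2, lt_min_iff] at hlt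
  refine isStable_of_chain hs h hr hadd c1 c2 ?_ ?_ ?_
  · rw [inertia_eq r h, c1', c2', hz, rate_lt_iff hH hI]
    have e : restLength r i j k - (r i + r j) = r j + r k := by rw [restLength_eq]; ring
    have := hlt.2
    rwa [e] at this
  · rw [inertia_eq r h, c1', c2', hz, rate_lt_iff hH hI]
    exact hlt.1
  · rw [inertia_eq r h, c1', c2', hz, ← not_le, kepler_le_iff hH hI hz0, not_le]
    exact hgt

/-- Up to the vertex the outer body slides outwards at lower energy. At the vertex itself it slides
inwards, which is possible because it is apart. -/
lemma IsEA.not_isStable (hm : IsEA r i j k q) (hH : 0 ≤ H) {v : ℝ}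
    (hanti : StrictAntiOn (hEA r i j k) (Ioc (r i + r j) v)) (hv : ‖q k - q i‖ ≤ v) :
    ¬ IsStable r H q := by
  intro hst
  have ha := hst.1.admissible
  obtain ⟨hd, e⟩ := hm.relEq hs h hH hst.1
  obtain ⟨c1, c2, hq⟩ := hm
  have hadd := norm_add_of_sbtw hq
  have hlt := (lt_restLength hs).trans hd.1
  have y0 := ha.dist_pos hs h.jk
  rcases hv.lt_or_eq with hv | hv
  · exact not_isStable_of_slide_right hs h hadd c1 y0 e hv
      (hanti.mono fun t ht => ⟨hlt.trans_le ht.1, ht.2⟩) hst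
  · obtain ⟨w, w1, w2⟩ := exists_between hlt
    exact not_isStable_of_slide_left hs h hadd c1 (ha.lt_of_not_contact h.jk c2) e w2
      (hanti.mono fun t ht => ⟨w1.trans_le ht.1, ht.2.trans hv.le⟩) hst

lemma IsEA.isStable (hm : IsEA r i j k q) (hH : 0 ≤ H) (hr : IsRelEq r H q) {v : ℝ}
    (hmono : StrictMonoOn (hEA r i j k) (Ioi (r i + r j) ∩ Ici v)) (hv : v < ‖q k - q i‖)
    (hint : ‖q k - q i‖ ∈ interior (domEA r i j k)) : IsStable r H q := by
  obtain ⟨hd, e⟩ := hm.relEq hs h hH hr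
  obtain ⟨ρ, hρ, -⟩ := existsUnique_isEulerRatio hs i j k
  obtain ⟨c1, c2, hq⟩ := hm
  have c1' : ‖q i - q j‖ = r i + r j := c1
  have hadd := norm_add_of_sbtw hq
  have hlt := (lt_restLength hs).trans hd.1
  have hy : ‖q j - q k‖ = ‖q k - q i‖ - (r i + r j) := by linarith
  rw [interior_domEA_eq hs hρ] at hint
  have hrate := (rateSq_lt_iff hs hρ (add_pos (hs.pos i) (hs.pos j)) hlt).2 hint.2
  have hsq : (H / inertia r q) ^ 2 = rateSq r i j (r i + r j) ‖q k - q i‖ := by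
    rw [inertia_eq r h, c1', hy, e]
    exact sq_hEA_div hs hlt
  refine isStable_of_aligned hs h hr c1 hadd (by rw [c1', hsq]) ?_ e
    (l := max (r i + r j) v) (le_max_left _ _) ⟨max_lt hlt hv, lt_add_one _⟩
    (hmono.mono fun t ht => ⟨(le_max_left _ _).trans_lt ht.1, ((le_max_right _ _).trans_lt ht.1).le⟩)
  rw [hsq, hy]
  exact hrate

end stability

/-! ### Resting families and meetings of families -/

section junctions

variable {r : Fin 3 → ℝ} (hs : IsSizes r)

include hs

lemma exists_isLR (o : Bool) : ∃ q, IsLR r o q ∧ Centered r q ∧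
    (q, hTR r 0 2 1 (r 0 + r 1)) ∈ closure (branch r (.TR 2 o)) := by
  have h : IsTriple 0 2 (1 : Fin 3) := isTriple_zero_one_two.swapLeft.rotate
  have h0 := hs.pos 0; have h1 := hs.pos 1; have h2 := hs.pos 2
  have h01 := hs.le_left; have h12 := hs.le_right
  obtain ⟨ε, hε, ho⟩ := exists_placed_oriented r h o
  have t : IsTriangle (r 0 + r 2) (r 2 + r 1) (r 0 + r 1) := by
    refine ⟨?_, ?_, ?_, ?_, ?_, ?_⟩ <;> linarith
  have e1 := norm_placed_ij h hε t (r := r)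
  have e2 := norm_placed_jk h hε t (r := r)
  have e3 := norm_placed_ki h hε t (r := r)
  refine ⟨placed r 0 2 ε (r 0 + r 2) (r 2 + r 1) (r 0 + r 1), isLR_iff.2 ⟨⟨e1, e2, ?_⟩,
    ho _ _ _ t (by linarith) (by linarith) (by linarith)⟩, placed_centered hs .., ?_⟩
  · rw [Contact, e3, add_comm]
  · have hlt : r 0 + r 1 < restLength r 0 2 1 := by unfold restLength; linarith
    refine mem_closure_branch (γ := fun d => placed r 0 2 ε (r 0 + r 2) (r 2 + r 1) d)
      (g := hTR r 0 2 1) (D := Ioo (r 0 + r 1) (restLength r 0 2 1))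
      (continuousAt_placed_comp h continuousAt_const continuousAt_const continuousAt_id
        (by positivity)) (continuousAt_hTR (by linarith)) ?_ fun d hd => ?_
    · rw [closure_Ioo hlt.ne]; exact left_mem_Icc.2 hlt.le
    · have hd' : d ∈ domTR r 0 2 1 := ⟨by linarith [hd.1], by linarith [hd.1], by linarith [hd.1],
        hd.2⟩
      obtain ⟨t, t1, t2, t3⟩ := domTR_pos hs hd'
      exact branch_TR_of_norms hs h (placed_centered hs ..) (ho _ _ _ t t1 t2 t3)
        (norm_placed_ij h hε t) (norm_placed_jk h hε t) (norm_placed_ki h hε t) hd'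

lemma hTR_contact_pos : 0 < hTR r 0 2 1 (r 0 + r 1) := hTR_pos hs (add_pos (hs.pos 0) (hs.pos 1))

lemma branch_LR_iff {o : Bool} {p : Config × ℝ} : p ∈ branch r (.LR o) ↔
    p.2 ∈ Icc 0 (hTR r 0 2 1 (r 0 + r 1)) ∧ IsLR r o p.1 ∧ Centered r p.1 := by
  constructor
  · rintro ⟨h1, h2, h3⟩
    have := (IsLR.relEq_iff hs h2 h1).1 h3
    exact ⟨⟨h1, this.2⟩, h2, this.1⟩
  · rintro ⟨⟨h1, h1'⟩, h2, h3⟩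
    exact ⟨h1, h2, (h2.relEq_iff hs h1).2 ⟨h3, h1'⟩⟩

lemma isRestingFamily_LR (o : Bool) :
    IsRestingFamily r (.LR o) (hTR r 0 2 1 (r 0 + r 1)) := by
  constructor
  · intro H
    constructor
    · rintro ⟨q, hq⟩
      exact ((branch_LR_iff hs).1 hq).1
    · intro hH
      obtain ⟨q, h1, h2, -⟩ := exists_isLR hs o
      exact ⟨q, (branch_LR_iff hs).2 ⟨hH, h1, h2⟩⟩
  · rintro ⟨q, H⟩ hq ⟨q', H'⟩ hq'
    have h : IsTriple 0 2 (1 : Fin 3) := isTriple_zero_one_two.swapLeft.rotate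
    obtain ⟨⟨c1, c2, c3⟩, ho⟩ := isLR_iff.1 ((branch_LR_iff hs).1 hq).2.1
    obtain ⟨⟨c1', c2', c3'⟩, ho'⟩ := isLR_iff.1 ((branch_LR_iff hs).1 hq').2.1
    exact congruent_of_oriented h (hq.2.2.admissible.ne hs h.ij) (c1'.trans c1.symm)
      (c2'.trans c2.symm) (c3'.trans c3.symm) ho ho'

lemma junction_LR_TR (o : Bool) :
    Junction r (.LR o) (.TR 2 o) (hTR r 0 2 1 (r 0 + r 1)) := by
  obtain ⟨q, h1, h2, h3⟩ := exists_isLR hs o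
  have hq : (q, hTR r 0 2 1 (r 0 + r 1)) ∈ branch r (.LR o) :=
    (branch_LR_iff hs).2 ⟨right_mem_Icc.2 (hTR_contact_pos hs).le, h1, h2⟩
  exact ⟨q, hq.2.2, subset_closure hq, h3⟩

variable {i j k : Fin 3} (h : IsTriple i j k)

lemma restLength_pos : 0 < restLength r i j k :=
  (add_pos (hs.pos i) (hs.pos j)).trans (lt_restLength hs)

/-- The nearer middle body makes the rate balancing an outer body exceed the rate with ω² d_ki³ = 1
(`rateSq_bounds`). A chain therefore stops bending strictly before either end detaches. -/
lemma hTR_rest_lt (i j k : Fin 3) : hTR r i j k (restLength r i j k)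
    < min (hEA r i j k (restLength r i j k)) (hEA r k j i (restLength r i j k)) := by
  have hz := restLength_pos hs (i := i) (j := j) (k := k)
  have hI := hs.inertiaOf_pos i j k (r i + r j) (r j + r k) (restLength r i j k)
  have key : ∀ a b : Fin 3, ∀ x, 0 < x → x < restLength r i j k →
      hTR r i j k (restLength r i j k) < inertiaOf r i j k (r i + r j) (r j + r k)
        (restLength r i j k) * √(rateSq r a b x (restLength r i j k)) := by
    intro a b x hx hxz
    have h1 := (rateSq_bounds hs a b hx hxz).1
    rw [← rate_lt_iff (hTR_pos hs hz).le hI]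
    rw [← mul_lt_mul_iff_left₀ (pow_pos hz 3), (kepler_eq_iff (hTR_pos hs hz).le hI hz).2 rfl]
    exact h1
  rw [hEA_rest_eq.1, hEA_rest_eq.2, lt_min_iff]
  have h1 := add_pos (hs.pos i) (hs.pos j)
  have h2 := add_pos (hs.pos j) (hs.pos k)
  have e := restLength_eq (r := r) (i := i) (j := j) (k := k)
  exact ⟨key _ _ _ h1 (by linarith), key _ _ _ (by linarith) (by linarith)⟩

lemma ER_threshold_pos (i j k : Fin 3) :
    0 < min (hEA r i j k (restLength r i j k)) (hEA r k j i (restLength r i j k)) :=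
  (hTR_pos hs (restLength_pos hs)).trans (hTR_rest_lt hs i j k)

include h

lemma branch_ER_iff {p : Config × ℝ} : p ∈ branch r (.ER j) ↔
    p.2 ∈ Icc 0 (min (hEA r i j k (restLength r i j k)) (hEA r k j i (restLength r i j k))) ∧
      IsER r i j k p.1 ∧ Centered r p.1 := by
  constructor
  · rintro ⟨h1, h2, h3⟩
    have h2 := (mem_ER_iff h).1 h2
    have := (h2.relEq_iff hs h h1).1 h3
    exact ⟨⟨h1, this.2⟩, h2, this.1⟩
  · rintro ⟨⟨h1, h1'⟩, h2, h3⟩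
    exact ⟨h1, (mem_ER_iff h).2 h2, (h2.relEq_iff hs h h1).2 ⟨h3, h1'⟩⟩

lemma isER_placed {ε : ℝ} (hε : ε = 1 ∨ ε = -1) :
    IsER r i j k (placed r i j ε (r i + r j) (r j + r k) (restLength r i j k)) := by
  obtain ⟨t, hq⟩ := sbtw_placed (r := r) h (add_pos (hs.pos i) (hs.pos j))
    (add_pos (hs.pos j) (hs.pos k)) restLength_eq.symm hε
  exact ⟨norm_placed_ij h hε t, norm_placed_jk h hε t, hq⟩

lemma branch_ER_placed {ε : ℝ} (hε : ε = 1 ∨ ε = -1) {H : ℝ} (hH : 0 ≤ H)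
    (hH' : H ≤ min (hEA r i j k (restLength r i j k)) (hEA r k j i (restLength r i j k))) :
    (placed r i j ε (r i + r j) (r j + r k) (restLength r i j k), H) ∈ branch r (.ER j) :=
  (branch_ER_iff hs h).2 ⟨⟨hH, hH'⟩, isER_placed hs h hε, placed_centered hs ..⟩

lemma isRestingFamily_ER : IsRestingFamily r (.ER j)
    (min (hEA r i j k (restLength r i j k)) (hEA r k j i (restLength r i j k))) := by
  constructor
  · intro H
    constructor
    · rintro ⟨q, hq⟩
      exact ((branch_ER_iff hs h).1 hq).1
    · intro hH
      exact ⟨_, branch_ER_placed hs h (Or.inl rfl) hH.1 hH.2⟩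
  · rintro ⟨q, H⟩ hq ⟨q', H'⟩ hq'
    obtain ⟨c1, c2, hb⟩ := ((branch_ER_iff hs h).1 hq).2.1
    obtain ⟨c1', c2', hb'⟩ := ((branch_ER_iff hs h).1 hq').2.1
    have n := norm_add_of_sbtw hb
    have n' := norm_add_of_sbtw hb'
    have e1 := c1'.trans c1.symm
    have e2 := c2'.trans c2.symm
    exact congruent_of_collinear h (hq.2.2.admissible.ne hs h.ij) e1 e2
      (by rw [← n, ← n', e1, e2]) (cross_eq_zero_of_add n)

lemma junction_TR_ER (o : Bool) :
    Junction r (.TR j o) (.ER j) (hTR r i j k (restLength r i j k)) := by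
  have hi := hs.pos i; have hj := hs.pos j; have hk := hs.pos k
  have hz := restLength_pos hs (i := i) (j := j) (k := k)
  obtain ⟨ε, hε, ho⟩ := exists_placed_oriented r h o
  have hq := branch_ER_placed hs h hε (hTR_pos hs hz).le (hTR_rest_lt hs i j k).le
  refine ⟨_, hq.2.2, ?_, subset_closure hq⟩
  have hlt : max (max (r i + r j) (r j + r k)) (r k + r i) < restLength r i j k := by
    rw [max_lt_iff, max_lt_iff]; unfold restLength
    refine ⟨⟨?_, ?_⟩, ?_⟩ <;> linarith
  refine mem_closure_branch (γ := fun d => placed r i j ε (r i + r j) (r j + r k) d)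
    (g := hTR r i j k) (D := Ioo (max (max (r i + r j) (r j + r k)) (r k + r i))
      (restLength r i j k))
    (continuousAt_placed_comp h continuousAt_const continuousAt_const continuousAt_id
      (by positivity)) (continuousAt_hTR hz) ?_ fun d hd => ?_
  · rw [closure_Ioo hlt.ne]; exact right_mem_Icc.2 hlt.le
  · obtain ⟨d1, d2⟩ := hd
    rw [max_lt_iff, max_lt_iff] at d1
    have hd' : d ∈ domTR r i j k := ⟨d1.1.1.le, d1.1.2.le, d1.2, d2⟩
    obtain ⟨t, t1, t2, t3⟩ := domTR_pos hs hd'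
    exact branch_TR_of_norms hs h (placed_centered hs ..) (ho _ _ _ t t1 t2 t3)
      (norm_placed_ij h hε t) (norm_placed_jk h hε t) (norm_placed_ki h hε t) hd'

/-- At d_ki = r i + r j the edges at `i` are equal, so the balance holding for the pair `k i` leaves
the contact `i j` without reaction. From there the chain can bend, or `i` can move away equally from
`j` and `k`. -/
lemma junction_TR_IS (h1 : r j + r k ≤ r i + r j) (h2 : r k + r i ≤ r i + r j) (o : Bool) :
    Junction r (.TR j o) (.IS i o) (hTR r i j k (r i + r j)) := by
  have hi := hs.pos i; have hj := hs.pos j; have hk := hs.pos k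
  have ha := add_pos hi hj
  obtain ⟨ε, hε, ho⟩ := exists_placed_oriented r h o
  have t : IsTriangle (r i + r j) (r j + r k) (r i + r j) := by
    refine ⟨?_, ?_, ?_, ?_, ?_, ?_⟩ <;> linarith
  have e1 := norm_placed_ij h hε t (r := r)
  have e2 := norm_placed_jk h hε t (r := r)
  have e3 := norm_placed_ki h hε t (r := r)
  have hI := hs.inertiaOf_pos i j k (r i + r j) (r j + r k) (r i + r j)
  refine ⟨placed r i j ε (r i + r j) (r j + r k) (r i + r j), ?_, ?_, ?_⟩
  · refine (relEq_oriented_iff hs h (ho _ _ _ t (by linarith) (by linarith) (by linarith))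
      (hTR_pos hs ha).le e1 e2 e3).2 ⟨admissible_of_norms h e1.ge e2.ge (by rw [e3]; exact h2),
      placed_centered hs .., ⟨le_rfl, fun _ => rfl⟩, ⟨?_, fun hn => absurd e2 hn⟩, le_rfl,
      fun _ => rfl⟩
    exact (div_rpow_le_iff hI ha (add_pos hj hk)).2 h1
  · have hlt : r i + r j < restLength r i j k := lt_restLength hs
    refine mem_closure_branch (γ := fun d => placed r i j ε (r i + r j) (r j + r k) d)
      (g := hTR r i j k) (D := Ioo (r i + r j) (restLength r i j k))
      (continuousAt_placed_comp h continuousAt_const continuousAt_const continuousAt_id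
        ha.ne') (continuousAt_hTR ha) ?_ fun d hd => ?_
    · rw [closure_Ioo hlt.ne]; exact left_mem_Icc.2 hlt.le
    · have hd' : d ∈ domTR r i j k := ⟨by linarith [hd.1], by linarith [hd.1], by linarith [hd.1],
        hd.2⟩
      obtain ⟨t, t1, t2, t3⟩ := domTR_pos hs hd'
      exact branch_TR_of_norms hs h (placed_centered hs ..) (ho _ _ _ t t1 t2 t3)
        (norm_placed_ij h hε t) (norm_placed_jk h hε t) (norm_placed_ki h hε t) hd'
  · have e : hTR r i j k (r i + r j) = hIS r j k i (r i + r j) := by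
      unfold hTR hIS; rw [inertiaOf_rotate]
    rw [e]
    refine mem_closure_branch (γ := fun d => placed r i j ε d (r j + r k) d)
      (g := hIS r j k i) (D := Ioi (r i + r j))
      (continuousAt_placed_comp h continuousAt_id continuousAt_const continuousAt_id
        ha.ne') (continuousAt_hIS ha) ?_ fun d hd => ?_
    · rw [closure_Ioi]; exact self_mem_Ici
    · have hd : r i + r j < d := hd
      have hd' : d ∈ domIS r j k i := ⟨by linarith, by linarith, hd⟩
      have t : IsTriangle d (r j + r k) d := by refine ⟨?_, ?_, ?_, ?_, ?_, ?_⟩ <;> linarith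
      exact branch_IS_of_norms hs h.rotate (placed_centered hs ..)
        (ho _ _ _ t (by linarith) (by linarith) (by linarith))
        (norm_placed_jk h hε t) (norm_placed_ki h hε t) (norm_placed_ij h hε t) hd'

omit h in
lemma junction_IS_LO (o : Bool) : Junction r (.IS 2 o) (.LO o) (hLO r (r 0 + r 1)) := by
  have h := isTriple_zero_one_two
  have h0 := hs.pos 0; have h1 := hs.pos 1; have h2 := hs.pos 2
  have h01 := hs.le_left; have h12 := hs.le_right
  have ha := add_pos h0 h1
  obtain ⟨ε, hε, ho⟩ := exists_placed_oriented r h o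
  have t := isTriangle_equilateral ha
  have e1 := norm_placed_ij h hε t (r := r)
  have e2 := norm_placed_jk h hε t (r := r)
  have e3 := norm_placed_ki h hε t (r := r)
  refine ⟨placed r 0 1 ε (r 0 + r 1) (r 0 + r 1) (r 0 + r 1), ?_, ?_, ?_⟩
  · exact (relEq_oriented_iff hs h (ho _ _ _ t (by linarith) (by linarith) (by linarith))
      (hLO_pos hs ha).le e1 e2 e3).2 ⟨admissible_of_norms h e1.ge (by rw [e2]; linarith)
      (by rw [e3]; linarith), placed_centered hs .., ⟨le_rfl, fun _ => rfl⟩,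
      ⟨le_rfl, fun _ => rfl⟩, le_rfl, fun _ => rfl⟩
  · refine mem_closure_branch (γ := fun d => placed r 0 1 ε (r 0 + r 1) d d)
      (g := hIS r 0 1 2) (D := Ioi (r 0 + r 1))
      (continuousAt_placed_comp h continuousAt_const continuousAt_id continuousAt_id
        ha.ne') (continuousAt_hIS ha) ?_ fun d hd => ?_
    · rw [closure_Ioi]; exact self_mem_Ici
    · have hd : r 0 + r 1 < d := hd
      have hd' : d ∈ domIS r 0 1 2 := ⟨by linarith, by linarith, by linarith⟩
      obtain ⟨t, t1, t2, t3⟩ := domIS_pos hs hd'.1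
      exact branch_IS_of_norms hs h (placed_centered hs ..) (ho _ _ _ t t1 t2 t3)
        (norm_placed_ij h hε t) (norm_placed_jk h hε t) (norm_placed_ki h hε t) hd'
  · refine mem_closure_branch (γ := fun d => placed r 0 1 ε d d d)
      (g := hLO r) (D := Ioi (r 0 + r 1))
      (continuousAt_placed_comp h continuousAt_id continuousAt_id continuousAt_id
        ha.ne') (continuousAt_hLO ha) ?_ fun d hd => ?_
    · rw [closure_Ioi]; exact self_mem_Ici
    · have hd' : r 0 + r 1 < d := hd
      have t := isTriangle_equilateral (ha.trans hd')
      exact branch_LO_of_norms hs (placed_centered hs ..)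
        (ho _ _ _ t (by linarith) (by linarith) (by linarith))
        (norm_placed_ij h hε t) (norm_placed_jk h hε t) (norm_placed_ki h hε t) hd

lemma continuousAt_hEA {x : ℝ} (hx : r i + r j < x) : ContinuousAt (hEA r i j k) x :=
  (continuousOn_hEA hs h).continuousAt (Ioi_mem_nhds hx)

lemma junction_ER_EA {σ : Equiv.Perm (Fin 3)} (h0 : σ 0 = i) (h1 : σ 1 = j) (h2 : σ 2 = k)
    (hD : domEA r i j k = Ioi (restLength r i j k))
    (hle : hEA r i j k (restLength r i j k) ≤ hEA r k j i (restLength r i j k)) :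
    Junction r (.ER j) (.EA σ) (hEA r i j k (restLength r i j k)) := by
  have ha := add_pos (hs.pos i) (hs.pos j)
  have hb := add_pos (hs.pos j) (hs.pos k)
  have hz := lt_restLength hs (i := i) (j := j) (k := k)
  have hq := branch_ER_placed hs h (Or.inl rfl) (hEA_pos hs hz).le (le_min le_rfl hle)
  refine ⟨_, hq.2.2, subset_closure hq, ?_⟩
  have e : r j + r k = restLength r i j k - (r i + r j) := by rw [restLength_eq]; ring
  rw [e]
  refine mem_closure_branch (γ := fun x => placed r i j 1 (r i + r j) (x - (r i + r j)) x)
    (g := hEA r i j k) (D := Ioi (restLength r i j k))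
    (continuousAt_placed_comp h continuousAt_const (continuousAt_id.sub continuousAt_const)
      continuousAt_id ha.ne') (continuousAt_hEA hs h hz) ?_ fun x hx => ?_
  · rw [closure_Ioi]; exact self_mem_Ici
  · have hx' : restLength r i j k < x := hx
    obtain ⟨t, hq⟩ := sbtw_placed (r := r) h (x := r i + r j) (y := x - (r i + r j)) (z := x)
      ha (by linarith) (by ring) (Or.inl rfl)
    exact branch_EA_of_norms hs h h0 h1 h2 (placed_centered hs ..) hq
      (norm_placed_ij h (Or.inl rfl) t) (norm_placed_ki h (Or.inl rfl) t) (hD ▸ hx)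

lemma mem_closure_EO {ρ : ℝ} (hρ : IsEulerRatio r i j k ρ) {d : ℝ} (hd1 : r i + r j ≤ ρ * d)
    (hd2 : r j + r k ≤ (1 - ρ) * d) :
    (placed r i j 1 (ρ * d) ((1 - ρ) * d) d, hEO r i j k ρ d) ∈ closure (branch r (.EO j)) := by
  have hi := hs.pos i; have hj := hs.pos j; have hk := hs.pos k
  have hρ' : 0 < 1 - ρ := sub_pos.2 hρ.2.1
  have hd : 0 < d := by linarith
  refine mem_closure_branch (γ := fun d => placed r i j 1 (ρ * d) ((1 - ρ) * d) d)
    (g := hEO r i j k ρ) (D := Ioi d)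
    (continuousAt_placed_comp h (continuousAt_const.mul continuousAt_id)
      (continuousAt_const.mul continuousAt_id) continuousAt_id (mul_pos hρ.1 hd).ne')
    (continuousAt_hEO hd) ?_ fun x hx => ?_
  · rw [closure_Ioi]; exact self_mem_Ici
  · have hx' : d < x := hx
    have m1 := mul_lt_mul_of_pos_left hx' hρ.1
    have m2 := mul_lt_mul_of_pos_left hx' hρ'
    obtain ⟨t, hq⟩ := sbtw_placed (r := r) h (x := ρ * x) (y := (1 - ρ) * x) (z := x)
      (by linarith) (by linarith) (by ring) (Or.inl rfl)
    exact branch_EO_of_norms hs h hρ (placed_centered hs ..) hq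
      (norm_placed_ij h (Or.inl rfl) t) (norm_placed_ki h (Or.inl rfl) t)
      ((mem_domEO hρ.1 hρ.2.1).2 ⟨hd1.trans_lt m1, hd2.trans_lt m2⟩)

omit h in
lemma hEO_eq_hEA {ρ : ℝ} (hρ : IsEulerRatio r i j k ρ) {d : ℝ} (hd : ρ * d = r i + r j) :
    hEO r i j k ρ d = hEA r i j k d := by
  have hd0 : 0 < d := pos_of_mul_pos_right (hd ▸ add_pos (hs.pos i) (hs.pos j)) hρ.1.le
  rw [hEO_eq_iff hs hρ hd0, hd, show (1 - ρ) * d = d - (r i + r j) by linarith, hEA]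

lemma junction_EO_EA {σ : Equiv.Perm (Fin 3)} (h0 : σ 0 = i) (h1 : σ 1 = j) (h2 : σ 2 = k)
    {ρ : ℝ} (hρ : IsEulerRatio r i j k ρ) {x : ℝ} (hx : x ∈ domEA r i j k)
    (e : ρ * x = r i + r j) : Junction r (.EO j) (.EA σ) (hEA r i j k x) := by
  have ha := add_pos (hs.pos i) (hs.pos j)
  have hb := add_pos (hs.pos j) (hs.pos k)
  have hz := hx.1
  rw [restLength_eq] at hz
  have e2 : (1 - ρ) * x = x - (r i + r j) := by linarith
  have hc := mem_closure_EO hs h hρ (d := x) e.ge (by linarith)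
  obtain ⟨t, hq⟩ := sbtw_placed (r := r) h (x := ρ * x) (y := (1 - ρ) * x) (z := x)
    (by linarith) (by linarith) (by ring) (Or.inl rfl)
  have hm := branch_EA_of_norms hs h h0 h1 h2 (placed_centered hs ..) hq
    ((norm_placed_ij h (Or.inl rfl) t).trans e) (norm_placed_ki h (Or.inl rfl) t) hx
  rw [hEO_eq_hEA hs hρ e] at hc
  exact ⟨_, hm.2.2, hc, subset_closure hm⟩

lemma junction_EO_ER
    (he : hEA r i j k (restLength r i j k) = hEA r k j i (restLength r i j k)) :
    Junction r (.EO j) (.ER j) (hEA r i j k (restLength r i j k)) := by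
  obtain ⟨ρ, hρ, -⟩ := existsUnique_isEulerRatio hs i j k
  have e : ρ * restLength r i j k = r i + r j :=
    le_antisymm ((hEA_rest_ge_iff hs hρ).1 he.ge) ((hEA_rest_le_iff hs hρ).1 he.le)
  have hz := lt_restLength hs (i := i) (j := j) (k := k)
  have e2 : (1 - ρ) * restLength r i j k = r j + r k := by
    have := restLength_eq (r := r) (i := i) (j := j) (k := k); linarith
  have hc := mem_closure_EO hs h hρ e.ge e2.ge
  have hq := branch_ER_placed hs h (Or.inl rfl) (hEA_pos hs hz).le (le_min le_rfl he.le)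
  rw [hEO_eq_hEA hs hρ e, e, e2] at hc
  exact ⟨_, hq.2.2, hc, subset_closure hq⟩

end junctions

/-! ### Presence, absence and stability at a given angular momentum -/

section existence

variable {r : Fin 3 → ℝ} (hs : IsSizes r)

lemma IsCurveFamily.branch_nonempty {F : Family} {s : Config → ℝ} {D : Set ℝ} {g : ℝ → ℝ}
    (hF : IsCurveFamily r F s D g) : (branch r F).Nonempty := by
  obtain ⟨⟨x, hx⟩, -, -, -, h, -⟩ := hF
  obtain ⟨q, hq, -⟩ := h x hx
  exact ⟨_, hq⟩

lemma IsCurveFamily.not_mem_zero {F : Family} {s : Config → ℝ} {D : Set ℝ} {g : ℝ → ℝ}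
    (hF : IsCurveFamily r F s D g) (hg : ∀ x ∈ D, 0 < g x) (q : Config) : (q, 0) ∉ branch r F := by
  intro hq
  obtain ⟨h1, h2⟩ := hF.2.2.2.1 _ hq
  exact (hg _ h1).ne h2

include hs

lemma branch_nonempty (F : Family) : (branch r F).Nonempty := by
  cases F with
  | LR o =>
    obtain ⟨q, hq⟩ := ((isRestingFamily_LR hs o).1 0).2 (left_mem_Icc.2 (hTR_contact_pos hs).le)
    exact ⟨_, hq⟩
  | ER j =>
    have t := isTriple_of_middle (i := j + 1) (j := j) (k := j + 2) rfl rfl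
    obtain ⟨q, hq⟩ := ((isRestingFamily_ER hs t).1 0).2 (left_mem_Icc.2 (ER_threshold_pos hs ..).le)
    exact ⟨_, hq⟩
  | TR j o => exact (isCurveFamily_TR hs (isTriple_of_middle rfl rfl) o).branch_nonempty
  | EA σ => exact (isCurveFamily_EA hs (isTriple_perm σ) rfl rfl rfl).branch_nonempty
  | IS k o => exact (isCurveFamily_IS hs (isTriple_of_last rfl rfl) o).branch_nonempty
  | EO j =>
    obtain ⟨ρ, hρ, -⟩ := existsUnique_isEulerRatio hs (j + 1) j (j + 2)
    exact (isCurveFamily_EO hs (isTriple_of_middle rfl rfl) hρ).branch_nonempty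
  | LO o => exact (isCurveFamily_LO hs o).branch_nonempty

/-- The curve families have h > 0 and are missing at H = 0; the resting ones are missing above their
largest threshold. -/
lemma exists_absent (c : EqClass) :
    ∃ H, 0 ≤ H ∧ ∀ F : Family, F.cls = c → ∀ q, (q, H) ∉ branch r F := by
  have ha : ∀ i j : Fin 3, 0 < r i + r j := fun i j => add_pos (hs.pos i) (hs.pos j)
  have zero : (∀ F : Family, F.cls = c → ∀ q, (q, (0 : ℝ)) ∉ branch r F) →
      ∃ H, 0 ≤ H ∧ ∀ F : Family, F.cls = c → ∀ q, (q, H) ∉ branch r F := fun h => ⟨0, le_rfl, h⟩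
  cases c with
  | LR =>
    refine ⟨hTR r 0 2 1 (r 0 + r 1) + 1, by linarith [hTR_contact_pos hs], ?_⟩
    rintro (o | _) hF q hq <;> cases hF
    have := ((branch_LR_iff hs).1 hq).1.2
    dsimp only at this
    linarith
  | ER =>
    obtain ⟨M, hM⟩ := (Set.finite_range fun j : Fin 3 =>
      min (hEA r (j + 1) j (j + 2) (restLength r (j + 1) j (j + 2)))
        (hEA r (j + 2) j (j + 1) (restLength r (j + 1) j (j + 2)))).bddAbove
    have hM' := fun j => hM (mem_range_self j)
    refine ⟨M + 1, ?_, ?_⟩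
    · have := (ER_threshold_pos hs ..).trans_le (hM' 0)
      linarith
    · rintro (_ | j | _) hF q hq <;> cases hF
      have := ((branch_ER_iff hs (isTriple_of_middle (i := j + 1) (k := j + 2) rfl rfl)).1 hq).1.2
      have := this.trans (hM' j)
      dsimp only at this
      linarith
  | TR =>
    refine zero ?_
    rintro (_ | _ | ⟨j, o⟩) hF <;> cases hF
    exact (isCurveFamily_TR hs (isTriple_of_middle rfl rfl) o).not_mem_zero
      fun x hx => hTR_pos hs (pos_of_mem_domTR hs hx)
  | EA =>
    refine zero ?_
    rintro (_ | _ | _ | σ) hF <;> cases hF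
    exact (isCurveFamily_EA hs (isTriple_perm σ) rfl rfl rfl).not_mem_zero
      fun x hx => hEA_pos hs ((lt_restLength hs).trans hx.1)
  | IS =>
    refine zero ?_
    rintro (_ | _ | _ | _ | ⟨k, o⟩) hF <;> cases hF
    exact (isCurveFamily_IS hs (isTriple_of_last rfl rfl) o).not_mem_zero
      fun x hx => hIS_pos hs ((ha _ _).trans_le hx.1)
  | EO =>
    refine zero ?_
    rintro (_ | _ | _ | _ | _ | j) hF <;> cases hF
    obtain ⟨ρ, hρ, -⟩ := existsUnique_isEulerRatio hs (j + 1) j (j + 2)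
    exact (isCurveFamily_EO hs (isTriple_of_middle rfl rfl) hρ).not_mem_zero
      fun x hx => hEO_pos hs hρ (pos_of_mem_domEO hs hρ hx)
  | LO =>
    refine zero ?_
    rintro (_ | _ | _ | _ | _ | _ | o) hF <;> cases hF
    exact (isCurveFamily_LO hs o).not_mem_zero fun x hx => hLO_pos hs ((ha _ _).trans hx)

/-- Past the escape momentum of an aligned resting chain, the outer body that leaves first settles
on the stable part of the corresponding aligned family. -/
lemma exists_stable_EA {i j k : Fin 3} (h : IsTriple i j k) (hj : j ≠ 2)
    (hle : hEA r i j k (restLength r i j k) ≤ hEA r k j i (restLength r i j k)) {H : ℝ}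
    (hH : hEA r i j k (restLength r i j k) ≤ H) : ∃ q, IsStable r H q := by
  obtain ⟨ρ, hρ, -⟩ := existsUnique_isEulerRatio hs i j k
  have hD := domEA_eq_Ioi hs hρ ((hEA_rest_le_iff hs hρ).1 hle)
  obtain ⟨v, hanti, hmono, hneg⟩ := exists_hEA_vertex hs h
  have hv := exists_vertex_mem_interior hs h hj fun x hx => (hneg x hx).1
  rw [hD, interior_Ioi] at hv
  have hv' : restLength r i j k < v := hv
  have hz := lt_restLength hs (i := i) (j := j) (k := k)
  -- The vertex lies past the resting length and h decreases strictly up to it, so h(v) is below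
  -- `H`; on the increasing branch, which tends to infinity, `H` is then attained strictly to the
  -- right of `v`.
  have hlt : hEA r i j k v < H := (hanti ⟨hz, hv'.le⟩ ⟨hz.trans hv', le_rfl⟩ hv').trans_le hH
  obtain ⟨w, hvw, hw⟩ := (((eventually_ge_atTop v).and
    ((tendsto_hEA hs (i := i) (j := j) (k := k)).eventually_ge_atTop H))).exists
  obtain ⟨x, hx, e⟩ := intermediate_value_Icc hvw ((continuousOn_hEA hs h).mono
    fun y hy => hz.trans (hv'.trans_le hy.1)) ⟨hlt.le, hw⟩
  have hvx : v < x := lt_of_le_of_ne hx.1 fun hne => by rw [hne, e] at hlt; exact hlt.false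
  obtain ⟨σ, h0, h1, h2⟩ := h.exists_perm
  have hxD : x ∈ domEA r i j k := hD ▸ hv'.trans hvx
  obtain ⟨q, hq, hqx⟩ := (isCurveFamily_EA hs h h0 h1 h2).2.2.2.2.1 x hxD
  rw [e] at hq
  refine ⟨q, ((mem_EA_iff h0 h1 h2).1 hq.2.1).isStable hs h hq.1 hq.2.2 hmono ?_ ?_⟩
  · exact hvx.trans_eq hqx.symm
  · rw [show ‖q k - q i‖ = x from hqx, hD, interior_Ioi]
    exact hv'.trans hvx

/-- LR covers H < H_L. The chain 0, 1, 2 becomes stable below H_L and stays so until it breaks. From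
the breaking value on, EA takes over, with whichever end has the smaller threshold detached; the
middle body `1` guarantees a vertex inside the domain. -/
lemma exists_stable {H : ℝ} (hH : 0 ≤ H) : ∃ q, IsStable r H q := by
  rcases lt_or_ge H (hTR r 0 2 1 (r 0 + r 1)) with h1 | h1
  · obtain ⟨q, hq⟩ := ((isRestingFamily_LR hs true).1 H).2 ⟨hH, h1.le⟩
    exact ⟨q, (IsLR.isStable_iff hs hq.2.1 hH hq.2.2).2 h1⟩
  · have t : IsTriple 0 1 (2 : Fin 3) := isTriple_zero_one_two
    have h2 := (hTR_chain_lt_triangle hs t).trans_le h1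
    rcases lt_or_ge H (min (hEA r 0 1 2 (restLength r 0 1 2)) (hEA r 2 1 0 (restLength r 0 1 2)))
      with h3 | h3
    · obtain ⟨q, hq⟩ := ((isRestingFamily_ER hs t).1 H).2 ⟨hH, h3.le⟩
      exact ⟨q, ((mem_ER_iff t).1 hq.2.1).isStable hs t hq.2.2 h2 h3⟩
    · rcases le_total (hEA r 0 1 2 (restLength r 0 1 2)) (hEA r 2 1 0 (restLength r 0 1 2))
        with hle | hle
      · exact exists_stable_EA hs t (by decide) hle (by rwa [min_eq_left hle] at h3)
      · rw [min_eq_right hle] at h3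
        rw [restLength_comm] at hle h3
        exact exists_stable_EA hs t.swap (by decide) hle h3

end existence

/-! ### Assembling the charts of the families -/

section charts

variable {r : Fin 3 → ℝ} (hs : IsSizes r)

include hs

lemma relEq_existsUnique_family {H : ℝ} {q : Config} (hH : 0 ≤ H) (hr : IsRelEq r H q) :
    ∃! F : Family, F.Mem r q := by
  obtain ⟨F, hF⟩ := exists_family hs hH hr
  exact ⟨F, hF, fun G hG => family_unique hs hG hF hr.admissible⟩

lemma LR_chart (o : Bool) : IsRestingFamily r (.LR o) (hTR r 0 2 1 (r 0 + r 1)) ∧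
    (∀ p ∈ branch r (.LR o), IsStable r p.2 p.1 ↔ p.2 < hTR r 0 2 1 (r 0 + r 1)) ∧
    Junction r (.LR o) (.TR 2 o) (hTR r 0 2 1 (r 0 + r 1)) :=
  ⟨isRestingFamily_LR hs o, fun _ hp => IsLR.isStable_iff hs hp.2.1 hp.1 hp.2.2,
    junction_LR_TR hs o⟩

variable {i j k : Fin 3} (h : IsTriple i j k)

include h

lemma ER_chart : 0 < hTR r i j k (restLength r i j k) ∧
    hTR r i j k (restLength r i j k)
      < min (hEA r i j k (restLength r i j k)) (hEA r k j i (restLength r i j k)) ∧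
    IsRestingFamily r (.ER j)
      (min (hEA r i j k (restLength r i j k)) (hEA r k j i (restLength r i j k))) ∧
    (∀ p ∈ branch r (.ER j),
      (p.2 < hTR r i j k (restLength r i j k) → ¬ IsStable r p.2 p.1) ∧
      (hTR r i j k (restLength r i j k) < p.2 →
        p.2 < min (hEA r i j k (restLength r i j k)) (hEA r k j i (restLength r i j k)) →
        IsStable r p.2 p.1)) ∧
    ∀ o, Junction r (.TR j o) (.ER j) (hTR r i j k (restLength r i j k)) := by
  refine ⟨hTR_pos hs (restLength_pos hs), hTR_rest_lt hs i j k, isRestingFamily_ER hs h,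
    fun p hp => ?_, junction_TR_ER hs h⟩
  have m := (mem_ER_iff h).1 hp.2.1
  exact ⟨m.not_isStable hs h hp.1, m.isStable hs h hp.2.2⟩

omit h in
lemma TR_chart (hi : i = j + 1) (hk : k = j + 2) (o : Bool) :
    IsCurveFamily r (.TR j o) (fun q => ‖q k - q i‖) (domTR r i j k) (hTR r i j k) ∧
    (j ≠ 2 → StrictAntiOn (hTR r i j k) (domTR r i j k) ∧ NeverStable r (.TR j o)) ∧
    (j = 2 → ∃ v, r 0 + r 1 < v ∧ VShaped (hTR r i j k) (domTR r i j k) v ∧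
      ∀ p ∈ branch r (.TR j o), IsStable r p.2 p.1 ↔ v < ‖p.1 k - p.1 i‖) := by
  have h := isTriple_of_middle hi hk
  refine ⟨isCurveFamily_TR hs h o, fun hj => ⟨strictAntiOn_hTR hs h hj, fun p hp => ?_⟩, fun hj => ?_⟩
  · have m := (mem_TR_iff h).1 hp.2.1
    exact m.not_isStable hs h hp.1
      ((m.relEq hs h hp.1 hp.2.2).1.2.2.2.trans (restLength_lt_vertexTR hs h hj)).le
  · subst hj hi hk
    have hv := contact_lt_vertexTR hs
    obtain ⟨a1, a2, a3⟩ := h.add_le hs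
    refine ⟨vertexTR r 0 2 1, hv, vShaped_hTR hs 0 2 1, fun p hp => ?_⟩
    have m := (mem_TR_iff h).1 hp.2.1
    refine ⟨fun hst => ?_, fun hlt => m.isStable hs h hp.1 hp.2.2 (a1.trans_lt hv) (a2.trans_lt hv) hlt⟩
    by_contra hn
    exact m.not_isStable hs h hp.1 (not_lt.1 hn) hst

lemma IS_chart (o : Bool) :
    IsCurveFamily r (.IS k o) (fun q => ‖q k - q i‖) (domIS r i j k) (hIS r i j k) ∧
    HBifurcation (hIS r i j k) (domIS r i j k) ∧
    Tendsto (fun d => hIS r i j k d / √d) atTop (𝓝 (mass r k * (mass r i + mass r j))) ∧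
    NeverStable r (.IS k o) :=
  ⟨isCurveFamily_IS hs h o, hBifurcation_hIS hs h, tendsto_hIS_div_sqrt i j k,
    fun _ hp => ((mem_IS_iff h).1 hp.2.1).not_isStable hs h hp.2.2.admissible⟩

omit h in
lemma isosceles_junctions (o : Bool) :
    Junction r (.TR 1 o) (.IS 0 o) (hTR r 0 1 2 (r 0 + r 1)) ∧
    Junction r (.TR 0 o) (.IS 1 o) (hTR r 1 0 2 (r 0 + r 1)) ∧
    Junction r (.IS 2 o) (.LO o) (hLO r (r 0 + r 1)) := by
  have t := isTriple_zero_one_two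
  have h01 := hs.le_left; have h12 := hs.le_right
  refine ⟨junction_TR_IS hs t (by linarith) (by linarith) o, ?_, junction_IS_LO hs o⟩
  rw [add_comm (r 0)]
  exact junction_TR_IS hs t.swapLeft (by linarith) (by linarith) o

lemma EA_chart {σ : Equiv.Perm (Fin 3)} (h0 : σ 0 = i) (h1 : σ 1 = j) (h2 : σ 2 = k) :
    IsCurveFamily r (.EA σ) (fun q => ‖q k - q i‖) (domEA r i j k) (hEA r i j k) ∧
    (∃ v, VShaped (hEA r i j k) (domEA r i j k) v ∧ (j ≠ 2 → v ∈ interior (domEA r i j k)) ∧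
      ∀ p ∈ branch r (.EA σ),
        (IsStable r p.2 p.1 → v < ‖p.1 k - p.1 i‖) ∧
        (v < ‖p.1 k - p.1 i‖ → ‖p.1 k - p.1 i‖ ∈ interior (domEA r i j k) →
          IsStable r p.2 p.1)) ∧
    Tendsto (fun x => hEA r i j k x / √x) atTop (𝓝 (mass r k * (mass r i + mass r j))) ∧
    (hEA r i j k (restLength r i j k) ≤ hEA r k j i (restLength r i j k) →
      domEA r i j k = Set.Ioi (restLength r i j k) ∧
      Junction r (.ER j) (.EA σ) (hEA r i j k (restLength r i j k))) ∧
    (hEA r k j i (restLength r i j k) < hEA r i j k (restLength r i j k) →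
      ∃ x₀, restLength r i j k < x₀ ∧ domEA r i j k = Set.Ici x₀ ∧
        Junction r (.EO j) (.EA σ) (hEA r i j k x₀)) ∧
    (hEA r i j k (restLength r i j k) = hEA r k j i (restLength r i j k) →
      Junction r (.EO j) (.ER j) (hEA r i j k (restLength r i j k))) := by
  obtain ⟨ρ, hρ, -⟩ := existsUnique_isEulerRatio hs i j k
  refine ⟨isCurveFamily_EA hs h h0 h1 h2, ?_, tendsto_hEA_div_sqrt hs, fun hle => ?_, fun hlt => ?_,
    junction_EO_ER hs h⟩
  · obtain ⟨v, hanti, hmono, hneg⟩ := exists_hEA_vertex hs h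
    have hlt : ∀ x ∈ domEA r i j k, r i + r j < x := fun x hx => (lt_restLength hs).trans hx.1
    refine ⟨v, ⟨hanti.mono fun x hx => ⟨hlt x hx.1, hx.2⟩, hmono.mono fun x hx =>
      ⟨hlt x hx.1, hx.2⟩⟩, fun hj => exists_vertex_mem_interior hs h hj fun x hx => (hneg x hx).1, fun p hp => ?_⟩
    have m := (mem_EA_iff h0 h1 h2).1 hp.2.1
    refine ⟨fun hst => ?_, m.isStable hs h hp.1 hp.2.2 hmono⟩
    by_contra hn
    exact m.not_isStable hs h hp.1 hanti (not_lt.1 hn) hst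
  · have hD := domEA_eq_Ioi hs hρ ((hEA_rest_le_iff hs hρ).1 hle)
    exact ⟨hD, junction_ER_EA hs h h0 h1 h2 hD hle⟩
  · obtain ⟨e1, e2⟩ := domEA_eq_Ici hs hρ ((hEA_rest_gt_iff hs hρ).1 hlt)
    refine ⟨_, e1, e2, junction_EO_EA hs h h0 h1 h2 hρ (e2 ▸ self_mem_Ici) ?_⟩
    rw [mul_div_cancel₀ _ hρ.1.ne']

lemma EO_chart : (∃! ρ, IsEulerRatio r i j k ρ) ∧ ∀ ρ, IsEulerRatio r i j k ρ →
    IsCurveFamily r (.EO j) (fun q => ‖q k - q i‖) (domEO r i j k ρ) (hEO r i j k ρ) ∧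
    (∀ p ∈ branch r (.EO j), ‖p.1 i - p.1 j‖ = ρ * ‖p.1 k - p.1 i‖) ∧
    (∃ v, VShaped (hEO r i j k ρ) (domEO r i j k ρ) v) ∧
    Tendsto (hEO r i j k ρ) atTop atTop ∧ NeverStable r (.EO j) := by
  refine ⟨existsUnique_isEulerRatio hs i j k, fun ρ hρ => ⟨isCurveFamily_EO hs h hρ,
    fun p hp => ?_, ⟨_, vShaped_hEO hs hρ⟩, tendsto_hEO hs hρ, fun p hp => ?_⟩⟩
  · exact (((mem_EO_iff h).1 hp.2.1).relEq hs h hρ hp.1 hp.2.2).1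
  · exact ((mem_EO_iff h).1 hp.2.1).not_isStable hs h hp.2.2

omit h in
lemma LO_chart (o : Bool) :
    IsCurveFamily r (.LO o) (fun q => ‖q 0 - q 1‖) (Set.Ioi (r 0 + r 1)) (hLO r) ∧
    (∃ v, VShaped (hLO r) (Set.Ioi (r 0 + r 1)) v) ∧
    Tendsto (hLO r) atTop atTop ∧ NeverStable r (.LO o) :=
  ⟨isCurveFamily_LO hs o, ⟨_, vShaped_hLO hs⟩, tendsto_hLO hs,
    fun _ hp => IsLO.not_isStable hs hp.2.1 hp.2.2.admissible⟩

end charts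

/-! ### Criteria for the alternatives left open -/

section criteria

variable {r : Fin 3 → ℝ} (hs : IsSizes r) {i j k : Fin 3} {ρ : ℝ}

include hs

lemma hBifurcation_hTR (hlt : 3 * (mass r 0 * mass r 2 * (r 0 + r 2) ^ 2
      + mass r 2 * mass r 1 * (r 2 + r 1) ^ 2 + ∑ l, ballInertia r l)
      < mass r 1 * mass r 0 * restLength r 0 2 1 ^ 2) :
    HBifurcation (hTR r 0 2 1) (domTR r 0 2 1) := by
  have h01 := hs.le_left; have h12 := hs.le_right
  have hv := contact_lt_vertexTR hs
  have hB := mul_pos (hs.mass_pos 1) (hs.mass_pos 0)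
  refine ⟨_, interior_maximal (t := Ioo (r 0 + r 1) (restLength r 0 2 1)) (fun d hd => ?_)
    isOpen_Ioo ⟨hv, ?_⟩, vShaped_hTR hs 0 2 1⟩
  · obtain ⟨h1, h2⟩ := hd
    exact ⟨by linarith, by linarith, by linarith, h2⟩
  · rw [vertexTR, Real.sqrt_lt' (restLength_pos hs), div_lt_iff₀ hB, mul_comm (_ ^ 2)]
    exact hlt

lemma strictAntiOn_hTR_of_le (hle : mass r 1 * mass r 0 * restLength r 0 2 1 ^ 2
      < 3 * (mass r 0 * mass r 2 * (r 0 + r 2) ^ 2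
      + mass r 2 * mass r 1 * (r 2 + r 1) ^ 2 + ∑ l, ballInertia r l)) :
    StrictAntiOn (hTR r 0 2 1) (domTR r 0 2 1) := by
  obtain ⟨-, h1, -, h2⟩ := vertexTR_spec hs 0 2 1
  have hz := (h2 _ (restLength_pos hs)).2 hle
  exact h1.mono fun d hd => ⟨pos_of_mem_domTR hs hd, (hd.2.2.2.trans hz).le⟩

lemma hBifurcation_hLO (hlt : (mass r 0 * mass r 1 + mass r 1 * mass r 2 + mass r 2 * mass r 0)
      * (r 0 + r 1) ^ 2 < 3 * ∑ l, ballInertia r l) : HBifurcation (hLO r) (Ioi (r 0 + r 1)) := by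
  refine ⟨_, ?_, vShaped_hLO hs⟩
  rw [interior_Ioi]
  exact (lt_vertex_iff (hLO_coeff_pos hs) (add_pos (hs.pos 0) (hs.pos 1))).2 hlt

lemma strictMonoOn_hLO (hle : 3 * ∑ l, ballInertia r l
      ≤ (mass r 0 * mass r 1 + mass r 1 * mass r 2 + mass r 2 * mass r 0) * (r 0 + r 1) ^ 2) :
    StrictMonoOn (hLO r) (Ioi (r 0 + r 1)) := by
  refine (vShaped_hLO hs).2.mono fun d hd => ⟨hd, ?_⟩
  have hd' : r 0 + r 1 < d := hd
  refine le_trans (not_lt.1 fun hlt => ?_) hd'.le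
  have := (lt_vertex_iff (hLO_coeff_pos hs) (add_pos (hs.pos 0) (hs.pos 1))).1 hlt
  linarith

lemma hBifurcation_hEO (hρ : IsEulerRatio r i j k ρ)
    (h1 : eulerCoeff r i j k ρ * (r i + r j) ^ 2 < 3 * (∑ l, ballInertia r l) * ρ ^ 2)
    (h2 : eulerCoeff r i j k ρ * (r j + r k) ^ 2 < 3 * (∑ l, ballInertia r l) * (1 - ρ) ^ 2) :
    HBifurcation (hEO r i j k ρ) (domEO r i j k ρ) := by
  have hc := eulerCoeff_pos hs i j k ρ
  have hρ0 := hρ.1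
  have hρ1 := sub_pos.2 hρ.2.1
  have ha := add_pos (hs.pos i) (hs.pos j)
  have hb := add_pos (hs.pos j) (hs.pos k)
  refine ⟨_, ?_, vShaped_hEO hs hρ⟩
  rw [domEO, interior_Ioi, mem_Ioi, max_lt_iff, lt_vertex_iff hc (by positivity),
    lt_vertex_iff hc (by positivity)]
  constructor
  · rw [div_pow, ← mul_div_assoc, div_lt_iff₀ (by positivity)]; exact h1
  · rw [div_pow, ← mul_div_assoc, div_lt_iff₀ (by positivity)]; exact h2

lemma strictMonoOn_hEO (hρ : IsEulerRatio r i j k ρ)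
    (hle : 3 * (∑ l, ballInertia r l) * ρ ^ 2 ≤ eulerCoeff r i j k ρ * (r i + r j) ^ 2 ∨
      3 * (∑ l, ballInertia r l) * (1 - ρ) ^ 2 ≤ eulerCoeff r i j k ρ * (r j + r k) ^ 2) :
    StrictMonoOn (hEO r i j k ρ) (domEO r i j k ρ) := by
  have hc := eulerCoeff_pos hs i j k ρ
  have hρ0 := hρ.1
  have hρ1 := sub_pos.2 hρ.2.1
  have ha := add_pos (hs.pos i) (hs.pos j)
  have hb := add_pos (hs.pos j) (hs.pos k)
  refine (vShaped_hEO hs hρ).2.mono fun d hd => ⟨hd, ?_⟩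
  obtain ⟨m1, m2⟩ := max_lt_iff.1 (mem_Ioi.1 hd)
  refine mem_Ici.2 (not_lt.1 fun hlt => ?_)
  rcases hle with hle | hle
  · have := (lt_vertex_iff hc (by positivity)).1 (m1.trans hlt)
    rw [div_pow, ← mul_div_assoc, div_lt_iff₀ (by positivity)] at this
    linarith
  · have := (lt_vertex_iff hc (by positivity)).1 (m2.trans hlt)
    rw [div_pow, ← mul_div_assoc, div_lt_iff₀ (by positivity)] at this
    linarith

lemma rateSq_gt_iff (hρ : IsEulerRatio r i j k ρ) {a x : ℝ} (ha : 0 < a) (hx : a < x) :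
    rateSq r k j (x - a) x < rateSq r i j a x ↔ ρ * x < a := by
  rw [← not_le, rateSq_le_iff hs hρ ha hx, not_le]

omit hs in
lemma hEA_rest_symm {i j k : Fin 3} (e : r i = r k) :
    hEA r i j k (restLength r i j k) = hEA r k j i (restLength r i j k) := by
  have em : mass r i = mass r k := by unfold mass; rw [e]
  obtain ⟨e1, e2⟩ := hEA_rest_eq (r := r) (i := i) (j := j) (k := k)
  rw [e1, e2]
  have : restLength r i j k - (r i + r j) = r i + r j := by unfold restLength; rw [e]; ring
  rw [this]
  unfold rateSq
  rw [em]

omit hs in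
lemma isEulerRatio_half {i j k : Fin 3} (e : r i = r k) : IsEulerRatio r i j k (1 / 2) := by
  have em : mass r i = mass r k := by unfold mass; rw [e]
  refine ⟨by norm_num, by norm_num, ?_⟩
  rw [show (1 : ℝ) - 1 / 2 = 1 / 2 by norm_num]
  unfold rateSq
  rw [em]

/-- Equal outer bodies detach together, so the domain starts right at the resting length, and a
negative sign there puts the vertex inside. -/
lemma hBifurcation_hEA (h : IsTriple i j k) (e : r i = r k)
    (hneg : alignedSign (mass r i) (mass r j) (mass r k) (∑ l, ballInertia r l) (r i + r j)
      (restLength r i j k) < 0) : HBifurcation (hEA r i j k) (domEA r i j k) := by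
  obtain ⟨ρ, hρ, -⟩ := existsUnique_isEulerRatio hs i j k
  have hD := domEA_eq_Ioi hs hρ ((hEA_rest_le_iff hs hρ).1 (hEA_rest_symm e).le)
  obtain ⟨v, hanti, hmono, hv⟩ := exists_hEA_vertex hs h
  have hz := lt_restLength hs (i := i) (j := j) (k := k)
  rw [hD]
  refine ⟨v, by rw [interior_Ioi]; exact (hv _ hz).1 hneg,
    hanti.mono fun x hx => ⟨hz.trans hx.1, hx.2⟩, hmono.mono fun x hx => ⟨hz.trans hx.1, hx.2⟩⟩

lemma strictMonoOn_hEA (h : IsTriple i j k)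
    (hpos : 0 ≤ alignedSign (mass r i) (mass r j) (mass r k) (∑ l, ballInertia r l) (r i + r j)
      (restLength r i j k)) : StrictMonoOn (hEA r i j k) (domEA r i j k) := by
  obtain ⟨v, hanti, hmono, hv⟩ := exists_hEA_vertex hs h
  have hz := lt_restLength hs (i := i) (j := j) (k := k)
  have hvz : v ≤ restLength r i j k := not_lt.1 fun hlt => hpos.not_gt ((hv _ hz).2 hlt)
  exact hmono.mono fun x hx => ⟨hz.trans hx.1, hvz.trans (le_of_lt hx.1)⟩

end criteria

/-- Examples are given by unnormalized integer radii; the formulas turn every later condition into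
rational arithmetic. -/
lemma exists_isSizes {p q u : ℝ} (hu : 0 < u) (hq : u ≤ q) (hp : q ≤ p) :
    ∃ r, IsSizes r ∧ r 0 = p / (p + q + u) ∧ r 1 = q / (p + q + u) ∧ r 2 = u / (p + q + u) ∧
      mass r 0 = p ^ 3 / (p ^ 3 + q ^ 3 + u ^ 3) ∧ mass r 1 = q ^ 3 / (p ^ 3 + q ^ 3 + u ^ 3) ∧
      mass r 2 = u ^ 3 / (p ^ 3 + q ^ 3 + u ^ 3) ∧
      ∑ l, ballInertia r l = 2 / 5 * (p ^ 5 + q ^ 5 + u ^ 5)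
        / ((p ^ 3 + q ^ 3 + u ^ 3) * (p + q + u) ^ 2) := by
  have hq0 := hu.trans_le hq
  have hp0 := hq0.trans_le hp
  have hN : 0 < p + q + u := by positivity
  have hM : 0 < p ^ 3 + q ^ 3 + u ^ 3 := by positivity
  refine ⟨![p / (p + q + u), q / (p + q + u), u / (p + q + u)], ⟨?_, ?_, ?_, ?_⟩, rfl, rfl, rfl,
    ?_, ?_, ?_, ?_⟩
  · intro i; fin_cases i <;> simp <;> positivity
  · simp; field_simp
  · simp; gcongr
  · simp; gcongr
  · simp [mass, Fin.sum_univ_three]; field_simp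
  · simp [mass, Fin.sum_univ_three]; field_simp
  · simp [mass, Fin.sum_univ_three]; field_simp
  · simp [ballInertia, mass, Fin.sum_univ_three]; field_simp

/-! ### Explicit radii -/

section examples

lemma exists_hBifurcation_TR_mono_EA : ∃ r, IsSizes r ∧
    HBifurcation (hTR r 0 2 1) (domTR r 0 2 1) ∧ StrictMonoOn (hEA r 0 2 1) (domEA r 0 2 1) := by
  obtain ⟨r, hs, e0, e1, e2, m0, m1, m2, hS⟩ := exists_isSizes (p := 9) (q := 9) (u := 2)
    (by norm_num) (by norm_num) (by norm_num)
  norm_num at e0 e1 e2 m0 m1 m2 hS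
  refine ⟨r, hs, hBifurcation_hTR hs ?_, strictMonoOn_hEA hs
    isTriple_zero_one_two.swapLeft.rotate ?_⟩
  · rw [restLength, e0, e1, e2, m0, m1, m2, hS]; norm_num
  · rw [alignedSign, skew, restLength, e0, e1, e2, m0, m1, m2, hS]; norm_num

lemma exists_equal_sizes : ∃ r, IsSizes r ∧ StrictAntiOn (hTR r 0 2 1) (domTR r 0 2 1) ∧
    HBifurcation (hEA r 0 2 1) (domEA r 0 2 1) ∧
    (∃ ρ, IsEulerRatio r 0 2 1 ρ ∧ StrictMonoOn (hEO r 0 2 1 ρ) (domEO r 0 2 1 ρ)) ∧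
    StrictMonoOn (hLO r) (Ioi (r 0 + r 1)) := by
  obtain ⟨r, hs, e0, e1, e2, m0, m1, m2, hS⟩ := exists_isSizes (p := 1) (q := 1) (u := 1)
    (by norm_num) (by norm_num) (by norm_num)
  norm_num at e0 e1 e2 m0 m1 m2 hS
  have e : r 0 = r 1 := e0.trans e1.symm
  have hρ := isEulerRatio_half (j := 2) e
  refine ⟨r, hs, strictAntiOn_hTR_of_le hs ?_, hBifurcation_hEA hs
    isTriple_zero_one_two.swapLeft.rotate e ?_, ⟨_, hρ, strictMonoOn_hEO hs hρ (Or.inl ?_)⟩,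
    strictMonoOn_hLO hs ?_⟩
  · rw [restLength, e0, e1, e2, m0, m1, m2, hS]; norm_num
  · rw [alignedSign, skew, restLength, e0, e1, e2, m0, m1, m2, hS]; norm_num
  · rw [eulerCoeff, e0, e2, m0, m1, m2, hS]; norm_num
  · rw [e0, e1, m0, m1, m2, hS]; norm_num

/-- Two equal large bodies and a very small one. -/
lemma exists_small_third : ∃ r, IsSizes r ∧
    (∃ ρ, IsEulerRatio r 0 2 1 ρ ∧ HBifurcation (hEO r 0 2 1 ρ) (domEO r 0 2 1 ρ)) ∧
    HBifurcation (hLO r) (Ioi (r 0 + r 1)) ∧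
    (∃ ρ, IsEulerRatio r 0 1 2 ρ ∧
      hEA r 2 1 0 (restLength r 0 1 2) < hEA r 0 1 2 (restLength r 0 1 2) ∧
      HBifurcation (hEO r 0 1 2 ρ) (domEO r 0 1 2 ρ)) ∧
    (∃ ρ, IsEulerRatio r 1 0 2 ρ ∧
      hEA r 2 0 1 (restLength r 1 0 2) < hEA r 1 0 2 (restLength r 1 0 2) ∧
      HBifurcation (hEO r 1 0 2 ρ) (domEO r 1 0 2 ρ)) := by
  obtain ⟨r, hs, e0, e1, e2, m0, m1, m2, hS⟩ := exists_isSizes (p := 24) (q := 24) (u := 1)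
    (by norm_num) (by norm_num) (by norm_num)
  norm_num at e0 e1 e2 m0 m1 m2 hS
  have hρ := isEulerRatio_half (j := 2) (e0.trans e1.symm)
  have key : ∀ i j : Fin 3, r i = 24 / 49 → r j = 24 / 49 → mass r i = 13824 / 27649 →
      mass r j = 13824 / 27649 → ∃ ρ, IsEulerRatio r i j 2 ρ ∧
      hEA r 2 j i (restLength r i j 2) < hEA r i j 2 (restLength r i j 2) ∧
      HBifurcation (hEO r i j 2 ρ) (domEO r i j 2 ρ) := by
    intro i j ei ej mi mj
    obtain ⟨ρ, hρ, -⟩ := existsUnique_isEulerRatio hs i j 2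
    have lo : 1 / 2 < ρ := by
      have := (rateSq_lt_iff hs hρ (a := 1 / 2) (x := 1) (by norm_num) (by norm_num)).1
        (by rw [rateSq, rateSq, mi, mj, m2]; norm_num)
      linarith
    -- ρ is enclosed between rational points at which the two rates are compared. For radii 24, 24,
    -- 1 the bound 48/73 is (r i + r j) / `restLength`, so it is exactly the required order of the
    -- two thresholds.
    have hi : ρ < 48 / 73 := by
      have := (rateSq_gt_iff hs hρ (a := 48 / 73) (x := 1) (by norm_num) (by norm_num)).1
        (by rw [rateSq, rateSq, mi, mj, m2]; norm_num)
      linarith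
    refine ⟨ρ, hρ, (hEA_rest_gt_iff hs hρ).2 ?_, hBifurcation_hEO hs hρ ?_ ?_⟩
    · rw [restLength, ei, ej, e2]; linarith
    · rw [eulerCoeff, ei, ej, mi, mj, m2, hS]; nlinarith
    · rw [eulerCoeff, ej, e2, mi, mj, m2, hS]; nlinarith
  refine ⟨r, hs, ⟨_, hρ, hBifurcation_hEO hs hρ ?_ ?_⟩, hBifurcation_hLO hs ?_,
    key 0 1 e0 e1 m0 m1, key 1 0 e1 e0 m1 m0⟩
  · rw [eulerCoeff, e0, e2, m0, m1, m2, hS]; norm_num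
  · rw [eulerCoeff, e1, e2, m0, m1, m2, hS]; norm_num
  · rw [e0, e1, m0, m1, m2, hS]; norm_num

lemma exists_moderate_third : ∃ r, IsSizes r ∧
    (∃ ρ, IsEulerRatio r 0 1 2 ρ ∧
      hEA r 2 1 0 (restLength r 0 1 2) < hEA r 0 1 2 (restLength r 0 1 2) ∧
      StrictMonoOn (hEO r 0 1 2 ρ) (domEO r 0 1 2 ρ)) ∧
    (∃ ρ, IsEulerRatio r 1 0 2 ρ ∧
      hEA r 2 0 1 (restLength r 1 0 2) < hEA r 1 0 2 (restLength r 1 0 2) ∧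
      StrictMonoOn (hEO r 1 0 2 ρ) (domEO r 1 0 2 ρ)) := by
  obtain ⟨r, hs, e0, e1, e2, m0, m1, m2, hS⟩ := exists_isSizes (p := 7) (q := 7) (u := 3)
    (by norm_num) (by norm_num) (by norm_num)
  norm_num at e0 e1 e2 m0 m1 m2 hS
  have key : ∀ i j : Fin 3, r i = 7 / 17 → r j = 7 / 17 → mass r i = 343 / 713 →
      mass r j = 343 / 713 → ∃ ρ, IsEulerRatio r i j 2 ρ ∧
      hEA r 2 j i (restLength r i j 2) < hEA r i j 2 (restLength r i j 2) ∧
      StrictMonoOn (hEO r i j 2 ρ) (domEO r i j 2 ρ) := by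
    intro i j ei ej mi mj
    obtain ⟨ρ, hρ, -⟩ := existsUnique_isEulerRatio hs i j 2
    -- Again (r i + r j) / `restLength`, here 14/24.
    have hi : ρ < 7 / 12 := by
      have := (rateSq_gt_iff hs hρ (a := 7 / 12) (x := 1) (by norm_num) (by norm_num)).1
        (by rw [rateSq, rateSq, mi, mj, m2]; norm_num)
      linarith
    have lo := hρ.1
    refine ⟨ρ, hρ, (hEA_rest_gt_iff hs hρ).2 ?_, strictMonoOn_hEO hs hρ (Or.inl ?_)⟩
    · rw [restLength, ei, ej, e2]; linarith
    · rw [eulerCoeff, ei, ej, mi, mj, m2, hS]; nlinarith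
  exact ⟨r, hs, key 0 1 e0 e1 m0 m1, key 1 0 e1 e0 m1 m0⟩

lemma exists_large_first_hBifurcation : ∃ r ρ, IsSizes r ∧ IsEulerRatio r 0 1 2 ρ ∧
    hEA r 0 1 2 (restLength r 0 1 2) < hEA r 2 1 0 (restLength r 0 1 2) ∧
    HBifurcation (hEO r 0 1 2 ρ) (domEO r 0 1 2 ρ) := by
  obtain ⟨r, hs, e0, e1, e2, m0, m1, m2, hS⟩ := exists_isSizes (p := 4) (q := 1) (u := 1)
    (by norm_num) (by norm_num) (by norm_num)
  norm_num at e0 e1 e2 m0 m1 m2 hS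
  obtain ⟨ρ, hρ, -⟩ := existsUnique_isEulerRatio hs 0 1 2
  -- 5/7 is (r 0 + r 1) / `restLength` and settles which end detaches first; the upper bound 81/100
  -- is needed for the contact of bodies `1` and `2` in the bifurcation criterion.
  have lo : 5 / 7 < ρ := by
    have := (rateSq_lt_iff hs hρ (a := 5 / 7) (x := 1) (by norm_num) (by norm_num)).1
      (by rw [rateSq, rateSq, m0, m1, m2]; norm_num)
    linarith
  have hi : ρ < 81 / 100 := by
    have := (rateSq_gt_iff hs hρ (a := 81 / 100) (x := 1) (by norm_num) (by norm_num)).1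
      (by rw [rateSq, rateSq, m0, m1, m2]; norm_num)
    linarith
  refine ⟨r, ρ, hs, hρ, (hEA_rest_lt_iff hs hρ).2 ?_, hBifurcation_hEO hs hρ ?_ ?_⟩
  · rw [restLength, e0, e1, e2]; linarith
  · rw [eulerCoeff, e0, e1, m0, m1, m2, hS]; nlinarith
  · rw [eulerCoeff, e1, e2, m0, m1, m2, hS]; nlinarith

lemma exists_large_first_strictMonoOn : ∃ r ρ, IsSizes r ∧ IsEulerRatio r 0 1 2 ρ ∧
    hEA r 0 1 2 (restLength r 0 1 2) < hEA r 2 1 0 (restLength r 0 1 2) ∧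
    StrictMonoOn (hEO r 0 1 2 ρ) (domEO r 0 1 2 ρ) := by
  obtain ⟨r, hs, e0, e1, e2, m0, m1, m2, hS⟩ := exists_isSizes (p := 15) (q := 8) (u := 8)
    (by norm_num) (by norm_num) (by norm_num)
  norm_num at e0 e1 e2 m0 m1 m2 hS
  obtain ⟨ρ, hρ, -⟩ := existsUnique_isEulerRatio hs 0 1 2
  -- Larger than the detachment ratio 23/39, so that the same bound also puts the EO vertex before
  -- the contact of bodies `1` and `2`.
  have lo : 16 / 25 < ρ := by
    have := (rateSq_lt_iff hs hρ (a := 16 / 25) (x := 1) (by norm_num) (by norm_num)).1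
      (by rw [rateSq, rateSq, m0, m1, m2]; norm_num)
    linarith
  have hi := hρ.2.1
  refine ⟨r, ρ, hs, hρ, (hEA_rest_lt_iff hs hρ).2 ?_, strictMonoOn_hEO hs hρ (Or.inr ?_)⟩
  · rw [restLength, e0, e1, e2]; linarith
  · rw [eulerCoeff, e1, e2, m0, m1, m2, hS]; nlinarith

lemma exists_hEA_lt_of_large_pair : ∃ r, IsSizes r ∧
    hEA r 1 0 2 (restLength r 1 0 2) < hEA r 2 0 1 (restLength r 1 0 2) := by
  obtain ⟨r, hs, e0, e1, e2, m0, m1, m2, hS⟩ := exists_isSizes (p := 4) (q := 4) (u := 3)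
    (by norm_num) (by norm_num) (by norm_num)
  norm_num at e0 e1 e2 m0 m1 m2
  obtain ⟨ρ, hρ, -⟩ := existsUnique_isEulerRatio hs 1 0 2
  refine ⟨r, hs, (hEA_rest_lt_iff hs hρ).2 ?_⟩
  rw [← rateSq_lt_iff hs hρ (add_pos (hs.pos 1) (hs.pos 0)) (lt_restLength hs), rateSq, rateSq,
    restLength, e0, e1, e2, m0, m1, m2]
  norm_num

end examples

end FullThreeBody

end

open FullThreeBody in
theorem theorem1 :
    -- for every choice of sizes
    (∀ r : Fin 3 → ℝ, IsSizes r →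
      -- the 28 families, distributed over seven classes
      Nat.card Family = 28 ∧
      {F : Family | F.cls = .LR}.ncard = 2 ∧ {F : Family | F.cls = .ER}.ncard = 3 ∧
      {F : Family | F.cls = .TR}.ncard = 6 ∧ {F : Family | F.cls = .EA}.ncard = 6 ∧
      {F : Family | F.cls = .IS}.ncard = 6 ∧ {F : Family | F.cls = .EO}.ncard = 3 ∧
      {F : Family | F.cls = .LO}.ncard = 2 ∧
      -- every family occurs, and every relative equilibrium belongs to exactly one family
      (∀ F : Family, (branch r F).Nonempty) ∧
      (∀ H q, 0 ≤ H → IsRelEq r H q → ∃! F : Family, F.Mem r q) ∧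
      -- no class exists, or is stable, for all angular momenta
      (∀ c : EqClass, ∃ H, 0 ≤ H ∧ ∀ F : Family, F.cls = c → ∀ q, (q, H) ∉ branch r F) ∧
      (∀ c : EqClass, ∃ H, 0 ≤ H ∧
        ∀ F : Family, F.cls = c → ∀ q, (q, H) ∈ branch r F → ¬ IsStable r H q) ∧
      -- at every angular momentum something is stable
      (∀ H, 0 ≤ H → ∃ q, IsStable r H q) ∧
      -- Lagrange resting
      (∀ o, IsRestingFamily r (.LR o) (hTR r 0 2 1 (r 0 + r 1)) ∧
        (∀ p ∈ branch r (.LR o), IsStable r p.2 p.1 ↔ p.2 < hTR r 0 2 1 (r 0 + r 1)) ∧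
        Junction r (.LR o) (.TR 2 o) (hTR r 0 2 1 (r 0 + r 1))) ∧
      -- Euler resting
      (∀ i j k : Fin 3, i = j + 1 → k = j + 2 →
        0 < hTR r i j k (restLength r i j k) ∧
        hTR r i j k (restLength r i j k)
          < min (hEA r i j k (restLength r i j k)) (hEA r k j i (restLength r i j k)) ∧
        IsRestingFamily r (.ER j)
          (min (hEA r i j k (restLength r i j k)) (hEA r k j i (restLength r i j k))) ∧
        (∀ p ∈ branch r (.ER j),
          (p.2 < hTR r i j k (restLength r i j k) → ¬ IsStable r p.2 p.1) ∧
          (hTR r i j k (restLength r i j k) < p.2 →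
            p.2 < min (hEA r i j k (restLength r i j k)) (hEA r k j i (restLength r i j k)) →
            IsStable r p.2 p.1)) ∧
        ∀ o, Junction r (.TR j o) (.ER j) (hTR r i j k (restLength r i j k))) ∧
      -- Transitional resting
      (∀ i j k : Fin 3, i = j + 1 → k = j + 2 → ∀ o,
        IsCurveFamily r (.TR j o) (fun q => ‖q k - q i‖) (domTR r i j k) (hTR r i j k) ∧
        (j ≠ 2 → StrictAntiOn (hTR r i j k) (domTR r i j k) ∧ NeverStable r (.TR j o)) ∧
        (j = 2 → ∃ v, r 0 + r 1 < v ∧ VShaped (hTR r i j k) (domTR r i j k) v ∧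
          ∀ p ∈ branch r (.TR j o), IsStable r p.2 p.1 ↔ v < ‖p.1 k - p.1 i‖)) ∧
      -- Isosceles
      (∀ i j k : Fin 3, i = k + 1 → j = k + 2 → ∀ o,
        IsCurveFamily r (.IS k o) (fun q => ‖q k - q i‖) (domIS r i j k) (hIS r i j k) ∧
        HBifurcation (hIS r i j k) (domIS r i j k) ∧
        Tendsto (fun d => hIS r i j k d / √d) atTop (𝓝 (mass r k * (mass r i + mass r j))) ∧
        NeverStable r (.IS k o)) ∧
      (∀ o, Junction r (.TR 1 o) (.IS 0 o) (hTR r 0 1 2 (r 0 + r 1)) ∧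
        Junction r (.TR 0 o) (.IS 1 o) (hTR r 1 0 2 (r 0 + r 1)) ∧
        Junction r (.IS 2 o) (.LO o) (hLO r (r 0 + r 1))) ∧
      -- Euler aligned
      (∀ i j k : Fin 3, ∀ σ : Equiv.Perm (Fin 3), σ 0 = i → σ 1 = j → σ 2 = k →
        IsCurveFamily r (.EA σ) (fun q => ‖q k - q i‖) (domEA r i j k) (hEA r i j k) ∧
        (∃ v, VShaped (hEA r i j k) (domEA r i j k) v ∧ (j ≠ 2 → v ∈ interior (domEA r i j k)) ∧
          ∀ p ∈ branch r (.EA σ),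
            (IsStable r p.2 p.1 → v < ‖p.1 k - p.1 i‖) ∧
            (v < ‖p.1 k - p.1 i‖ → ‖p.1 k - p.1 i‖ ∈ interior (domEA r i j k) →
              IsStable r p.2 p.1)) ∧
        Tendsto (fun x => hEA r i j k x / √x) atTop (𝓝 (mass r k * (mass r i + mass r j))) ∧
        (hEA r i j k (restLength r i j k) ≤ hEA r k j i (restLength r i j k) →
          domEA r i j k = Set.Ioi (restLength r i j k) ∧
          Junction r (.ER j) (.EA σ) (hEA r i j k (restLength r i j k))) ∧
        (hEA r k j i (restLength r i j k) < hEA r i j k (restLength r i j k) →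
          ∃ x₀, restLength r i j k < x₀ ∧ domEA r i j k = Set.Ici x₀ ∧
            Junction r (.EO j) (.EA σ) (hEA r i j k x₀)) ∧
        (hEA r i j k (restLength r i j k) = hEA r k j i (restLength r i j k) →
          Junction r (.EO j) (.ER j) (hEA r i j k (restLength r i j k)))) ∧
      (r 1 < r 0 → hEA r 0 2 1 (restLength r 0 2 1) < hEA r 1 2 0 (restLength r 0 2 1)) ∧
      -- Euler orbital
      (∀ i j k : Fin 3, i = j + 1 → k = j + 2 →
        (∃! ρ, IsEulerRatio r i j k ρ) ∧ ∀ ρ, IsEulerRatio r i j k ρ →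
        IsCurveFamily r (.EO j) (fun q => ‖q k - q i‖) (domEO r i j k ρ) (hEO r i j k ρ) ∧
        (∀ p ∈ branch r (.EO j), ‖p.1 i - p.1 j‖ = ρ * ‖p.1 k - p.1 i‖) ∧
        (∃ v, VShaped (hEO r i j k ρ) (domEO r i j k ρ) v) ∧
        Tendsto (hEO r i j k ρ) atTop atTop ∧ NeverStable r (.EO j)) ∧
      -- Lagrange orbital
      (∀ o, IsCurveFamily r (.LO o) (fun q => ‖q 0 - q 1‖) (Set.Ioi (r 0 + r 1)) (hLO r) ∧
        (∃ v, VShaped (hLO r) (Set.Ioi (r 0 + r 1)) v) ∧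
        Tendsto (hLO r) atTop atTop ∧ NeverStable r (.LO o))) ∧
    -- the alternatives left open above all occur
    (∃ r, IsSizes r ∧ HBifurcation (hTR r 0 2 1) (domTR r 0 2 1)) ∧
    (∃ r, IsSizes r ∧ StrictAntiOn (hTR r 0 2 1) (domTR r 0 2 1)) ∧
    (∃ r, IsSizes r ∧ HBifurcation (hEA r 0 2 1) (domEA r 0 2 1)) ∧
    (∃ r, IsSizes r ∧ StrictMonoOn (hEA r 0 2 1) (domEA r 0 2 1)) ∧
    (∃ r ρ, IsSizes r ∧ IsEulerRatio r 0 2 1 ρ ∧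
      HBifurcation (hEO r 0 2 1 ρ) (domEO r 0 2 1 ρ)) ∧
    (∃ r ρ, IsSizes r ∧ IsEulerRatio r 0 2 1 ρ ∧
      StrictMonoOn (hEO r 0 2 1 ρ) (domEO r 0 2 1 ρ)) ∧
    (∃ r ρ, IsSizes r ∧ IsEulerRatio r 0 1 2 ρ ∧
      hEA r 0 1 2 (restLength r 0 1 2) < hEA r 2 1 0 (restLength r 0 1 2) ∧
      HBifurcation (hEO r 0 1 2 ρ) (domEO r 0 1 2 ρ)) ∧
    (∃ r ρ, IsSizes r ∧ IsEulerRatio r 0 1 2 ρ ∧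
      hEA r 0 1 2 (restLength r 0 1 2) < hEA r 2 1 0 (restLength r 0 1 2) ∧
      StrictMonoOn (hEO r 0 1 2 ρ) (domEO r 0 1 2 ρ)) ∧
    (∃ r ρ, IsSizes r ∧ IsEulerRatio r 0 1 2 ρ ∧
      hEA r 2 1 0 (restLength r 0 1 2) < hEA r 0 1 2 (restLength r 0 1 2) ∧
      HBifurcation (hEO r 0 1 2 ρ) (domEO r 0 1 2 ρ)) ∧
    (∃ r ρ, IsSizes r ∧ IsEulerRatio r 0 1 2 ρ ∧
      hEA r 2 1 0 (restLength r 0 1 2) < hEA r 0 1 2 (restLength r 0 1 2) ∧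
      StrictMonoOn (hEO r 0 1 2 ρ) (domEO r 0 1 2 ρ)) ∧
    (∃ r ρ, IsSizes r ∧ IsEulerRatio r 1 0 2 ρ ∧
      hEA r 2 0 1 (restLength r 1 0 2) < hEA r 1 0 2 (restLength r 1 0 2) ∧
      HBifurcation (hEO r 1 0 2 ρ) (domEO r 1 0 2 ρ)) ∧
    (∃ r ρ, IsSizes r ∧ IsEulerRatio r 1 0 2 ρ ∧
      hEA r 2 0 1 (restLength r 1 0 2) < hEA r 1 0 2 (restLength r 1 0 2) ∧
      StrictMonoOn (hEO r 1 0 2 ρ) (domEO r 1 0 2 ρ)) ∧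
    (∃ r, IsSizes r ∧
      hEA r 1 0 2 (restLength r 1 0 2) < hEA r 2 0 1 (restLength r 1 0 2)) ∧
    (∃ r, IsSizes r ∧ HBifurcation (hLO r) (Set.Ioi (r 0 + r 1))) ∧
    (∃ r, IsSizes r ∧ StrictMonoOn (hLO r) (Set.Ioi (r 0 + r 1))) := by
  refine ⟨fun r hs => ⟨card_family, ncard_classes.1, ncard_classes.2.1, ncard_classes.2.2.1,
    ncard_classes.2.2.2.1, ncard_classes.2.2.2.2.1, ncard_classes.2.2.2.2.2.1,
    ncard_classes.2.2.2.2.2.2, branch_nonempty hs, fun H q => relEq_existsUnique_family hs,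
    exists_absent hs, fun c => ?_, fun H => exists_stable hs, LR_chart hs,
    fun i j k hi hk => ER_chart hs (isTriple_of_middle hi hk),
    fun i j k hi hk => TR_chart hs hi hk,
    fun i j k hi hj => IS_chart hs (isTriple_of_last hi hj), isosceles_junctions hs,
    fun i j k σ h0 h1 h2 => EA_chart hs (by subst h0 h1 h2; exact isTriple_perm σ) h0 h1 h2,
    hEA_middle_two hs, fun i j k hi hk => EO_chart hs (isTriple_of_middle hi hk), LO_chart hs⟩, ?_⟩
  -- Where a class has no relative equilibrium at all, it has no stable one.
  · obtain ⟨H, hH, h⟩ := exists_absent hs c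
    exact ⟨H, hH, fun F hF q hq => absurd hq (h F hF q)⟩
  · obtain ⟨r₁, s₁, tr₁, ea₁⟩ := exists_hBifurcation_TR_mono_EA
    obtain ⟨r₂, s₂, tr₂, ea₂, ⟨ρ₂, eo₂⟩, lo₂⟩ := exists_equal_sizes
    obtain ⟨r₃, s₃, ⟨ρ₃, eo₃⟩, lo₃, ⟨ρ₃', eo₃'⟩, ρ₃'', eo₃''⟩ := exists_small_third
    obtain ⟨r₄, s₄, ⟨ρ₄, eo₄⟩, ρ₄', eo₄'⟩ := exists_moderate_third
    exact ⟨⟨r₁, s₁, tr₁⟩, ⟨r₂, s₂, tr₂⟩, ⟨r₂, s₂, ea₂⟩, ⟨r₁, s₁, ea₁⟩, ⟨r₃, ρ₃, s₃, eo₃⟩,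
      ⟨r₂, ρ₂, s₂, eo₂⟩, exists_large_first_hBifurcation, exists_large_first_strictMonoOn,
      ⟨r₃, ρ₃', s₃, eo₃'⟩, ⟨r₄, ρ₄, s₄, eo₄⟩, ⟨r₃, ρ₃'', s₃, eo₃''⟩, ⟨r₄, ρ₄', s₄, eo₄'⟩,
      exists_hEA_lt_of_large_pair, ⟨r₃, s₃, lo₃⟩, ⟨r₂, s₂, lo₂⟩⟩
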